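/- **Notation.** Fix integers $n,N\ge 0$; $v_1,\dots,v_N$ is the standard basis of $\mathbb C^N$, $\boldsymbol z=(z_1,\dots,z_n)$, $K=\mathbb C(\boldsymbol z,h)$. For $\lambda\in\mathbb Z_{\ge0}^N$ with $|\lambda|=n$ let $\mathcal I_\lambda$ be the set of partitions $I=(I_1,\dots,I_N)$ of $\{1,\dots,n\}$ with $|I_k|=\lambda_k$, $v_I=v_{i_1}\otimes\dots\otimes v_{i_n}$ ($i_j=k$ iff $j\in I_k$), and $(\mathbb C^N)^{\otimes n}_\lambda=\mathrm{span}\{v_I: I\in\mathcal I_\lambda\}$. Let $I^{\min}=(\{1,\dots,\lambda_1\},\{\lambda_1+1,\dots,\lambda_1+\lambda_2\},\dots)$, $I^{\max}=(\{n-\lambda_1+1,\dots,n\},\dots,\{1,\dots,\lambda_N\})$, and let $S_\lambda\subset S_n$ be the isotropy subgroup of $I^{\min}$. $\mathbb C[\boldsymbol z^{\pm1}]^{S_\lambda}$ is the algebra of $S_\lambda$-invariant Laurent polynomials; for such $f$, $f(\boldsymbol z_I)$ is obtained by substituting $\{z_a: a\in I_k\}$ for the variables with indices in $I^{\min}_k$,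 $k=1,\dots,N$. Put $$R(\boldsymbol z_I)=\prod_{k<l}\prod_{a\in I_k}\prod_{b\in I_l}(1-z_b/z_a),\quad Q(\boldsymbol z_I,h)=\prod_{k<l}\prod_{a\in I_k}\prod_{b\in I_l}(1-hz_b/z_a),\quad D=\prod_{b<a}(1-hz_b/z_a).$$ *$R$-matrix.* $\mathcal R(x)=\mathcal R(x,h)$ acts on $\mathbb C^N\otimes\mathbb C^N$ by $v_i\otimes v_i\mapsto v_i\otimes v_i$ and, for $i<j$, $$v_i\otimes v_j\mapsto\tfrac{1-x}{1-hx}v_i\otimes v_j+\tfrac{(1-h)x}{1-hx}v_j\otimes v_i,\qquad v_j\otimes v_i\mapsto\tfrac{1-h}{1-hx}v_i\otimes v_j+\tfrac{h(1-x)}{1-hx}v_j\otimes v_i .$$ *Algebra.* $\mathcal U$ is the unital $\mathbb C(h)$-algebra with generators $\tilde L_{i,j,\pm s}$ ($1\le i,j\le N$, $s\ge0$, with $+0$ and $-0$ distinguished) and $\tilde L_{i,i,+0}^{-1}$, and with the relations: $\tilde L_{i,j,+0}=\tilde L_{j,i,-0}=0$ for $i<j$; $\tilde L_{i,i,+0}\tilde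 L_{i,i,+0}^{-1}=\tilde L_{i,i,+0}^{-1}\tilde L_{i,i,+0}=1$; $\tilde L_{1,1,-0}=1$; $\tilde L_{i,i,+0}=\tilde L_{i+1,i+1,-0}$ for $i<N$; and $\mathcal R^{(1,2)}(v/u)\tilde L^{(1)}_\alpha(u)\tilde L^{(2)}_\beta(v)=\tilde L^{(2)}_\beta(v)\tilde L^{(1)}_\alpha(u)\mathcal R^{(1,2)}(v/u)$ for $(\alpha,\beta)=(+,+),(+,-),(-,-)$ (multiplied by $u-hv$ and read coefficientwise), where $\tilde L_\pm(u)=\bigl(\sum_{s\ge0}\tilde L_{i,j,\pm s}u^{\pm s}\bigr)_{i,j}$. For $p=1,\dots,N$ let $$A_{p,\pm}(u)=\sum_{\sigma\in S_p}(-1)^\sigma\tilde L_{1,\sigma(1),\pm}(u)\tilde L_{2,\sigma(2),\pm}(uh)\cdots\tilde L_{p,\sigma(p),\pm}(uh^{p-1})\;\tilde L_{1,1,\pm0}^{-1}\cdots\tilde L_{p,p,\pm0}^{-1}=1+\sum_{s\ge1}B^\infty_{p,\pm s}u^{\pm s}.$$ The Gelfand–Zetlin algebra (limiting Bethe algebra)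 $\mathcal B^\infty\subset\mathcal U$ is the unital $\mathbb C(h)$-subalgebra generated by all $\tilde L_{i,i,+0}^{\pm1}$ and $B^\infty_{p,\pm s}$, $1\le p\le N$, $s\ge1$. *$S_n$-action.* $\tilde s_i=P^{(i,i+1)}\mathcal R^{(i,i+1)}(z_i/z_{i+1})K_i$ acts on $(\mathbb C^N)^{\otimes n}$-valued functions of $\boldsymbol z,h$, where $K_i$ exchanges $z_i,z_{i+1}$ and $P^{(i,i+1)}$ exchanges the tensor factors. Let $\frac1D\mathcal V^-$ (resp. $\frac1D\mathcal V^-_\lambda$) be the space of $(\mathbb C^N)^{\otimes n}$-valued (resp. $(\mathbb C^N)^{\otimes n}_\lambda$-valued) functions with coordinates in $\frac1D\mathbb C[\boldsymbol z^{\pm1},h^{\pm1}]$ invariant under all $\tilde s_i$. Let $\frac1D\mathcal V^-_\lambda\otimes\mathbb C(h)$ be its $\mathbb C(h)$-span, and $\frac1D\mathcal V^-\otimes\mathbb C[\boldsymbol z^{\pm1}]\otimes\mathbb C(h)$ the $\mathbb C[\boldsymbol z^{\pm1}]\otimes\mathbb C(h)$-span of $\frac1D\mathcal V^-$, in $(\mathbb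 C^N)^{\otimes n}\otimes K$. Let also $\hat s_i=\frac{1-hz_{i+1}/z_i}{1-z_{i+1}/z_i}K_i+\frac{h-1}{1-z_{i+1}/z_i}$ on scalar functions; for $\sigma=s_{j_1}\cdots s_{j_r}$ reduced put $\hat\sigma=\hat s_{j_1}\cdots\hat s_{j_r}$, and let $\sigma_I$ be the shortest permutation with $\sigma_I(I^{\max})=I$. *$K$-theory.* $K_T(T^*\mathcal F_\lambda)\otimes\mathbb C(h)$, for the cotangent bundle of the variety of partial flags in $\mathbb C^n$ with dimension steps $\lambda$ and $T=(\mathbb C^\times)^n\times\mathbb C^\times$, is understood through its standard presentation $\mathbb C[\boldsymbol\Gamma^{\pm1}]^{S_\lambda}\otimes\mathbb C[\boldsymbol z^{\pm1}]\otimes\mathbb C(h)\big/\langle f(\boldsymbol\Gamma)=f(\boldsymbol z):f\in\mathbb C[\boldsymbol z^{\pm1}]^{S_n}\rangle$ with $\boldsymbol\Gamma=(\gamma_{k,j})_{1\le k\le N,\,1\le j\le\lambda_k}$; $f(\boldsymbol z_I,\boldsymbol z,h)$ is obtained from $f(\boldsymbol\Gamma,\boldsymbol z,h)$ by $\{\gamma_{k,1},\dots,\gamma_{k,\lambda_k}\}\mapsto\{z_a:a\in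 I_k\}$. $K_T(\mathcal X_n)=\bigoplus_{|\lambda|=n}K_T(T^*\mathcal F_\lambda)$. **Theorem.** (0) There is a unique homomorphism of $\mathbb C(h)$-algebras $\varphi:\mathcal U\to\mathrm{End}((\mathbb C^N)^{\otimes n})\otimes\mathbb C[\boldsymbol z^{\pm1}]\otimes\mathbb C(h)$ sending $\tilde L_{i,j,+s}$ (resp. $\tilde L_{i,j,-s}$) to the coefficient of $u^s$ (resp. $u^{-s}$) in the expansion at $u=0$ (resp. $u=\infty$) of the $(i,j)$ entry of $$L(u)=\mathcal R^{(0,n)}(z_n/u)\cdots\mathcal R^{(0,1)}(z_1/u)\prod_{i=1}^n\frac{1-hz_i/u}{1-z_i/u}.$$ There are unique vectors $\xi_I\in(\mathbb C^N)^{\otimes n}\otimes K$ with $\xi_{I^{\min}}=v_{I^{\min}}$ for all $\lambda$ and $\xi_{s_i(I)}=\tilde s_i\xi_I$ for all $i,I$; the $\xi_I$, $I\in\mathcal I_\lambda$, form a $K$-basis of $(\mathbb C^N)^{\otimes n}_\lambda\otimes K$. The operators $\varphi(X)$, $X\in\mathcal B^\infty$, preserve $(\mathbb C^N)^{\otimes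 n}_\lambda\otimes K$; let $\varphi_\lambda(X)$ be the restriction. (1) For every $\lambda$ the formula $$\theta_\lambda(f)=\sum_{I\in\mathcal I_\lambda}\hat\sigma_I\Bigl(\frac{f(z_n,\dots,z_1,h)}{Q(\boldsymbol z_{I^{\max}},h)}\Bigr)v_I=\sum_{I\in\mathcal I_\lambda}\frac{f(\boldsymbol z_I,h)}{R(\boldsymbol z_I)}\,\xi_I$$ defines an isomorphism of $\mathbb C[\boldsymbol z^{\pm1}]^{S_n}\otimes\mathbb C(h)$-modules $\theta_\lambda:\mathbb C[\boldsymbol z^{\pm1}]^{S_\lambda}\otimes\mathbb C(h)\to\frac1D\mathcal V^-_\lambda\otimes\mathbb C(h)$ (the first expression does not depend on the reduced presentations used for $\hat\sigma_I$), the rule $\psi_\lambda(g):\xi_I\mapsto g(\boldsymbol z_I,h)\,\xi_I$, $I\in\mathcal I_\lambda$, defines an isomorphism of $\mathbb C[\boldsymbol z^{\pm1}]^{S_n}\otimes\mathbb C(h)$-algebras $\psi_\lambda:\mathbb C[\boldsymbol z^{\pm1}]^{S_\lambda}\otimes\mathbb C(h)\to\varphi_\lambda(\mathcal B^\infty)$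 (a symmetric $f$ goes to multiplication by $f$), and $\psi_\lambda(g)\,\theta_\lambda(f)=\theta_\lambda(gf)$. Thus $\theta_\lambda,\psi_\lambda$ identify the $\varphi_\lambda(\mathcal B^\infty)$-module $\frac1D\mathcal V^-_\lambda\otimes\mathbb C(h)$ with the regular representation of $\mathbb C[\boldsymbol z^{\pm1}]^{S_\lambda}\otimes\mathbb C(h)$. (2) The formula $\nu:[f(\boldsymbol\Gamma,\boldsymbol z,h)]\mapsto\sum_{I\in\mathcal I_\lambda}\frac{f(\boldsymbol z_I,\boldsymbol z,h)}{R(\boldsymbol z_I)}\xi_I$ on $K_T(T^*\mathcal F_\lambda)\otimes\mathbb C(h)$, for all $\lambda$, defines an isomorphism of $\mathbb C[\boldsymbol z^{\pm1}]\otimes\mathbb C(h)$-modules $\nu:K_T(\mathcal X_n)\otimes\mathbb C(h)\to\frac1D\mathcal V^-\otimes\mathbb C[\boldsymbol z^{\pm1}]\otimes\mathbb C(h)$; the rule $\mu([f]):\xi_I\mapsto f(\boldsymbol z_I,\boldsymbol z,h)\,\xi_I$ for $I\in\mathcal I_\lambda$ ($\xi_J\mapsto0$ for $J\notin\mathcal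 I_\lambda$) defines an isomorphism of $\mathbb C[\boldsymbol z^{\pm1}]\otimes\mathbb C(h)$-algebras $\mu:K_T(\mathcal X_n)\otimes\mathbb C(h)\to\varphi(\mathcal B^\infty)\otimes\mathbb C[\boldsymbol z^{\pm1}]$, the latter being the algebra of operators generated by $\varphi(\mathcal B^\infty)$ and $\mathbb C[\boldsymbol z^{\pm1}]$; and $\nu(bf)=\mu(b)\nu(f)$. Thus $\nu,\mu$ identify the $\varphi(\mathcal B^\infty)\otimes\mathbb C[\boldsymbol z^{\pm1}]$-module $\frac1D\mathcal V^-\otimes\mathbb C[\boldsymbol z^{\pm1}]\otimes\mathbb C(h)$ with the regular representation of $K_T(\mathcal X_n)\otimes\mathbb C(h)$. In particular, for every $\lambda$, the action of $\mathcal B^\infty$ transported via $\nu$ preserves $K_T(T^*\mathcal F_\lambda)\otimes\mathbb C(h)$, and the $\mathbb C[\boldsymbol z^{\pm1}]\otimes\mathbb C(h)$-algebra generated by the image of $\mathcal B^\infty$ there is exactly the algebra of multiplication operators of $K_T(T^*\mathcal F_\lambda)\otimes\mathbb C(h)$. -/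

import Mathlib

open scoped TensorProduct

noncomputable section

namespace KStab

/-! ## Scalars: `ℂ(h)`, `ℂ[z^{±1}] ⊗ ℂ(h)` and `ℂ(z, h)` -/

/-- The field `ℂ(h)`. -/
abbrev Ch : Type := RatFunc ℂ

/-- The variable `h` in `ℂ(h)`. -/
def hh : Ch := RatFunc.X

/-- `ℂ[z₁^{±1}, …, zₙ^{±1}] ⊗ ℂ(h)`: Laurent polynomials in `z₁, …, zₙ` over `ℂ(h)`. -/
abbrev P (n : ℕ) : Type := AddMonoidAlgebra Ch (Fin n →₀ ℤ)

/-- `ℂ(z₁, …, zₙ, h)`: the field of fractions of `ℂ[z^{±1}] ⊗ ℂ(h)`. -/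
def K (n : ℕ) : Type := FractionRing (P n)

instance (n : ℕ) : Field (K n) := inferInstanceAs (Field (FractionRing (P n)))

instance (n : ℕ) {R : Type*} [CommSemiring R] [Algebra R (P n)] : Algebra R (K n) :=
  inferInstanceAs (Algebra R (FractionRing (P n)))

instance (n : ℕ) {R S : Type*} [CommSemiring R] [CommSemiring S] [Algebra R (P n)]
    [Algebra S (P n)] [SMul R S] [IsScalarTower R S (P n)] : IsScalarTower R S (K n) :=
  inferInstanceAs (IsScalarTower R S (FractionRing (P n)))

instance (n : ℕ) : IsFractionRing (P n) (K n) :=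
  inferInstanceAs (IsFractionRing (P n) (FractionRing (P n)))

/-- `f(z₁, …, zₙ, h) ↦ f(z_{σ(1)}, …, z_{σ(n)}, h)` on Laurent polynomials. -/
def permP {n : ℕ} (σ : Equiv.Perm (Fin n)) : P n ≃ₐ[Ch] P n :=
  AddMonoidAlgebra.domCongr Ch Ch (Finsupp.domCongr σ)

/-- `f(z₁, …, zₙ, h) ↦ f(z_{σ(1)}, …, z_{σ(n)}, h)` on rational functions. -/
def permK {n : ℕ} (σ : Equiv.Perm (Fin n)) : K n ≃+* K n :=
  IsFractionRing.ringEquivOfRingEquiv (permP σ).toRingEquiv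

/-- The rational function `z_i`. -/
def z {n : ℕ} (i : Fin n) : K n :=
  algebraMap (P n) (K n) (AddMonoidAlgebra.single (Finsupp.single i 1) 1)

/-- The rational function `h`. -/
def hK (n : ℕ) : K n := algebraMap Ch (K n) hh

/-- `ℂ[z^{±1}, h^{±1}]` as a subalgebra of `ℂ(z, h)`. -/
def intLaurent (n : ℕ) : Subalgebra ℂ (K n) :=
  Algebra.adjoin ℂ ({x | ∃ i, x = z i ∨ x = (z i)⁻¹} ∪ {hK n, (hK n)⁻¹})

/-- An elementary transposition `s_i = (i, i+1)` of `S_n` (positions are numbered from `0`). -/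
abbrev Adj (n : ℕ) : Type := {i : Fin n // i.val + 1 < n}

/-- The position `i + 1`. -/
def Adj.next {n : ℕ} (i : Adj n) : Fin n := ⟨i.1.val + 1, i.2⟩

/-- The transposition `s_i`. -/
def Adj.s {n : ℕ} (i : Adj n) : Equiv.Perm (Fin n) := Equiv.swap i.1 i.next

/-! ## Partitions `I = (I₁, …, I_N)` of `{1, …, n}` and the space `(ℂ^N)^{⊗n} ⊗ ℂ(z, h)` -/

/-- A partition `I = (I₁, …, I_N)` of `{1, …, n}`, encoded by the word `(i₁, …, iₙ)` with
`i_j = k` iff `j ∈ I_k`; it labels the basis vector `v_I = v_{i₁} ⊗ ⋯ ⊗ v_{iₙ}`.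
The partition `σ(I) = (σ(I₁), …, σ(I_N))` is encoded by the word `w ∘ σ⁻¹`. -/
abbrev Word (n N : ℕ) : Type := Fin n → Fin N

/-- The weights `λ ∈ ℤ_{≥0}^N` with `|λ| = n`. -/
abbrev Comp (n N : ℕ) : Type := {l : Fin N → ℕ // ∑ k, l k = n}

/-- The weight `λ = (|I₁|, …, |I_N|)` of `I`; thus `I ∈ 𝓘_λ` iff `wt I = λ`. -/
def wt {n N : ℕ} (w : Word n N) : Comp n N :=
  ⟨fun k => (Finset.univ.filter fun i => w i = k).card, by
    have h := Finset.card_eq_sum_card_fiberwise (f := w) (s := Finset.univ) (t := Finset.univ)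
      (fun _ _ => Finset.mem_coe.2 (Finset.mem_univ _))
    simpa using h.symm⟩

/-- `I^min = ({1, …, λ₁}, {λ₁ + 1, …, λ₁ + λ₂}, …)`. -/
def imin {n N : ℕ} (l : Comp n N) : Word n N :=
  fun i => (finSigmaFinEquiv.symm (Fin.cast l.2.symm i)).1

/-- `I^max = ({n - λ₁ + 1, …, n}, …, {1, …, λ_N})`. -/
def imax {n N : ℕ} (l : Comp n N) : Word n N := fun i => imin l i.rev

/-- `(ℂ^N)^{⊗n} ⊗ ℂ(z, h)`, in coordinates with respect to the basis `v_I`. -/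
abbrev V (n N : ℕ) : Type := Word n N → K n

/-- The weight subspace `(ℂ^N)^{⊗n}_λ ⊗ ℂ(z, h)`, spanned by `v_I`, `I ∈ 𝓘_λ`. -/
def Vwt {n N : ℕ} (l : Comp n N) : Submodule (K n) (V n N) :=
  Submodule.span (K n) {v | ∃ w, wt w = l ∧ v = Pi.single w 1}

/-! ## The trigonometric `R`-matrix -/

/-- The numerator of the trigonometric `R`-matrix in homogeneous form: for `x`, `y` in a
commutative ring it is `(y - h x) 𝓡(x / y, h)`. The entry with indices `o`, `q` is
the coefficient of `v_{o.1} ⊗ v_{o.2}` in the image of `v_{q.1} ⊗ v_{q.2}`. -/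
def Rnum (N : ℕ) {A : Type*} [CommRing A] (h x y : A) :
    Matrix (Fin N × Fin N) (Fin N × Fin N) A :=
  Matrix.of fun o q =>
    if o = q then
      if q.1 = q.2 then y - h * x else if q.1 < q.2 then y - x else h * (y - x)
    else if o = q.swap then
      if q.1 < q.2 then (1 - h) * x else (1 - h) * y
    else 0

/-- The trigonometric `R`-matrix `𝓡(x, h)` over a field: `v_i ⊗ v_i ↦ v_i ⊗ v_i`, and for `i < j`
`v_i ⊗ v_j ↦ ((1 - x) v_i ⊗ v_j + (1 - h) x v_j ⊗ v_i) / (1 - h x)`,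
`v_j ⊗ v_i ↦ ((1 - h) v_i ⊗ v_j + h (1 - x) v_j ⊗ v_i) / (1 - h x)`. -/
def Rmat (N : ℕ) {F : Type*} [Field F] (h x : F) : Matrix (Fin N × Fin N) (Fin N × Fin N) F :=
  (1 - h * x)⁻¹ • Rnum N h x 1

/-- `M^{(i,j)}`: the operator `M` on `ℂ^N ⊗ ℂ^N` acting in the factors `i` and `j` (`i ≠ j`) of
`(ℂ^N)^{⊗n}`. -/
def actSites {n N : ℕ} {F : Type*} [Field F] (i j : Fin n)
    (M : Matrix (Fin N × Fin N) (Fin N × Fin N) F) : Matrix (Word n N) (Word n N) F :=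
  Matrix.of fun w w' =>
    if ∀ k, k ≠ i → k ≠ j → w k = w' k then M (w i, w j) (w' i, w' j) else 0

/-- `M^{(0,i)}`: the operator `M` on `ℂ^N ⊗ ℂ^N` acting in the auxiliary factor and in the
factor `i` of `ℂ^N ⊗ (ℂ^N)^{⊗n}`. -/
def actAux {n N : ℕ} {F : Type*} [Field F] (i : Fin n)
    (M : Matrix (Fin N × Fin N) (Fin N × Fin N) F) :
    Matrix (Fin N × Word n N) (Fin N × Word n N) F :=
  Matrix.of fun p q =>
    if ∀ k, k ≠ i → p.2 k = q.2 k then M (p.1, p.2 i) (q.1, q.2 i) else 0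

/-- `L(u) = 𝓡^{(0,n)}(z_n/u) ⋯ 𝓡^{(0,1)}(z_1/u) ∏_i (1 - h z_i/u) / (1 - z_i/u)`. -/
def monodromy (N : ℕ) {n : ℕ} {F : Type*} [Field F] (h : F) (x : Fin n → F) (u : F) :
    Matrix (Fin N × Word n N) (Fin N × Word n N) F :=
  (∏ i, (1 - h * (x i / u)) / (1 - x i / u)) •
    ((List.finRange n).reverse.map fun i => actAux i (Rmat N h (x i / u))).prod

/-- The two signs `+` and `-`. -/
inductive Sgn : Type
  | plus : Sgn
  | minus : Sgn

/-- The sign as an integer `±1`. -/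
def Sgn.toInt : Sgn → ℤ
  | .plus => 1
  | .minus => -1

/-- The coefficients `L_{i,j,±s}` of the Laurent expansions of `L_{i,j}(u)` at `u = 0` (sign `+`,
coefficient of `u^s`) and at `u = ∞` (sign `-`, coefficient of `u^{-s}`). The expansion at
`u = 0` is computed in the field of Laurent series in `u`, that at `u = ∞` in the field of
Laurent series in `u⁻¹`. -/
def Lcoeff {n N : ℕ} {F : Type*} [Field F] (h : F) (x : Fin n → F) (ε : Sgn) (i j : Fin N)
    (s : ℕ) : Matrix (Word n N) (Word n N) F :=
  Matrix.of fun w w' =>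
    HahnSeries.coeff
      (monodromy N (F := LaurentSeries F) (HahnSeries.C h) (fun a => HahnSeries.C (x a))
        (HahnSeries.single ε.toInt 1) (i, w) (j, w')) (s : ℤ)

/-- The operator `L_{i,j,±s}` on `(ℂ^N)^{⊗n}`-valued functions of `z, h`. -/
def Lop {n N : ℕ} (ε : Sgn) (i j : Fin N) (s : ℕ) : Module.End (K n) (V n N) :=
  Matrix.toLin' (Lcoeff (hK n) z ε i j s)

/-! ## The algebra `𝒰` (quantum loop algebra) and its Gelfand–Zetlin subalgebra `𝓑^∞` -/

/-- Generators: `L ε i j s` is `L̃_{i,j,εs}` and `Linv i` is `L̃_{i,i,+0}⁻¹`. -/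
inductive Gen (N : ℕ) : Type
  | L (ε : Sgn) (i j : Fin N) (s : ℕ) : Gen N
  | Linv (i : Fin N) : Gen N

/-- The coefficient of `u^m` in the generating series `L̃_{i,j,±}(u)`, in the free algebra. -/
def serCoeff {N : ℕ} (ε : Sgn) (i j : Fin N) (m : ℤ) : FreeAlgebra Ch (Gen N) :=
  if 0 ≤ ε.toInt * m then FreeAlgebra.ι Ch (Gen.L ε i j (ε.toInt * m).toNat) else 0

/-- The defining relations. The relation `rtt` is the coefficient of `u^m v^k` in
`(u - h v) 𝓡^{(1,2)}(v/u, h) L̃_α^{(1)}(u) L̃_β^{(2)}(v) =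
L̃_β^{(2)}(v) L̃_α^{(1)}(u) (u - h v) 𝓡^{(1,2)}(v/u, h)`, where
`(u - h v) 𝓡(v/u, h) = u · Rnum h 0 1 + v · Rnum h 1 0`. -/
inductive Rel (N : ℕ) : FreeAlgebra Ch (Gen N) → FreeAlgebra Ch (Gen N) → Prop
  | plus_zero (i j : Fin N) (hij : i < j) : Rel N (FreeAlgebra.ι Ch (Gen.L .plus i j 0)) 0
  | minus_zero (i j : Fin N) (hij : i < j) : Rel N (FreeAlgebra.ι Ch (Gen.L .minus j i 0)) 0
  | mul_inv (i : Fin N) :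
      Rel N (FreeAlgebra.ι Ch (Gen.L .plus i i 0) * FreeAlgebra.ι Ch (Gen.Linv i)) 1
  | inv_mul (i : Fin N) :
      Rel N (FreeAlgebra.ι Ch (Gen.Linv i) * FreeAlgebra.ι Ch (Gen.L .plus i i 0)) 1
  | first (i : Fin N) (hi : i.val = 0) : Rel N (FreeAlgebra.ι Ch (Gen.L .minus i i 0)) 1
  | shift (i j : Fin N) (hij : i.val + 1 = j.val) :
      Rel N (FreeAlgebra.ι Ch (Gen.L .plus i i 0)) (FreeAlgebra.ι Ch (Gen.L .minus j j 0))
  | rtt (α β : Sgn) (hαβ : ¬ (α = .minus ∧ β = .plus)) (a b c d : Fin N) (m k : ℤ) :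
      Rel N
        (∑ e : Fin N, ∑ f : Fin N,
          (Rnum N hh 0 1 (a, b) (e, f) • (serCoeff α e c (m - 1) * serCoeff β f d k) +
           Rnum N hh 1 0 (a, b) (e, f) • (serCoeff α e c m * serCoeff β f d (k - 1))))
        (∑ e : Fin N, ∑ f : Fin N,
          (Rnum N hh 0 1 (e, f) (c, d) • (serCoeff β b f k * serCoeff α a e (m - 1)) +
           Rnum N hh 1 0 (e, f) (c, d) • (serCoeff β b f (k - 1) * serCoeff α a e m)))

/-- The unital associative `ℂ(h)`-algebra `𝒰` given by these generators and relations. -/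
abbrev U (N : ℕ) : Type := RingQuot (Rel N)

/-- The element `L̃_{i,j,±s}` of `𝒰`. -/
def L {N : ℕ} (ε : Sgn) (i j : Fin N) (s : ℕ) : U N :=
  RingQuot.mkAlgHom Ch (Rel N) (FreeAlgebra.ι Ch (Gen.L ε i j s))

/-- The element `L̃_{i,i,+0}⁻¹` of `𝒰`. -/
def Linv {N : ℕ} (i : Fin N) : U N :=
  RingQuot.mkAlgHom Ch (Rel N) (FreeAlgebra.ι Ch (Gen.Linv i))

/-- The inverse of `L̃_{i,i,±0}`; recall `L̃_{1,1,-0} = 1` and `L̃_{i,i,-0} = L̃_{i-1,i-1,+0}`. -/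
def Linv0 {N : ℕ} : Sgn → Fin N → U N
  | .plus, i => Linv i
  | .minus, i => if i.val = 0 then 1 else Linv ⟨i.val - 1, by omega⟩

/-- The series `L̃_{i,j,±}(u h^a)`, as a power series in `u^{±1}`. -/
def Lser {N : ℕ} (ε : Sgn) (a : ℕ) (i j : Fin N) : PowerSeries (U N) :=
  PowerSeries.mk fun s => (hh ^ (ε.toInt * a * s) : Ch) • L ε i j s

/-- The quantum minor `M_{𝐢,𝐢,±}(u)` for `𝐢 = {1, …, p}`, as a power series in `u^{±1}`. -/
def minorSer {N : ℕ} (ε : Sgn) (p : ℕ) (hp : p ≤ N) : PowerSeries (U N) :=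
  ∑ σ : Equiv.Perm (Fin p), (Equiv.Perm.sign σ : ℤ) •
    (List.ofFn fun a : Fin p => Lser ε a (Fin.castLE hp a) (Fin.castLE hp (σ a))).prod

/-- `A_{p,±}(u) = M_{𝐢,𝐢,±}(u) L̃_{1,1,±0}⁻¹ ⋯ L̃_{p,p,±0}⁻¹ = 1 + ∑_{s ≥ 1} B^∞_{p,±s} u^{±s}`. -/
def Aser {N : ℕ} (ε : Sgn) (p : ℕ) (hp : p ≤ N) : PowerSeries (U N) :=
  minorSer ε p hp *
    PowerSeries.C (List.ofFn fun a : Fin p => Linv0 ε (Fin.castLE hp a)).prod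

/-- The Gelfand–Zetlin subalgebra `𝓑^∞ ⊂ 𝒰`: the unital `ℂ(h)`-subalgebra generated by
`L̃_{i,i,+0}^{±1}` and `B^∞_{p,±s}`, `p = 1, …, N`, `s ≥ 1`. -/
def GZ (N : ℕ) : Subalgebra Ch (U N) :=
  Algebra.adjoin Ch
    ({X | ∃ i, X = L .plus i i 0 ∨ X = Linv i} ∪
     {X | ∃ (ε : Sgn) (p : ℕ) (hp : p ≤ N) (s : ℕ), 1 ≤ p ∧ 1 ≤ s ∧
        X = PowerSeries.coeff s (Aser ε p hp)})

/-- `φ` is the `R`-matrix representation: the homomorphism with `L̃_{i,j,±s} ↦ L_{i,j,±s}`. -/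
def IsPho {n N : ℕ} (φ : U N →ₐ[Ch] Module.End (K n) (V n N)) : Prop :=
  ∀ (ε : Sgn) (i j : Fin N) (s : ℕ), φ (L ε i j s) = Lop ε i j s

/-- `φ_λ(𝓑^∞)`: the algebra of restrictions of the operators `φ(X)`, `X ∈ 𝓑^∞`, to the weight
subspace of weight `λ`. -/
def GZimage {n N : ℕ} (φ : U N →ₐ[Ch] Module.End (K n) (V n N)) (l : Comp n N) :
    Subalgebra Ch (Module.End (K n) (Vwt l)) where
  carrier := {T | ∃ X ∈ GZ N, ∀ v : Vwt l, φ X v = (T v : V n N)}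
  mul_mem' := by
    rintro S T ⟨X, hX, hS⟩ ⟨Y, hY, hT⟩
    exact ⟨X * Y, mul_mem hX hY, fun v => by simp [hT, hS]⟩
  add_mem' := by
    rintro S T ⟨X, hX, hS⟩ ⟨Y, hY, hT⟩
    exact ⟨X + Y, add_mem hX hY, fun v => by simp [hT, hS]⟩
  algebraMap_mem' := by
    intro c
    exact ⟨algebraMap Ch _ c, Subalgebra.algebraMap_mem _ c, fun v => by
      simp [Module.algebraMap_end_apply]⟩

/-! ## The `S_n`-action, the vectors `ξ_I`, and the spaces `(1/D)𝒱⁻` -/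

/-- `s̃_i = P^{(i,i+1)} 𝓡^{(i,i+1)}(z_i / z_{i+1}) K_i` on `(ℂ^N)^{⊗n}`-valued functions, where
`K_i` exchanges the variables `z_i`, `z_{i+1}` and `P^{(i,i+1)}` exchanges tensor factors. -/
def sTilde {n N : ℕ} (i : Adj n) (v : V n N) : V n N := fun w =>
  (actSites i.1 i.next (Rmat N (hK n) (z i.1 / z i.next))).mulVec
    (fun w' => permK i.s (v w')) (w ∘ i.s)

/-- The defining properties of the vectors `ξ_I`: `ξ_{I^min} = v_{I^min}` for every `λ`, and
`ξ_{s_i(I)} = s̃_i ξ_I`. -/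
def IsXi {n N : ℕ} (ξ : Word n N → V n N) : Prop :=
  (∀ l : Comp n N, ξ (imin l) = Pi.single (imin l) 1) ∧
  ∀ (i : Adj n) (w : Word n N), ξ (w ∘ i.s) = sTilde i (ξ w)

/-- `D = ∏_{b < a} (1 - h z_b / z_a)`. -/
def Den (n : ℕ) : K n :=
  ∏ a : Fin n, ∏ b : Fin n, if b < a then 1 - hK n * (z b / z a) else 1

/-- `v` is an `S_n`-invariant function with coordinates in `(1/D) ℂ[z^{±1}, h^{±1}]`, that is, an
element of `(1/D)𝒱⁻`. -/
def IsDV {n N : ℕ} (v : V n N) : Prop :=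
  (∀ w, Den n * v w ∈ intLaurent n) ∧ ∀ i : Adj n, sTilde i v = v

/-- `(1/D)𝒱⁻_λ ⊗ ℂ(h)`. -/
def DVh {n N : ℕ} (l : Comp n N) : Submodule Ch (V n N) :=
  Submodule.span Ch {v | v ∈ Vwt l ∧ IsDV v}

theorem DVh_le {n N : ℕ} {l : Comp n N} {v : V n N} (hv : v ∈ DVh l) : v ∈ Vwt l := by
  have h : DVh l ≤ (Vwt l).restrictScalars Ch := Submodule.span_le.2 fun _ hx => hx.1
  exact h hv

/-- `(1/D)𝒱⁻ ⊗ ℂ[z^{±1}] ⊗ ℂ(h)`. -/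
def DVz (n N : ℕ) : Submodule (P n) (V n N) := Submodule.span (P n) {v | IsDV v}

/-- `Q(z_I, h) = ∏_{k < l} ∏_{a ∈ I_k} ∏_{b ∈ I_l} (1 - h z_b / z_a)`. -/
def Qf {n N : ℕ} (w : Word n N) : K n :=
  ∏ a : Fin n, ∏ b : Fin n, if w a < w b then 1 - hK n * (z b / z a) else 1

/-- `R(z_I) = ∏_{k < l} ∏_{a ∈ I_k} ∏_{b ∈ I_l} (1 - z_b / z_a)`. -/
def Rf {n N : ℕ} (w : Word n N) : K n :=
  ∏ a : Fin n, ∏ b : Fin n, if w a < w b then 1 - z b / z a else 1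

/-- `ŝ_i = (1 - h z_{i+1}/z_i) / (1 - z_{i+1}/z_i) K_i + (h - 1) / (1 - z_{i+1}/z_i)`. -/
def sHat {n : ℕ} (i : Adj n) (f : K n) : K n :=
  (1 - hK n * (z i.next / z i.1)) / (1 - z i.next / z i.1) * permK i.s f +
    (hK n - 1) / (1 - z i.next / z i.1) * f

/-- `s_{j₁} ⋯ s_{j_r} (I)` for the list `j₁, …, j_r`. -/
def wordAct {n N : ℕ} (js : List (Adj n)) (w : Word n N) : Word n N :=
  js.foldr (fun i w => w ∘ i.s) w

/-- `ŝ_{j₁} ⋯ ŝ_{j_r} f` for the list `j₁, …, j_r`. -/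
def hatAct {n : ℕ} (js : List (Adj n)) (f : K n) : K n := js.foldr sHat f

/-- `s_{j₁} ⋯ s_{j_r}` is a reduced presentation of `σ_I`, the shortest permutation with
`σ_I(I^max) = I`. -/
def IsReducedFor {n N : ℕ} (js : List (Adj n)) (w : Word n N) : Prop :=
  wordAct js (imax (wt w)) = w ∧
    ∀ js' : List (Adj n), wordAct js' (imax (wt w)) = w → js.length ≤ js'.length

/-! ## The algebras `ℂ[z^{±1}]^{S_λ} ⊗ ℂ(h)` and `K_T(T^*𝓕_λ) ⊗ ℂ(h)` -/

/-- Symmetric Laurent polynomials, `ℂ[z^{±1}]^{S_n} ⊗ ℂ(h)`. -/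
def IsSymm {n : ℕ} (f : P n) : Prop := ∀ σ : Equiv.Perm (Fin n), permP σ f = f

/-- `ℂ[z^{±1}]^{S_λ} ⊗ ℂ(h)`, with `S_λ` the isotropy subgroup of `I^min`. Numbering the
variables `γ_{1,1}, …, γ_{1,λ₁}, γ_{2,1}, …, γ_{N,λ_N}` by `1, …, n` in this order, this is
also the algebra `ℂ[Γ^{±1}]^{S_λ} ⊗ ℂ(h)`. -/
def symL {n N : ℕ} (l : Comp n N) : Subalgebra Ch (P n) where
  carrier := {f | ∀ σ : Equiv.Perm (Fin n), imin l ∘ σ = imin l → permP σ f = f}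
  mul_mem' := fun ha hb σ hσ => by rw [map_mul, ha σ hσ, hb σ hσ]
  add_mem' := fun ha hb σ hσ => by rw [map_add, ha σ hσ, hb σ hσ]
  algebraMap_mem' := fun c σ _ => AlgEquiv.commutes (permP σ) c

/-- `f ↦ f(z_I)`: the variables with numbers in `I^min_k` (that is, `γ_{k,1}, …, γ_{k,λ_k}`) are
replaced by `{z_a | a ∈ I_k}`, for every `k`. The permutation `Tuple.sort w`, for which
`w ∘ Tuple.sort w` is weakly increasing, maps `I^min_k` onto `I_k`. -/
def atI {n N : ℕ} (w : Word n N) : P n →ₐ[Ch] P n := (permP (Tuple.sort w)).toAlgHom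

/-- `ℂ[Γ^{±1}]^{S_λ} ⊗ ℂ[z^{±1}] ⊗ ℂ(h)`. -/
abbrev preK {n N : ℕ} (l : Comp n N) : Type := P n ⊗[Ch] symL l

/-- The ideal generated by `f(Γ) - f(z)`, for symmetric Laurent polynomials `f`. -/
def relK {n N : ℕ} (l : Comp n N) : Ideal (preK l) :=
  Ideal.span {x | ∃ f : symL l, IsSymm (f : P n) ∧ x = 1 ⊗ₜ[Ch] f - (f : P n) ⊗ₜ[Ch] 1}

/-- `K_T(T^*𝓕_λ) ⊗ ℂ(h)`. -/
def KT {n N : ℕ} (l : Comp n N) : Type := preK l ⧸ relK l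

instance {n N : ℕ} (l : Comp n N) : CommRing (KT l) :=
  inferInstanceAs (CommRing (preK l ⧸ relK l))

instance {n N : ℕ} (l : Comp n N) : Algebra (P n) (KT l) :=
  inferInstanceAs (Algebra (P n) (preK l ⧸ relK l))

/-- The class `[f(Γ, z, h)]`. -/
def cls {n N : ℕ} {l : Comp n N} (f : preK l) : KT l := Ideal.Quotient.mk (relK l) f

/-- `K_T(𝒳_n) ⊗ ℂ(h) = ⊕_{|λ| = n} K_T(T^*𝓕_λ) ⊗ ℂ(h)` (a finite direct sum of algebras). -/
abbrev KX (n N : ℕ) : Type := (l : Comp n N) → KT l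

/-- `f(Γ, z, h) ↦ f(z_I, z, h)`. -/
def locI {n N : ℕ} (l : Comp n N) (w : Word n N) : preK l →ₐ[P n] P n :=
  Algebra.TensorProduct.lift (AlgHom.id (P n) (P n)) ((atI w).comp (symL l).val)
    (fun _ _ => Commute.all _ _)

/-- `φ(𝓑^∞) ⊗ ℂ[z^{±1}]`: the subalgebra of the operators on `(ℂ^N)^{⊗n}`-valued functions
generated by `φ(𝓑^∞)` and the multiplications by Laurent polynomials in `z`. -/
def GZz {n N : ℕ} (φ : U N →ₐ[Ch] Module.End (K n) (V n N)) :
    Subalgebra (P n) (Module.End (K n) (V n N)) :=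
  Algebra.adjoin (P n) {T | ∃ X ∈ GZ N, T = φ X}

/-- The operators on `K_T(T^*𝓕_λ) ⊗ ℂ(h)` by which the elements of `𝓑^∞` act, the action on
`K_T(𝒳_n) ⊗ ℂ(h)` being transported from the representation `φ` via `ν`. -/
def GZonKT {n N : ℕ} (φ : U N →ₐ[Ch] Module.End (K n) (V n N)) (ν : KX n N → V n N)
    (l : Comp n N) : Set (Module.End (P n) (KT l)) :=
  {T | ∃ X ∈ GZ N, ∀ f : KT l, ν (Pi.single l (T f)) = φ X (ν (Pi.single l f))}

end KStab

end

open KStab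

/-! The Gelfand–Zetlin algebra is diagonalized in the basis `ξ_I`, its eigenvalues are identified
with the `S_n`-equivariant families of Laurent polynomials, and invariant vectors and K-theory
classes are then compared with such families.

Representation. With denominators cleared and spectral parameters written as fractions `u₁/u₀`, the
Yang–Baxter equation is a polynomial identity (`yangBaxter_op`). Applied site by site it gives the
RTT relation for the monodromy matrix (`isRTT_listL`, `zcoefL_rtt`), hence `φ`. Applied to two
neighbouring sites it shows that every `φ(X)` commutes with `s̃_i` (`pho_sTilde`).

Eigenvectors. At spectral ratio `h` the `R`-matrix degenerates, so quantum minors alternate in their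
rows. Expanding a minor on `v_{I^min}` one site at a time leaves a single nonzero term
(`qMinor_mulVec`). Thus `v_{I^min}` is an eigenvector of all `A_{p,±}(u)`, with eigenvalue the
product over `I_1 ∪ ⋯ ∪ I_p` of the factors `(1 - h z_a/u)/(1 - z_a/u)`, each normalized to constant
term 1. Since `φ(X)` commutes with `s̃_i`, applying the `s̃_i` permutes eigenvalues. One element
`sepElt` has distinct eigenvalues for all `I`, so `ξ_I` is the unique eigenvector with a prescribed
diagonal coefficient. This uniqueness gives `ξ_{s_i(I)} = s̃_i ξ_I` without any braid relation, as
well as linear independence.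

Size of the algebra. Logarithmic derivatives turn the eigenvalue series into power sums of the
variables in each block, because `h` is not a root of unity. In characteristic zero these generate
all `S_λ`-invariant Laurent polynomials, and the `L̃_{i,i,+0}` separate the weights. Hence every
equivariant family `(e_I)` is the spectrum of some `X ∈ 𝓑^∞` (`exists_mem_GZ`). A family is
determined by its values at the `I^min`, which are arbitrary elements of `ℂ[z^{±1}]^{S_λ} ⊗ ℂ(h)`.

Invariant vectors. A vector is invariant exactly when its coefficients in the `ξ_I` are equivariant,
and its coordinates are obtained from the one at `I^max` by the operators `ŝ_i`. In the vector `∑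
(e_I/R(z_I)) ξ_I` the coordinate at `I^max` is `e/Q`. The operators `ŝ_i` do not worsen the
denominator `D` (`Den_mul_sHat_mem`), so equivariant families give elements of `(1/D)𝒱⁻ ⊗ ℂ(h)`.
Conversely `D` is `Q` times factors internal to the blocks, and an `S_λ`-invariant function cannot
have these as denominators (`mem_regK_of_blockDen`). This gives `θ_λ`, and `ψ_λ` is read off from
the eigenvalues.

K-theory. Classes are separated by their values at the fixed points (`locKT_injective`). For full
flags there are `n!` spanning monomials and `n!` fixed points, and Dedekind's independence of
characters makes the square evaluation matrix invertible. Averaging over `S_λ` descends this to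
partial flags. Then `ν` and `μ` are `ℂ[z^{±1}]`-linear versions of the previous isomorphisms. -/

noncomputable section
namespace KStab

/-! ### The Yang–Baxter equation and the RTT relation. -/

section RMatrix

variable {N : ℕ} {A : Type*} [CommRing A]

/-- The diagonal entry of `Rnum` at `v_a ⊗ v_b`. -/
def rDiag (h x y : A) (a b : Fin N) : A :=
  if a = b then y - h * x else if a < b then y - x else h * (y - x)

/-- The entry of `Rnum` from `v_b ⊗ v_a` to `v_a ⊗ v_b`, `a ≠ b`. -/
def rOff (h x y : A) (a b : Fin N) : A :=
  if a = b then 0 else if b < a then (1 - h) * x else (1 - h) * y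

theorem Rnum_apply (h x y : A) (a b e f : Fin N) :
    Rnum N h x y (a, b) (e, f) =
      (if e = a ∧ f = b then rDiag h x y a b else 0) +
        (if e = b ∧ f = a then rOff h x y a b else 0) := by
  simp only [Rnum, Matrix.of_apply, rDiag, rOff, Prod.mk.injEq, Prod.swap_prod_mk]
  by_cases hea : e = a
  · subst hea
    by_cases hfb : f = b
    · subst hfb
      by_cases hef : e = f
      · subst hef; simp
      · simp [hef]
    · simp only [hfb, and_false, if_false, Ne.symm hfb]
      by_cases hb : e = b
      · subst hb; simp [Ne.symm hfb, hfb]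
      · simp [hb, Ne.symm hb]
  · by_cases heb : e = b
    · subst heb
      by_cases hf : f = a
      · subst hf; simp [hea, Ne.symm hea]
      · simp [hf, Ne.symm hf, hea, Ne.symm hea]
    · simp [hea, Ne.symm hea, heb, Ne.symm heb]

theorem sum_Rnum_mul (h x y : A) (a b : Fin N) {M : Type*} [AddCommGroup M] [Module A M]
    (g : Fin N → Fin N → M) :
    ∑ e, ∑ f, Rnum N h x y (a, b) (e, f) • g e f =
      rDiag h x y a b • g a b + rOff h x y a b • g b a := by
  simp [Rnum_apply, add_smul, Finset.sum_add_distrib, ite_and]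

/-- The operators `(y - h x) 𝓡(x / y)` in the factors 1 and 2 of a triple tensor product. -/
def rOp12 (h x y : A) (g : Fin N → Fin N → Fin N → A) : Fin N → Fin N → Fin N → A :=
  fun a b c => rDiag h x y a b * g a b c + rOff h x y a b * g b a c

/-- The operators `(y - h x) 𝓡(x / y)` in the factors 1 and 3. -/
def rOp13 (h x y : A) (g : Fin N → Fin N → Fin N → A) : Fin N → Fin N → Fin N → A :=
  fun a b c => rDiag h x y a c * g a b c + rOff h x y a c * g c b a

/-- The operators `(y - h x) 𝓡(x / y)` in the factors 2 and 3. -/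
def rOp23 (h x y : A) (g : Fin N → Fin N → Fin N → A) : Fin N → Fin N → Fin N → A :=
  fun a b c => rDiag h x y b c * g a b c + rOff h x y b c * g a c b

/-- With `u = u₁/u₀`, `v = v₁/v₀`, `z = z₁/z₀` this is `𝓡^{(12)}(v/u) 𝓡^{(13)}(z/u) 𝓡^{(23)}(z/v) =
𝓡^{(23)}(z/v) 𝓡^{(13)}(z/u) 𝓡^{(12)}(v/u)` with all denominators cleared. Nothing is inverted, so
the expansions at `u = 0` and at `u = ∞` are instances of one identity. For each relative order of
the three letters it is a polynomial identity. -/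
theorem yangBaxter_op (h u₁ u₀ v₁ v₀ z₁ z₀ : A) (g : Fin N → Fin N → Fin N → A) :
    rOp12 h (v₁ * u₀) (u₁ * v₀) (rOp13 h (z₁ * u₀) (u₁ * z₀) (rOp23 h (z₁ * v₀) (v₁ * z₀) g)) =
    rOp23 h (z₁ * v₀) (v₁ * z₀) (rOp13 h (z₁ * u₀) (u₁ * z₀) (rOp12 h (v₁ * u₀) (u₁ * v₀) g)) := by
  funext a b c
  simp only [rOp12, rOp13, rOp23, rDiag, rOff]
  rcases lt_trichotomy a b with h1 | h1 | h1 <;> rcases lt_trichotomy a c with h2 | h2 | h2 <;>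
    rcases lt_trichotomy b c with h3 | h3 | h3 <;> first
    | (exfalso; omega)
    | (subst_vars
       simp only [*, ne_of_lt, ne_of_gt, not_lt_of_gt, lt_irrefl, if_true, if_false]
       ring)

theorem sum_Rnum_mul' (h x y : A) (a b : Fin N) (g : Fin N → Fin N → A) :
    rDiag h x y a b * g a b + rOff h x y a b * g b a =
      ∑ e, ∑ f, Rnum N h x y (a, b) (e, f) * g e f :=
  (sum_Rnum_mul (M := A) h x y a b g).symm

theorem rOp12_apply (h x y : A) (g : Fin N → Fin N → Fin N → A) (a b c : Fin N) :
    rOp12 h x y g a b c = ∑ e, ∑ f, Rnum N h x y (a, b) (e, f) * g e f c :=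
  sum_Rnum_mul' h x y a b fun e f => g e f c

theorem rOp13_apply (h x y : A) (g : Fin N → Fin N → Fin N → A) (a b c : Fin N) :
    rOp13 h x y g a b c = ∑ e, ∑ f, Rnum N h x y (a, c) (e, f) * g e b f :=
  sum_Rnum_mul' h x y a c fun e f => g e b f

theorem rOp23_apply (h x y : A) (g : Fin N → Fin N → Fin N → A) (a b c : Fin N) :
    rOp23 h x y g a b c = ∑ e, ∑ f, Rnum N h x y (b, c) (e, f) * g a e f :=
  sum_Rnum_mul' h x y b c fun e f => g a e f

theorem yangBaxter (h u₁ u₀ v₁ v₀ z₁ z₀ : A) (a b p c d q : Fin N) :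
    ∑ e, ∑ f, Rnum N h (v₁ * u₀) (u₁ * v₀) (a, b) (e, f) *
      ∑ r, Rnum N h (z₁ * u₀) (u₁ * z₀) (e, p) (c, r) *
        Rnum N h (z₁ * v₀) (v₁ * z₀) (f, r) (d, q) =
    ∑ f, ∑ r, Rnum N h (z₁ * v₀) (v₁ * z₀) (b, p) (f, r) *
      ∑ e, Rnum N h (z₁ * u₀) (u₁ * z₀) (a, r) (e, q) *
        Rnum N h (v₁ * u₀) (u₁ * v₀) (e, f) (c, d) := by
  have key := congr_fun (congr_fun (congr_fun (yangBaxter_op h u₁ u₀ v₁ v₀ z₁ z₀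
    (fun c' d' q' => if c' = c then if d' = d then if q' = q then 1 else 0 else 0 else 0)) a) b) p
  simp only [rOp12_apply, rOp13_apply, rOp23_apply] at key
  simp only [mul_ite, mul_one, mul_zero] at key
  have e : ∀ (g : Fin N → A) (P : Prop) [Decidable P], (∑ r, if P then g r else 0) =
      if P then ∑ r, g r else 0 := by
    intro g P _; split_ifs <;> simp
  simp only [e, mul_ite, mul_zero, Finset.sum_ite_eq', Finset.mem_univ, if_true] at key
  exact key

/-- `X ⊗ 1`, for a matrix over a not necessarily commutative ring. -/
def lft {M : Type*} [Ring M] (X : Matrix (Fin N) (Fin N) M) :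
    Matrix (Fin N × Fin N) (Fin N × Fin N) M :=
  Matrix.of fun p q => if p.2 = q.2 then X p.1 q.1 else 0

/-- `1 ⊗ X`, for a matrix over a not necessarily commutative ring. -/
def rgt {M : Type*} [Ring M] (X : Matrix (Fin N) (Fin N) M) :
    Matrix (Fin N × Fin N) (Fin N × Fin N) M :=
  Matrix.of fun p q => if p.1 = q.1 then X p.2 q.2 else 0

section
variable {M : Type*} [Ring M] (X Y : Matrix (Fin N) (Fin N) M)

theorem lft_mul : lft (X * Y) = lft X * lft Y := by
  ext ⟨a, b⟩ ⟨c, d⟩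
  simp [lft, Matrix.mul_apply, Fintype.sum_prod_type]

theorem rgt_mul : rgt (X * Y) = rgt X * rgt Y := by
  ext ⟨a, b⟩ ⟨c, d⟩
  simp [rgt, Matrix.mul_apply, Fintype.sum_prod_type]

theorem lft_mul_rgt_apply (a b c d : Fin N) : (lft X * rgt Y) (a, b) (c, d) = X a c * Y b d := by
  simp [lft, rgt, Matrix.mul_apply, Fintype.sum_prod_type]

theorem rgt_mul_lft_apply (a b c d : Fin N) : (rgt Y * lft X) (a, b) (c, d) = Y b d * X a c := by
  simp [lft, rgt, Matrix.mul_apply, Fintype.sum_prod_type]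

variable [Algebra A M]

/-- The relation `(y - h x) 𝓡(x / y) X⁽¹⁾ Y⁽²⁾ = Y⁽²⁾ X⁽¹⁾ (y - h x) 𝓡(x / y)`. -/
def IsRTT (h x y : A) : Prop :=
  (Rnum N h x y).map (algebraMap A M) * (lft X * rgt Y) =
    rgt Y * lft X * (Rnum N h x y).map (algebraMap A M)

theorem isRTT_iff (h x y : A) : IsRTT X Y h x y ↔ ∀ a b c d,
    ∑ e, ∑ f, Rnum N h x y (a, b) (e, f) • (X e c * Y f d) =
      ∑ e, ∑ f, Rnum N h x y (e, f) (c, d) • (Y b f * X a e) := by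
  have hL : ∀ a b c d, ((Rnum N h x y).map (algebraMap A M) * (lft X * rgt Y)) (a, b) (c, d) =
      ∑ e, ∑ f, Rnum N h x y (a, b) (e, f) • (X e c * Y f d) := by
    intro a b c d
    rw [Matrix.mul_apply, Fintype.sum_prod_type]
    simp [lft_mul_rgt_apply, Algebra.smul_def]
  have hR : ∀ a b c d, (rgt Y * lft X * (Rnum N h x y).map (algebraMap A M)) (a, b) (c, d) =
      ∑ e, ∑ f, Rnum N h x y (e, f) (c, d) • (Y b f * X a e) := by
    intro a b c d
    rw [Matrix.mul_apply, Fintype.sum_prod_type]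
    simp [rgt_mul_lft_apply, Algebra.smul_def, Algebra.commutes]
  constructor
  · intro H a b c d
    rw [← hL, ← hR, H]
  · intro H
    ext ⟨a, b⟩ ⟨c, d⟩
    rw [hL, hR, H]

variable {X Y}

/-- The coproduct argument: `X'` commutes past `Y` and `X` past `Y'`, so the product regroups into
the pairs `(X, Y)` and `(X', Y')`, and the `R`-matrix passes through one pair after the other. -/
theorem IsRTT.mul {h x y : A} {X' Y' : Matrix (Fin N) (Fin N) M} (H : IsRTT X Y h x y)
    (H' : IsRTT X' Y' h x y) (c₁ : ∀ i j k l, Commute (X' i j) (Y k l))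
    (c₂ : ∀ i j k l, Commute (X i j) (Y' k l)) : IsRTT (X * X') (Y * Y') h x y := by
  have e₁ : lft X' * rgt Y = rgt Y * lft X' := by
    ext ⟨a, b⟩ ⟨c, d⟩
    rw [lft_mul_rgt_apply, rgt_mul_lft_apply, (c₁ _ _ _ _).eq]
  have e₂ : lft X * rgt Y' = rgt Y' * lft X := by
    ext ⟨a, b⟩ ⟨c, d⟩
    rw [lft_mul_rgt_apply, rgt_mul_lft_apply, (c₂ _ _ _ _).eq]
  unfold IsRTT at *
  rw [lft_mul, rgt_mul]
  calc _ = (Rnum N h x y).map (algebraMap A M) * (lft X * (lft X' * rgt Y) * rgt Y') := by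
        simp only [mul_assoc]
    _ = ((Rnum N h x y).map (algebraMap A M) * (lft X * rgt Y)) * (lft X' * rgt Y') := by
        rw [e₁]; simp only [mul_assoc]
    _ = rgt Y * lft X * ((Rnum N h x y).map (algebraMap A M) * (lft X' * rgt Y')) := by
        rw [H]; simp only [mul_assoc]
    _ = rgt Y * (lft X * rgt Y') * lft X' * (Rnum N h x y).map (algebraMap A M) := by
        rw [H']; simp only [mul_assoc]
    _ = _ := by rw [e₂]; simp only [mul_assoc]

theorem IsRTT.one (h x y : A) : IsRTT (1 : Matrix (Fin N) (Fin N) M) 1 h x y := by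
  rw [isRTT_iff]
  intro a b c d
  simp only [Matrix.one_apply, mul_ite, mul_one, mul_zero, smul_ite, smul_zero]
  have : ∀ e f : Fin N, (if f = d then if e = c then Rnum N h x y (a, b) (e, f) • (1 : M) else 0 else 0)
    = if e = c then if f = d then Rnum N h x y (a, b) (e, f) • (1 : M) else 0 else 0 := by
    intro e f; split_ifs <;> rfl
  simp [this]

theorem IsRTT.smul {h x y : A} (H : IsRTT X Y h x y) (g g' : A) :
    IsRTT (g • X) (g' • Y) h x y := by
  rw [isRTT_iff] at *
  intro a b c d
  have := congr_arg (fun t => (g * g') • t) (H a b c d)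
  simp only [Finset.smul_sum] at this
  have e : ∀ (r : A) (m : M), r • ((g * g') • m) = (g * g') • (r • m) :=
    fun r m => smul_comm _ _ _
  simp only [Matrix.smul_apply, smul_mul_smul_comm, mul_comm g' g, e]
  exact this

theorem IsRTT.map {M' : Type*} [Ring M'] [Algebra A M'] {h x y : A} (H : IsRTT X Y h x y)
    (F : M →ₐ[A] M') : IsRTT (X.map F) (Y.map F) h x y := by
  rw [isRTT_iff] at *
  intro a b c d
  simpa using congr_arg F (H a b c d)

end

/-- The entry of `(y - h x) 𝓡(x / y)` with respect to the first factor, an operator in the second. -/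
def letterMat (h x y : A) : Matrix (Fin N) (Fin N) (Matrix (Fin N) (Fin N) A) :=
  Matrix.of fun j k => Matrix.of fun p q => Rnum N h x y (j, p) (k, q)

/-- For a single site the RTT relation is the Yang–Baxter equation, with the third tensor factor
read as the space on which the matrix entries act. -/
theorem isRTT_letterMat (h u₁ u₀ v₁ v₀ z₁ z₀ : A) :
    IsRTT (letterMat (N := N) h (z₁ * u₀) (u₁ * z₀)) (letterMat h (z₁ * v₀) (v₁ * z₀)) h
      (v₁ * u₀) (u₁ * v₀) := by
  rw [isRTT_iff]
  intro a b c d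
  ext p q
  have := yangBaxter h u₁ u₀ v₁ v₀ z₁ z₀ a b p c d q
  simp only [letterMat, Matrix.sum_apply, Matrix.smul_apply, Matrix.mul_apply, Matrix.of_apply,
    smul_eq_mul]
  rw [this]
  simp only [Finset.mul_sum]
  rw [Finset.sum_comm' (t' := Finset.univ) (s' := fun _ => Finset.univ) (by simp)]
  conv_rhs => rw [Finset.sum_comm]
  rw [Finset.sum_comm]
  refine Finset.sum_congr rfl fun f _ => ?_
  rw [Finset.sum_comm]
  refine Finset.sum_congr rfl fun e _ => Finset.sum_congr rfl fun r _ => ?_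
  ring

end RMatrix
-- Operators at one site and products over sites.
section Sites

variable {n N : ℕ} {S : Type*} [CommRing S]

theorem sum_word_off {M : Type*} [AddCommMonoid M] (i : Fin n) (w : Word n N)
    (f : Word n N → M) :
    (∑ w' : Word n N, if ∀ k, k ≠ i → w k = w' k then f w' else 0) =
      ∑ r, f (Function.update w i r) := by
  symm
  refine Fintype.sum_of_injective (fun r => Function.update w i r)
    (Function.update_injective w i) _ _ ?_ ?_
  · intro w' hw'
    rw [if_neg]
    intro h
    refine hw' ⟨w' i, ?_⟩
    funext k
    by_cases hk : k = i
    · subst hk; simp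
    · simp [hk, h k hk]
  · intro r
    rw [if_pos]
    intro k hk
    simp [hk]

/-- An operator in one tensor factor, as an operator in the tensor product. -/
def siteMat (i : Fin n) (m : Matrix (Fin N) (Fin N) S) : Matrix (Word n N) (Word n N) S :=
  Matrix.of fun w w' => if ∀ k, k ≠ i → w k = w' k then m (w i) (w' i) else 0

theorem siteMat_mulVec (i : Fin n) (m : Matrix (Fin N) (Fin N) S) (f : Word n N → S)
    (w : Word n N) :
    (siteMat i m).mulVec f w = ∑ r, m (w i) r * f (Function.update w i r) := by
  simp only [Matrix.mulVec, dotProduct, siteMat, Matrix.of_apply, ite_mul, zero_mul]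
  rw [sum_word_off i w fun w' => m (w i) (w' i) * f w']
  simp

theorem siteMat_single (i : Fin n) (m : Matrix (Fin N) (Fin N) S) (w : Word n N) :
    (siteMat i m).mulVec (Pi.single w 1) =
      ∑ r, m r (w i) • Pi.single (Function.update w i r) (1 : S) := by
  ext w'
  rw [Matrix.mulVec_single_one]
  simp only [Matrix.col_apply, siteMat, Matrix.of_apply, Finset.sum_apply, Pi.smul_apply,
    Pi.single_apply, smul_eq_mul, mul_ite, mul_one, mul_zero]
  have : ∀ r, (w' = Function.update w i r) ↔ ((∀ k, k ≠ i → w' k = w k) ∧ r = w' i) := by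
    intro r
    constructor
    · rintro rfl
      exact ⟨fun k hk => by simp [hk], by simp⟩
    · rintro ⟨h, rfl⟩
      funext k
      by_cases hk : k = i
      · subst hk; simp
      · simp [hk, h k hk]
  simp only [this, ite_and]
  split_ifs <;> simp

/-- `siteMat` as a homomorphism of algebras. -/
def siteHom (i : Fin n) :
    Matrix (Fin N) (Fin N) S →ₐ[S] Matrix (Word n N) (Word n N) S :=
  AlgHom.ofLinearMap
    { toFun := siteMat i
      map_add' := by
        intro a b; ext w w'
        simp only [siteMat, Matrix.of_apply, Matrix.add_apply]
        split_ifs <;> simp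
      map_smul' := by
        intro c a; ext w w'
        simp [siteMat] }
    (by
      refine (Matrix.ext_iff_mulVec).2 fun f => ?_
      funext w
      show (siteMat i 1).mulVec f w = _
      rw [siteMat_mulVec]
      simp [Matrix.one_apply])
    (by
      intro a b
      refine (Matrix.ext_iff_mulVec).2 fun f => ?_
      funext w
      show (siteMat i (a * b)).mulVec f w = (siteMat i a * siteMat i b).mulVec f w
      rw [← Matrix.mulVec_mulVec, siteMat_mulVec, siteMat_mulVec]
      simp only [siteMat_mulVec, Matrix.mul_apply, Function.update_self, Function.update_idem,
        Finset.sum_mul, Finset.mul_sum]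
      rw [Finset.sum_comm]
      simp only [mul_assoc])

theorem siteHom_apply (i : Fin n) (m : Matrix (Fin N) (Fin N) S) :
    siteHom i m = siteMat i m := rfl

theorem siteHom_commute {i j : Fin n} (hij : i ≠ j) (m m' : Matrix (Fin N) (Fin N) S) :
    Commute (siteHom i m) (siteHom j m') := by
  refine (Matrix.ext_iff_mulVec).2 fun f => ?_
  funext w
  rw [← Matrix.mulVec_mulVec, ← Matrix.mulVec_mulVec]
  simp only [siteHom_apply, siteMat_mulVec, ne_eq, hij, Ne.symm hij, not_false_eq_true,
    Function.update_of_ne, Finset.mul_sum]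
  rw [Finset.sum_comm]
  refine Finset.sum_congr rfl fun r _ => Finset.sum_congr rfl fun s _ => ?_
  rw [Function.update_comm hij]
  ring

theorem siteHom_map {S' : Type*} [CommRing S'] (F : S →+* S') (i : Fin n)
    (m : Matrix (Fin N) (Fin N) S) : (siteHom i m).map F = siteHom i (m.map F) := by
  ext w w'
  simp only [siteHom_apply, siteMat, Matrix.map_apply, Matrix.of_apply]
  split_ifs <;> simp

/-- The factor of the monodromy matrix belonging to one site. -/
def siteL (h x y g : S) (i : Fin n) :
    Matrix (Fin N) (Fin N) (Matrix (Word n N) (Word n N) S) :=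
  g • (letterMat h x y).map (siteHom i)

theorem siteL_apply (h x y g : S) (i : Fin n) (j k : Fin N) :
    siteL h x y g i j k = siteHom i (g • letterMat h x y j k) := by
  simp [siteL]

/-- The product of the factors of the monodromy matrix over a list of sites. -/
def listL (h : S) (x : Fin n → S) (y : S) (g : Fin n → S) (l : List (Fin n)) :
    Matrix (Fin N) (Fin N) (Matrix (Word n N) (Word n N) S) :=
  (l.map fun i => siteL h (x i) y (g i) i).prod

theorem listL_nil (h : S) (x : Fin n → S) (y : S) (g : Fin n → S) :
    listL (N := N) h x y g [] = 1 := rfl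

theorem listL_cons (h : S) (x : Fin n → S) (y : S) (g : Fin n → S) (i : Fin n)
    (l : List (Fin n)) :
    listL (N := N) h x y g (i :: l) = siteL h (x i) y (g i) i * listL h x y g l := rfl

theorem siteHom_commute_listL (h : S) (x : Fin n → S) (y : S) (g : Fin n → S) (l : List (Fin n)) (i : Fin n) (hi : i ∉ l) (m : Matrix (Fin N) (Fin N) S)
    (j k : Fin N) : Commute (siteHom i m) (listL h x y g l j k) := by
  induction l generalizing j k with
  | nil =>
    rw [listL_nil, Matrix.one_apply]
    split_ifs
    · exact Commute.one_right _
    · exact Commute.zero_right _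
  | cons a l ih =>
    rw [listL_cons, Matrix.mul_apply]
    refine Commute.sum_right _ _ _ fun e _ => ?_
    rw [siteL_apply]
    exact (siteHom_commute (List.ne_of_not_mem_cons hi) _ _).mul_right
      (ih (fun h' => hi (List.mem_cons_of_mem _ h')) _ _)

/-- Operators at distinct sites commute, so the relation for one site multiplies up along the list.
The scalars `g`, `g'` enter both sides equally and may be arbitrary; later they invert the
denominators of the monodromy matrix. -/
theorem isRTT_listL (h : S) (z : Fin n → S) (u₁ u₀ v₁ v₀ : S) (g g' : Fin n → S)
    (l : List (Fin n)) (hl : l.Nodup) :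
    IsRTT (listL (N := N) h (fun i => z i * u₀) u₁ g l) (listL h (fun i => z i * v₀) v₁ g' l) h
      (v₁ * u₀) (u₁ * v₀) := by
  induction l with
  | nil => exact IsRTT.one _ _ _
  | cons a l ih =>
    rw [listL_cons, listL_cons]
    have ha := (List.nodup_cons.1 hl).1
    refine IsRTT.mul ?_ (ih (List.nodup_cons.1 hl).2) ?_ ?_
    · have := (isRTT_letterMat (N := N) h u₁ u₀ v₁ v₀ (z a) 1).map (siteHom a)
      simp only [mul_one] at this
      exact this.smul (g a) (g' a)
    · intro i j k m
      rw [siteL_apply]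
      exact (siteHom_commute_listL h _ _ _ l a ha _ _ _).symm
    · intro i j k m
      rw [siteL_apply]
      exact (siteHom_commute_listL h _ _ _ l a ha _ _ _)

theorem Rnum_map {S' : Type*} [CommRing S'] (F : S →+* S') (h x y : S) (o q : Fin N × Fin N) :
    F (Rnum N h x y o q) = Rnum N (F h) (F x) (F y) o q := by
  simp only [Rnum, Matrix.of_apply]
  split_ifs <;> simp

/-- This is the splitting by which `Rel.rtt` extracts the coefficient of `u^m v^k`. -/
theorem Rnum_linear (h x y : S) (o q : Fin N × Fin N) :
    Rnum N h x y o q = y * Rnum N h 0 1 o q + x * Rnum N h 1 0 o q := by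
  simp only [Rnum, Matrix.of_apply]
  split_ifs <;> ring

theorem Rnum_mul (h x y c : S) (o q : Fin N × Fin N) :
    Rnum N h (c * x) (c * y) o q = c * Rnum N h x y o q := by
  simp only [Rnum, Matrix.of_apply]
  split_ifs <;> ring

theorem listL_map {S' : Type*} [CommRing S'] (F : S →+* S') (h : S) (x : Fin n → S) (y : S)
    (g : Fin n → S) (l : List (Fin n)) (j k : Fin N) :
    (listL h x y g l j k).map F =
      listL (F h) (fun i => F (x i)) (F y) (fun i => F (g i)) l j k := by
  induction l generalizing j k with
  | nil =>
    simp only [listL_nil, Matrix.one_apply]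
    split_ifs
    · exact Matrix.map_one _ (map_zero F) (map_one F)
    · exact Matrix.map_zero _ (map_zero F)
  | cons a l ih =>
    simp only [listL_cons, Matrix.mul_apply]
    have hs : ∀ (s : Finset (Fin N)) (f : Fin N → Matrix (Word n N) (Word n N) S),
        (∑ e ∈ s, f e).map F = ∑ e ∈ s, (f e).map F :=
      fun s f => map_sum (F.toAddMonoidHom.mapMatrix) f s
    rw [hs]
    refine Finset.sum_congr rfl fun e _ => ?_
    rw [Matrix.map_mul, ih, siteL_apply, siteL_apply, siteHom_map]
    congr 2
    ext p q
    simp [letterMat, Rnum_map]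

/-- The monodromy matrix. -/
def fullL (h : S) (x : Fin n → S) (y : S) (g : Fin n → S) :
    Matrix (Fin N) (Fin N) (Matrix (Word n N) (Word n N) S) :=
  listL h x y g (List.finRange n).reverse

end Sites
-- The monodromy matrix as a power series in `u` or in `u⁻¹`.
section Series

variable {n N : ℕ} {F : Type*} [CommRing F]

/-- The numerator of the spectral parameter `u = u₁ / u₀`, as a power series in `u^{±1}`. -/
def uNum (F : Type*) [CommRing F] : Sgn → PowerSeries F
  | .plus => PowerSeries.X
  | .minus => 1

/-- The denominator of the spectral parameter `u = u₁ / u₀`, as a power series in `u^{±1}`. -/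
def uDen (F : Type*) [CommRing F] : Sgn → PowerSeries F
  | .plus => 1
  | .minus => PowerSeries.X

/-- The inverse of `u₁ - z u₀`, as a power series in `u^{±1}`. -/
def invSer (z zi : F) : Sgn → PowerSeries F
  | .plus => PowerSeries.mk fun s => -zi ^ (s + 1)
  | .minus => PowerSeries.mk fun s => z ^ s

/-- Both expansions are geometric series over any ring in which `z` is invertible. This is why the
coefficients of the monodromy matrix are Laurent polynomials in the `z_i`. -/
theorem invSer_mul {z zi : F} (hz : z * zi = 1) (ε : Sgn) :
    invSer z zi ε * (uNum F ε - PowerSeries.C z * uDen F ε) = 1 := by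
  cases ε with
  | plus =>
    ext m
    simp only [invSer, uNum, uDen, mul_sub, mul_one, map_sub]
    rw [← mul_comm (PowerSeries.C z), PowerSeries.coeff_C_mul]
    cases m with
    | zero => simp [hz]
    | succ m =>
      rw [PowerSeries.coeff_succ_mul_X]
      simp only [PowerSeries.coeff_mk, PowerSeries.coeff_one, Nat.add_eq_zero_iff, one_ne_zero,
        and_false, if_false]
      linear_combination (zi ^ (m + 1)) * hz
  | minus =>
    ext m
    simp only [invSer, uNum, uDen, mul_sub, mul_one, map_sub]
    rw [mul_left_comm, PowerSeries.coeff_C_mul]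
    cases m with
    | zero => simp
    | succ m =>
      rw [PowerSeries.coeff_succ_mul_X]
      simp [pow_succ, mul_comm]

/-- The monodromy matrix, as a power series in `u^{±1}`. -/
def serL (N : ℕ) (h : F) (z zi : Fin n → F) (ε : Sgn) :
    Matrix (Fin N) (Fin N) (Matrix (Word n N) (Word n N) (PowerSeries F)) :=
  fullL (PowerSeries.C h) (fun i => PowerSeries.C (z i) * uDen F ε) (uNum F ε)
    (fun i => invSer (z i) (zi i) ε)

/-- The coefficients of the monodromy matrix. -/
def coefL (h : F) (z zi : Fin n → F) (ε : Sgn) (i j : Fin N) (s : ℕ) :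
    Matrix (Word n N) (Word n N) F :=
  (serL N h z zi ε i j).map (PowerSeries.coeff s)

/-- Naturality serves two purposes: passing from Laurent polynomials to rational functions, and
permuting the variables. -/
theorem coefL_map {F' : Type*} [CommRing F'] (Φ : F →+* F') (h : F) (z zi : Fin n → F) (ε : Sgn)
    (i j : Fin N) (s : ℕ) :
    (coefL h z zi ε i j s).map Φ =
      coefL (Φ h) (fun i => Φ (z i)) (fun i => Φ (zi i)) ε i j s := by
  have e := listL_map (PowerSeries.map Φ) (PowerSeries.C h)
    (fun i => PowerSeries.C (z i) * uDen F ε) (uNum F ε)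
    (fun i => invSer (z i) (zi i) ε) (List.finRange n).reverse i j
  have hn : PowerSeries.map Φ (uNum F ε) = uNum F' ε := by cases ε <;> simp [uNum]
  have hd : PowerSeries.map Φ (uDen F ε) = uDen F' ε := by cases ε <;> simp [uDen]
  have hg : ∀ i, PowerSeries.map Φ (invSer (z i) (zi i) ε) =
      invSer (Φ (z i)) (Φ (zi i)) ε := by
    intro i; cases ε <;> · ext; simp [invSer]
  simp only [map_mul, PowerSeries.map_C, hn, hd, hg] at e
  simp only [coefL, serL, fullL]
  rw [← e]
  ext w w'
  simp

theorem smul_list_prod {M S : Type*} [CommRing S] [Ring M] [Algebra S M] {ι : Type*} (c : ι → S)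
    (A : ι → M) (l : List ι) :
    (l.map c).prod • (l.map A).prod = (l.map fun i => c i • A i).prod := by
  induction l with
  | nil => simp
  | cons a l ih => simp only [List.map_cons, List.prod_cons, ← ih, smul_mul_smul_comm]

/-- The prefactor of `L(u)` cancels the denominators `1 - h z_i/u` of the `R`-matrices. What remains
at each site is `Rnum` divided by `u₁ - z_i u₀`. -/
theorem monodromy_eq {E : Type*} [Field E] (h : E) (x : Fin n → E) (u : E) (y u₀ : E)
    (g : Fin n → E) (hy : y ≠ 0) (hu : u * u₀ = y) (hu₀ : u₀ ≠ 0)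
    (h1 : ∀ i, 1 - h * (x i / u) ≠ 0) (hg : ∀ i, g i * (y - x i * u₀) = 1) (i j : Fin N)
    (w w' : Word n N) :
    monodromy N h x u (i, w) (j, w') = fullL h (fun i => x i * u₀) y g i j w w' := by
  have hune : u ≠ 0 := by rintro rfl; simp at hu; exact hy hu.symm
  have hp : (∏ i, (1 - h * (x i / u)) / (1 - x i / u)) =
      ((List.finRange n).reverse.map fun i => (1 - h * (x i / u)) / (1 - x i / u)).prod := by
    rw [← List.prod_ofFn, List.ofFn_eq_map]
    exact ((List.reverse_perm _).map _).prod_eq.symm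
  have hm : monodromy N h x u = Matrix.compRingEquiv (Fin N) (Word n N) E
      (fullL h (fun i => x i * u₀) y g) := by
    unfold monodromy
    rw [hp, smul_list_prod, fullL, listL, map_list_prod, List.map_map]
    congr 1
    refine List.map_congr_left fun a _ => ?_
    ext ⟨j, w⟩ ⟨k, w'⟩
    have hc : (1 - h * (x a / u)) / (1 - x a / u) * (1 - h * (x a / u))⁻¹ = g a * y := by
      have h2 : 1 - x a / u ≠ 0 := by
        intro h0
        have : x a = u := (div_eq_one_iff_eq hune).1 (sub_eq_zero.1 h0).symm
        have h3 := hg a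
        rw [this, hu, sub_self, mul_zero] at h3
        exact zero_ne_one h3
      have h3 : 1 - x a / u = (y - x a * u₀) / y := by
        rw [← hu]; field_simp
      have h4 : y - x a * u₀ ≠ 0 := right_ne_zero_of_mul_eq_one (hg a)
      rw [div_mul_eq_mul_div, mul_inv_cancel₀ (h1 a), h3, eq_div_of_mul_eq h4 (hg a)]
      field_simp
    have hr : ∀ o q, Rnum N h (x a * u₀) y o q = y * Rnum N h (x a / u) 1 o q := by
      intro o q
      rw [← Rnum_mul]
      congr 1
      · rw [← hu]; field_simp
      · ring
    simp only [Function.comp, Matrix.compRingEquiv_apply, Matrix.comp_apply, Matrix.smul_apply,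
      actAux, Matrix.of_apply, siteL_apply, siteHom_apply, siteMat, letterMat, Rmat]
    split_ifs with hif
    · rw [hr, smul_smul, hc]
      simp only [smul_eq_mul]
      ring
    · simp
  rw [hm]
  rfl

theorem Lcoeff_eq {F : Type*} [Field F] (h : F) (z zi : Fin n → F) (hz : ∀ i, z i * zi i = 1)
    (ε : Sgn) (i j : Fin N) (s : ℕ) : Lcoeff h z ε i j s = coefL h z zi ε i j s := by
  ext w w'
  simp only [Lcoeff, Matrix.of_apply, coefL, Matrix.map_apply, serL]
  let Φ : PowerSeries F →+* LaurentSeries F := HahnSeries.ofPowerSeries ℤ F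
  have hΦ : Function.Injective Φ := HahnSeries.ofPowerSeries_injective
  have hX : Φ PowerSeries.X = HahnSeries.single 1 1 := HahnSeries.ofPowerSeries_X
  have hC : ∀ c, Φ (PowerSeries.C c) = HahnSeries.C c := fun c => HahnSeries.ofPowerSeries_C c
  have hε : ε.toInt ≠ 0 := by cases ε <;> simp [Sgn.toInt]
  have hinv : (HahnSeries.single ε.toInt (1 : F))⁻¹ = HahnSeries.single (-ε.toInt) 1 := by
    refine inv_eq_of_mul_eq_one_right ?_
    rw [HahnSeries.single_mul_single]; simp
  rw [monodromy_eq (HahnSeries.C h) (fun a => HahnSeries.C (z a)) _ (Φ (uNum F ε)) (Φ (uDen F ε))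
    (fun a => Φ (invSer (z a) (zi a) ε))]
  · have e := listL_map Φ (PowerSeries.C h)
      (fun i => PowerSeries.C (z i) * uDen F ε) (uNum F ε)
      (fun i => invSer (z i) (zi i) ε) (List.finRange n).reverse i j
    simp only [map_mul, hC] at e
    unfold fullL
    rw [← e, Matrix.map_apply]
    exact HahnSeries.ofPowerSeries_apply_coeff _ _
  · rw [Ne, map_eq_zero_iff Φ hΦ]
    cases ε <;> simp [uNum]
  · cases ε
    · simp [uNum, uDen, hX, Sgn.toInt]
    · simp [uNum, uDen, hX, Sgn.toInt, HahnSeries.single_mul_single]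
  · rw [Ne, map_eq_zero_iff Φ hΦ]
    cases ε <;> simp [uDen]
  -- The term with `h` lives in degree `±1`, so the coefficient in degree 0 of this denominator is
  -- 1.
  · intro a h0
    have := congr_arg (fun f => HahnSeries.coeff f 0) h0
    rw [div_eq_mul_inv, hinv] at this
    simp [HahnSeries.C_apply, HahnSeries.single_mul_single, HahnSeries.coeff_single_of_ne,
      HahnSeries.coeff_one, hε] at this
  · intro a
    have := congr_arg Φ (invSer_mul (hz a) ε)
    simpa [hC] using this

/-- The coefficient of `u^m` in a power series in `u^{±1}`. -/
def zcoeff (ε : Sgn) (m : ℤ) : PowerSeries F →ₗ[F] F :=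
  if 0 ≤ ε.toInt * m then PowerSeries.coeff (ε.toInt * m).toNat else 0

/-- The functional sending `u₁ f` and `u₀ f` to the coefficients of `u^{m-1}` and `u^m` in `f`. -/
def scoeff (ε : Sgn) (m : ℤ) : PowerSeries F →ₗ[F] F :=
  match ε with
  | .plus => zcoeff .plus m
  | .minus => zcoeff .minus (m - 1)

theorem zcoeff_X_mul (ε : Sgn) (m : ℤ) (f : PowerSeries F) :
    zcoeff ε m (PowerSeries.X * f) = zcoeff ε (m - ε.toInt) f := by
  have e : ε.toInt * (m - ε.toInt) = ε.toInt * m - 1 := by cases ε <;> (simp [Sgn.toInt]; try ring)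
  unfold zcoeff
  rw [e]
  rcases lt_trichotomy (ε.toInt * m) 0 with h | h | h
  · rw [if_neg (by omega), if_neg (by omega)]; simp
  · rw [if_pos (by omega), if_neg (by omega), h]; simp
  · rw [if_pos (by omega), if_pos (by omega)]
    obtain ⟨k, hk⟩ := Int.eq_ofNat_of_zero_le (show 0 ≤ ε.toInt * m - 1 by omega)
    rw [show (ε.toInt * m).toNat = k + 1 by omega, show (ε.toInt * m - 1).toNat = k by omega,
      PowerSeries.coeff_succ_X_mul]

/-- For the sign `-` the homogeneous relation is the original one multiplied by `u₀ = u⁻¹`. The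
shift of the index in `scoeff` undoes this, so that both signs obey the same two rules. -/
theorem scoeff_uNum (ε : Sgn) (m : ℤ) (f : PowerSeries F) :
    scoeff ε m (uNum F ε * f) = zcoeff ε (m - 1) f := by
  cases ε
  · simp only [scoeff, uNum]; rw [zcoeff_X_mul]; rfl
  · simp [scoeff, uNum]

theorem scoeff_uDen (ε : Sgn) (m : ℤ) (f : PowerSeries F) :
    scoeff ε m (uDen F ε * f) = zcoeff ε m f := by
  cases ε
  · simp [scoeff, uDen]
  · simp only [scoeff, uDen]; rw [zcoeff_X_mul]; simp [Sgn.toInt]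

theorem scoeff_map_C (ε : Sgn) (m : ℤ) (f : PowerSeries F) :
    scoeff ε m (PowerSeries.map (PowerSeries.C (R := F)) f) = PowerSeries.C (scoeff ε m f) := by
  have : ∀ m, zcoeff ε m (PowerSeries.map (PowerSeries.C (R := F)) f) =
      PowerSeries.C (zcoeff ε m f) := by
    intro m; unfold zcoeff; split_ifs <;> simp
  cases ε <;> simp [scoeff, this]

theorem scoeff_C_mul (ε : Sgn) (m : ℤ) (c : F) (f : PowerSeries F) :
    scoeff ε m (PowerSeries.C c * f) = c * scoeff ε m f := by
  have : ∀ m, zcoeff ε m (PowerSeries.C c * f) = c * zcoeff ε m f := by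
    intro m; unfold zcoeff; split_ifs <;> simp
  cases ε <;> simp [scoeff, this]

/-- The coefficients in two variables. -/
def scoeff₂ (α β : Sgn) (m k : ℤ) : PowerSeries (PowerSeries F) →+ F :=
  (scoeff α m).toAddMonoidHom.comp (scoeff (F := PowerSeries F) β k).toAddMonoidHom

theorem scoeff₂_mul (α β : Sgn) (m k : ℤ) (f g : PowerSeries F) :
    scoeff₂ α β m k (PowerSeries.C f * PowerSeries.map PowerSeries.C g) =
      scoeff α m f * scoeff β k g := by
  simp only [scoeff₂, AddMonoidHom.comp_apply, LinearMap.toAddMonoidHom_coe]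
  rw [scoeff_C_mul, scoeff_map_C, mul_comm f, scoeff_C_mul, mul_comm]

/-- The coefficients of the monodromy matrix at all integer powers of `u`. -/
def zcoefL (h : F) (z zi : Fin n → F) (ε : Sgn) (i j : Fin N) (m : ℤ) :
    Matrix (Word n N) (Word n N) F :=
  (serL N h z zi ε i j).map (zcoeff ε m)

/-- The defining relation `Rel.rtt` for the coefficients of the monodromy matrix. It is the RTT
relation over power series in two variables, read coefficientwise, and no restriction on the signs
is needed. -/
theorem zcoefL_rtt (h : F) (z zi : Fin n → F) (α β : Sgn) (a b c d : Fin N) (m k : ℤ) :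
    ∑ e : Fin N, ∑ f : Fin N,
      (Rnum N h 0 1 (a, b) (e, f) • (zcoefL h z zi α e c (m - 1) * zcoefL h z zi β f d k) +
        Rnum N h 1 0 (a, b) (e, f) • (zcoefL h z zi α e c m * zcoefL h z zi β f d (k - 1))) =
    ∑ e : Fin N, ∑ f : Fin N,
      (Rnum N h 0 1 (e, f) (c, d) • (zcoefL h z zi β b f k * zcoefL h z zi α a e (m - 1)) +
        Rnum N h 1 0 (e, f) (c, d) • (zcoefL h z zi β b f (k - 1) * zcoefL h z zi α a e m)) := by
  -- The inner variable carries the expansion in `u`, the outer one that in `v`.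
  let i₁ : PowerSeries F →+* PowerSeries (PowerSeries F) := PowerSeries.C
  let i₂ : PowerSeries F →+* PowerSeries (PowerSeries F) := PowerSeries.map PowerSeries.C
  have hi : ∀ c, i₂ (PowerSeries.C c) = i₁ (PowerSeries.C c) := fun c => by simp [i₁, i₂]
  have key := isRTT_listL (N := N) (i₁ (PowerSeries.C h)) (fun i => i₁ (PowerSeries.C (z i)))
    (i₁ (uNum F α)) (i₁ (uDen F α)) (i₂ (uNum F β)) (i₂ (uDen F β))
    (fun i => i₁ (invSer (z i) (zi i) α)) (fun i => i₂ (invSer (z i) (zi i) β))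
    (List.finRange n).reverse (List.nodup_reverse.2 (List.nodup_finRange n))
  rw [isRTT_iff] at key
  have e₁ : ∀ e c, listL (i₁ (PowerSeries.C h)) (fun i => i₁ (PowerSeries.C (z i)) * i₁ (uDen F α))
      (i₁ (uNum F α)) (fun i => i₁ (invSer (z i) (zi i) α)) (List.finRange n).reverse e c =
      (serL N h z zi α e c).map i₁ := by
    intro e c
    rw [serL, fullL, listL_map]
    simp only [map_mul]
  have e₂ : ∀ e c, listL (i₁ (PowerSeries.C h)) (fun i => i₁ (PowerSeries.C (z i)) * i₂ (uDen F β))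
      (i₂ (uNum F β)) (fun i => i₂ (invSer (z i) (zi i) β)) (List.finRange n).reverse e c =
      (serL N h z zi β e c).map i₂ := by
    intro e c
    rw [serL, fullL, listL_map]
    simp only [map_mul, hi]
  have key := key a b c d
  simp only [e₁, e₂] at key
  ext w w'
  have key := congr_arg (scoeff₂ α β m k) (congr_fun (congr_fun key w) w')
  have hR : ∀ o q, Rnum N (i₁ (PowerSeries.C h)) 0 1 o q = i₁ (PowerSeries.C (Rnum N h 0 1 o q)) ∧
      Rnum N (i₁ (PowerSeries.C h)) 1 0 o q = i₁ (PowerSeries.C (Rnum N h 1 0 o q)) := by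
    intro o q
    have := Rnum_map (N := N) (i₁.comp PowerSeries.C) h 0 1 o q
    have h2 := Rnum_map (N := N) (i₁.comp PowerSeries.C) h 1 0 o q
    simp only [map_zero, map_one] at this h2
    exact ⟨this.symm, h2.symm⟩
  have hterm : ∀ (o q : Fin N × Fin N) (f g : PowerSeries F),
      scoeff₂ α β m k (Rnum N (i₁ (PowerSeries.C h)) (i₂ (uNum F β) * i₁ (uDen F α))
        (i₁ (uNum F α) * i₂ (uDen F β)) o q * (i₁ f * i₂ g)) =
      Rnum N h 0 1 o q * (zcoeff α (m - 1) f * zcoeff β k g) +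
        Rnum N h 1 0 o q * (zcoeff α m f * zcoeff β (k - 1) g) := by
    intro o q f g
    rw [Rnum_linear, (hR o q).1, (hR o q).2]
    have : (i₁ (uNum F α) * i₂ (uDen F β) * i₁ (PowerSeries.C (Rnum N h 0 1 o q)) +
        i₂ (uNum F β) * i₁ (uDen F α) * i₁ (PowerSeries.C (Rnum N h 1 0 o q))) * (i₁ f * i₂ g) =
        i₁ (uNum F α * (PowerSeries.C (Rnum N h 0 1 o q) * f)) * i₂ (uDen F β * g) +
        i₁ (uDen F α * (PowerSeries.C (Rnum N h 1 0 o q) * f)) * i₂ (uNum F β * g) := by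
      simp only [map_mul]; ring
    rw [this, map_add, scoeff₂_mul, scoeff₂_mul, scoeff_uNum, scoeff_uDen, scoeff_uNum,
      scoeff_uDen, ← PowerSeries.smul_eq_C_mul, ← PowerSeries.smul_eq_C_mul, map_smul, map_smul]
    simp only [smul_eq_mul]
    ring
  have hterm' : ∀ (o q : Fin N × Fin N) (f g : PowerSeries F),
      scoeff₂ α β m k (Rnum N (i₁ (PowerSeries.C h)) (i₂ (uNum F β) * i₁ (uDen F α))
        (i₁ (uNum F α) * i₂ (uDen F β)) o q * (i₂ g * i₁ f)) =
      Rnum N h 0 1 o q * (zcoeff β k g * zcoeff α (m - 1) f) +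
        Rnum N h 1 0 o q * (zcoeff β (k - 1) g * zcoeff α m f) := by
    intro o q f g
    rw [mul_comm (i₂ g), hterm]; ring
  simp only [Matrix.sum_apply, Matrix.smul_apply, Matrix.mul_apply, Matrix.map_apply, smul_eq_mul,
    Finset.mul_sum, map_sum, hterm, hterm'] at key
  simp only [Matrix.sum_apply, Matrix.smul_apply, Matrix.mul_apply, zcoefL, Matrix.map_apply,
    Matrix.add_apply, smul_eq_mul, Finset.mul_sum, ← Finset.sum_add_distrib]
  exact key

end Series
-- Leading coefficients of the monodromy matrix at zero and infinity.
section Triangular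

variable {n N : ℕ} {S : Type*} [CommRing S]

theorem siteHom_diagonal (i : Fin n) (d : Fin N → S) :
    siteHom i (Matrix.diagonal d) = Matrix.diagonal fun w : Word n N => d (w i) := by
  ext w w'
  simp only [siteHom_apply, siteMat, Matrix.of_apply, Matrix.diagonal_apply]
  by_cases h : w = w'
  · subst h; simp
  · rw [if_neg h]
    split_ifs with h1 h2
    · exact absurd (funext fun k => by
        by_cases hk : k = i
        · subst hk; exact h2
        · exact h1 k hk) h
    · rfl
    · rfl

/-- Upper and lower triangular products are treated together: `r j k` says that the entry `(j, k)`
has to vanish, and the three conditions on `r` are what the strict order and its reverse have in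
common. -/
theorem listL_triangular (r : Fin N → Fin N → Prop) [DecidableRel r]
    (hr : ∀ i j k, r i j → ¬ r i k → r k j) (hrr : ∀ i, ¬ r i i)
    (hr'' : ∀ i j, ¬ r i j → ¬ r j i → i = j)
    (h : S) (x : Fin n → S) (y : S) (g : Fin n → S) (d : Fin N → Fin N → S)
    (hoff : ∀ i j k, r j k → siteL h (x i) y (g i) i j k = 0)
    (hdiag : ∀ i j, siteL h (x i) y (g i) i j j = siteHom i (Matrix.diagonal (d j)))
    (l : List (Fin n)) (j : Fin N) :
    (∀ k, r j k → listL h x y g l j k = 0) ∧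
      listL h x y g l j j = Matrix.diagonal fun w => (l.map fun i => d j (w i)).prod := by
  induction l generalizing j with
  | nil =>
    refine ⟨fun k hk => ?_, ?_⟩
    · rw [listL_nil, Matrix.one_apply_ne]
      rintro rfl; exact hrr _ hk
    · rw [listL_nil, Matrix.one_apply_eq]
      simp
  | cons a l ih =>
    simp only [listL_cons, Matrix.mul_apply]
    refine ⟨fun k hk => Finset.sum_eq_zero fun e _ => ?_, ?_⟩
    · by_cases he : r j e
      · rw [hoff _ _ _ he, zero_mul]
      · rw [(ih e).1 k (hr _ _ _ hk he), mul_zero]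
    · rw [Finset.sum_eq_single j]
      · rw [hdiag, (ih j).2, siteHom_diagonal, Matrix.diagonal_mul_diagonal]
        simp
      · intro e _ he
        by_cases he' : r j e
        · rw [hoff _ _ _ he', zero_mul]
        · by_cases he2 : r e j
          · rw [(ih e).1 j he2, mul_zero]
          · exact absurd (hr'' _ _ he2 he') he
      · simp

theorem siteL_eq (h x y g : S) (i : Fin n) (j k : Fin N) (m : Matrix (Fin N) (Fin N) S)
    (hm : ∀ p q, g * Rnum N h x y (j, p) (k, q) = m p q) : siteL h x y g i j k = siteHom i m := by
  rw [siteL_apply]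
  congr 1
  ext p q
  exact hm p q

variable {F : Type*} [CommRing F]

theorem coefL_zero (h : F) (z zi : Fin n → F) (ε : Sgn) (i j : Fin N) :
    coefL h z zi ε i j 0 =
      fullL h (fun i => z i * PowerSeries.constantCoeff (uDen F ε))
        (PowerSeries.constantCoeff (uNum F ε))
        (fun i => PowerSeries.constantCoeff (invSer (z i) (zi i) ε)) i j := by
  have e := listL_map (PowerSeries.constantCoeff (R := F)) (PowerSeries.C h)
    (fun i => PowerSeries.C (z i) * uDen F ε) (uNum F ε)
    (fun i => invSer (z i) (zi i) ε) (List.finRange n).reverse i j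
  simp only [map_mul, PowerSeries.constantCoeff_C] at e
  simp only [coefL, serL, fullL]
  rw [← e]
  ext w w'
  simp

/-- At `u = 0` every site contributes a triangular matrix. Its `j`-th diagonal entry is `h` on the
letters `≤ j` and 1 on the others. At `u = ∞` the condition becomes `< j`, whence `L̃_{j,j,+0} =
L̃_{j+1,j+1,-0}`. -/
theorem coefL_plus_zero (h : F) (z zi : Fin n → F) (hz : ∀ i, z i * zi i = 1) (j : Fin N) :
    (∀ k, j < k → coefL h z zi .plus j k 0 = 0) ∧
      coefL h z zi .plus j j 0 = Matrix.diagonal fun w => ∏ i, if w i ≤ j then h else 1 := by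
  simp only [coefL_zero, fullL]
  have := listL_triangular (n := n) (N := N) (· < ·) (fun i j k h1 h2 => by omega)
    (fun i => by omega) (fun i j => by omega) h
    (fun i => z i * PowerSeries.constantCoeff (uDen F .plus))
    (PowerSeries.constantCoeff (uNum F .plus))
    (fun i => PowerSeries.constantCoeff (invSer (z i) (zi i) .plus))
    (fun j p => if p ≤ j then h else 1) ?_ ?_ (List.finRange n).reverse j
  · refine ⟨this.1, this.2.trans ?_⟩
    congr 1
    funext w
    rw [← List.prod_ofFn, List.ofFn_eq_map]
    exact ((List.reverse_perm _).map _).prod_eq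
  · intro i j k hjk
    rw [siteL_eq (m := 0), map_zero]
    intro p q
    simp only [Rnum_apply, rDiag, rOff, uNum, uDen, invSer, Matrix.zero_apply]
    rw [if_neg (by rintro ⟨rfl, _⟩; omega)]
    split_ifs <;> first | omega | simp
  · intro i j
    rw [siteL_eq]
    intro p q
    simp only [Rnum_apply, rDiag, rOff, uNum, uDen, invSer, Matrix.diagonal_apply, true_and]
    split_ifs <;> first
      | omega
      | (simp; done)
      | (simp; linear_combination h * hz i)
      | (simp; linear_combination hz i)

theorem coefL_minus_zero (h : F) (z zi : Fin n → F) (j : Fin N) :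
    (∀ k, k < j → coefL h z zi .minus j k 0 = 0) ∧
      coefL h z zi .minus j j 0 = Matrix.diagonal fun w => ∏ i, if w i < j then h else 1 := by
  simp only [coefL_zero, fullL]
  have := listL_triangular (n := n) (N := N) (fun j k => k < j) (fun i j k h1 h2 => by omega)
    (fun i => by omega) (fun i j => by omega) h
    (fun i => z i * PowerSeries.constantCoeff (uDen F .minus))
    (PowerSeries.constantCoeff (uNum F .minus))
    (fun i => PowerSeries.constantCoeff (invSer (z i) (zi i) .minus))
    (fun j p => if p < j then h else 1) ?_ ?_ (List.finRange n).reverse j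
  · refine ⟨this.1, this.2.trans ?_⟩
    congr 1
    funext w
    rw [← List.prod_ofFn, List.ofFn_eq_map]
    exact ((List.reverse_perm _).map _).prod_eq
  · intro i j k hjk
    rw [siteL_eq (m := 0), map_zero]
    intro p q
    simp only [Rnum_apply, rDiag, rOff, uNum, uDen, invSer, Matrix.zero_apply]
    rw [if_neg (by rintro ⟨rfl, _⟩; omega)]
    split_ifs <;> first | omega | simp
  · intro i j
    rw [siteL_eq]
    intro p q
    simp only [Rnum_apply, rDiag, rOff, uNum, uDen, invSer, Matrix.diagonal_apply, true_and]
    split_ifs <;> first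
      | omega
      | simp

end Triangular

/-! ### Construction and uniqueness of the representation. -/

section Representation

variable {n N : ℕ}

/-- The Laurent polynomial `z_i`. -/
def zP (i : Fin n) : P n := AddMonoidAlgebra.single (Finsupp.single i 1) 1

/-- The Laurent polynomial `z_i⁻¹`. -/
def ziP (i : Fin n) : P n := AddMonoidAlgebra.single (Finsupp.single i (-1)) 1

theorem zP_mul_ziP (i : Fin n) : zP i * ziP i = 1 := by
  rw [zP, ziP, AddMonoidAlgebra.single_mul_single, ← Finsupp.single_add]
  simp [AddMonoidAlgebra.one_def]

/-- The constant Laurent polynomial `h`. -/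
def hP (n : ℕ) : P n := algebraMap Ch (P n) hh

theorem algebraMap_zP (i : Fin n) : algebraMap (P n) (K n) (zP i) = z i := rfl

theorem algebraMap_hP : algebraMap (P n) (K n) (hP n) = hK n :=
  (IsScalarTower.algebraMap_apply Ch (P n) (K n) hh).symm

theorem hh_ne_zero : hh ≠ 0 := RatFunc.X_ne_zero

/-- The images of the generators. -/
def genMap (n : ℕ) {N : ℕ} : Gen N → Matrix (Word n N) (Word n N) (P n)
  | .L ε i j s => coefL (hP n) zP ziP ε i j s
  | .Linv j => Matrix.diagonal fun w => ∏ i, if w i ≤ j then algebraMap Ch (P n) hh⁻¹ else 1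

theorem lift_serCoeff (ε : Sgn) (i j : Fin N) (m : ℤ) :
    FreeAlgebra.lift Ch (genMap n) (serCoeff ε i j m) = zcoefL (hP n) zP ziP ε i j m := by
  unfold serCoeff zcoefL zcoeff
  split_ifs
  · rw [FreeAlgebra.lift_ι_apply]; rfl
  · rw [map_zero]; ext; simp

theorem genMap_rel {x y : FreeAlgebra Ch (Gen N)} (hxy : Rel N x y) :
    FreeAlgebra.lift Ch (genMap n) x = FreeAlgebra.lift Ch (genMap n) y := by
  have hone : ∀ (j : Fin N) (w : Word n N), (∏ i, if w i ≤ j then hP n else 1) *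
      (∏ i, if w i ≤ j then algebraMap Ch (P n) hh⁻¹ else 1) = 1 := by
    intro j w
    simp only [← Finset.prod_mul_distrib]
    refine Finset.prod_eq_one fun i _ => ?_
    split_ifs
    · rw [hP, ← map_mul, mul_inv_cancel₀ hh_ne_zero, map_one]
    · simp
  induction hxy with
  | plus_zero i j hij =>
    rw [FreeAlgebra.lift_ι_apply, map_zero]
    exact (coefL_plus_zero _ _ _ zP_mul_ziP i).1 j hij
  | minus_zero i j hij =>
    rw [FreeAlgebra.lift_ι_apply, map_zero]
    exact (coefL_minus_zero _ _ _ j).1 i hij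
  | mul_inv i =>
    rw [map_mul, FreeAlgebra.lift_ι_apply, FreeAlgebra.lift_ι_apply, map_one]
    simp only [genMap]
    rw [(coefL_plus_zero _ _ _ zP_mul_ziP i).2, Matrix.diagonal_mul_diagonal']
    simp only [hone]; exact Matrix.diagonal_one
  | inv_mul i =>
    rw [map_mul, FreeAlgebra.lift_ι_apply, FreeAlgebra.lift_ι_apply, map_one]
    simp only [genMap]
    rw [(coefL_plus_zero _ _ _ zP_mul_ziP i).2, Matrix.diagonal_mul_diagonal']
    simp only [mul_comm _ (∏ i, if _ ≤ _ then hP n else 1), hone]; exact Matrix.diagonal_one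
  | first i hi =>
    rw [FreeAlgebra.lift_ι_apply, map_one]
    simp only [genMap]
    rw [(coefL_minus_zero _ _ _ i).2]
    rw [← Matrix.diagonal_one]
    congr 1
    funext w
    refine Finset.prod_eq_one fun k _ => if_neg ?_
    rw [Fin.lt_def]; omega
  | shift i j hij =>
    rw [FreeAlgebra.lift_ι_apply, FreeAlgebra.lift_ι_apply]
    simp only [genMap]
    rw [(coefL_minus_zero _ _ _ j).2, (coefL_plus_zero _ _ _ zP_mul_ziP i).2]
    congr 1
    funext w
    refine Finset.prod_congr rfl fun k _ => ?_
    congr 1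
    rw [Fin.lt_def, Fin.le_def, eq_iff_iff]; omega
  | rtt α β hαβ a b c d m k =>
    have key := zcoefL_rtt (N := N) (hP n) zP ziP α β a b c d m k
    have hR : ∀ (x y : Ch) (o q) (M : Matrix (Word n N) (Word n N) (P n)),
        Rnum N hh x y o q • M =
          Rnum N (hP n) (algebraMap Ch (P n) x) (algebraMap Ch (P n) y) o q • M := by
      intro x y o q M
      rw [hP, ← Rnum_map, algebraMap_smul]
    simp only [map_sum, map_add, map_smul, map_mul, lift_serCoeff, hR, map_zero, map_one]
    exact key

/-- The `R`-matrix representation, by matrices over `ℂ[z^{±1}] ⊗ ℂ(h)`. -/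
def phoMat (n N : ℕ) : U N →ₐ[Ch] Matrix (Word n N) (Word n N) (P n) :=
  RingQuot.liftAlgHom Ch ⟨FreeAlgebra.lift Ch (genMap n), fun _ _ h => genMap_rel h⟩

theorem phoMat_L (ε : Sgn) (i j : Fin N) (s : ℕ) :
    phoMat n N (L ε i j s) = coefL (hP n) zP ziP ε i j s := by
  unfold phoMat L
  rw [RingQuot.liftAlgHom_mkAlgHom_apply, FreeAlgebra.lift_ι_apply]; rfl

theorem phoMat_Linv (j : Fin N) :
    phoMat n N (Linv j) =
      Matrix.diagonal fun w => ∏ i, if w i ≤ j then algebraMap Ch (P n) hh⁻¹ else 1 := by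
  unfold phoMat Linv
  rw [RingQuot.liftAlgHom_mkAlgHom_apply, FreeAlgebra.lift_ι_apply]; rfl

/-- Matrices over `ℂ[z^{±1}] ⊗ ℂ(h)` as operators over `ℂ(z, h)`. -/
def matToEnd (n N : ℕ) :
    Matrix (Word n N) (Word n N) (P n) →ₐ[Ch] Module.End (K n) (V n N) :=
  ((Matrix.toLinAlgEquiv' (R := K n) (n := Word n N)).toAlgHom.restrictScalars Ch).comp
    (IsScalarTower.toAlgHom Ch (P n) (K n)).mapMatrix

/-- The `R`-matrix representation `φ`. -/
def pho (n N : ℕ) : U N →ₐ[Ch] Module.End (K n) (V n N) := (matToEnd n N).comp (phoMat n N)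

theorem pho_apply (X : U N) (v : V n N) :
    pho n N X v = ((phoMat n N X).map (algebraMap (P n) (K n))).mulVec v := rfl

theorem isPho_pho : IsPho (pho n N) := by
  intro ε i j s
  refine LinearMap.ext fun v => ?_
  rw [pho_apply, phoMat_L, coefL_map]
  unfold Lop
  rw [Matrix.toLin'_apply, Lcoeff_eq (hK n) z (fun i => algebraMap (P n) (K n) (ziP i))]
  · rw [algebraMap_hP]; rfl
  · intro i
    rw [← algebraMap_zP, ← map_mul, zP_mul_ziP, map_one]

theorem L_mul_Linv (i : Fin N) : L .plus i i 0 * Linv i = 1 := by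
  have := RingQuot.mkAlgHom_rel Ch (Rel.mul_inv i)
  rwa [map_mul, map_one] at this

theorem Linv_mul_L (i : Fin N) : Linv i * L .plus i i 0 = 1 := by
  have := RingQuot.mkAlgHom_rel Ch (Rel.inv_mul i)
  rwa [map_mul, map_one] at this

/-- The generators `Linv` are not prescribed, but their images are inverses of prescribed operators.
-/
theorem IsPho.eq {φ φ' : U N →ₐ[Ch] Module.End (K n) (V n N)} (h : IsPho φ) (h' : IsPho φ') :
    φ = φ' := by
  refine RingQuot.ringQuot_ext' Ch _ _ ?_
  refine FreeAlgebra.hom_ext ?_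
  funext g
  cases g with
  | L ε i j s => exact (h ε i j s).trans (h' ε i j s).symm
  | Linv i =>
    show φ (Linv i) = φ' (Linv i)
    have h1 : φ' (Linv i) * φ (L .plus i i 0) = 1 := by
      rw [h, ← h', ← map_mul, Linv_mul_L, map_one]
    have h2 : φ (L .plus i i 0) * φ (Linv i) = 1 := by
      rw [← map_mul, L_mul_Linv, map_one]
    exact (left_inv_eq_right_inv h1 h2).symm

theorem pho_single (X : U N) (w w' : Word n N) :
    pho n N X (Pi.single w' 1) w = algebraMap (P n) (K n) (phoMat n N X w w') := by
  rw [pho_apply, Matrix.mulVec_single_one]; rfl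

end Representation
-- Ordered products in noncommutative rings.
section ListProducts

theorem ofFn_prod_split {M : Type*} [Ring M] {p : ℕ} (f : Fin p → M) (a : ℕ) (ha : a + 1 < p) :
    (List.ofFn f).prod = ((List.ofFn f).take a).prod *
      (f ⟨a, by omega⟩ * f ⟨a + 1, ha⟩) * ((List.ofFn f).drop (a + 2)).prod := by
  conv_lhs => rw [← List.take_append_drop a (List.ofFn f), List.prod_append]
  rw [List.drop_eq_getElem_cons (by simp; omega), List.drop_eq_getElem_cons (by simp; omega)]
  simp [mul_assoc]

theorem ofFn_take_congr {X : Type*} {p : ℕ} {f g : Fin p → X} (a : ℕ) (h : ∀ i : Fin p, i.val < a → f i = g i) :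
    (List.ofFn f).take a = (List.ofFn g).take a := by
  refine List.ext_getElem (by simp) fun m h1 h2 => ?_
  simp only [List.getElem_take, List.getElem_ofFn]
  simp only [List.length_take, lt_inf_iff] at h1
  exact h _ h1.1

theorem ofFn_drop_congr {X : Type*} {p : ℕ} {f g : Fin p → X} (a : ℕ) (h : ∀ i : Fin p, a ≤ i.val → f i = g i) :
    (List.ofFn f).drop a = (List.ofFn g).drop a := by
  refine List.ext_getElem (by simp) fun m h1 h2 => ?_
  simp only [List.getElem_drop, List.getElem_ofFn]
  exact h _ (by simp)

/-- In the application `E` projects onto one letter at one site. On its image each factor `X a` is a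
scalar multiple of an operator `Y a` that does not see this site, so the site can be split off the
whole product. -/
theorem list_prod_mul_of_commute {S ι M : Type*} [CommRing S] [Ring M] [Algebra S M] (X Y : ι → M) (c : ι → S)
    (E : M) (l : List ι) (h : ∀ a ∈ l, X a * E = c a • (Y a * E))
    (hc : ∀ a ∈ l, Commute (Y a) E) :
    (l.map X).prod * E = (l.map c).prod • ((l.map Y).prod * E) := by
  induction l with
  | nil => simp
  | cons a l ih =>
    have ih := ih (fun b hb => h b (List.mem_cons_of_mem _ hb))
      (fun b hb => hc b (List.mem_cons_of_mem _ hb))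
    have hl : Commute (l.map Y).prod E := by
      refine (Commute.list_prod_left _ _ fun x hx => ?_)
      obtain ⟨b, hb, rfl⟩ := List.mem_map.1 hx
      exact hc b (List.mem_cons_of_mem _ hb)
    simp only [List.map_cons, List.prod_cons]
    rw [mul_assoc, ih, mul_smul_comm, hl.eq, ← mul_assoc, h a List.mem_cons_self, smul_mul_assoc,
      smul_smul, mul_assoc, ← hl.eq, mul_assoc, mul_comm]

end ListProducts

/-! ### Quantum minors alternate in their rows. -/

section Minors

variable {N q : ℕ} {M : Type*} [Ring M]

/-- The quantum minor with columns `1, …, q + 1` and rows `c`. -/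
def qMinor (hp : q + 1 ≤ N) (A : Fin (q + 1) → Matrix (Fin N) (Fin N) M)
    (c : Fin (q + 1) → Fin N) : M :=
  ∑ σ : Equiv.Perm (Fin (q + 1)), (Equiv.Perm.sign σ : ℤ) •
    (List.ofFn fun a => A a (c a) (Fin.castLE hp (σ a))).prod

/-- The exchange relation for two rows of consecutive factors. -/
def IsExchange (A B : Matrix (Fin N) (Fin N) M) : Prop :=
  ∀ i j k l, A i k * B j l - A i l * B j k + (A j k * B i l - A j l * B i k) = 0

variable {hp : q + 1 ≤ N} {A : Fin (q + 1) → Matrix (Fin N) (Fin N) M}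

/-- Pair `σ` with `σ s`. All factors except the two in positions `a`, `a + 1` are common to the four
resulting terms, and these two factors combine to zero by the exchange relation. -/
theorem qMinor_swap_succ (hA : ∀ a : Fin q, IsExchange (A a.castSucc) (A a.succ))
    (c : Fin (q + 1) → Fin N) (a : Fin q) :
    qMinor hp A (c ∘ Equiv.swap a.castSucc a.succ) = -qMinor hp A c := by
  rw [eq_neg_iff_add_eq_zero]
  unfold qMinor
  rw [← Finset.sum_add_distrib]
  set s := Equiv.swap a.castSucc a.succ with hs
  have hne : a.castSucc ≠ a.succ := (Fin.castSucc_lt_succ).ne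
  refine Finset.sum_involution (fun σ _ => σ * s) ?_ ?_ (fun _ _ => Finset.mem_univ _) ?_
  · intro σ _
    have hsg : ((Equiv.Perm.sign (σ * s) : ℤˣ) : ℤ) = -(Equiv.Perm.sign σ : ℤ) := by
      rw [Equiv.Perm.sign_mul, hs, Equiv.Perm.sign_swap hne]; simp
    rw [hsg, ← smul_add, ← smul_add, neg_smul, ← sub_eq_add_neg, ← smul_sub]
    have hoff : ∀ i : Fin (q + 1), (i.val < a.val ∨ a.val + 2 ≤ i.val) → s i = i := by
      intro i hi
      refine Equiv.swap_apply_of_ne_of_ne ?_ ?_ <;>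
      · rintro rfl
        simp at hi
    have hsplit : ∀ (c' : Fin (q + 1) → Fin N) (τ : Equiv.Perm (Fin (q + 1))),
        (∀ i : Fin (q + 1), (i.val < a.val ∨ a.val + 2 ≤ i.val) → c' i = c i ∧ τ i = σ i) →
        (List.ofFn fun i => A i (c' i) (Fin.castLE hp (τ i))).prod =
          ((List.ofFn fun i => A i (c i) (Fin.castLE hp (σ i))).take a).prod *
          (A a.castSucc (c' a.castSucc) (Fin.castLE hp (τ a.castSucc)) *
            A a.succ (c' a.succ) (Fin.castLE hp (τ a.succ))) *
          ((List.ofFn fun i => A i (c i) (Fin.castLE hp (σ i))).drop (a + 2)).prod := by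
      intro c' τ h
      rw [ofFn_prod_split _ a.val (by omega)]
      congr 2
      · congr 1
        · refine ofFn_take_congr _ fun i hi => ?_
          rw [(h i (Or.inl hi)).1, (h i (Or.inl hi)).2]
      · refine ofFn_drop_congr _ fun i hi => ?_
        rw [(h i (Or.inr hi)).1, (h i (Or.inr hi)).2]
    rw [hsplit (c ∘ s) σ (fun i hi => ⟨by simp [hoff i hi], rfl⟩),
      hsplit c σ (fun i hi => ⟨rfl, rfl⟩),
      hsplit (c ∘ s) (σ * s) (fun i hi => ⟨by simp [hoff i hi], by simp [hoff i hi]⟩),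
      hsplit c (σ * s) (fun i hi => ⟨rfl, by simp [hoff i hi]⟩)]
    have e1 : s a.castSucc = a.succ := Equiv.swap_apply_left _ _
    have e2 : s a.succ = a.castSucc := Equiv.swap_apply_right _ _
    simp only [Function.comp, e1, e2, Equiv.Perm.mul_apply]
    rw [← add_mul, ← mul_add, ← add_mul, ← mul_add, ← sub_mul, ← mul_sub]
    have := hA a (c a.succ) (c a.castSucc) (Fin.castLE hp (σ a.castSucc))
      (Fin.castLE hp (σ a.succ))
    rw [add_sub_add_comm, this]
    simp
  · intro σ _ _ h
    have : s = 1 := by simpa using h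
    have h2 := Equiv.swap_apply_left a.castSucc a.succ
    rw [← hs, this] at h2
    exact hne h2
  · intro σ _
    simp [hs, mul_assoc]

theorem qMinor_comp (hA : ∀ a : Fin q, IsExchange (A a.castSucc) (A a.succ))
    (c : Fin (q + 1) → Fin N) (τ : Equiv.Perm (Fin (q + 1))) :
    qMinor hp A (c ∘ τ) = (Equiv.Perm.sign τ : ℤ) • qMinor hp A c := by
  have hτ : τ ∈ Submonoid.closure (Set.range fun i : Fin q ↦ Equiv.swap i.castSucc i.succ) := by
    rw [Equiv.Perm.mclosure_swap_castSucc_succ]; trivial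
  induction hτ using Submonoid.closure_induction generalizing c with
  | mem x hx =>
    obtain ⟨a, rfl⟩ := hx
    simp only
    rw [qMinor_swap_succ hA, Equiv.Perm.sign_swap (Fin.castSucc_lt_succ).ne]
    simp
  | one => simp
  | mul x y _ _ hx hy =>
    rw [Equiv.Perm.coe_mul, ← Function.comp_assoc, hy, hx, Equiv.Perm.sign_mul, smul_smul, mul_comm]
    simp

theorem qMinor_eq_zero (hA : ∀ a : Fin q, IsExchange (A a.castSucc) (A a.succ))
    (h2 : ∀ x : M, x = -x → x = 0) (c : Fin (q + 1) → Fin N) {i j : Fin (q + 1)} (hij : i ≠ j)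
    (hc : c i = c j) : qMinor hp A c = 0 := by
  refine h2 _ ?_
  have h := qMinor_comp (hp := hp) hA c (Equiv.swap i j)
  rw [Equiv.Perm.sign_swap hij] at h
  have hcc : c ∘ Equiv.swap i j = c := by
    funext k
    simp only [Function.comp, Equiv.swap_apply_def]
    split_ifs with h1 h2
    · rw [h1, hc]
    · rw [h2, hc]
    · rfl
  rw [hcc] at h
  simpa using h

end Minors

/-! ### The exchange relation from the degenerate `R`-matrix. -/

section Exchange

variable {N : ℕ} {S M : Type*} [CommRing S] [Ring M] [Algebra S M]

/-- When the ratio `x/y` is `h`, the columns `(c, d)` and `(d, c)` of the `R`-matrix coincide, so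
the `R`-matrix annihilates the part of `X⁽¹⁾ Y⁽²⁾` that is antisymmetric in the columns. Row by row
this is the exchange relation multiplied by `(1 - h) y` or `h (1 - h) y`, and for equal rows it is
half of it multiplied by `(1 - h²) y`. Hence the three cancellation hypotheses. -/
theorem IsRTT.isExchange {X Y : Matrix (Fin N) (Fin N) M} {h y : S} (H : IsRTT X Y h (h * y) y)
    (h1 : ∀ m : M, ((1 - h) * y) • m = 0 → m = 0)
    (h2 : ∀ m : M, (h * ((1 - h) * y)) • m = 0 → m = 0)
    (h3 : ∀ m : M, ((1 - h * h) * y) • m = 0 → m = 0) : IsExchange X Y := by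
  rw [isRTT_iff] at H
  intro a b c d
  by_cases hcd : c = d
  · subst hcd; simp
  have hcol : ∀ e f, Rnum N h (h * y) y (e, f) (c, d) = Rnum N h (h * y) y (e, f) (d, c) := by
    intro e f
    simp only [Rnum_apply, rDiag, rOff]
    have hdc := Ne.symm hcd
    by_cases h1 : c = e ∧ d = f
    · obtain ⟨rfl, rfl⟩ := h1
      rcases lt_or_gt_of_ne hcd with hlt | hlt
      · simp [hcd, hdc, hlt, hlt.not_gt]; ring
      · simp [hcd, hdc, hlt, hlt.not_gt]; ring
    · by_cases h2 : c = f ∧ d = e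
      · obtain ⟨rfl, rfl⟩ := h2
        rcases lt_or_gt_of_ne hcd with hlt | hlt
        · simp [hcd, hdc, hlt, hlt.not_gt]; ring
        · simp [hcd, hdc, hlt, hlt.not_gt]; ring
      · rw [if_neg h1, if_neg h2, if_neg (fun h => h2 ⟨h.2, h.1⟩), if_neg (fun h => h1 ⟨h.2, h.1⟩)]
  have key : ∀ a b, rDiag h (h * y) y a b • (X a c * Y b d - X a d * Y b c) +
      rOff h (h * y) y a b • (X b c * Y a d - X b d * Y a c) = 0 := by
    intro a b
    have e1 := H a b c d
    have e2 := H a b d c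
    simp only [hcol] at e1
    have e3 := e1.trans e2.symm
    have h₁ := sum_Rnum_mul h (h * y) y a b (fun e f => X e c * Y f d)
    have h₂ := sum_Rnum_mul h (h * y) y a b (fun e f => X e d * Y f c)
    rw [h₁, h₂] at e3
    simp only [smul_sub]
    rw [sub_add_sub_comm, e3, sub_self]
  have k := key a b
  rcases lt_trichotomy a b with hab | hab | hab
  · refine h1 _ ?_
    simp only [rDiag, rOff, hab.ne, hab, hab.not_gt, if_true, if_false] at k
    rw [show y - h * y = (1 - h) * y by ring, ← smul_add] at k
    exact k
  · subst hab
    have : X a c * Y a d - X a d * Y a c = 0 := by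
      refine h3 _ ?_
      simp only [rDiag, rOff, if_true] at k
      rw [zero_smul, add_zero, show y - h * (h * y) = (1 - h * h) * y by ring] at k
      exact k
    rw [this, add_zero]
  · refine h2 _ ?_
    simp only [rDiag, rOff, hab.ne', hab, hab.not_gt, if_true, if_false] at k
    rw [show h * (y - h * y) = h * ((1 - h) * y) by ring,
      show (1 - h) * (h * y) = h * ((1 - h) * y) by ring, ← smul_add] at k
    exact k

end Exchange
-- Eigenvectors of quantum minors.
section Eigen

variable {n N q : ℕ} {S : Type*} [CommRing S]

/-- The projector onto the vectors with the letter `k` at the site `i`. -/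
def siteProj (S : Type*) [CommRing S] (i : Fin n) (k : Fin N) :
    Matrix (Word n N) (Word n N) S :=
  siteHom i (Matrix.single k k 1)

theorem siteProj_single (i : Fin n) (w : Word n N) :
    (siteProj S i (w i)).mulVec (Pi.single w 1) = Pi.single w 1 := by
  rw [siteProj, siteHom_apply, siteMat_single]
  simp [Matrix.single_apply, ite_smul]

/-- The `R`-matrix either keeps or exchanges the auxiliary and the site letter. Ending in the
auxiliary row `r ≠ k`, starting from the site letter `k`, excludes the exchange, so the site
contributes only a scalar. -/
theorem siteL_mul_siteProj (h x y g : S) (hg : g * (y - x) = 1) (i : Fin n) (r e k : Fin N)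
    (hrk : r ≠ k) :
    siteL h x y g i r e * siteProj S i k =
      if e = r then (if r < k then 1 else h) • siteProj S i k else 0 := by
  rw [siteL_apply, siteProj, ← map_mul]
  have : (g • letterMat h x y r e) * Matrix.single k k 1 =
      if e = r then (if r < k then 1 else h) • Matrix.single k k 1 else 0 := by
    ext p p'
    by_cases hp' : p' = k
    · subst hp'
      rw [Matrix.mul_single_apply_same]
      simp only [Matrix.smul_apply, letterMat, Matrix.of_apply, Rnum_apply, rDiag,
        Ne.symm hrk, and_false, if_false, add_zero, smul_eq_mul, mul_one]
      by_cases her : e = r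
      · simp only [her, true_and, if_true, Matrix.smul_apply, Matrix.single_apply, smul_eq_mul]
        by_cases hp : p = p'
        · subst hp
          simp only [if_true, hrk, if_false, and_self]
          split_ifs
          · linear_combination hg
          · linear_combination h * hg
        · simp [Ne.symm hp]
      · simp [her]
    · rw [Matrix.mul_single_apply_of_ne _ _ _ _ _ hp']
      split_ifs <;> simp [Ne.symm hp']
  rw [this, apply_ite (siteHom i), map_smul, map_zero]

theorem siteL_mul_siteProj_self (h x y g : S) (i : Fin n) (k : Fin N) :
    siteL h x y g i k k * siteProj S i k = (g * (y - h * x)) • siteProj S i k := by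
  rw [siteL_apply, siteProj, ← map_mul, ← map_smul]
  congr 1
  ext p p'
  by_cases hp' : p' = k
  · subst hp'
    rw [Matrix.mul_single_apply_same]
    by_cases hp : p = p'
    · subst hp
      simp [letterMat, Rnum_apply, rDiag, rOff]
    · simp [letterMat, Rnum_apply, rOff, Ne.symm hp]
  · rw [Matrix.mul_single_apply_of_ne _ _ _ _ _ hp']
    simp [Ne.symm hp']

theorem listL_mul_siteProj (h : S) (x : Fin n → S) (y : S) (g : Fin n → S)
    (hg : ∀ i, g i * (y - x i) = 1) (i : Fin n) (l : List (Fin n)) (hi : i ∉ l) (r e k : Fin N)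
    (hrk : r ≠ k) :
    listL h x y g (i :: l) r e * siteProj S i k =
      (if r < k then 1 else h) • (listL h x y g l r e * siteProj S i k) := by
  rw [listL_cons, Matrix.mul_apply, Finset.sum_mul]
  have : ∀ f, siteL h (x i) y (g i) i r f * listL h x y g l f e * siteProj S i k =
      if f = r then (if r < k then 1 else h) • (listL h x y g l r e * siteProj S i k) else 0 := by
    intro f
    have hc : listL h x y g l f e * siteProj S i k = siteProj S i k * listL h x y g l f e :=
      (siteHom_commute_listL h x y g l i hi _ f e).symm.eq
    have hc' : listL h x y g l r e * siteProj S i k = siteProj S i k * listL h x y g l r e :=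
      (siteHom_commute_listL h x y g l i hi _ r e).symm.eq
    rw [mul_assoc, hc, ← mul_assoc, siteL_mul_siteProj _ _ _ _ (hg i) _ _ _ _ hrk]
    by_cases hf : f = r
    · rw [if_pos hf, if_pos hf, hf, hc', smul_mul_assoc]
    · rw [if_neg hf, if_neg hf, zero_mul]
  simp only [this]
  simp

/-- A row outside the letters that occur passes every site by a scalar and never changes, so only
its diagonal entry survives. -/
theorem listL_mulVec_eq_zero (h : S) (x : Fin n → S) (y : S) (g : Fin n → S)
    (hg : ∀ i, g i * (y - x i) = 1) (l : List (Fin n)) (hl : l.Nodup) (w : Word n N) (p : ℕ)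
    (hw : ∀ i ∈ l, (w i).val < p) (r j : Fin N) (hr : p ≤ r.val) (hj : j.val < p) :
    (listL h x y g l r j).mulVec (Pi.single w 1) = 0 := by
  induction l generalizing r with
  | nil =>
    rw [listL_nil, Matrix.one_apply_ne, Matrix.zero_mulVec]
    rintro rfl; omega
  | cons a l ih =>
    have ha := (List.nodup_cons.1 hl).1
    have hwa := hw a List.mem_cons_self
    conv_lhs => rw [← siteProj_single a w]
    rw [Matrix.mulVec_mulVec, listL_mul_siteProj _ _ _ _ hg _ _ ha _ _ _ (by rintro rfl; omega),
      Matrix.smul_mulVec, ← Matrix.mulVec_mulVec, siteProj_single,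
      ih (List.nodup_cons.1 hl).2 (fun i hi => hw i (List.mem_cons_of_mem _ hi)) r hr, smul_zero]

variable {hp : q + 1 ≤ N} (h : S) (x : Fin (q + 1) → Fin n → S) (y : Fin (q + 1) → S)
  (g : Fin (q + 1) → Fin n → S)

/-- The eigenvalue of the quantum minor belonging to one site. -/
def siteEig (q : ℕ) (h x y g : S) (k : Fin N) : S :=
  if k.val < q + 1 then h ^ (q - k.val) * (g * (y - h * x)) else 1

/-- After the row `k` has been moved to the front, the remaining rows are the other indices up to
`q`. Those below `k` contribute 1 and the `q - k` above it contribute `h`. -/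
theorem prod_swap_rows (k : Fin (q + 1)) :
    ((List.finRange q).map fun a : Fin q =>
      if Equiv.swap 0 k a.succ < k then (1 : S) else h).prod = h ^ (q - k.val) := by
  have e1 : ∀ r : Fin (q + 1), (if r < k then (1 : S) else h) = h ^ (if r < k then 0 else 1) := by
    intro r; split_ifs <;> simp
  have e2 : ∑ r : Fin (q + 1), (if r < k then 0 else 1) = q + 1 - k.val := by
    rw [Finset.sum_ite, Finset.sum_const_zero, zero_add, Finset.sum_const, smul_eq_mul, mul_one,
      ← Fin.card_Ici]
    congr 1
    ext r; simp
  have e3 := Equiv.sum_comp (Equiv.swap 0 k) fun r : Fin (q + 1) => if r < k then 0 else 1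
  rw [e2, Fin.sum_univ_succ] at e3
  simp only [Equiv.swap_apply_left, lt_irrefl, if_false] at e3
  rw [← List.ofFn_eq_map, List.prod_ofFn]
  simp only [e1]
  rw [Finset.prod_pow_eq_pow_sum]
  congr 1
  omega

/-- Alternation moves the row that lies outside the occurring letters to the last factor. That
factor acts first on the vector and kills it, because all columns are at most `q`. -/
theorem qMinor_mulVec_eq_zero (hg : ∀ a i, g a i * (y a - x a i) = 1)
    (l : List (Fin n)) (hl : l.Nodup)
    (hex : ∀ a : Fin q,
      IsExchange (listL (N := N) h (x a.castSucc) (y a.castSucc) (g a.castSucc) l)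
        (listL h (x a.succ) (y a.succ) (g a.succ) l))
    (w : Word n N) (hw : ∀ i ∈ l, (w i).val < q + 1) (c : Fin (q + 1) → Fin N)
    (hc : q + 1 ≤ (c 0).val) :
    (qMinor hp (fun a => listL h (x a) (y a) (g a) l) c).mulVec (Pi.single w 1) = 0 := by
  have h3 := qMinor_comp (hp := hp) (A := fun a => listL h (x a) (y a) (g a) l) hex c (Equiv.swap 0 (Fin.last q))
  have h4 : (qMinor hp (fun a => listL h (x a) (y a) (g a) l)
      (c ∘ Equiv.swap 0 (Fin.last q))).mulVec (Pi.single w 1) = 0 := by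
    unfold qMinor
    rw [Matrix.sum_mulVec]
    refine Finset.sum_eq_zero fun σ _ => ?_
    rw [List.ofFn_succ_last, List.prod_append, List.prod_singleton, Matrix.smul_mulVec,
      ← Matrix.mulVec_mulVec]
    simp only [Function.comp, Equiv.swap_apply_right]
    rw [listL_mulVec_eq_zero h _ _ _ (hg _) l hl w (q + 1) hw _ _ hc
      (by simp only [Fin.val_castLE]; omega)]
    simp
  have h5 : qMinor hp (fun a => listL h (x a) (y a) (g a) l) c =
      (Equiv.Perm.sign (Equiv.swap 0 (Fin.last q)) : ℤ) •
        qMinor hp (fun a => listL h (x a) (y a) (g a) l) (c ∘ Equiv.swap 0 (Fin.last q)) := by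
    rw [h3, smul_smul]; simp
  rw [h5, Matrix.smul_mulVec, h4, smul_zero]

-- The list starts with the largest letters, and its first site is stripped off. If the letter there
-- exceeds all rows of the minor, every row passes it by the scalar 1. Otherwise the letter is one
-- of the rows; this row is brought to the front, the other rows pass with total scalar `h ^ (q -
-- k)`, and the front row expands into a sum over the letters `e` it can turn into. Only `e = w i`
-- contributes.
set_option maxHeartbeats 400000 in
theorem qMinor_mulVec (hg : ∀ a i, g a i * (y a - x a i) = 1)
    (hex : ∀ l : List (Fin n), l.Nodup → ∀ a : Fin q,
      IsExchange (listL (N := N) h (x a.castSucc) (y a.castSucc) (g a.castSucc) l)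
        (listL h (x a.succ) (y a.succ) (g a.succ) l))
    (h2 : ∀ m : Matrix (Word n N) (Word n N) S, m = -m → m = 0)
    (l : List (Fin n)) (hl : l.Nodup) (w : Word n N) (hw : l.Pairwise fun i j => w j ≤ w i) :
    (qMinor hp (fun a => listL h (x a) (y a) (g a) l) (Fin.castLE hp)).mulVec (Pi.single w 1) =
      (l.map fun i => siteEig q h (x 0 i) (y 0) (g 0 i) (w i)).prod • Pi.single w (1 : S) := by
  induction l with
  | nil =>
    have : qMinor hp (fun a => listL h (x a) (y a) (g a) []) (Fin.castLE hp) =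
        (1 : Matrix (Word n N) (Word n N) S) := by
      unfold qMinor
      rw [Finset.sum_eq_single 1]
      · simp only [listL_nil, Equiv.Perm.one_apply, Matrix.one_apply_eq, Equiv.Perm.sign_one]
        simp
      · intro σ _ hσ
        obtain ⟨a, ha⟩ : ∃ a, σ a ≠ a := by
          by_contra! hcon
          exact hσ (Equiv.ext hcon)
        rw [List.prod_eq_zero, smul_zero]
        rw [List.mem_ofFn]
        refine ⟨a, ?_⟩
        simp only [listL_nil]
        refine Matrix.one_apply_ne ?_
        intro h
        exact ha (Fin.castLE_injective hp h).symm
      · simp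
    rw [this, Matrix.one_mulVec]; simp
  | cons i l ih =>
    obtain ⟨hi, hl'⟩ := List.nodup_cons.1 hl
    obtain ⟨hw1, hw2⟩ := List.pairwise_cons.1 hw
    have ih := ih hl' hw2
    set A := fun a => listL (N := N) h (x a) (y a) (g a) (i :: l) with hA
    set A' := fun a => listL (N := N) h (x a) (y a) (g a) l with hA'
    set E := siteProj S i (w i) with hE
    have hAE : ∀ a r e, r ≠ w i → A a r e * E = (if r < w i then 1 else h) • (A' a r e * E) :=
      fun a r e hr => listL_mul_siteProj h (x a) (y a) (g a) (hg a) i l hi r e (w i) hr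
    have hcE : ∀ a r e, Commute (A' a r e) E :=
      fun a r e => (siteHom_commute_listL h _ _ _ l i hi _ r e).symm
    have hEv : E.mulVec (Pi.single w 1) = Pi.single w 1 := siteProj_single i w
    rw [List.map_cons, List.prod_cons]
    by_cases hk : (w i).val < q + 1
    · obtain ⟨k, hkk⟩ : ∃ k : Fin (q + 1), Fin.castLE hp k = w i := ⟨⟨(w i).val, hk⟩, rfl⟩
      have hkv : (w i).val = k.val := by rw [← hkk]; rfl
      set τ : Equiv.Perm (Fin (q + 1)) := Equiv.swap 0 k with hτ
      set c : Fin (q + 1) → Fin N := Fin.castLE hp ∘ τ with hc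
      have hsg : ∀ B : Fin (q + 1) → Matrix (Fin N) (Fin N) (Matrix (Word n N) (Word n N) S),
          (∀ a : Fin q, IsExchange (B a.castSucc) (B a.succ)) →
          qMinor hp B (Fin.castLE hp) = (Equiv.Perm.sign τ : ℤ) • qMinor hp B c := by
        intro B hB
        rw [hc, qMinor_comp hB, smul_smul]
        simp
      have hc0 : c 0 = w i := by rw [hc, ← hkk]; simp [hτ]
      have hcs : ∀ a : Fin q, c a.succ ≠ w i := by
        intro a ha
        rw [← hc0] at ha
        have := τ.injective (Fin.castLE_injective hp ha)
        exact Fin.succ_ne_zero _ this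
      have hmain : qMinor hp A c * E = h ^ (q - k.val) •
          (∑ e, siteL h (x 0 i) (y 0) (g 0 i) i (w i) e *
            (qMinor hp A' (Function.update c 0 e) * E)) := by
        have hprod : ∀ (σ : Equiv.Perm (Fin (q + 1))),
            (List.ofFn fun a => A a (c a) (Fin.castLE hp (σ a))).prod * E =
            h ^ (q - k.val) • (∑ e, siteL h (x 0 i) (y 0) (g 0 i) i (w i) e *
              ((List.ofFn fun a => A' a (Function.update c 0 e a)
                (Fin.castLE hp (σ a))).prod * E)) := by
          intro σ
          rw [List.ofFn_succ, List.prod_cons, List.ofFn_eq_map, mul_assoc,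
            list_prod_mul_of_commute _ (fun a : Fin q => A' a.succ (c a.succ)
              (Fin.castLE hp (σ a.succ))) (fun a : Fin q => if c a.succ < w i then 1 else h) E _
              (fun a _ => hAE _ _ _ (hcs a)) (fun a _ => hcE _ _ _)]
          have hpr : ((List.finRange q).map fun a : Fin q => if c a.succ < w i then 1 else h).prod =
              h ^ (q - k.val) := by
            rw [← prod_swap_rows h k]
            congr 2
            funext a
            rw [← hkk]
            rfl
          rw [hpr, mul_smul_comm]
          congr 1
          rw [hA]
          simp only
          rw [listL_cons, Matrix.mul_apply, Finset.sum_mul, hc0]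
          refine Finset.sum_congr rfl fun e _ => ?_
          rw [List.ofFn_succ, List.prod_cons, List.ofFn_eq_map]
          simp only [Function.update_self, Function.update_of_ne (Fin.succ_ne_zero _), mul_assoc]
          rfl
        unfold qMinor
        simp only [Finset.sum_mul, Finset.mul_sum, smul_mul_assoc, hprod, mul_smul_comm,
          Finset.smul_sum]
        rw [Finset.sum_comm]
        refine Finset.sum_congr rfl fun e _ => Finset.sum_congr rfl fun σ _ => ?_
        rw [smul_comm]
      have hup : Function.update c 0 (w i) = c := by
        rw [← hc0]; exact Function.update_eq_self _ _
      -- For `e` within the minor another row already equals `e`, so the minor vanishes. For `e`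
      -- beyond it, the remaining letters are at most `w i ≤ q`, so `qMinor_mulVec_eq_zero` applies.
      have hzero : ∀ e, e ≠ w i →
          (qMinor hp A' (Function.update c 0 e)).mulVec (Pi.single w 1) = 0 := by
        intro e he
        by_cases hep : e.val < q + 1
        · have hne : τ.symm ⟨e.val, hep⟩ ≠ 0 := by
            intro h0
            apply he
            rw [← hc0, hc, ← h0, Function.comp_apply, Equiv.apply_symm_apply]
            rfl
          have hce : Function.update c 0 e (τ.symm ⟨e.val, hep⟩) = Function.update c 0 e 0 := by
            rw [Function.update_of_ne hne, Function.update_self, hc, Function.comp_apply,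
              Equiv.apply_symm_apply]
            rfl
          rw [qMinor_eq_zero (A := A') (hex l hl') h2 _ hne hce, Matrix.zero_mulVec]
        · refine qMinor_mulVec_eq_zero h x y g hg l hl' (hex l hl') w
            (fun j hj => lt_of_le_of_lt (hw1 j hj) hk) _ ?_
          rw [Function.update_self]; omega
      have hfin : (qMinor hp A c).mulVec (Pi.single w 1) =
          siteEig q h (x 0 i) (y 0) (g 0 i) (w i) •
            (qMinor hp A' c).mulVec (Pi.single w 1) := by
        conv_lhs => rw [← hEv]
        rw [Matrix.mulVec_mulVec, hmain, Matrix.smul_mulVec, Matrix.sum_mulVec,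
          Finset.sum_eq_single (w i)]
        · rw [hup]
          have hcm : qMinor hp A' c * E = E * qMinor hp A' c := by
            unfold qMinor
            rw [Finset.sum_mul, Finset.mul_sum]
            refine Finset.sum_congr rfl fun σ _ => ?_
            rw [smul_mul_assoc, mul_smul_comm]
            congr 1
            refine (Commute.list_prod_left _ _ fun t ht => ?_).eq
            obtain ⟨b, rfl⟩ := (List.mem_ofFn' _ _).1 ht
            exact hcE _ _ _
          rw [hcm, ← mul_assoc, siteL_mul_siteProj_self, smul_mul_assoc, ← hE, ← hcm,
            Matrix.smul_mulVec, ← Matrix.mulVec_mulVec, hEv, smul_smul, siteEig, if_pos hk, hkv]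
        · intro e _ he
          rw [← Matrix.mulVec_mulVec, ← Matrix.mulVec_mulVec, hEv, hzero e he, Matrix.mulVec_zero]
        · simp
      rw [hsg A (hex _ hl), Matrix.smul_mulVec, hfin, mul_smul, ← ih, hsg A' (hex _ hl'),
        Matrix.smul_mulVec, smul_comm]
    · have hlt : ∀ r : Fin (q + 1), Fin.castLE hp r < w i := by
        intro r; rw [Fin.lt_def]; simp; omega
      have hEq : qMinor hp A (Fin.castLE hp) * E = qMinor hp A' (Fin.castLE hp) * E := by
        unfold qMinor
        rw [Finset.sum_mul, Finset.sum_mul]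
        refine Finset.sum_congr rfl fun σ _ => ?_
        rw [smul_mul_assoc, smul_mul_assoc, List.ofFn_eq_map, List.ofFn_eq_map,
          list_prod_mul_of_commute _ (fun a => A' a (Fin.castLE hp a) (Fin.castLE hp (σ a)))
            (fun _ => (1 : S)) E]
        · simp
        · intro a _
          rw [hAE _ _ _ (hlt a).ne, if_pos (hlt a)]
        · exact fun a _ => hcE _ _ _
      rw [siteEig, if_neg hk, one_mul, ← ih]
      conv_lhs => rw [← hEv]
      rw [Matrix.mulVec_mulVec, hEq, ← Matrix.mulVec_mulVec, hEv]

end Eigen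
-- Power series of matrices and matrices of power series.
section MatrixSeries

variable {W R : Type*} [Fintype W] [DecidableEq W] [CommRing R]

/-- A power series with matrix coefficients as a matrix of power series. -/
def seriesToMat (W R : Type*) [Fintype W] [DecidableEq W] [CommRing R] :
    PowerSeries (Matrix W W R) →+* Matrix W W (PowerSeries R) where
  toFun f := Matrix.of fun w w' => PowerSeries.mk fun s => PowerSeries.coeff s f w w'
  map_one' := by
    ext w w' s
    rw [Matrix.of_apply, PowerSeries.coeff_mk, PowerSeries.coeff_one, Matrix.one_apply]
    split_ifs <;> simp [PowerSeries.coeff_one, Matrix.one_apply, *]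
  map_zero' := by ext; simp
  map_add' f g := by ext; simp
  map_mul' f g := by
    ext w w' s
    simp only [Matrix.of_apply, PowerSeries.coeff_mk, PowerSeries.coeff_mul, Matrix.mul_apply,
      Matrix.sum_apply, map_sum]
    rw [Finset.sum_comm]

theorem coeff_seriesToMat (f : PowerSeries (Matrix W W R)) (s : ℕ) :
    (seriesToMat W R f).map (PowerSeries.coeff s) = PowerSeries.coeff s f := by
  ext; simp [seriesToMat]

theorem seriesToMat_C (m : Matrix W W R) :
    seriesToMat W R (PowerSeries.C m) = m.map (PowerSeries.C (R := R)) := by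
  ext w w' s
  simp only [seriesToMat, RingHom.coe_mk, MonoidHom.coe_mk, OneHom.coe_mk, Matrix.of_apply,
    PowerSeries.coeff_mk, PowerSeries.coeff_C, Matrix.map_apply]
  split_ifs <;> simp

end MatrixSeries

/-! ### Eigenvalues of `A_{p,±}(u)` at `I^min`. -/

section GZEigen

variable {n N : ℕ}

instance : CharZero (PowerSeries (P n)) :=
  charZero_of_injective_ringHom ((PowerSeries.C (R := P n)).comp (algebraMap Ch (P n))).injective

/-- Power series over `𝒰` act by matrices of power series. -/
def serPho (n N : ℕ) : PowerSeries (U N) →+* Matrix (Word n N) (Word n N) (PowerSeries (P n)) :=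
  (seriesToMat (Word n N) (P n)).comp (PowerSeries.map (phoMat n N).toRingHom)

theorem coeff_serPho (f : PowerSeries (U N)) (s : ℕ) :
    (serPho n N f).map (PowerSeries.coeff s) = phoMat n N (PowerSeries.coeff s f) := by
  rw [serPho, RingHom.comp_apply, coeff_seriesToMat]; simp

theorem serPho_C (X : U N) :
    serPho n N (PowerSeries.C X) = (phoMat n N X).map (PowerSeries.C (R := P n)) := by
  rw [serPho, RingHom.comp_apply, PowerSeries.map_C, seriesToMat_C]; rfl

/-- The substitution `u ↦ u h^a`. -/
def shiftHom (n : ℕ) (ε : Sgn) (a : ℕ) : PowerSeries (P n) →+* PowerSeries (P n) :=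
  PowerSeries.rescale (algebraMap Ch (P n) (hh ^ (ε.toInt * a)))

theorem shiftHom_C (ε : Sgn) (a : ℕ) (c : P n) :
    shiftHom n ε a (PowerSeries.C c) = PowerSeries.C c := by
  ext s
  simp only [shiftHom, PowerSeries.coeff_rescale, PowerSeries.coeff_C]
  split_ifs with h
  · simp [h]
  · simp

theorem shiftHom_zero (ε : Sgn) : shiftHom n ε 0 = RingHom.id _ := by
  rw [shiftHom, show hh ^ (ε.toInt * ((0 : ℕ) : ℤ)) = 1 by simp, map_one, PowerSeries.rescale_one]

/-- The monodromy matrix at `u h^a`. -/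
def shiftL (N : ℕ) (ε : Sgn) (a : ℕ) (l : List (Fin n)) :
    Matrix (Fin N) (Fin N) (Matrix (Word n N) (Word n N) (PowerSeries (P n))) :=
  listL (PowerSeries.C (hP n)) (fun i => PowerSeries.C (zP i) * shiftHom n ε a (uDen _ ε))
    (shiftHom n ε a (uNum _ ε)) (fun i => shiftHom n ε a (invSer (zP i) (ziP i) ε)) l

theorem serPho_Lser (ε : Sgn) (a : ℕ) (i j : Fin N) :
    serPho n N (Lser ε a i j) = shiftL N ε a (List.finRange n).reverse i j := by
  have e := listL_map (shiftHom n ε a) (PowerSeries.C (hP n))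
    (fun i => PowerSeries.C (zP i) * uDen _ ε) (uNum _ ε)
    (fun i => invSer (zP i) (ziP i) ε) (List.finRange n).reverse i j
  simp only [map_mul, shiftHom_C] at e
  rw [shiftL, ← e]
  refine Matrix.ext fun w w' => PowerSeries.ext fun s => ?_
  have h1 := congr_fun (congr_fun (coeff_serPho (n := n) (Lser ε a i j) s) w) w'
  rw [Matrix.map_apply] at h1
  rw [h1, Lser, PowerSeries.coeff_mk, map_smul, phoMat_L, Matrix.map_apply, shiftHom,
    PowerSeries.coeff_rescale, Matrix.smul_apply, coefL, Matrix.map_apply, Algebra.smul_def,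
    ← map_pow]
  rw [zpow_mul, zpow_natCast]
  rfl

theorem smul_mat_eq_zero {W R : Type*} [CommRing R] [IsDomain R] {c : R} (hc : c ≠ 0)
    (m : Matrix W W R) (h : c • m = 0) : m = 0 := by
  ext w w'
  have := congr_fun (congr_fun h w) w'
  simpa [hc] using this

/-- That `h` is not a root of unity is used throughout: for the exchange relation, for recovering
power sums, for separating weights and for clearing denominators inside the blocks. -/
theorem hh_pow_ne_one {k : ℕ} (hk : k ≠ 0) : hh ^ k ≠ 1 := by
  intro h
  have h1 : (algebraMap (Polynomial ℂ) Ch) (Polynomial.X ^ k) = algebraMap (Polynomial ℂ) Ch 1 := by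
    rw [map_pow, RatFunc.algebraMap_X, map_one]; exact h
  have h2 := RatFunc.algebraMap_injective ℂ h1
  have h3 := congr_arg Polynomial.natDegree h2
  simp at h3
  exact hk h3

theorem C_algebraMap_ne_zero {c : Ch} (hc : c ≠ 0) :
    PowerSeries.C (algebraMap Ch (P n) c) ≠ 0 := by
  intro h
  have : ((PowerSeries.C (R := P n)).comp (algebraMap Ch (P n))) c = 0 := h
  exact hc ((map_eq_zero _).1 this)

/-- The spectral parameters `u h^a` and `u h^{a+1}` have ratio exactly `h`, the value at which the
`R`-matrix degenerates. This is why the quantum minors use these shifts. -/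
theorem shiftL_isExchange (ε : Sgn) (a : ℕ) (l : List (Fin n)) (hl : l.Nodup) :
    IsExchange (shiftL N ε a l) (shiftL N ε (a + 1) l) := by
  have H := isRTT_listL (N := N) (PowerSeries.C (hP n)) (fun i => PowerSeries.C (zP i))
    (shiftHom n ε a (uNum _ ε)) (shiftHom n ε a (uDen _ ε)) (shiftHom n ε (a + 1) (uNum _ ε))
    (shiftHom n ε (a + 1) (uDen _ ε)) (fun i => shiftHom n ε a (invSer (zP i) (ziP i) ε))
    (fun i => shiftHom n ε (a + 1) (invSer (zP i) (ziP i) ε)) l hl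
  have hX : ∀ b, shiftHom n ε b PowerSeries.X =
      PowerSeries.C (algebraMap Ch (P n) (hh ^ (ε.toInt * b))) * PowerSeries.X :=
    fun b => PowerSeries.rescale_X _
  obtain ⟨b, hy, hx⟩ : ∃ b : ℤ, shiftHom n ε a (uNum _ ε) * shiftHom n ε (a + 1) (uDen _ ε) =
      PowerSeries.C (algebraMap Ch (P n) (hh ^ b)) * PowerSeries.X ∧
      shiftHom n ε (a + 1) (uNum _ ε) * shiftHom n ε a (uDen _ ε) = PowerSeries.C (hP n) *
        (shiftHom n ε a (uNum _ ε) * shiftHom n ε (a + 1) (uDen _ ε)) := by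
    cases ε with
    | plus =>
      refine ⟨a, ?_, ?_⟩
      · simp [uNum, uDen, hX, Sgn.toInt]
      · simp only [uNum, uDen, hX, map_one, mul_one]
        rw [← mul_assoc, ← map_mul, hP, ← map_mul]
        congr 3
        rw [← zpow_one_add₀ hh_ne_zero]
        congr 1
        simp [Sgn.toInt]; ring
    | minus =>
      refine ⟨-(a + 1), ?_, ?_⟩
      · simp [uNum, uDen, hX, Sgn.toInt]
      · simp only [uNum, uDen, hX, map_one, one_mul]
        rw [← mul_assoc, ← map_mul, hP, ← map_mul]
        congr 3
        rw [← zpow_one_add₀ hh_ne_zero]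
        congr 1
        simp [Sgn.toInt]
  rw [hx] at H
  have hyne : shiftHom n ε a (uNum _ ε) * shiftHom n ε (a + 1) (uDen _ ε) ≠ 0 := by
    rw [hy]
    exact mul_ne_zero (C_algebraMap_ne_zero (zpow_ne_zero _ hh_ne_zero)) PowerSeries.X_ne_zero
  have h1 : (1 - PowerSeries.C (hP n)) ≠ 0 := by
    rw [hP, ← map_one PowerSeries.C, ← map_one (algebraMap Ch (P n)), ← map_sub, ← map_sub]
    refine C_algebraMap_ne_zero (sub_ne_zero.2 (Ne.symm ?_))
    simpa using hh_pow_ne_one one_ne_zero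
  have h2 : (1 - PowerSeries.C (hP n) * PowerSeries.C (hP n)) ≠ 0 := by
    rw [hP, ← map_mul, ← map_one PowerSeries.C, ← map_mul, ← map_one (algebraMap Ch (P n)),
      ← map_sub, ← map_sub]
    refine C_algebraMap_ne_zero (sub_ne_zero.2 (Ne.symm ?_))
    simpa [sq] using hh_pow_ne_one two_ne_zero
  have h3 : PowerSeries.C (hP n) ≠ 0 := C_algebraMap_ne_zero hh_ne_zero
  exact H.isExchange (smul_mat_eq_zero (mul_ne_zero h1 hyne))
    (smul_mat_eq_zero (mul_ne_zero h3 (mul_ne_zero h1 hyne)))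
    (smul_mat_eq_zero (mul_ne_zero h2 hyne))

theorem serPho_minorSer (ε : Sgn) (q : ℕ) (hp : q + 1 ≤ N) :
    serPho n N (minorSer ε (q + 1) hp) =
      qMinor hp (fun a => shiftL N ε a (List.finRange n).reverse) (Fin.castLE hp) := by
  unfold minorSer qMinor
  rw [map_sum]
  refine Finset.sum_congr rfl fun σ _ => ?_
  rw [map_zsmul, map_list_prod, List.map_ofFn]
  congr 3
  funext a
  exact serPho_Lser _ _ _ _

/-- The contribution of the variable `z_i` to the eigenvalues of `A_{p,±}(u)`. -/
def eigSer (ε : Sgn) (i : Fin n) : PowerSeries (P n) :=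
  match ε with
  | .plus => (1 - PowerSeries.C (algebraMap Ch (P n) hh⁻¹ * ziP i) * PowerSeries.X) *
      PowerSeries.mk fun s => ziP i ^ s
  | .minus => (1 - PowerSeries.C (algebraMap Ch (P n) hh * zP i) * PowerSeries.X) *
      PowerSeries.mk fun s => zP i ^ s

/-- The powers of `h` from the rows passing the site cancel against the leading coefficients. What
is left is `(1 - h z/u)/(1 - z/u)` expanded at `u = 0` and scaled to constant term 1, independently
of the letter and of `q`. -/
theorem siteEig_plus (q : ℕ) (i : Fin n) (k : Fin N) :
    siteEig q (PowerSeries.C (hP n)) (PowerSeries.C (zP i) * uDen _ .plus) (uNum _ .plus)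
      (invSer (zP i) (ziP i) .plus) k *
      PowerSeries.C (∏ a : Fin (q + 1),
        if k.val ≤ a.val then algebraMap Ch (P n) hh⁻¹ else 1) =
      if k.val < q + 1 then eigSer .plus i else 1 := by
  have hhi : PowerSeries.C (hP n) * PowerSeries.C (algebraMap Ch (P n) hh⁻¹) = 1 := by
    rw [hP, ← map_mul, ← map_mul, mul_inv_cancel₀ hh_ne_zero, map_one, map_one]
  have hzz : PowerSeries.C (zP i) * PowerSeries.C (ziP i) = 1 := by
    rw [← map_mul, zP_mul_ziP, map_one]
  by_cases hk : k.val < q + 1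
  · have hprod : (∏ a : Fin (q + 1), if k.val ≤ a.val then algebraMap Ch (P n) hh⁻¹ else 1) =
        algebraMap Ch (P n) hh⁻¹ ^ (q - k.val + 1) := by
      rw [Finset.prod_ite, Finset.prod_const, Finset.prod_const_one, mul_one]
      congr 1
      have : (Finset.univ.filter fun a : Fin (q + 1) => k.val ≤ a.val) =
          Finset.Ici ⟨k.val, hk⟩ := by
        ext a; simp [Fin.le_def]
      rw [this, Fin.card_Ici]
      simp only
      omega
    rw [siteEig, if_pos hk, if_pos hk, hprod]
    have e1 : PowerSeries.C (hP n) ^ (q - k.val) *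
        PowerSeries.C (algebraMap Ch (P n) hh⁻¹) ^ (q - k.val) = 1 := by
      rw [← mul_pow, hhi, one_pow]
    have e2 : invSer (zP i) (ziP i) .plus =
        -PowerSeries.C (ziP i) * PowerSeries.mk fun s => ziP i ^ s := by
      ext s
      rw [neg_mul, map_neg, PowerSeries.coeff_C_mul]
      simp [invSer, pow_succ, mul_comm]
    simp only [eigSer, e2, uNum, uDen, map_pow, map_mul, pow_succ, mul_one]
    set H := PowerSeries.C (hP n)
    set Hi := PowerSeries.C (algebraMap Ch (P n) hh⁻¹)
    set Z := PowerSeries.C (zP i)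
    set Zi := PowerSeries.C (ziP i)
    set G : PowerSeries (P n) := PowerSeries.mk fun s => ziP i ^ s
    linear_combination (-(Zi * G * (PowerSeries.X - H * Z) * Hi)) * e1 +
      (Zi * G * Z) * hhi + G * hzz
  · rw [siteEig, if_neg hk, if_neg hk, Finset.prod_eq_one, map_one, one_mul]
    intro a _
    rw [if_neg (by omega)]

theorem siteEig_minus (q : ℕ) (i : Fin n) (k : Fin N) :
    siteEig q (PowerSeries.C (hP n)) (PowerSeries.C (zP i) * uDen _ .minus) (uNum _ .minus)
      (invSer (zP i) (ziP i) .minus) k *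
      PowerSeries.C (∏ a : Fin (q + 1),
        if k.val < a.val then algebraMap Ch (P n) hh⁻¹ else 1) =
      if k.val < q + 1 then eigSer .minus i else 1 := by
  have hhi : PowerSeries.C (hP n) * PowerSeries.C (algebraMap Ch (P n) hh⁻¹) = 1 := by
    rw [hP, ← map_mul, ← map_mul, mul_inv_cancel₀ hh_ne_zero, map_one, map_one]
  by_cases hk : k.val < q + 1
  · have hprod : (∏ a : Fin (q + 1), if k.val < a.val then algebraMap Ch (P n) hh⁻¹ else 1) =
        algebraMap Ch (P n) hh⁻¹ ^ (q - k.val) := by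
      rw [Finset.prod_ite, Finset.prod_const, Finset.prod_const_one, mul_one]
      congr 1
      have : (Finset.univ.filter fun a : Fin (q + 1) => k.val < a.val) =
          Finset.Ioi ⟨k.val, hk⟩ := by
        ext a; simp [Fin.lt_def]
      rw [this, Fin.card_Ioi]
      simp only
      omega
    rw [siteEig, if_pos hk, if_pos hk, hprod]
    have e1 : PowerSeries.C (hP n) ^ (q - k.val) *
        PowerSeries.C (algebraMap Ch (P n) hh⁻¹) ^ (q - k.val) = 1 := by
      rw [← mul_pow, hhi, one_pow]
    simp only [eigSer, invSer, uNum, uDen, map_pow, map_mul]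
    rw [← hP]
    set H := PowerSeries.C (hP n)
    set Z := PowerSeries.C (zP i)
    set G : PowerSeries (P n) := PowerSeries.mk fun s => zP i ^ s
    linear_combination (G * (1 - H * (Z * PowerSeries.X))) * e1
  · rw [siteEig, if_neg hk, if_neg hk, Finset.prod_eq_one, map_one, one_mul]
    intro a _
    rw [if_neg (by omega)]

/-- Whether `L̃_{a,a,±0}` acts by `h` on the letter `k`. -/
def Sgn.below : Sgn → ℕ → ℕ → Bool
  | .plus, k, a => decide (k ≤ a)
  | .minus, k, a => decide (k < a)

theorem phoMat_prod_Linv0 (ε : Sgn) (p : ℕ) (hp : p ≤ N) :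
    phoMat n N (List.ofFn fun a : Fin p => Linv0 ε (Fin.castLE hp a)).prod =
      Matrix.diagonal fun w => ∏ i, ∏ a : Fin p,
        if ε.below (w i) a
        then algebraMap Ch (P n) hh⁻¹ else 1 := by
  have h1 : ∀ a : Fin p, phoMat n N (Linv0 ε (Fin.castLE hp a)) = Matrix.diagonal fun w =>
      ∏ i, if ε.below (w i) a
        then algebraMap Ch (P n) hh⁻¹ else 1 := by
    intro a
    cases ε with
    | plus => simp [Linv0, phoMat_Linv, Fin.le_def, Sgn.below]
    | minus =>
      simp only [Linv0]
      split_ifs with ha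
      · rw [map_one, ← Matrix.diagonal_one]
        congr 1
        funext w
        refine (Finset.prod_eq_one fun i _ => if_neg ?_).symm
        simp only [Fin.val_castLE] at ha
        simp [Sgn.below, ha]
      · rw [phoMat_Linv]
        congr 1
        funext w
        refine Finset.prod_congr rfl fun i _ => ?_
        simp only [Fin.val_castLE] at ha
        congr 1
        rw [Fin.le_def, eq_iff_iff, Sgn.below, decide_eq_true_eq]
        simp only [Fin.val_castLE]
        omega
  rw [map_list_prod, List.map_ofFn]
  have h2 : (⇑(phoMat n N) ∘ fun a : Fin p => Linv0 ε (Fin.castLE hp a)) = fun a : Fin p =>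
      Matrix.diagonalRingHom (Word n N) (P n) (fun w =>
      ∏ i, if ε.below (w i) a
        then algebraMap Ch (P n) hh⁻¹ else 1) := funext h1
  rw [h2]
  rw [show (List.ofFn fun a : Fin p => Matrix.diagonalRingHom (Word n N) (P n) (fun w =>
      ∏ i, if ε.below (w i) a
        then algebraMap Ch (P n) hh⁻¹ else 1)) = (List.ofFn fun a : Fin p => (fun w : Word n N =>
      ∏ i, if ε.below (w i) a
        then algebraMap Ch (P n) hh⁻¹ else 1)).map (Matrix.diagonalRingHom (Word n N) (P n)) by
      rw [List.map_ofFn]; rfl, ← map_list_prod, List.prod_ofFn]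
  show Matrix.diagonal _ = _
  congr 1
  funext w
  rw [Finset.prod_apply, Finset.prod_comm]

/-- The eigenvalue of `A_{p,±}(u)` on `v_w` for `w` weakly increasing. -/
def eigProd (ε : Sgn) (p : ℕ) (w : Word n N) : PowerSeries (P n) :=
  ∏ i, if (w i).val < p then eigSer ε i else 1

/-- The monodromy matrix multiplies the sites from the last to the first, so a weakly increasing
word is met in weakly decreasing order, as `qMinor_mulVec` requires. -/
theorem serPho_Aser (ε : Sgn) (q : ℕ) (hp : q + 1 ≤ N) (w : Word n N) (hw : Monotone w) :
    (serPho n N (Aser ε (q + 1) hp)).mulVec (Pi.single w 1) =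
      eigProd ε (q + 1) w • Pi.single w (1 : PowerSeries (P n)) := by
  have h2 : ∀ m : Matrix (Word n N) (Word n N) (PowerSeries (P n)), m = -m → m = 0 := by
    intro m hm
    refine Matrix.ext fun w w' => ?_
    have := congr_fun (congr_fun hm w) w'
    exact self_eq_neg.1 this
  have key := qMinor_mulVec (hp := hp) (PowerSeries.C (hP n))
    (fun a i => PowerSeries.C (zP i) * shiftHom n ε a (uDen _ ε))
    (fun a => shiftHom n ε a (uNum _ ε))
    (fun a i => shiftHom n ε a (invSer (zP i) (ziP i) ε))
    (fun a i => by
      have := congr_arg (shiftHom n ε a) (invSer_mul (zP_mul_ziP i) ε)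
      simpa [shiftHom_C] using this)
    (fun l hl a => shiftL_isExchange ε a l hl) h2 (List.finRange n).reverse
    (List.nodup_reverse.2 (List.nodup_finRange n)) w
    (by
      rw [List.pairwise_reverse]
      exact (List.pairwise_lt_finRange n).imp fun h => hw h.le)
  rw [Aser, map_mul, ← Matrix.mulVec_mulVec, serPho_C, phoMat_prod_Linv0, serPho_minorSer]
  rw [Matrix.diagonal_map (map_zero _), Matrix.diagonal_mulVec_single, mul_one]
  rw [show ∀ c : PowerSeries (P n), Pi.single w c = c • Pi.single w (1 : PowerSeries (P n)) from
    fun c => by rw [← Pi.single_smul, smul_eq_mul, mul_one], Matrix.mulVec_smul]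
  refine (congr_arg _ key).trans ?_
  rw [smul_smul]
  congr 1
  have e0 : ((0 : Fin (q + 1)) : ℕ) = 0 := rfl
  simp only [e0, shiftHom_zero, RingHom.id_apply]
  rw [((List.reverse_perm _).map _).prod_eq, ← List.ofFn_eq_map, List.prod_ofFn, map_prod,
    ← Finset.prod_mul_distrib, eigProd]
  refine Finset.prod_congr rfl fun i _ => ?_
  rw [mul_comm]
  cases ε with
  | plus =>
    simp only [Sgn.below, decide_eq_true_eq]
    exact siteEig_plus q i (w i)
  | minus =>
    simp only [Sgn.below, decide_eq_true_eq]
    exact siteEig_minus q i (w i)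

theorem phoMat_Aser (ε : Sgn) (p : ℕ) (hp1 : 1 ≤ p) (hp : p ≤ N) (s : ℕ) (w : Word n N)
    (hw : Monotone w) :
    (phoMat n N (PowerSeries.coeff s (Aser ε p hp))).mulVec (Pi.single w 1) =
      PowerSeries.coeff s (eigProd ε p w) • Pi.single w (1 : P n) := by
  obtain ⟨q, rfl⟩ : ∃ q, p = q + 1 := ⟨p - 1, by omega⟩
  have := serPho_Aser ε q hp w hw
  rw [← coeff_serPho]
  funext w'
  have h := congr_arg (PowerSeries.coeff s) (congr_fun this w')
  rw [Matrix.mulVec_single_one] at h ⊢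
  refine Eq.trans h ?_
  simp only [Pi.smul_apply, Pi.single_apply, smul_eq_mul]
  split_ifs <;> simp

end GZEigen
-- Permutations of the variables.
section Permutations

variable {n : ℕ}

theorem permP_single (σ : Equiv.Perm (Fin n)) (e : Fin n →₀ ℤ) (c : Ch) :
    permP σ (AddMonoidAlgebra.single e c) =
      AddMonoidAlgebra.single (Finsupp.equivMapDomain σ e) c := by
  simp [permP]

theorem permP_zP (σ : Equiv.Perm (Fin n)) (i : Fin n) : permP σ (zP i) = zP (σ i) := by
  rw [zP, permP_single, Finsupp.equivMapDomain_single]; rfl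

theorem permP_ziP (σ : Equiv.Perm (Fin n)) (i : Fin n) : permP σ (ziP i) = ziP (σ i) := by
  rw [ziP, permP_single, Finsupp.equivMapDomain_single]; rfl

theorem permP_mul (σ τ : Equiv.Perm (Fin n)) (f : P n) : permP (σ * τ) f = permP σ (permP τ f) := by
  have : (permP (σ * τ) : P n ≃ₐ[Ch] P n).toAlgHom =
      (permP σ).toAlgHom.comp (permP τ).toAlgHom := by
    apply AddMonoidAlgebra.algHom_ext
    swap
    · exact Subsingleton.elim _ _
    intro e
    show permP (σ * τ) _ = permP σ (permP τ _)
    rw [permP_single, permP_single, permP_single]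
    congr 1
    exact Finsupp.equivMapDomain_trans τ σ e
  exact congr_fun (congr_arg DFunLike.coe this) f

theorem permP_one (f : P n) : permP (1 : Equiv.Perm (Fin n)) f = f := by
  have : (permP 1 : P n ≃ₐ[Ch] P n).toAlgHom = AlgHom.id Ch (P n) := by
    apply AddMonoidAlgebra.algHom_ext
    swap
    · exact Subsingleton.elim _ _
    intro e
    show permP 1 _ = _
    rw [permP_single]
    congr 1
    exact Finsupp.equivMapDomain_refl e
  exact congr_fun (congr_arg DFunLike.coe this) f

theorem permP_hP (σ : Equiv.Perm (Fin n)) : permP σ (hP n) = hP n := AlgEquiv.commutes _ _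

theorem permK_algebraMap (σ : Equiv.Perm (Fin n)) (f : P n) :
    permK σ (algebraMap (P n) (K n) f) = algebraMap (P n) (K n) (permP σ f) :=
  IsFractionRing.ringEquivOfRingEquiv_algebraMap _ _

theorem permK_ext {σ τ : K n →+* K n} (h : ∀ f : P n, σ (algebraMap (P n) (K n) f) =
    τ (algebraMap (P n) (K n) f)) (x : K n) : σ x = τ x := by
  obtain ⟨a, b, -, rfl⟩ := IsFractionRing.div_surjective (A := P n) x
  rw [map_div₀, map_div₀, h, h]

theorem permK_mul (σ τ : Equiv.Perm (Fin n)) (x : K n) :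
    permK (σ * τ) x = permK σ (permK τ x) := by
  refine permK_ext (σ := (permK (σ * τ) : K n ≃+* K n).toRingHom)
    (τ := (permK σ).toRingHom.comp (permK τ).toRingHom) (fun f => ?_) x
  show permK (σ * τ) _ = permK σ (permK τ _)
  rw [permK_algebraMap, permK_algebraMap, permK_algebraMap, permP_mul]

theorem permK_one (x : K n) : permK (1 : Equiv.Perm (Fin n)) x = x := by
  refine permK_ext (σ := (permK 1 : K n ≃+* K n).toRingHom) (τ := RingHom.id _) (fun f => ?_) x
  show permK 1 _ = _
  rw [permK_algebraMap, permP_one]; rfl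

theorem permK_z (σ : Equiv.Perm (Fin n)) (i : Fin n) : permK σ (z i) = z (σ i) := by
  rw [← algebraMap_zP, permK_algebraMap, permP_zP]; rfl

theorem permK_hK (σ : Equiv.Perm (Fin n)) : permK σ (hK n) = hK n := by
  rw [← algebraMap_hP, permK_algebraMap, permP_hP]

theorem permK_algebraMap_Ch (σ : Equiv.Perm (Fin n)) (c : Ch) :
    permK σ (algebraMap Ch (K n) c) = algebraMap Ch (K n) c := by
  rw [IsScalarTower.algebraMap_apply Ch (P n) (K n), permK_algebraMap, AlgEquiv.commutes]

theorem Adj.s_mul_s (i : Adj n) : i.s * i.s = 1 := Equiv.swap_mul_self _ _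

theorem Adj.s_s (i : Adj n) (a : Fin n) : i.s (i.s a) = a := Equiv.swap_swap_apply _ _ _
  where
  Equiv.swap_swap_apply (a b c : Fin n) : Equiv.swap a b (Equiv.swap a b c) = c := by simp

theorem Adj.comp_s_s {X : Type*} (i : Adj n) (w : Fin n → X) : (w ∘ i.s) ∘ i.s = w := by
  funext a; simp [Adj.s]

theorem Adj.ne (i : Adj n) : i.1 ≠ i.next := by
  intro h
  have := congr_arg Fin.val h
  simp [Adj.next] at this

theorem Adj.lt (i : Adj n) : i.1 < i.next := by
  rw [Fin.lt_def]; simp [Adj.next]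

theorem Adj.s_left (i : Adj n) : i.s i.1 = i.next := Equiv.swap_apply_left _ _

theorem Adj.s_right (i : Adj n) : i.s i.next = i.1 := Equiv.swap_apply_right _ _

theorem Adj.s_of_ne (i : Adj n) {a : Fin n} (h : a ≠ i.1) (h' : a ≠ i.next) : i.s a = a :=
  Equiv.swap_apply_of_ne_of_ne h h'

theorem permK_s_s (i : Adj n) (x : K n) : permK i.s (permK i.s x) = x := by
  rw [← permK_mul, i.s_mul_s, permK_one]

end Permutations

/-! ### The intertwiner of two neighbouring sites. -/

section Exch

variable {n N : ℕ} {S : Type*} [CommRing S]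

/-- The operator `P (y - h x) 𝓡(x / y)` in two neighbouring tensor factors. -/
def exch (h x y : S) (i : Adj n) : Matrix (Word n N) (Word n N) S :=
  Matrix.of fun w w' => (if w' = w ∘ i.s then rDiag h x y (w i.next) (w i.1) else 0) +
    (if w' = w then rOff h x y (w i.next) (w i.1) else 0)

theorem exch_mulVec (h x y : S) (i : Adj n) (f : Word n N → S) (w : Word n N) :
    (exch h x y i).mulVec f w = rDiag h x y (w i.next) (w i.1) * f (w ∘ i.s) +
      rOff h x y (w i.next) (w i.1) * f w := by
  simp [Matrix.mulVec, dotProduct, exch, add_mul, Finset.sum_add_distrib]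

theorem exch_map {S' : Type*} [CommRing S'] (F : S →+* S') (h x y : S) (i : Adj n) :
    (exch (N := N) h x y i).map F = exch (F h) (F x) (F y) i := by
  ext w w'
  simp only [exch, Matrix.map_apply, Matrix.of_apply, map_add, rDiag, rOff]
  congr 1 <;> split_ifs <;> simp

theorem sum_siteL_mulVec (h x y g : S) (i : Fin n) (j : Fin N) (F : Fin N → Word n N → S)
    (w : Word n N) :
    ∑ k, (siteL h x y g i j k).mulVec (F k) w =
      g * (rDiag h x y j (w i) * F j w + rOff h x y j (w i) * F (w i) (Function.update w i j)) := by
  have h1 : ∀ k, (siteL h x y g i j k).mulVec (F k) w =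
      g * ∑ r, Rnum N h x y (j, w i) (k, r) * F k (Function.update w i r) := by
    intro k
    rw [siteL_apply, map_smul, Matrix.smul_mulVec, Pi.smul_apply, smul_eq_mul, siteHom_apply,
      siteMat_mulVec]
    rfl
  simp only [h1]
  rw [← Finset.mul_sum]
  congr 1
  rw [← sum_Rnum_mul' h x y j (w i) fun k r => F k (Function.update w i r)]
  simp

/-- The word with the letters at two neighbouring sites replaced. -/
def put (i : Adj n) (w : Word n N) (b c : Fin N) : Word n N :=
  Function.update (Function.update w i.1 b) i.next c

theorem put_left (i : Adj n) (w : Word n N) (b c : Fin N) : put i w b c i.1 = b := by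
  simp [put, i.ne]

theorem put_right (i : Adj n) (w : Word n N) (b c : Fin N) : put i w b c i.next = c := by
  simp [put]

theorem put_update_left (i : Adj n) (w : Word n N) (b c d : Fin N) :
    Function.update (put i w b c) i.1 d = put i w d c := by
  rw [put, Function.update_comm i.ne.symm, Function.update_idem, put]

theorem put_update_right (i : Adj n) (w : Word n N) (b c d : Fin N) :
    Function.update (put i w b c) i.next d = put i w b d := by
  rw [put, Function.update_idem, put]

theorem put_self (i : Adj n) (w : Word n N) : put i w (w i.1) (w i.next) = w := by
  simp [put]

theorem put_comp_s (i : Adj n) (w : Word n N) (b c : Fin N) :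
    put i w b c ∘ i.s = put i w c b := by
  funext a
  rw [Function.comp_apply]
  by_cases h1 : a = i.1
  · rw [h1, i.s_left, put_right, put_left]
  · by_cases h2 : a = i.next
    · rw [h2, i.s_right, put_right, put_left]
    · rw [i.s_of_ne h1 h2]
      simp [put, h1, h2]

/-- The Yang–Baxter equation for the auxiliary factor and two neighbouring sites: `P 𝓡` carries the
product with exchanged variables into the original one. -/
theorem exch_siteL (h x₁ x₂ u₁ u₀ g₁ g₂ : S) (i : Adj n) (j k : Fin N) :
    exch h x₁ x₂ i * ∑ e, siteL h (x₁ * u₀) u₁ g₁ i.next j e * siteL h (x₂ * u₀) u₁ g₂ i.1 e k =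
      (∑ e, siteL h (x₂ * u₀) u₁ g₂ i.next j e * siteL h (x₁ * u₀) u₁ g₁ i.1 e k) *
        exch h x₁ x₂ i := by
  refine Matrix.ext_iff_mulVec.2 fun f => ?_
  have hB : ∀ (f : Word n N → S) (G : Fin N → Word n N → S),
      (∀ e', G e' = if e' = k then f else 0) →
      ∀ (x y g x' y' g' : S) (i₁ i₂ : Fin n) (j : Fin N) (w : Word n N),
      (∑ e, siteL h x y g i₁ j e * siteL h x' y' g' i₂ e k).mulVec f w =
        ∑ e, (siteL h x y g i₁ j e).mulVec (fun w' => ∑ e', (siteL h x' y' g' i₂ e e').mulVec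
          (G e') w') w := by
    intro f G hG x y g x' y' g' i₁ i₂ j w
    rw [Matrix.sum_mulVec, Finset.sum_apply]
    refine Finset.sum_congr rfl fun e _ => ?_
    rw [← Matrix.mulVec_mulVec]
    congr 2
    funext w'
    rw [Finset.sum_eq_single k]
    · rw [hG, if_pos rfl]
    · intro e' _ he'; rw [hG, if_neg he', Matrix.mulVec_zero]; rfl
    · simp
  -- `F` is `f` tensored with the `k`-th auxiliary basis vector, so that the column `k` of a matrix
  -- product becomes an operator applied to `F`, as in `yangBaxter_op`.
  set F : Fin N → Word n N → S := fun e' => if e' = k then f else 0 with hF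
  have hB₁ := hB f F (fun _ => rfl)
  have hB₂ := hB ((exch h x₁ x₂ i).mulVec f) (fun e' => (exch h x₁ x₂ i).mulVec (F e')) (by
    intro e'; rw [hF]; simp only; split_ifs <;> simp)
  have main : ∀ (w : Word n N) (b c : Fin N),
      ((exch h x₁ x₂ i * ∑ e, siteL h (x₁ * u₀) u₁ g₁ i.next j e *
        siteL h (x₂ * u₀) u₁ g₂ i.1 e k).mulVec f) (put i w b c) =
      (((∑ e, siteL h (x₂ * u₀) u₁ g₂ i.next j e * siteL h (x₁ * u₀) u₁ g₁ i.1 e k) *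
        exch h x₁ x₂ i).mulVec f) (put i w b c) := by
    intro w b c
    have key := congr_fun (congr_fun (congr_fun (yangBaxter_op h u₁ u₀ x₂ 1 x₁ 1
      (fun a b c => F a (put i w b c))) j) c) b
    simp only [mul_one, rOp12, rOp13, rOp23] at key
    rw [← Matrix.mulVec_mulVec, ← Matrix.mulVec_mulVec, exch_mulVec]
    simp only [hB₁, hB₂]
    simp only [sum_siteL_mulVec, exch_mulVec, put_left, put_right, put_update_left,
      put_update_right, put_comp_s]
    linear_combination (-(g₁ * g₂)) * key
  funext w
  have := main w (w i.1) (w i.next)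
  rwa [put_self] at this

end Exch
-- The intertwiner and the whole monodromy matrix.
section ExchCommute

variable {n N : ℕ} {S : Type*} [CommRing S]

theorem listL_append (h : S) (x : Fin n → S) (y : S) (g : Fin n → S) (l l' : List (Fin n)) :
    listL (N := N) h x y g (l ++ l') = listL h x y g l * listL h x y g l' := by
  simp [listL]

theorem exch_commute_siteHom (h x y : S) (i : Adj n) {a : Fin n} (h1 : a ≠ i.1) (h2 : a ≠ i.next)
    (m : Matrix (Fin N) (Fin N) S) : Commute (exch h x y i) (siteHom a m) := by
  refine Matrix.ext_iff_mulVec.2 fun f => ?_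
  funext w
  have hu : ∀ r, Function.update (w ∘ i.s) a r = Function.update w a r ∘ i.s := by
    intro r
    funext b
    by_cases hb : b = a
    · subst hb
      simp [i.s_of_ne h1 h2]
    · rw [Function.update_of_ne hb, Function.comp_apply, Function.comp_apply,
        Function.update_of_ne]
      intro h
      exact hb (by rw [← i.s_s b, h, i.s_of_ne h1 h2])
  rw [← Matrix.mulVec_mulVec, ← Matrix.mulVec_mulVec, exch_mulVec]
  simp only [siteHom_apply, siteMat_mulVec, exch_mulVec, Finset.mul_sum, hu,
    Function.comp_apply, i.s_of_ne h1 h2, Function.update_of_ne h1.symm,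
    Function.update_of_ne h2.symm]
  rw [← Finset.sum_add_distrib]
  refine Finset.sum_congr rfl fun r _ => ?_
  ring

theorem exch_commute_listL (h₀ x₀ y₀ : S) (i : Adj n) (h : S) (x : Fin n → S) (y : S)
    (g : Fin n → S) (l : List (Fin n)) (h1 : i.1 ∉ l) (h2 : i.next ∉ l) (j k : Fin N) :
    Commute (exch h₀ x₀ y₀ i) (listL h x y g l j k) := by
  induction l generalizing j with
  | nil =>
    rw [listL_nil, Matrix.one_apply]
    split_ifs
    · exact Commute.one_right _
    · exact Commute.zero_right _
  | cons a l ih =>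
    rw [listL_cons, Matrix.mul_apply]
    refine Commute.sum_right _ _ _ fun e _ => ?_
    rw [siteL_apply]
    exact (exch_commute_siteHom _ _ _ _ (List.ne_of_not_mem_cons h1).symm
      (List.ne_of_not_mem_cons h2).symm _).mul_right
      (ih (fun h' => h1 (List.mem_cons_of_mem _ h')) (fun h' => h2 (List.mem_cons_of_mem _ h')) _)

theorem listL_congr (h : S) (x x' : Fin n → S) (y : S) (g g' : Fin n → S) (l : List (Fin n))
    (hx : ∀ a ∈ l, x a = x' a) (hg : ∀ a ∈ l, g a = g' a) :
    listL (N := N) h x y g l = listL h x' y g' l := by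
  unfold listL
  rw [List.map_congr_left fun a ha => by rw [hx a ha, hg a ha]]

theorem exists_finRange_split (i : Adj n) : ∃ l₁ l₂ : List (Fin n),
    (List.finRange n).reverse = l₁ ++ ([i.next, i.1] ++ l₂) := by
  refine ⟨((List.finRange n).drop (i.1.val + 2)).reverse,
    ((List.finRange n).take i.1.val).reverse, ?_⟩
  conv_lhs => rw [← List.take_append_drop i.1.val (List.finRange n)]
  rw [List.drop_eq_getElem_cons (by simp), List.drop_eq_getElem_cons (by simp; exact i.2)]
  simp [Adj.next]

/-- The neighbouring sites stand side by side in the product. The intertwiner commutes with all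
other sites, where the permuted variables agree with the original ones. -/
theorem exch_mul_listL (h : S) (z : Fin n → S) (u₁ u₀ : S) (g : Fin n → S) (i : Adj n)
    (j k : Fin N) :
    exch h (z i.1) (z i.next) i *
      fullL h (fun a => z (i.s a) * u₀) u₁ (fun a => g (i.s a)) j k =
      fullL h (fun a => z a * u₀) u₁ g j k * exch h (z i.1) (z i.next) i := by
  obtain ⟨l₁, l₂, hl⟩ := exists_finRange_split i
  have hnd := List.nodup_reverse.2 (List.nodup_finRange n)
  rw [hl, List.nodup_append] at hnd
  obtain ⟨-, hnd2, hd1⟩ := hnd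
  rw [List.nodup_append] at hnd2
  obtain ⟨-, -, hd2⟩ := hnd2
  have hn1 : i.1 ∉ l₁ := fun h => hd1 _ h _ (by simp) rfl
  have hn2 : i.next ∉ l₁ := fun h => hd1 _ h _ (by simp) rfl
  have hn3 : i.1 ∉ l₂ := fun h => hd2 i.1 (by simp) _ h rfl
  have hn4 : i.next ∉ l₂ := fun h => hd2 i.next (by simp) _ h rfl
  have hz : ∀ l : List (Fin n), i.1 ∉ l → i.next ∉ l →
      listL (N := N) h (fun a => z (i.s a) * u₀) u₁ (fun a => g (i.s a)) l =
        listL h (fun a => z a * u₀) u₁ g l := by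
    intro l h1 h2
    have hs : ∀ a ∈ l, i.s a = a := fun a ha =>
      i.s_of_ne (fun h => h1 (h ▸ ha)) (fun h => h2 (h ▸ ha))
    exact listL_congr _ _ _ _ _ _ _ (fun a ha => by rw [hs a ha]) (fun a ha => by rw [hs a ha])
  have hmid : ∀ j k : Fin N, exch h (z i.1) (z i.next) i *
      listL h (fun a => z (i.s a) * u₀) u₁ (fun a => g (i.s a)) [i.next, i.1] j k =
      listL h (fun a => z a * u₀) u₁ g [i.next, i.1] j k * exch h (z i.1) (z i.next) i := by
    intro j k
    simp only [listL_cons, listL_nil, mul_one, Matrix.mul_apply, i.s_left, i.s_right]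
    exact exch_siteL h (z i.1) (z i.next) u₁ u₀ (g i.1) (g i.next) i j k
  unfold fullL
  rw [hl]
  simp only [listL_append, Matrix.mul_apply, Finset.mul_sum, Finset.sum_mul, hz l₁ hn1 hn2,
    hz l₂ hn3 hn4]
  refine Finset.sum_congr rfl fun e _ => Finset.sum_congr rfl fun f _ => ?_
  have c1 := (exch_commute_listL h (z i.1) (z i.next) i h (fun a => z a * u₀) u₁ g l₁ hn1 hn2
    j e).eq
  have c2 := (exch_commute_listL h (z i.1) (z i.next) i h (fun a => z a * u₀) u₁ g l₂ hn3 hn4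
    f k).eq
  rw [← mul_assoc, c1, mul_assoc, ← mul_assoc (exch _ _ _ _), hmid]
  simp only [mul_assoc]
  rw [c2]

end ExchCommute

/-! ### The representation commutes with the `S_n`-action. -/

section SymmetricAction

variable {n N : ℕ}

theorem U_induction {p : U N → Prop} (halg : ∀ c, p (algebraMap Ch (U N) c))
    (hL : ∀ ε i j s, p (L ε i j s)) (hLinv : ∀ i, p (Linv i))
    (hadd : ∀ x y, p x → p y → p (x + y)) (hmul : ∀ x y, p x → p y → p (x * y)) (X : U N) :
    p X := by
  obtain ⟨x, rfl⟩ := RingQuot.mkAlgHom_surjective Ch (Rel N) X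
  induction x using FreeAlgebra.induction with
  | grade0 c => rw [AlgHom.commutes]; exact halg c
  | grade1 g =>
    cases g with
    | L ε i j s => exact hL ε i j s
    | Linv i => exact hLinv i
  | mul a b ha hb => rw [map_mul]; exact hmul _ _ ha hb
  | add a b ha hb => rw [map_add]; exact hadd _ _ ha hb

theorem exch_mul_coefL (i : Adj n) (ε : Sgn) (j k : Fin N) (s : ℕ) :
    exch (hP n) (zP i.1) (zP i.next) i * (coefL (hP n) zP ziP ε j k s).map (permP i.s) =
      coefL (hP n) zP ziP ε j k s * exch (hP n) (zP i.1) (zP i.next) i := by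
  have h1 := coefL_map (N := N) (permP i.s : P n ≃ₐ[Ch] P n).toRingEquiv.toRingHom (hP n) zP ziP
    ε j k s
  have h2 : (coefL (hP n) zP ziP ε j k s).map (permP i.s) =
      coefL (hP n) (fun a => zP (i.s a)) (fun a => ziP (i.s a)) ε j k s := by
    have e1 : ∀ f, (permP i.s : P n ≃ₐ[Ch] P n).toRingEquiv.toRingHom f = permP i.s f :=
      fun _ => rfl
    simp only [e1, permP_zP, permP_ziP, permP_hP] at h1
    exact h1
  rw [h2]
  have key := exch_mul_listL (N := N) (PowerSeries.C (hP n)) (fun a => PowerSeries.C (zP a))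
    (uNum _ ε) (uDen _ ε) (fun a => invSer (zP a) (ziP a) ε) i j k
  rw [← exch_map] at key
  refine Matrix.ext fun w w' => ?_
  have key := congr_arg (PowerSeries.coeff s) (congr_fun (congr_fun key w) w')
  simp only [Matrix.mul_apply, Matrix.map_apply, map_sum, PowerSeries.coeff_C_mul,
    PowerSeries.coeff_mul_C] at key
  simpa only [Matrix.mul_apply, coefL, Matrix.map_apply, serL] using key

theorem map_permP_algebraMap (σ : Equiv.Perm (Fin n)) (c : Ch) :
    (algebraMap Ch (Matrix (Word n N) (Word n N) (P n)) c).map (permP σ) =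
      algebraMap Ch (Matrix (Word n N) (Word n N) (P n)) c := by
  rw [Algebra.algebraMap_eq_smul_one]
  refine Matrix.ext fun w w' => ?_
  simp only [Matrix.map_apply, Matrix.smul_apply, map_smul, Matrix.one_apply]
  split_ifs <;> simp

/-- The property is multiplicative in `X`, so generators suffice. For `Linv` the diagonal entries
depend only on the weight of the word, which an exchange of letters does not change. -/
theorem exch_mul_phoMat (i : Adj n) (X : U N) :
    exch (hP n) (zP i.1) (zP i.next) i * (phoMat n N X).map (permP i.s) =
      phoMat n N X * exch (hP n) (zP i.1) (zP i.next) i := by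
  induction X using U_induction with
  | halg c =>
    rw [AlgHom.commutes, map_permP_algebraMap]
    exact (Algebra.commutes _ _).symm
  | hL ε j k s => rw [phoMat_L, exch_mul_coefL]
  | hLinv j =>
    rw [phoMat_Linv, Matrix.diagonal_map (map_zero _)]
    have hd : ∀ w : Word n N, (∏ a, if (w ∘ i.s) a ≤ j then algebraMap Ch (P n) hh⁻¹ else 1) =
        ∏ a, if w a ≤ j then algebraMap Ch (P n) hh⁻¹ else 1 := fun w =>
      Equiv.prod_comp i.s fun a => if w a ≤ j then algebraMap Ch (P n) hh⁻¹ else 1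
    have hd' : ∀ w : Word n N, permP i.s (∏ a, if w a ≤ j then algebraMap Ch (P n) hh⁻¹ else 1) =
        ∏ a, if w a ≤ j then algebraMap Ch (P n) hh⁻¹ else 1 := by
      intro w
      rw [map_prod]
      refine Finset.prod_congr rfl fun a _ => ?_
      rw [apply_ite (permP i.s), AlgEquiv.commutes, map_one]
    refine Matrix.ext fun w w' => ?_
    rw [Matrix.mul_diagonal, Matrix.diagonal_mul, hd', exch, Matrix.of_apply, mul_comm]
    by_cases h1 : w' = w ∘ i.s
    · rw [h1, hd]
    · by_cases h2 : w' = w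
      · rw [h2]
      · simp [h1, h2]
  | hadd x y hx hy =>
    rw [map_add, Matrix.map_add _ (map_add _), mul_add, hx, hy, add_mul]
  | hmul x y hx hy =>
    rw [map_mul, Matrix.map_mul, ← mul_assoc, hx, mul_assoc, hy, mul_assoc]

theorem z_ne_zero (i : Fin n) : (z i : K n) ≠ 0 := by
  rw [← algebraMap_zP]
  intro h
  have h0 : zP i = 0 := (map_eq_zero_iff _ (IsFractionRing.injective (P n) (K n))).1 h
  have := zP_mul_ziP i
  rw [h0, zero_mul] at this
  exact zero_ne_one this

theorem sTilde_eq (i : Adj n) (v : V n N) :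
    sTilde i v = (z i.next - hK n * z i.1)⁻¹ •
      (exch (hK n) (z i.1) (z i.next) i).mulVec fun w => permK i.s (v w) := by
  funext w
  have hne := z_ne_zero i.next
  have hx : z i.1 / z i.next * z i.next = (z i.1 : K n) := div_mul_cancel₀ _ hne
  have hR : ∀ o q, (1 - hK n * (z i.1 / z i.next))⁻¹ * Rnum N (hK n) (z i.1 / z i.next) 1 o q =
      (z i.next - hK n * z i.1)⁻¹ * Rnum N (hK n) (z i.1) (z i.next) o q := by
    intro o q
    have : Rnum N (hK n) (z i.1) (z i.next) o q =
        z i.next * Rnum N (hK n) (z i.1 / z i.next) 1 o q := by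
      rw [← Rnum_mul, mul_one, mul_comm, hx]
    rw [this, show z i.next - hK n * z i.1 = z i.next * (1 - hK n * (z i.1 / z i.next)) by
      rw [mul_sub, mul_one, mul_left_comm, mul_comm (z i.next), hx], mul_inv]
    field_simp
  have hent : ∀ w w' : Word n N,
      actSites i.1 i.next (Rmat N (hK n) (z i.1 / z i.next)) w w' =
        (z i.next - hK n * z i.1)⁻¹ *
          ((if w' = w then rDiag (hK n) (z i.1) (z i.next) (w i.1) (w i.next) else 0) +
          (if w' = w ∘ i.s then rOff (hK n) (z i.1) (z i.next) (w i.1) (w i.next) else 0)) := by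
    intro w w'
    have e1 : (w' = w) ↔ ((∀ k, k ≠ i.1 → k ≠ i.next → w k = w' k) ∧
        (w' i.1 = w i.1 ∧ w' i.next = w i.next)) := by
      constructor
      · rintro rfl; simp
      · rintro ⟨h1, h2, h3⟩
        funext k
        by_cases hk1 : k = i.1
        · rw [hk1, h2]
        · by_cases hk2 : k = i.next
          · rw [hk2, h3]
          · exact (h1 k hk1 hk2).symm
    have e2 : (w' = w ∘ i.s) ↔ ((∀ k, k ≠ i.1 → k ≠ i.next → w k = w' k) ∧
        (w' i.1 = w i.next ∧ w' i.next = w i.1)) := by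
      constructor
      · rintro rfl
        refine ⟨fun k h1 h2 => ?_, ?_, ?_⟩
        · rw [Function.comp_apply, i.s_of_ne h1 h2]
        · rw [Function.comp_apply, i.s_left]
        · rw [Function.comp_apply, i.s_right]
      · rintro ⟨h1, h2, h3⟩
        funext k
        rw [Function.comp_apply]
        by_cases hk1 : k = i.1
        · rw [hk1, h2, i.s_left]
        · by_cases hk2 : k = i.next
          · rw [hk2, h3, i.s_right]
          · rw [i.s_of_ne hk1 hk2]; exact (h1 k hk1 hk2).symm
    simp only [actSites, Matrix.of_apply, Rmat, Matrix.smul_apply, smul_eq_mul, hR, e1, e2]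
    by_cases hag : ∀ k, k ≠ i.1 → k ≠ i.next → w k = w' k
    · rw [if_pos hag, Rnum_apply]
      simp only [eq_true hag, true_and]
    · rw [if_neg hag]
      simp only [eq_false hag, false_and, if_false, mul_zero, add_zero]
  unfold sTilde
  rw [Matrix.mulVec, dotProduct]
  simp only [hent]
  rw [Pi.smul_apply, smul_eq_mul, exch_mulVec]
  simp only [mul_add, add_mul, mul_ite, ite_mul, mul_zero, zero_mul, Finset.sum_add_distrib,
    Finset.sum_ite_eq', Finset.mem_univ, if_true, Adj.comp_s_s, Function.comp_apply, i.s_left,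
    i.s_right, mul_assoc]

theorem pho_sTilde (X : U N) (i : Adj n) (v : V n N) :
    pho n N X (sTilde i v) = sTilde i (pho n N X v) := by
  rw [sTilde_eq, sTilde_eq, map_smul, pho_apply]
  congr 1
  have key := congr_arg (fun M => M.map (algebraMap (P n) (K n))) (exch_mul_phoMat i X)
  simp only [Matrix.map_mul] at key
  have he : (exch (N := N) (hP n) (zP i.1) (zP i.next) i).map (algebraMap (P n) (K n)) =
      exch (hK n) (z i.1) (z i.next) i := by
    rw [exch_map, algebraMap_hP]; rfl
  rw [he] at key
  rw [Matrix.mulVec_mulVec, ← key, ← Matrix.mulVec_mulVec]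
  congr 1
  funext w
  rw [pho_apply]
  simp only [Matrix.mulVec, dotProduct, Matrix.map_apply, map_sum, map_mul, permK_algebraMap]

end SymmetricAction
-- Words, inversions and the Bruhat order.
section Words

variable {n N : ℕ}

theorem wt_eq_iff {w w' : Word n N} : wt w = wt w' ↔ ∃ σ : Equiv.Perm (Fin n), w = w' ∘ σ := by
  constructor
  · intro h
    have hc : ∀ c, Fintype.card {a // w a = c} = Fintype.card {b // w' b = c} := by
      intro c
      have := congr_fun (congr_arg Subtype.val h) c
      simpa [wt, Fintype.card_subtype] using this
    exact ⟨Equiv.ofFiberEquiv fun c => Fintype.equivOfCardEq (hc c),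
      funext fun a => (Equiv.ofFiberEquiv_map _ a).symm⟩
  · rintro ⟨σ, rfl⟩
    refine Subtype.ext (funext fun k => ?_)
    show (Finset.univ.filter fun i => w' (σ i) = k).card = (Finset.univ.filter fun i => w' i = k).card
    refine Finset.card_bij (fun a _ => σ a)
      (fun a ha => Finset.mem_filter.2 ⟨Finset.mem_univ _, (Finset.mem_filter.1 ha).2⟩)
      (fun a _ b _ h => σ.injective h) fun b hb => ⟨σ.symm b, Finset.mem_filter.2
        ⟨Finset.mem_univ _, ?_⟩, by simp⟩
    rw [Equiv.apply_symm_apply]; exact (Finset.mem_filter.1 hb).2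

theorem wt_comp (w : Word n N) (σ : Equiv.Perm (Fin n)) : wt (w ∘ σ) = wt w :=
  wt_eq_iff.2 ⟨σ, rfl⟩

theorem wt_imin (l : Comp n N) : wt (imin l) = l := by
  refine Subtype.ext (funext fun k => ?_)
  show (Finset.univ.filter fun i => imin l i = k).card = l.1 k
  rw [← Fintype.card_fin (l.1 k), ← Finset.card_univ (α := Fin (l.1 k))]
  refine (Finset.card_bij (fun b _ => Fin.cast l.2 (finSigmaFinEquiv ⟨k, b⟩)) ?_ ?_ ?_).symm
  · intro b _
    refine Finset.mem_filter.2 ⟨Finset.mem_univ _, ?_⟩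
    simp [imin]
  · intro a _ b _ h
    have := finSigmaFinEquiv.injective (Fin.cast_injective _ h)
    simpa using this
  · intro b hb
    replace hb := (Finset.mem_filter.1 hb).2
    unfold imin at hb
    subst hb
    refine ⟨(finSigmaFinEquiv.symm (Fin.cast l.2.symm b)).2, Finset.mem_univ _, ?_⟩
    simp

theorem monotone_imin (l : Comp n N) : Monotone (imin l) := by
  intro a b hab
  by_contra hlt
  rw [not_le] at hlt
  unfold imin at hlt
  set p := finSigmaFinEquiv.symm (Fin.cast l.2.symm a) with hp
  set q := finSigmaFinEquiv.symm (Fin.cast l.2.symm b) with hq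
  have ha : (a : ℕ) = (finSigmaFinEquiv p : ℕ) := by rw [hp]; simp
  have hb : (b : ℕ) = (finSigmaFinEquiv q : ℕ) := by rw [hq]; simp
  rw [finSigmaFinEquiv_apply] at ha hb
  have h1 : (a : ℕ) ≤ b := hab
  have h2 : ∑ i : Fin q.1.val, l.1 (Fin.castLE q.1.2.le i) + q.2 <
      ∑ i : Fin (q.1.val + 1), l.1 (Fin.castLE q.1.2 i) := by
    rw [Fin.sum_univ_castSucc]
    have := q.2.2
    exact Nat.add_lt_add_left this _
  have h3 : ∑ i : Fin (q.1.val + 1), l.1 (Fin.castLE q.1.2 i) ≤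
      ∑ i : Fin p.1.val, l.1 (Fin.castLE p.1.2.le i) := by
    obtain ⟨k, hk⟩ : ∃ k, p.1.val = q.1.val + 1 + k :=
      ⟨p.1.val - (q.1.val + 1), by have : q.1.val < p.1.val := hlt; omega⟩
    have h4 : ∀ m m' (hm : m ≤ N) (hm' : m' ≤ N), m ≤ m' →
        ∑ i : Fin m, l.1 (Fin.castLE hm i) ≤ ∑ i : Fin m', l.1 (Fin.castLE hm' i) := by
      intro m m' hm hm' hmm
      rw [← Finset.sum_image (f := l.1) (s := Finset.univ) (g := Fin.castLE hm)
        (fun _ _ _ _ h => Fin.castLE_injective _ h),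
        ← Finset.sum_image (f := l.1) (s := Finset.univ) (g := Fin.castLE hm')
        (fun _ _ _ _ h => Fin.castLE_injective _ h)]
      refine Finset.sum_le_sum_of_subset fun x hx => ?_
      obtain ⟨i, -, rfl⟩ := Finset.mem_image.1 hx
      exact Finset.mem_image.2 ⟨Fin.castLE hmm i, Finset.mem_univ _, rfl⟩
    exact h4 _ _ _ _ (by omega)
  omega

theorem eq_of_monotone {w w' : Word n N} (hw : Monotone w) (hw' : Monotone w')
    (h : wt w = wt w') : w = w' := by
  obtain ⟨σ, rfl⟩ := wt_eq_iff.1 h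
  exact Tuple.unique_monotone (f := w') (τ := 1) hw hw'

theorem comp_sort_eq (w : Word n N) : w ∘ Tuple.sort w = imin (wt w) :=
  eq_of_monotone (Tuple.monotone_sort w) (monotone_imin _) (by rw [wt_comp, wt_imin])

theorem exists_adj_of_not_monotone {X : Type*} [LinearOrder X] {w : Fin n → X}
    (h : ¬ Monotone w) : ∃ i : Adj n, w i.next < w i.1 := by
  by_contra! hc
  apply h
  rcases n with _ | n
  · intro a; exact a.elim0
  refine Fin.monotone_iff_le_succ.2 fun i => ?_
  exact hc ⟨i.castSucc, by simp⟩

/-- The set of inversions of a word. -/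
def invSet {X : Type*} [LinearOrder X] (w : Fin n → X) : Finset (Fin n × Fin n) :=
  Finset.univ.filter fun p => p.1 < p.2 ∧ w p.2 < w p.1

theorem Adj.s_lt_s (i : Adj n) {a b : Fin n} (h : ¬ (a = i.1 ∧ b = i.next)) (hab : a < b) :
    i.s a < i.s b := by
  have hn : i.next.val = i.1.val + 1 := rfl
  have hv : ∀ c : Fin n, (i.s c).val = if c.val = i.1.val then i.1.val + 1 else
      if c.val = i.1.val + 1 then i.1.val else c.val := by
    intro c
    split_ifs with h1 h2
    · rw [Fin.ext h1, i.s_left]; rfl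
    · rw [show c = i.next from Fin.ext h2, i.s_right]
    · rw [i.s_of_ne (fun h => h1 (congr_arg Fin.val h)) (fun h => h2 (congr_arg Fin.val h))]
  have hab' : a.val < b.val := hab
  have h' : ¬ (a.val = i.1.val ∧ b.val = i.1.val + 1) :=
    fun hh => h ⟨Fin.ext hh.1, Fin.ext hh.2⟩
  show (i.s a).val < (i.s b).val
  rw [hv, hv]
  split_ifs <;> omega

/-- The action of a transposition on pairs of positions. -/
def Adj.pairMap (i : Adj n) : Fin n × Fin n ↪ Fin n × Fin n :=
  ⟨fun p => (i.s p.1, i.s p.2), fun p q h => by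
    simp only [Prod.mk.injEq, EmbeddingLike.apply_eq_iff_eq] at h
    exact Prod.ext h.1 h.2⟩

/-- An adjacent transposition reverses the order of a single pair of positions. Knowing the
inversions as a set, and not only their number, yields the recursion for `leadCoeff`. -/
theorem invSet_comp_s {X : Type*} [LinearOrder X] (w : Fin n → X) (i : Adj n)
    (h : w i.1 < w i.next) :
    (i.1, i.next) ∉ (invSet w).map i.pairMap ∧
      invSet (w ∘ i.s) = insert (i.1, i.next) ((invSet w).map i.pairMap) := by
  have hne : ∀ a b : Fin n, a < b → w b < w a → ¬ (a = i.1 ∧ b = i.next) := by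
    rintro a b - hlt ⟨rfl, rfl⟩
    exact lt_asymm h hlt
  constructor
  · simp only [Finset.mem_map, invSet, Finset.mem_filter, Finset.mem_univ, true_and, Adj.pairMap,
      Prod.exists, not_exists, not_and]
    intro a b hab h12
    obtain ⟨h1, h2⟩ := Prod.mk.inj h12
    have ha : a = i.next := by rw [← i.s_left, ← h1, i.s_s]
    have hb : b = i.1 := by rw [← i.s_right, ← h2, i.s_s]
    rw [ha, hb] at hab
    exact lt_asymm i.lt hab.1
  · ext ⟨a, b⟩
    simp only [Finset.mem_insert, Finset.mem_map, invSet, Finset.mem_filter, Finset.mem_univ,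
      true_and, Adj.pairMap, Prod.mk.injEq, Prod.exists,
      Function.comp_apply]
    constructor
    · rintro ⟨h1, h2⟩
      by_cases hc : a = i.1 ∧ b = i.next
      · exact Or.inl hc
      · exact Or.inr ⟨i.s a, i.s b, ⟨i.s_lt_s hc h1, h2⟩,
          Prod.ext (i.s_s a) (i.s_s b)⟩
    · rintro (⟨rfl, rfl⟩ | ⟨a', b', ⟨h1, h2⟩, h⟩)
      · exact ⟨i.lt, by rw [i.s_left, i.s_right]; exact h⟩
      · obtain ⟨rfl, rfl⟩ := Prod.mk.inj h
        exact ⟨i.s_lt_s (hne _ _ h1 h2) h1, by rwa [i.s_s, i.s_s]⟩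

theorem card_invSet_comp_s {X : Type*} [LinearOrder X] (w : Fin n → X) (i : Adj n)
    (h : w i.1 < w i.next) : (invSet (w ∘ i.s)).card = (invSet w).card + 1 := by
  obtain ⟨h1, h2⟩ := invSet_comp_s w i h
  rw [h2, Finset.card_insert_of_notMem h1, Finset.card_map]

theorem Adj.comp_s_of_eq {X : Type*} (i : Adj n) {w : Fin n → X} (h : w i.1 = w i.next) :
    w ∘ i.s = w := by
  funext a
  by_cases h1 : a = i.1
  · rw [h1, Function.comp_apply, i.s_left, h]
  · by_cases h2 : a = i.next
    · rw [h2, Function.comp_apply, i.s_right, h]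
    · rw [Function.comp_apply, i.s_of_ne h1 h2]

/-- Every word is obtained from the weakly increasing one by ascending transpositions. -/
theorem word_induction {p : Word n N → Prop} (h0 : ∀ l, p (imin l))
    (hs : ∀ (i : Adj n) (w : Word n N), w i.1 < w i.next → p w → p (w ∘ i.s)) (w : Word n N) :
    p w := by
  by_cases hm : Monotone w
  · rw [eq_of_monotone hm (monotone_imin (wt w)) (wt_imin _).symm]
    exact h0 _
  · obtain ⟨i, hi⟩ := exists_adj_of_not_monotone hm
    have hlt : (w ∘ i.s) i.1 < (w ∘ i.s) i.next := by
      simpa [i.s_left, i.s_right] using hi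
    have hcard := card_invSet_comp_s (w ∘ i.s) i hlt
    rw [i.comp_s_s] at hcard
    have hcard' : (invSet (w ∘ i.s)).card < (invSet w).card := by omega
    have := hs i (w ∘ i.s) hlt (word_induction h0 hs (w ∘ i.s))
    rwa [i.comp_s_s] at this
termination_by (invSet w).card
decreasing_by exact hcard'

/-- The number of letters at most `k` among the first `m` letters of a word. -/
def prefixCount (w : Word n N) (m : ℕ) (k : Fin N) : ℕ :=
  (Finset.univ.filter fun a : Fin n => a.val < m ∧ w a ≤ k).card

theorem prefixCount_succ (w : Word n N) (m : Fin n) (k : Fin N) :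
    prefixCount w (m.val + 1) k = prefixCount w m.val k + if w m ≤ k then 1 else 0 := by
  unfold prefixCount
  split_ifs with h
  · rw [← Finset.card_insert_of_notMem (a := m) (by simp)]
    congr 1
    ext a
    simp only [Finset.mem_filter, Finset.mem_univ, true_and, Finset.mem_insert]
    constructor
    · rintro ⟨h1, h2⟩
      rcases Nat.lt_succ_iff_lt_or_eq.1 h1 with h3 | h3
      · exact Or.inr ⟨h3, h2⟩
      · exact Or.inl (Fin.ext h3)
    · rintro (rfl | ⟨h1, h2⟩)
      · exact ⟨Nat.lt_succ_self _, h⟩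
      · exact ⟨Nat.lt_succ_of_lt h1, h2⟩
  · rw [add_zero]
    congr 1
    ext a
    simp only [Finset.mem_filter, Finset.mem_univ, true_and]
    constructor
    · rintro ⟨h1, h2⟩
      rcases Nat.lt_succ_iff_lt_or_eq.1 h1 with h3 | h3
      · exact ⟨h3, h2⟩
      · rw [Fin.ext h3] at h2; exact absurd h2 h
    · rintro ⟨h1, h2⟩
      exact ⟨Nat.lt_succ_of_lt h1, h2⟩

theorem prefixCount_comp_s (w : Word n N) (i : Adj n) {m : ℕ} (hm : m ≠ i.1.val + 1) (k : Fin N) :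
    prefixCount (w ∘ i.s) m k = prefixCount w m k := by
  have hlt : ∀ a : Fin n, a.val < m → (i.s a).val < m := by
    intro a ha
    by_cases h1 : a = i.1
    · rw [h1, i.s_left]
      have : a.val = i.1.val := congr_arg _ h1
      show i.1.val + 1 < m
      omega
    · by_cases h2 : a = i.next
      · rw [h2, i.s_right]
        have : a.val = i.1.val + 1 := congr_arg Fin.val h2
        omega
      · rwa [i.s_of_ne h1 h2]
  refine Finset.card_bij (fun a _ => i.s a) (fun a => ?_) (fun a _ b _ h => i.s.injective h)
      fun b hb => ⟨i.s b, ?_, i.s_s b⟩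
  · simp only [Finset.mem_filter, Finset.mem_univ, true_and, Function.comp_apply]
    exact fun h => ⟨hlt a h.1, h.2⟩
  · simp only [Finset.mem_filter, Finset.mem_univ, true_and, Function.comp_apply, i.s_s] at hb ⊢
    exact ⟨hlt b hb.1, hb.2⟩

/-- The Bruhat order on words, by comparison of prefixes. -/
def Below (u w : Word n N) : Prop := ∀ m k, prefixCount w m k ≤ prefixCount u m k

theorem Below.antisymm {u w : Word n N} (h : Below u w) (h' : Below w u) : u = w := by
  have he : ∀ m k, prefixCount w m k = prefixCount u m k := fun m k => le_antisymm (h m k) (h' m k)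
  have hk : ∀ (a : Fin n) k, u a ≤ k ↔ w a ≤ k := by
    intro a k
    have h1 := prefixCount_succ w a k
    rw [he, he, prefixCount_succ] at h1
    by_cases h2 : u a ≤ k <;> by_cases h3 : w a ≤ k <;> simp [h2, h3] at h1 ⊢
  funext a
  exact le_antisymm ((hk a (w a)).2 le_rfl) ((hk a (u a)).1 le_rfl)

theorem Below.refl (w : Word n N) : Below w w := fun _ _ => le_rfl

theorem Below.trans {u v w : Word n N} (h : Below u v) (h' : Below v w) : Below u w :=
  fun m k => (h' m k).trans (h m k)

/-- Exchanging neighbours changes only the prefix that ends between them. Its count for `w ∘ i.s` is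
bounded through one of the two neighbouring prefixes, on which `u` and `u ∘ i.s` agree. -/
theorem Below.comp_s_or {u w : Word n N} (i : Adj n) (hi : w i.1 < w i.next)
    (h : Below u w ∨ Below (u ∘ i.s) w) : Below u (w ∘ i.s) := by
  intro m k
  have hi1 := prefixCount_succ w i.1 k
  have hi2 := prefixCount_succ w i.next k
  have hj1 := prefixCount_succ (w ∘ i.s) i.1 k
  have hu1 := prefixCount_succ u i.1 k
  have hu2 := prefixCount_succ u i.next k
  have hn : i.next.val = i.1.val + 1 := rfl
  simp only [hn] at hi2 hu2
  rw [prefixCount_comp_s w i (m := i.1.val) (by omega), Function.comp_apply, i.s_left] at hj1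
  by_cases hm : m = i.1.val + 1
  · subst hm
    have key : prefixCount w i.1.val k ≤ prefixCount u i.1.val k ∧
        prefixCount w (i.1.val + 1 + 1) k ≤ prefixCount u (i.1.val + 1 + 1) k := by
      rcases h with h | h
      · exact ⟨h _ _, h _ _⟩
      · have h1 := h i.1.val k
        have h2 := h (i.1.val + 1 + 1) k
        rw [prefixCount_comp_s u i (by omega)] at h1
        rw [prefixCount_comp_s u i (by omega)] at h2
        exact ⟨h1, h2⟩
    have hle : w i.next ≤ k → w i.1 ≤ k := fun h => hi.le.trans h
    have hu3 : (if u i.next ≤ k then 1 else 0) ≤ 1 := by split_ifs <;> simp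
    by_cases h5 : w i.next ≤ k
    · have h6 := hle h5
      rw [if_pos h5] at hi2 hj1
      rw [if_pos h6] at hi1
      omega
    · rw [if_neg h5] at hi2 hj1
      omega
  · rw [prefixCount_comp_s w i hm]
    rcases h with h | h
    · exact h m k
    · have := h m k
      rwa [prefixCount_comp_s u i hm] at this

theorem not_below_of_lt {w : Word n N} (i : Adj n) (hi : w i.1 < w i.next) :
    ¬ Below (w ∘ i.s) w := by
  intro h
  have := h.antisymm (Below.comp_s_or i hi (Or.inl (Below.refl w)))
  have h2 := congr_fun this i.1
  rw [Function.comp_apply, i.s_left] at h2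
  exact hi.ne' h2

end Words
-- The operators `s̃_i` in coordinates.
section TildeAction

variable {n N : ℕ}

theorem zP_sub_smul_ne_zero {a b : Fin n} (h : a ≠ b) (c : Ch) :
    zP a - algebraMap Ch (P n) c * zP b ≠ 0 := by
  intro h0
  have h1 : zP a - algebraMap Ch (P n) c * zP b =
      AddMonoidAlgebra.single (Finsupp.single a 1) 1 -
        AddMonoidAlgebra.single (Finsupp.single b 1) c := by
    rw [zP, zP, ← Algebra.smul_def, AddMonoidAlgebra.smul_single, smul_eq_mul, mul_one]
  rw [h1, sub_eq_zero] at h0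
  have hne : Finsupp.single a (1 : ℤ) ≠ Finsupp.single b 1 := fun h2 =>
    h ((Finsupp.single_left_inj one_ne_zero).1 h2)
  have h2 := congr_arg (fun f : P n => f.coeff (Finsupp.single a 1)) h0
  simp [AddMonoidAlgebra.coeff_single, hne.symm] at h2

theorem z_sub_ne_zero {a b : Fin n} (h : a ≠ b) (c : Ch) :
    (z a : K n) - algebraMap Ch (K n) c * z b ≠ 0 := by
  intro h0
  apply zP_sub_smul_ne_zero h c
  apply IsFractionRing.injective (P n) (K n)
  rw [map_zero, ← h0, map_sub, map_mul, algebraMap_zP, algebraMap_zP,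
    ← IsScalarTower.algebraMap_apply]

theorem z_sub_hz_ne_zero {a b : Fin n} (h : a ≠ b) : (z a : K n) - hK n * z b ≠ 0 :=
  z_sub_ne_zero h hh

theorem z_sub_z_ne_zero {a b : Fin n} (h : a ≠ b) : (z a : K n) - z b ≠ 0 := by
  have := z_sub_ne_zero h 1
  rwa [map_one, one_mul] at this

theorem sTilde_apply (i : Adj n) (v : V n N) (w : Word n N) :
    sTilde i v w = (z i.next - hK n * z i.1)⁻¹ *
      (rDiag (hK n) (z i.1) (z i.next) (w i.next) (w i.1) * permK i.s (v (w ∘ i.s)) +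
        rOff (hK n) (z i.1) (z i.next) (w i.next) (w i.1) * permK i.s (v w)) := by
  rw [sTilde_eq, Pi.smul_apply, smul_eq_mul, exch_mulVec]

theorem sTilde_apply_eq (i : Adj n) (v : V n N) {w : Word n N} (h : w i.1 = w i.next) :
    sTilde i v w = permK i.s (v w) := by
  rw [sTilde_apply, i.comp_s_of_eq h, rDiag, if_pos h.symm, rOff, if_pos h.symm, zero_mul,
    add_zero, inv_mul_cancel_left₀ (z_sub_hz_ne_zero i.ne.symm)]

theorem sTilde_apply_gt (i : Adj n) (v : V n N) {w : Word n N} (h : w i.next < w i.1) :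
    sTilde i v w = (z i.next - hK n * z i.1)⁻¹ *
      ((z i.next - z i.1) * permK i.s (v (w ∘ i.s)) +
        (1 - hK n) * z i.next * permK i.s (v w)) := by
  rw [sTilde_apply, rDiag, rOff, if_neg h.ne, if_pos h, if_neg h.ne, if_neg h.not_gt]

theorem sTilde_apply_lt (i : Adj n) (v : V n N) {w : Word n N} (h : w i.1 < w i.next) :
    sTilde i v w = (z i.next - hK n * z i.1)⁻¹ *
      (hK n * (z i.next - z i.1) * permK i.s (v (w ∘ i.s)) +
        (1 - hK n) * z i.1 * permK i.s (v w)) := by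
  rw [sTilde_apply, rDiag, rOff, if_neg h.ne', if_neg h.not_gt, if_neg h.ne', if_pos h]

theorem sTilde_add (i : Adj n) (v v' : V n N) : sTilde i (v + v') = sTilde i v + sTilde i v' := by
  funext w
  simp only [sTilde_apply, Pi.add_apply, map_add]
  ring

theorem sTilde_smul (i : Adj n) (c : K n) (v : V n N) :
    sTilde i (c • v) = permK i.s c • sTilde i v := by
  funext w
  simp only [sTilde_apply, Pi.smul_apply, smul_eq_mul, map_mul]
  ring

/-- `s̃_i` as an additive map. -/
def sTildeHom (i : Adj n) : V n N →+ V n N :=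
  AddMonoidHom.mk' (sTilde i) (sTilde_add i)

theorem sTilde_sum {ι : Type*} (i : Adj n) (s : Finset ι) (f : ι → V n N) :
    sTilde i (∑ j ∈ s, f j) = ∑ j ∈ s, sTilde i (f j) :=
  map_sum (sTildeHom i) f s

/-- Unitarity of the `R`-matrix, checked on the pair of coordinates `w`, `w ∘ i.s`. -/
theorem sTilde_sTilde (i : Adj n) (v : V n N) : sTilde i (sTilde i v) = v := by
  funext w
  have h1 : (z i.next : K n) - hK n * z i.1 ≠ 0 := z_sub_hz_ne_zero i.ne.symm
  have h2 : (z i.1 : K n) - hK n * z i.next ≠ 0 := z_sub_hz_ne_zero i.ne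
  have e1 : (w ∘ i.s) i.1 = w i.next := by rw [Function.comp_apply, i.s_left]
  have e2 : (w ∘ i.s) i.next = w i.1 := by rw [Function.comp_apply, i.s_right]
  rcases lt_trichotomy (w i.1) (w i.next) with h | h | h
  · rw [sTilde_apply_lt i _ h, sTilde_apply_lt i _ h, sTilde_apply_gt i v (by rw [e1, e2]; exact h),
      i.comp_s_s]
    simp only [map_mul, map_add, map_sub, map_inv₀, permK_s_s, permK_z, permK_hK, i.s_left,
      i.s_right, map_one]
    have h1' := inv_mul_cancel₀ h1
    have h2' := inv_mul_cancel₀ h2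
    generalize (z i.next - hK n * z i.1)⁻¹ = t₁ at *
    generalize (z i.1 - hK n * z i.next)⁻¹ = t₂ at *
    linear_combination (v w * (t₁ * (z i.next - hK n * z i.1))) * h2' + v w * h1'
  · rw [sTilde_apply_eq i _ h, sTilde_apply_eq i _ h, permK_s_s]
  · rw [sTilde_apply_gt i _ h, sTilde_apply_gt i _ h, sTilde_apply_lt i v (by rw [e1, e2]; exact h),
      i.comp_s_s]
    simp only [map_mul, map_add, map_sub, map_inv₀, permK_s_s, permK_z, permK_hK, i.s_left,
      i.s_right, map_one]
    have h1' := inv_mul_cancel₀ h1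
    have h2' := inv_mul_cancel₀ h2
    generalize (z i.next - hK n * z i.1)⁻¹ = t₁ at *
    generalize (z i.1 - hK n * z i.next)⁻¹ = t₂ at *
    linear_combination (v w * (t₁ * (z i.next - hK n * z i.1))) * h2' + v w * h1'

theorem ne_zero_of_sTilde {i : Adj n} {v : V n N} {w : Word n N} (h : sTilde i v w ≠ 0) :
    v w ≠ 0 ∨ v (w ∘ i.s) ≠ 0 := by
  by_contra! hc
  apply h
  rw [sTilde_apply, hc.1, hc.2]
  simp

end TildeAction

/-! ### Newton's identities for the eigenvalue series. -/

section LogDerivative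

variable {n N : ℕ}

/-- `z_i` for the sign `-` and `z_i⁻¹` for the sign `+`. -/
def signedVar (ε : Sgn) (i : Fin n) : P n :=
  match ε with
  | .plus => ziP i
  | .minus => zP i

/-- `h` for the sign `-` and `h⁻¹` for the sign `+`. -/
def signedH (ε : Sgn) : Ch :=
  match ε with
  | .plus => hh⁻¹
  | .minus => hh

theorem signedH_pow_ne_one (ε : Sgn) {k : ℕ} (hk : k ≠ 0) : signedH ε ^ k ≠ 1 := by
  cases ε
  · show hh⁻¹ ^ k ≠ 1
    rw [inv_pow, ne_eq, inv_eq_one]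
    exact hh_pow_ne_one hk
  · exact hh_pow_ne_one hk

theorem eigSer_eq (ε : Sgn) (i : Fin n) : eigSer ε i =
    (1 - PowerSeries.C (algebraMap Ch (P n) (signedH ε) * signedVar ε i) * PowerSeries.X) *
      PowerSeries.mk fun s => signedVar ε i ^ s := by
  cases ε <;> rfl

/-- The eigenvalue `∑_{w_a < p} (1 - h^{±s}) z_a^{±s}` of a logarithmic derivative. -/
def powEig (ε : Sgn) (p s : ℕ) (w : Word n N) : P n :=
  ∑ a, if (w a).val < p then
    algebraMap Ch (P n) (1 - signedH ε ^ s) * signedVar ε a ^ s else 0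

open PowerSeries in
theorem geom_mul_sub {R : Type*} [CommRing R] (y : R) :
    (PowerSeries.mk fun s => y ^ s) * (1 - C y * X) = 1 := by
  ext m
  rw [mul_sub, mul_one, map_sub, mul_left_comm, coeff_C_mul, coeff_mk]
  cases m with
  | zero => simp
  | succ m => rw [coeff_succ_mul_X, coeff_mk, coeff_one, if_neg (Nat.succ_ne_zero m)]; ring

-- The logarithmic derivative of `(1 - c y X)/(1 - y X)` is `y/(1 - y X) - c y/(1 - c y X)`, whose
-- coefficients are multiples of pure powers of `y`.
open PowerSeries in
theorem derivative_geom {R : Type*} [CommRing R] (c y : R) :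
    d⁄dX R ((1 - C (c * y) * X) * PowerSeries.mk fun s => y ^ s) =
      ((1 - C (c * y) * X) * PowerSeries.mk fun s => y ^ s) *
        PowerSeries.mk fun s => (1 - c ^ (s + 1)) * y ^ (s + 1) := by
  have hA := geom_mul_sub y
  have hB := geom_mul_sub (c * y)
  set A := PowerSeries.mk fun s => y ^ s with hAd
  set B := PowerSeries.mk fun s => (c * y) ^ s with hBd
  have hmk : (PowerSeries.mk fun s => (1 - c ^ (s + 1)) * y ^ (s + 1)) = C y * A - C (c * y) * B := by
    ext m
    rw [map_sub, coeff_C_mul, coeff_C_mul, coeff_mk, hAd, hBd, coeff_mk, coeff_mk]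
    ring
  have hdA : d⁄dX R A = C y * A * A := by
    have h1 := congr_arg (d⁄dX R) hA
    rw [Derivation.leibniz, map_sub, derivative_one, Derivation.leibniz, derivative_C,
      derivative_X] at h1
    simp only [smul_eq_mul, mul_zero, add_zero, mul_one, zero_sub] at h1
    have h2 : (1 - C y * X) * d⁄dX R A = A * C y := by linear_combination h1
    calc d⁄dX R A = (A * (1 - C y * X)) * d⁄dX R A := by rw [hA, one_mul]
      _ = _ := by rw [mul_assoc, h2]; ring
  rw [Derivation.leibniz, map_sub, derivative_one, Derivation.leibniz, derivative_C,
    derivative_X, hdA, hmk]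
  simp only [smul_eq_mul, mul_zero, add_zero, mul_one, zero_sub]
  linear_combination (C (c * y) * A) * hB

theorem Derivation.prod_log {R A ι : Type*} [CommSemiring R] [CommSemiring A] [Algebra R A]
    (D : Derivation R A A) (f g : ι → A) (s : Finset ι) (h : ∀ i ∈ s, D (f i) = f i * g i) :
    D (∏ i ∈ s, f i) = (∏ i ∈ s, f i) * ∑ i ∈ s, g i := by
  classical
  induction s using Finset.induction_on with
  | empty => simp
  | insert a s ha ih =>
    rw [Finset.prod_insert ha, Finset.sum_insert ha, D.leibniz,
      ih fun i hi => h i (Finset.mem_insert_of_mem hi), h a (Finset.mem_insert_self a s)]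
    simp only [smul_eq_mul]
    ring

open PowerSeries in
theorem derivative_eigProd (ε : Sgn) (p : ℕ) (w : Word n N) :
    d⁄dX (P n) (eigProd ε p w) =
      eigProd ε p w * PowerSeries.mk fun s => powEig ε p (s + 1) w := by
  have : (PowerSeries.mk fun s => powEig ε p (s + 1) w) =
      ∑ a, if (w a).val < p then PowerSeries.mk fun s =>
        (1 - algebraMap Ch (P n) (signedH ε) ^ (s + 1)) * signedVar ε a ^ (s + 1) else 0 := by
    ext1 m
    rw [map_sum, coeff_mk, powEig]
    refine Finset.sum_congr rfl fun a _ => ?_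
    split_ifs
    · rw [coeff_mk, map_sub, map_one, map_pow]
    · rw [map_zero]
  rw [this, eigProd]
  refine Derivation.prod_log _ _ _ _ fun a _ => ?_
  split_ifs
  · rw [eigSer_eq, derivative_geom]
  · rw [derivative_one, mul_zero]

theorem constantCoeff_eigProd (ε : Sgn) (p : ℕ) (w : Word n N) :
    PowerSeries.constantCoeff (eigProd ε p w) = 1 := by
  rw [eigProd, map_prod]
  refine Finset.prod_eq_one fun a _ => ?_
  split_ifs
  · rw [eigSer_eq, map_mul, map_sub, map_mul, PowerSeries.constantCoeff_X, mul_zero, map_one,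
      sub_zero, one_mul, ← PowerSeries.coeff_zero_eq_constantCoeff_apply, PowerSeries.coeff_mk,
      pow_zero]
  · exact map_one _

/-- Newton's identities: they let the power sums `powEig` be expressed recursively through the
coefficients of the eigenvalue series, which are eigenvalues of the generators `B^∞_{p,±s}`. -/
theorem coeff_succ_eigProd (ε : Sgn) (p : ℕ) (w : Word n N) (s : ℕ) :
    PowerSeries.coeff (s + 1) (eigProd ε p w) * ((s : P n) + 1) =
      ∑ q ∈ Finset.HasAntidiagonal.antidiagonal s, PowerSeries.coeff q.1 (eigProd ε p w) *
        powEig ε p (q.2 + 1) w := by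
  have h := congr_arg (PowerSeries.coeff s) (derivative_eigProd ε p w)
  rw [PowerSeries.coeff_derivative, PowerSeries.coeff_mul] at h
  simpa only [PowerSeries.coeff_mk] using h

theorem coeff_one_eigProd (ε : Sgn) (p : ℕ) (w : Word n N) :
    PowerSeries.coeff 1 (eigProd ε p w) = powEig ε p 1 w := by
  have := coeff_succ_eigProd ε p w 0
  simpa [constantCoeff_eigProd] using this

theorem permP_signedVar (σ : Equiv.Perm (Fin n)) (ε : Sgn) (a : Fin n) :
    permP σ (signedVar ε a) = signedVar ε (σ a) := by
  cases ε
  · exact permP_ziP σ a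
  · exact permP_zP σ a

theorem permP_powEig (σ : Equiv.Perm (Fin n)) (ε : Sgn) (p s : ℕ) (w : Word n N) :
    permP σ (powEig ε p s (w ∘ σ)) = powEig ε p s w := by
  unfold powEig
  rw [map_sum, ← Equiv.sum_comp σ fun a => if (w a).val < p then
    algebraMap Ch (P n) (1 - signedH ε ^ s) * signedVar ε a ^ s else 0]
  refine Finset.sum_congr rfl fun a _ => ?_
  rw [Function.comp_apply]
  split_ifs
  · rw [map_mul, AlgEquiv.commutes, map_pow, permP_signedVar]
  · rw [map_zero]

end LogDerivative
-- Weight subspaces.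
section WeightSpaces

variable {n N : ℕ}

theorem mem_Vwt {l : Comp n N} {v : V n N} : v ∈ Vwt l ↔ ∀ w, v w ≠ 0 → wt w = l := by
  constructor
  · intro h
    refine Submodule.span_induction (p := fun v _ => ∀ w, v w ≠ 0 → wt w = l) ?_ ?_ ?_ ?_ h
    · rintro _ ⟨w', rfl, rfl⟩ w hw
      by_contra hne
      exact hw (Pi.single_eq_of_ne (fun h => hne (by rw [h])) _)
    · intro w hw
      exact absurd rfl hw
    · intro x y _ _ hx hy w hw
      by_cases h0 : x w = 0
      · exact hy w fun h1 => hw (by rw [Pi.add_apply, h0, h1, add_zero])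
      · exact hx w h0
    · intro c x _ hx w hw
      exact hx w fun h0 => hw (by rw [Pi.smul_apply, h0, smul_zero])
  · intro h
    have hv : v = ∑ w, v w • (Pi.single w 1 : V n N) := by
      funext w
      simp [Finset.sum_apply, Pi.single_apply]
    rw [hv]
    refine Submodule.sum_mem _ fun w _ => ?_
    by_cases h0 : v w = 0
    · rw [h0, zero_smul]; exact Submodule.zero_mem _
    · exact Submodule.smul_mem _ _ (Submodule.subset_span ⟨w, h w h0, rfl⟩)

/-- The projection onto the weight subspace. -/
def wtProj (l : Comp n N) : V n N →ₗ[K n] V n N where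
  toFun v w := if wt w = l then v w else 0
  map_add' v v' := by funext w; simp only [Pi.add_apply]; split_ifs <;> simp
  map_smul' c v := by funext w; simp only [Pi.smul_apply, RingHom.id_apply]; split_ifs <;> simp

theorem wtProj_of_mem {l : Comp n N} {v : V n N} (h : v ∈ Vwt l) : wtProj l v = v := by
  funext w
  show (if wt w = l then v w else 0) = v w
  split_ifs with h1
  · rfl
  · by_contra h2
    exact h1 (mem_Vwt.1 h w (Ne.symm h2))

theorem wtProj_of_mem_ne {l l' : Comp n N} {v : V n N} (h : v ∈ Vwt l) (hl : l ≠ l') :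
    wtProj l' v = 0 := by
  funext w
  show (if wt w = l' then v w else 0) = 0
  split_ifs with h1
  · by_contra h2
    exact hl ((mem_Vwt.1 h w h2).symm.trans h1)
  · rfl

theorem sTilde_mem_Vwt (i : Adj n) {l : Comp n N} {v : V n N} (h : v ∈ Vwt l) :
    sTilde i v ∈ Vwt l := by
  refine mem_Vwt.2 fun w hw => ?_
  rcases ne_zero_of_sTilde hw with h1 | h1
  · exact mem_Vwt.1 h w h1
  · rw [← mem_Vwt.1 h _ h1, wt_comp]

end WeightSpaces

/-! ### The vectors `ξ_I` as normalized eigenvectors. -/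

section Xi

variable {n N : ℕ}

/-- The diagonal coefficient of `ξ_I`. -/
def leadCoeff (w : Word n N) : K n :=
  ∏ p ∈ invSet w, (z p.2 - z p.1) / (z p.2 - hK n * z p.1)

theorem leadCoeff_ne_zero (w : Word n N) : leadCoeff w ≠ 0 := by
  refine Finset.prod_ne_zero_iff.2 fun p hp => div_ne_zero ?_ ?_
  · exact z_sub_z_ne_zero (Finset.mem_filter.1 hp).2.1.ne'
  · exact z_sub_hz_ne_zero (Finset.mem_filter.1 hp).2.1.ne'

theorem leadCoeff_comp_s (w : Word n N) (i : Adj n) (h : w i.1 < w i.next) :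
    leadCoeff (w ∘ i.s) = (z i.next - z i.1) / (z i.next - hK n * z i.1) *
      permK i.s (leadCoeff w) := by
  obtain ⟨h1, h2⟩ := invSet_comp_s w i h
  rw [leadCoeff, h2, Finset.prod_insert h1, Finset.prod_map, leadCoeff, map_prod]
  congr 1
  refine Finset.prod_congr rfl fun p _ => ?_
  simp only [map_div₀, map_sub, map_mul, permK_hK, permK_z]
  rfl

theorem permK_leadCoeff_of_eq (w : Word n N) (i : Adj n) (h : w i.1 = w i.next) :
    permK i.s (leadCoeff w) = leadCoeff w := by
  unfold leadCoeff
  rw [map_prod]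
  have hne : ∀ p ∈ invSet w, ¬ (p.1 = i.1 ∧ p.2 = i.next) := by
    intro p hp hc
    have := (Finset.mem_filter.1 hp).2.2
    rw [hc.1, hc.2, h] at this
    exact lt_irrefl _ this
  have hw := i.comp_s_of_eq h
  have hwa : ∀ a, w (i.s a) = w a := fun a => congr_fun hw a
  refine Finset.prod_bij (fun p _ => i.pairMap p) ?_ (fun p _ q _ hpq => i.pairMap.injective hpq)
    ?_ ?_
  · intro p hp
    refine Finset.mem_filter.2 ⟨Finset.mem_univ _, i.s_lt_s (hne p hp)
      (Finset.mem_filter.1 hp).2.1, ?_⟩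
    show w (i.s p.2) < w (i.s p.1)
    rw [hwa, hwa]
    exact (Finset.mem_filter.1 hp).2.2
  · intro p hp
    refine ⟨i.pairMap p, Finset.mem_filter.2 ⟨Finset.mem_univ _, i.s_lt_s (hne p hp)
      (Finset.mem_filter.1 hp).2.1, ?_⟩, Prod.ext (i.s_s _) (i.s_s _)⟩
    show w (i.s p.2) < w (i.s p.1)
    rw [hwa, hwa]
    exact (Finset.mem_filter.1 hp).2.2
  · intro p _
    simp only [map_div₀, map_sub, map_mul, permK_hK, permK_z]
    rfl

theorem invSet_imin (l : Comp n N) : invSet (imin l) = ∅ :=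
  Finset.filter_eq_empty_iff.2 fun _ _ hp => (monotone_imin l hp.1.le).not_gt hp.2

/-- An element of the Gelfand–Zetlin algebra with simple spectrum. -/
def sepElt (N : ℕ) : U N :=
  ∑ p : Fin N, PowerSeries.coeff 1 (Aser .minus (p.val + 1) p.2)

/-- The eigenvalues of `sepElt`. -/
def sepEig (w : Word n N) : P n := ∑ p : Fin N, powEig .minus (p.val + 1) 1 w

theorem permP_sepEig (σ : Equiv.Perm (Fin n)) (w : Word n N) :
    permP σ (sepEig (w ∘ σ)) = sepEig w := by
  rw [sepEig, map_sum]
  exact Finset.sum_congr rfl fun p _ => permP_powEig σ _ _ _ w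

/-- The variable `z_a` occurs in the eigenvalue of `B^∞_{p,-1}` for all `p` from the letter at `a`
onwards, so its coefficient in the sum over `p` reveals that letter. Hence the spectrum is simple.
-/
theorem sepEig_eq (w : Word n N) : sepEig w =
    ∑ a, AddMonoidAlgebra.single (Finsupp.single a 1) ((1 - hh) * ((N - (w a).val : ℕ) : Ch)) := by
  simp only [sepEig, powEig]
  rw [Finset.sum_comm]
  refine Finset.sum_congr rfl fun a _ => ?_
  rw [← Finset.sum_filter, Finset.sum_const]
  have hc : (Finset.univ.filter fun p : Fin N => (w a).val < p.val + 1).card = N - (w a).val := by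
    have : (Finset.univ.filter fun p : Fin N => (w a).val < p.val + 1) = Finset.Ici (w a) := by
      ext p
      rw [Finset.mem_filter, Finset.mem_Ici]
      exact ⟨fun h => Nat.lt_succ_iff.1 h.2, fun h => ⟨Finset.mem_univ _, Nat.lt_succ_iff.2 h⟩⟩
    rw [this, Fin.card_Ici]
  rw [hc, pow_one, pow_one]
  have hz : algebraMap Ch (P n) (1 - signedH .minus) * signedVar .minus a =
      (1 - hh) • AddMonoidAlgebra.single (Finsupp.single a 1) 1 := (Algebra.smul_def _ _).symm
  rw [hz, AddMonoidAlgebra.smul_single, smul_eq_mul, mul_one,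
    AddMonoidAlgebra.smul_single, nsmul_eq_mul, mul_comm]

theorem sepEig_injective : Function.Injective (sepEig : Word n N → P n) := by
  intro w w' h
  have h1h : (1 : Ch) - hh ≠ 0 := by
    rw [sub_ne_zero]
    have := hh_pow_ne_one one_ne_zero
    rw [pow_one] at this
    exact this.symm
  have hcoeff : ∀ (w : Word n N) (a : Fin n), (sepEig w).coeff (Finsupp.single a 1) =
      (1 - hh) * ((N - (w a).val : ℕ) : Ch) := by
    intro w a
    rw [sepEig_eq, AddMonoidAlgebra.coeff_sum, Finsupp.finsetSum_apply, Finset.sum_eq_single a]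
    · simp [AddMonoidAlgebra.coeff_single]
    · intro b _ hb
      have : Finsupp.single b (1 : ℤ) ≠ Finsupp.single a 1 := fun h2 =>
        hb ((Finsupp.single_left_inj one_ne_zero).1 h2)
      rw [AddMonoidAlgebra.coeff_single, Finsupp.single_eq_of_ne this.symm]
    · intro h; exact absurd (Finset.mem_univ _) h
  funext a
  have h2 := hcoeff w a
  rw [h, hcoeff w' a] at h2
  have h3 := mul_left_cancel₀ h1h h2
  have h4 : N - (w' a).val = N - (w a).val := by exact_mod_cast h3
  have := (w a).2
  have := (w' a).2
  exact Fin.ext (by omega)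

theorem pho_single_of_phoMat {X : U N} {w : Word n N} {c : P n}
    (h : (phoMat n N X).mulVec (Pi.single w 1) = c • Pi.single w (1 : P n)) :
    pho n N X (Pi.single w 1) = algebraMap (P n) (K n) c • Pi.single w 1 := by
  funext w'
  have h1 := congr_fun h w'
  rw [Matrix.mulVec_single_one] at h1
  rw [pho_single, show phoMat n N X w' w = _ from h1, Pi.smul_apply, Pi.smul_apply, smul_eq_mul,
    smul_eq_mul, map_mul]
  congr 1
  by_cases h : w' = w
  · subst h; simp
  · simp [h]

theorem pho_coeff_Aser_imin (ε : Sgn) (p : ℕ) (hp1 : 1 ≤ p) (hp : p ≤ N) (s : ℕ) (l : Comp n N) :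
    pho n N (PowerSeries.coeff s (Aser ε p hp)) (Pi.single (imin l) 1) =
      algebraMap (P n) (K n) (PowerSeries.coeff s (eigProd ε p (imin l))) •
        Pi.single (imin l) 1 :=
  pho_single_of_phoMat (phoMat_Aser ε p hp1 hp s _ (monotone_imin l))

theorem pho_sepElt_imin (l : Comp n N) :
    pho n N (sepElt N) (Pi.single (imin l) 1) =
      algebraMap (P n) (K n) (sepEig (imin l)) • Pi.single (imin l) 1 := by
  rw [sepElt, map_sum, LinearMap.sum_apply, sepEig, map_sum, Finset.sum_smul]
  refine Finset.sum_congr rfl fun p _ => ?_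
  rw [pho_coeff_Aser_imin _ _ (by omega), coeff_one_eigProd]

/-- The characterization of `ξ_I` as a normalized eigenvector. -/
structure IsXiVec (w : Word n N) (v : V n N) : Prop where
  eig : pho n N (sepElt N) v = algebraMap (P n) (K n) (sepEig w) • v
  supp : ∀ u, v u ≠ 0 → Below u w
  lead : v w = leadCoeff w
  mem : v ∈ Vwt (wt w)

theorem isXiVec_imin (l : Comp n N) : IsXiVec (imin l) (Pi.single (imin l) 1) where
  eig := pho_sepElt_imin l
  supp u hu := by
    by_cases h : u = imin l
    · subst h; exact Below.refl _
    · exact absurd (Pi.single_eq_of_ne h _) hu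
  lead := by rw [leadCoeff, invSet_imin, Finset.prod_empty, Pi.single_eq_same]
  mem := Submodule.subset_span ⟨_, rfl, rfl⟩

/-- The operator `s̃_i` commutes with `φ(X)` but is only semilinear over rational functions: it
permutes the variables in the eigenvalue. -/
theorem eig_sTilde {X : U N} {v : V n N} {c : P n} (i : Adj n)
    (h : pho n N X v = algebraMap (P n) (K n) c • v) :
    pho n N X (sTilde i v) = algebraMap (P n) (K n) (permP i.s c) • sTilde i v := by
  rw [pho_sTilde, h, sTilde_smul, permK_algebraMap]

theorem permP_sepEig' (i : Adj n) (w : Word n N) :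
    permP i.s (sepEig w) = sepEig (w ∘ i.s) := by
  rw [← permP_sepEig i.s (w ∘ i.s), i.comp_s_s]

theorem IsXiVec.sTilde_of_lt {w : Word n N} {v : V n N} (h : IsXiVec w v) (i : Adj n)
    (hi : w i.1 < w i.next) : IsXiVec (w ∘ i.s) (sTilde i v) where
  eig := by rw [eig_sTilde i h.eig, permP_sepEig']
  supp u hu := by
    refine Below.comp_s_or i hi ?_
    rcases ne_zero_of_sTilde hu with h1 | h1
    · exact Or.inl (h.supp _ h1)
    · exact Or.inr (h.supp _ h1)
  lead := by
    -- The word `w ∘ i.s` is not below `w`, so only one of the two terms of `s̃_i` remains, and it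
    -- reproduces the recursion for `leadCoeff`.
    have h0 : v (w ∘ i.s) = 0 := by
      by_contra h1
      exact not_below_of_lt i hi (h.supp _ h1)
    have h2 : (w ∘ i.s) i.next < (w ∘ i.s) i.1 := by
      rw [Function.comp_apply, Function.comp_apply, i.s_left, i.s_right]; exact hi
    rw [sTilde_apply_gt i v h2, i.comp_s_s, h0, map_zero, mul_zero, add_zero, h.lead,
      leadCoeff_comp_s w i hi, div_eq_inv_mul, mul_assoc]
  mem := by rw [wt_comp]; exact sTilde_mem_Vwt i h.mem

theorem exists_isXiVec (w : Word n N) : ∃ v, IsXiVec w v :=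
  word_induction (p := fun w => ∃ v, IsXiVec w v) (fun l => ⟨_, isXiVec_imin l⟩)
    (fun i _ hi ⟨v, hv⟩ => ⟨sTilde i v, hv.sTilde_of_lt i hi⟩) w

/-- The vectors `ξ_I`. -/
def xi (w : Word n N) : V n N := (exists_isXiVec w).choose

theorem isXiVec_xi (w : Word n N) : IsXiVec w (xi w) := (exists_isXiVec w).choose_spec

theorem xi_ne_zero (w : Word n N) : xi w ≠ 0 := fun h =>
  leadCoeff_ne_zero w (by rw [← (isXiVec_xi w).lead, h]; rfl)

theorem linearIndependent_xi : LinearIndependent (K n) (xi : Word n N → V n N) := by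
  refine Module.End.eigenvectors_linearIndependent' (pho n N (sepElt N))
    (fun w => algebraMap (P n) (K n) (sepEig w))
    ((IsFractionRing.injective (P n) (K n)).comp sepEig_injective) xi fun w => ?_
  exact ⟨Module.End.mem_eigenspace_iff.2 (isXiVec_xi w).eig, xi_ne_zero w⟩

/-- The basis of the vectors `ξ_I`. -/
def xiBasis (n N : ℕ) : Module.Basis (Word n N) (K n) (V n N) :=
  basisOfLinearIndependentOfCardEqFinrank' xi linearIndependent_xi
    (by rw [Module.finrank_fintype_fun_eq_card])

theorem xiBasis_apply (w : Word n N) : xiBasis n N w = xi w := by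
  simp [xiBasis]

theorem sum_repr_xi (v : V n N) : ∑ w, (xiBasis n N).repr v w • xi w = v := by
  have := (xiBasis n N).sum_repr v
  simpa only [xiBasis_apply] using this

theorem eq_smul_xi {w : Word n N} {v : V n N}
    (h : pho n N (sepElt N) v = algebraMap (P n) (K n) (sepEig w) • v) :
    v = (xiBasis n N).repr v w • xi w := by
  have h1 : ∑ u, ((xiBasis n N).repr v u * (algebraMap (P n) (K n) (sepEig u) -
      algebraMap (P n) (K n) (sepEig w))) • xi u = 0 := by
    have h2 := h
    rw [← sum_repr_xi v, map_sum, Finset.smul_sum, ← sub_eq_zero, ← Finset.sum_sub_distrib] at h2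
    rw [← h2]
    refine Finset.sum_congr rfl fun u _ => ?_
    rw [map_smul, (isXiVec_xi u).eig, smul_smul, smul_smul, ← sub_smul]
    congr 1
    ring
  have h3 := Fintype.linearIndependent_iff.1 linearIndependent_xi _ h1
  conv_lhs => rw [← sum_repr_xi v]
  rw [Finset.sum_eq_single w]
  · intro u _ hu
    rcases mul_eq_zero.1 (h3 u) with h4 | h4
    · rw [h4, zero_smul]
    · exact absurd (sepEig_injective (IsFractionRing.injective (P n) (K n) (sub_eq_zero.1 h4))) hu
  · intro h; exact absurd (Finset.mem_univ _) h

/-- The spectrum is simple, so an eigenvector is fixed by one nonzero coordinate. -/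
theorem eq_xi {w : Word n N} {v : V n N}
    (h : pho n N (sepElt N) v = algebraMap (P n) (K n) (sepEig w) • v)
    (hl : v w = leadCoeff w) : v = xi w := by
  have h1 := eq_smul_xi h
  have h2 := congr_fun h1 w
  rw [Pi.smul_apply, hl, (isXiVec_xi w).lead, smul_eq_mul] at h2
  have h3 : (xiBasis n N).repr v w = 1 :=
    mul_right_cancel₀ (leadCoeff_ne_zero w) (by rw [← h2, one_mul])
  rw [h1, h3, one_smul]

theorem xi_imin (l : Comp n N) : xi (imin l) = Pi.single (imin l) 1 :=
  (eq_xi (isXiVec_imin l).eig (isXiVec_imin l).lead).symm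

/-- Both sides are eigenvectors for the same eigenvalue with the same diagonal coefficient.
Ascending transpositions come from the construction, equal letters leave eigenvalue and coefficient
unchanged, and descending transpositions follow since `s̃_i` is an involution. No braid relation is
needed. -/
theorem xi_comp_s (i : Adj n) (w : Word n N) : xi (w ∘ i.s) = sTilde i (xi w) := by
  have hlt : ∀ u : Word n N, u i.1 < u i.next → xi (u ∘ i.s) = sTilde i (xi u) := fun u hu =>
    have h := (isXiVec_xi u).sTilde_of_lt i hu
    (eq_xi h.eig h.lead).symm
  rcases lt_trichotomy (w i.1) (w i.next) with h | h | h
  · exact hlt w h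
  · symm
    rw [i.comp_s_of_eq h]
    refine eq_xi ?_ ?_
    · rw [eig_sTilde i (isXiVec_xi w).eig, permP_sepEig', i.comp_s_of_eq h]
    · rw [sTilde_apply_eq i _ h, (isXiVec_xi w).lead, permK_leadCoeff_of_eq w i h]
  · have h1 := hlt (w ∘ i.s) (by
      rw [Function.comp_apply, Function.comp_apply, i.s_left, i.s_right]; exact h)
    rw [i.comp_s_s] at h1
    rw [h1, sTilde_sTilde]

theorem isXi_xi : IsXi (xi : Word n N → V n N) := ⟨xi_imin, xi_comp_s⟩

theorem IsXi.eq_xi {ξ : Word n N → V n N} (h : IsXi ξ) : ξ = xi := by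
  funext w
  refine word_induction (p := fun w => ξ w = xi w) (fun l => ?_) (fun i u _ hu => ?_) w
  · rw [h.1, xi_imin]
  · rw [h.2, hu, xi_comp_s]

theorem xi_mem (w : Word n N) : xi w ∈ Vwt (wt w) := (isXiVec_xi w).mem

/-- Compare the expansion of `v` with that of its projection to weight `l`; each `ξ_I` has a
definite weight. -/
theorem repr_xi_of_mem {l : Comp n N} {v : V n N} (hv : v ∈ Vwt l) {w : Word n N}
    (hw : wt w ≠ l) : (xiBasis n N).repr v w = 0 := by
  have h1 : ∑ u, (if wt u = l then 0 else (xiBasis n N).repr v u) • xi u = 0 := by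
    have h2 := wtProj_of_mem hv
    rw [← sum_repr_xi v, map_sum, eq_comm, ← sub_eq_zero, ← Finset.sum_sub_distrib] at h2
    rw [← h2]
    refine Finset.sum_congr rfl fun u _ => ?_
    rw [map_smul]
    split_ifs with hu
    · rw [wtProj_of_mem (hu ▸ xi_mem u), zero_smul, sub_self]
    · rw [wtProj_of_mem_ne (xi_mem u) hu, smul_zero, sub_zero]
  have := Fintype.linearIndependent_iff.1 linearIndependent_xi _ h1 w
  rwa [if_neg hw] at this

theorem span_xi (l : Comp n N) :
    Submodule.span (K n) (xi '' {w | wt w = l}) = (Vwt l : Submodule (K n) (V n N)) := by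
  refine le_antisymm (Submodule.span_le.2 ?_) fun v hv => ?_
  · rintro _ ⟨w, rfl, rfl⟩
    exact xi_mem w
  · rw [← sum_repr_xi v]
    refine Submodule.sum_mem _ fun w _ => ?_
    by_cases hw : wt w = l
    · exact Submodule.smul_mem _ _ (Submodule.subset_span ⟨w, hw, rfl⟩)
    · rw [repr_xi_of_mem hv hw, zero_smul]; exact Submodule.zero_mem _

end Xi
-- The spectrum of the Gelfand–Zetlin algebra is all equivariant families.
section Families

variable {n N : ℕ}

/-- Families of Laurent polynomials `e_I` with `e_{σ(I)} = σ(e_I)`. -/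
def symFam (n N : ℕ) : Subalgebra Ch (Word n N → P n) where
  carrier := {e | ∀ (i : Adj n) (w : Word n N), permP i.s (e w) = e (w ∘ i.s)}
  mul_mem' ha hb i w := by rw [Pi.mul_apply, map_mul, ha i w, hb i w, Pi.mul_apply]
  add_mem' ha hb i w := by rw [Pi.add_apply, map_add, ha i w, hb i w, Pi.add_apply]
  algebraMap_mem' c i _ := AlgEquiv.commutes (permP i.s) c

theorem perm_induction {p : Equiv.Perm (Fin n) → Prop} (h1 : p 1)
    (hm : ∀ (i : Adj n) σ, p σ → p (i.s * σ)) (σ : Equiv.Perm (Fin n)) : p σ := by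
  rcases n with _ | n
  · rwa [Subsingleton.elim σ 1]
  have hσ : σ ∈ Submonoid.closure
      (Set.range fun i : Fin n => Equiv.swap i.castSucc i.succ) := by
    rw [Equiv.Perm.mclosure_swap_castSucc_succ]; exact Submonoid.mem_top _
  induction hσ using Submonoid.closure_induction_left with
  | one => exact h1
  | mul_left x hx y _ ih =>
    obtain ⟨i, rfl⟩ := hx
    exact hm ⟨i.castSucc, by simp⟩ y ih

theorem symFam_perm {e : Word n N → P n} (he : e ∈ symFam n N) (σ : Equiv.Perm (Fin n)) :
    ∀ w, permP σ (e (w ∘ σ)) = e w := by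
  refine perm_induction (p := fun σ => ∀ w, permP σ (e (w ∘ σ)) = e w) (fun w => permP_one _)
    (fun i τ h w => ?_) σ
  have h2 := h (w ∘ i.s)
  rw [permP_mul]
  have h3 : w ∘ ⇑(i.s * τ) = (w ∘ i.s) ∘ τ := rfl
  rw [h3, h2, he i, i.comp_s_s]

theorem mem_symFam_of_perm {e : Word n N → P n}
    (h : ∀ (σ : Equiv.Perm (Fin n)) w, permP σ (e (w ∘ σ)) = e w) : e ∈ symFam n N := by
  intro i w
  have := h i.s (w ∘ i.s)
  rwa [i.comp_s_s] at this

theorem permP_eq_of_comp_eq {l : Comp n N} {w : Word n N} {g : P n} (hg : g ∈ symL l)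
    {σ τ : Equiv.Perm (Fin n)} (hσ : w ∘ σ = imin l) (hτ : w ∘ τ = imin l) :
    permP σ g = permP τ g := by
  have h1 : imin l ∘ ⇑(τ⁻¹ * σ) = imin l := by
    rw [← hτ]
    funext a
    show w (τ (τ⁻¹ (σ a))) = w (τ a)
    rw [show τ (τ⁻¹ (σ a)) = σ a from τ.apply_symm_apply (σ a)]
    exact congr_fun (hσ.trans hτ.symm) a
  calc permP σ g = permP (τ * (τ⁻¹ * σ)) g := by rw [mul_inv_cancel_left]
    _ = permP τ g := by rw [permP_mul, hg _ h1]

theorem atI_eq {l : Comp n N} {w : Word n N} {g : P n} (hg : g ∈ symL l)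
    {τ : Equiv.Perm (Fin n)} (hτ : w ∘ τ = imin l) : atI w g = permP τ g := by
  have hw : wt w = l := by rw [← wt_comp w τ, hτ, wt_imin]
  subst hw
  exact permP_eq_of_comp_eq hg (comp_sort_eq w) hτ

theorem atI_imin {l : Comp n N} {g : P n} (hg : g ∈ symL l) : atI (imin l) g = g := by
  rw [atI_eq (τ := 1) hg rfl, permP_one]

/-- The words of weight `λ` form the orbit of `I^min`, whose stabilizer is `S_λ`. So an equivariant
family amounts to one `S_λ`-invariant polynomial for each weight; `symFam_imin_mem` and
`symFam_eq_atI` give the converse. -/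
theorem atI_mem_symFam (g : ∀ l : Comp n N, symL l) :
    (fun w => atI w (g (wt w) : P n)) ∈ symFam n N := by
  refine mem_symFam_of_perm fun σ w => ?_
  show permP σ (permP (Tuple.sort (w ∘ σ)) (g (wt (w ∘ σ)))) = _
  rw [← permP_mul, wt_comp, atI_eq (τ := σ * Tuple.sort (w ∘ σ)) (g (wt w)).2]
  rw [← wt_comp w σ, ← comp_sort_eq]; rfl

theorem symFam_imin_mem {e : Word n N → P n} (he : e ∈ symFam n N) (l : Comp n N) :
    e (imin l) ∈ symL l := by
  intro σ hσ
  have := symFam_perm he σ (imin l)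
  rwa [hσ] at this

theorem symFam_eq_atI {e : Word n N → P n} (he : e ∈ symFam n N) (w : Word n N) :
    e w = atI w (e (imin (wt w))) := by
  rw [← comp_sort_eq]
  exact (symFam_perm he _ w).symm

theorem symFam_ext {e e' : Word n N → P n} (he : e ∈ symFam n N) (he' : e' ∈ symFam n N)
    {l : Comp n N} (h : e (imin l) = e' (imin l)) {w : Word n N} (hw : wt w = l) : e w = e' w := by
  subst hw
  rw [symFam_eq_atI he, symFam_eq_atI he', h]

theorem xi_smul_cancel {w : Word n N} {a b : P n}
    (h : algebraMap (P n) (K n) a • xi w = algebraMap (P n) (K n) b • xi w) : a = b :=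
  IsFractionRing.injective (P n) (K n) (smul_left_injective _ (xi_ne_zero w) h)

/-- `φ(X)` acts on the vectors `ξ_I` by the eigenvalues `e_I`. -/
def HasEig (X : U N) (e : Word n N → P n) : Prop :=
  ∀ w, pho n N X (xi w) = algebraMap (P n) (K n) (e w) • xi w

theorem HasEig.mem_symFam {X : U N} {e : Word n N → P n} (h : HasEig X e) : e ∈ symFam n N := by
  intro i w
  have h1 := eig_sTilde i (h w)
  rw [← xi_comp_s, h] at h1
  exact (xi_smul_cancel h1).symm

/-- Quantum minors are computed only on `v_{I^min}`. Commutation with the `s̃_i` propagates the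
eigenvalues to all `ξ_I`. -/
theorem HasEig.of_imin {X : U N} {e : Word n N → P n} (he : e ∈ symFam n N)
    (h : ∀ l, pho n N X (Pi.single (imin l) 1) =
      algebraMap (P n) (K n) (e (imin l)) • Pi.single (imin l) 1) : HasEig X e := by
  intro w
  refine word_induction (p := fun w => pho n N X (xi w) = algebraMap (P n) (K n) (e w) • xi w)
    (fun l => ?_) (fun i u _ hu => ?_) w
  · rw [xi_imin, h]
  · rw [xi_comp_s, eig_sTilde i hu, he i]

theorem HasEig.add {X Y : U N} {e f : Word n N → P n} (h : HasEig X e) (h' : HasEig Y f) :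
    HasEig (X + Y) (e + f) := by
  intro w
  rw [map_add, LinearMap.add_apply, h, h', Pi.add_apply, map_add, add_smul]

theorem HasEig.mul {X Y : U N} {e f : Word n N → P n} (h : HasEig X e) (h' : HasEig Y f) :
    HasEig (X * Y) (e * f) := by
  intro w
  rw [map_mul, Module.End.mul_apply, h', map_smul, h, Pi.mul_apply, map_mul, smul_smul, mul_comm]

theorem HasEig.algebraMap (c : Ch) :
    HasEig (algebraMap Ch (U N) c) (algebraMap Ch (Word n N → P n) c) := by
  intro w
  rw [AlgHom.commutes, Module.algebraMap_end_apply, Pi.algebraMap_apply,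
    ← IsScalarTower.algebraMap_apply, algebraMap_smul]

theorem diagonal_mulVec_single (d : Word n N → P n) (w : Word n N) :
    (Matrix.diagonal d).mulVec (Pi.single w 1) = d w • Pi.single w (1 : P n) := by
  funext w'
  rw [Matrix.mulVec_single_one, Pi.smul_apply, smul_eq_mul]
  show Matrix.diagonal d w' w = _
  by_cases h : w' = w
  · subst h; simp
  · simp [h]

theorem prod_mem_symFam (q : Fin N → Prop) [DecidablePred q] (c : Ch) :
    (fun w : Word n N => ∏ a, if q (w a) then algebraMap Ch (P n) c else 1) ∈ symFam n N := by
  refine mem_symFam_of_perm fun σ w => ?_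
  rw [map_prod, ← Equiv.prod_comp σ fun a => if q (w a) then algebraMap Ch (P n) c else 1]
  refine Finset.prod_congr rfl fun a _ => ?_
  rw [apply_ite (permP σ), AlgEquiv.commutes, map_one]; rfl

theorem hasEig_L (j : Fin N) : HasEig (L .plus j j 0)
    fun w : Word n N => ∏ a, if w a ≤ j then algebraMap Ch (P n) hh else 1 := by
  refine HasEig.of_imin (prod_mem_symFam (· ≤ j) hh) fun l => pho_single_of_phoMat ?_
  rw [phoMat_L, (coefL_plus_zero (hP n) zP ziP zP_mul_ziP j).2, diagonal_mulVec_single]; rfl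

theorem hasEig_Linv (j : Fin N) : HasEig (Linv j)
    fun w : Word n N => ∏ a, if w a ≤ j then algebraMap Ch (P n) hh⁻¹ else 1 := by
  refine HasEig.of_imin (prod_mem_symFam (· ≤ j) hh⁻¹) fun l => pho_single_of_phoMat ?_
  rw [phoMat_Linv, diagonal_mulVec_single]

theorem map_permP_eigSer (σ : Equiv.Perm (Fin n)) (ε : Sgn) (a : Fin n) :
    PowerSeries.map (permP σ : P n →+* P n) (eigSer ε a) = eigSer ε (σ a) := by
  rw [eigSer_eq, eigSer_eq]
  simp only [map_mul, map_sub, map_one, PowerSeries.map_C, PowerSeries.map_X, RingHom.coe_coe,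
    AlgEquiv.commutes, permP_signedVar]
  congr 1
  ext1 m
  rw [PowerSeries.coeff_map, PowerSeries.coeff_mk, PowerSeries.coeff_mk, map_pow, RingHom.coe_coe,
    permP_signedVar]

theorem coeff_eigProd_mem (ε : Sgn) (p s : ℕ) :
    (fun w : Word n N => PowerSeries.coeff s (eigProd ε p w)) ∈ symFam n N := by
  refine mem_symFam_of_perm fun σ w => ?_
  have h : PowerSeries.map (permP σ : P n →+* P n) (eigProd ε p (w ∘ σ)) = eigProd ε p w := by
    unfold eigProd
    rw [map_prod, ← Equiv.prod_comp σ fun a => if (w a).val < p then eigSer ε a else 1]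
    refine Finset.prod_congr rfl fun a _ => ?_
    rw [apply_ite (PowerSeries.map (permP σ : P n →+* P n)), map_one, map_permP_eigSer]; rfl
  show permP σ _ = _
  rw [← h, PowerSeries.coeff_map]; rfl

theorem hasEig_Aser (ε : Sgn) (p : ℕ) (hp1 : 1 ≤ p) (hp : p ≤ N) (s : ℕ) :
    HasEig (PowerSeries.coeff s (Aser ε p hp))
      fun w : Word n N => PowerSeries.coeff s (eigProd ε p w) :=
  HasEig.of_imin (coeff_eigProd_mem ε p s) fun l => pho_coeff_Aser_imin ε p hp1 hp s l

theorem exists_hasEig {X : U N} (hX : X ∈ GZ N) : ∃ e : Word n N → P n, HasEig X e := by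
  refine Algebra.adjoin_induction (p := fun X _ => ∃ e : Word n N → P n, HasEig X e)
    ?_ ?_ ?_ ?_ hX
  · rintro _ (⟨j, rfl | rfl⟩ | ⟨ε, p, hp, s, hp1, -, rfl⟩)
    · exact ⟨_, hasEig_L j⟩
    · exact ⟨_, hasEig_Linv j⟩
    · exact ⟨_, hasEig_Aser ε p hp1 hp s⟩
  · exact fun c => ⟨_, HasEig.algebraMap c⟩
  · rintro X Y - - ⟨e, he⟩ ⟨f, hf⟩
    exact ⟨_, he.add hf⟩
  · rintro X Y - - ⟨e, he⟩ ⟨f, hf⟩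
    exact ⟨_, he.mul hf⟩

/-- The eigenvalue families of the Gelfand–Zetlin algebra. -/
def eigAlg (n N : ℕ) : Subalgebra Ch (Word n N → P n) where
  carrier := {e | ∃ X ∈ GZ N, HasEig X e}
  mul_mem' := fun ⟨X, hX, h⟩ ⟨Y, hY, h'⟩ => ⟨X * Y, mul_mem hX hY, h.mul h'⟩
  add_mem' := fun ⟨X, hX, h⟩ ⟨Y, hY, h'⟩ => ⟨X + Y, add_mem hX hY, h.add h'⟩
  algebraMap_mem' c := ⟨_, Subalgebra.algebraMap_mem _ c, HasEig.algebraMap c⟩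

theorem coeff_eigProd_mem_eigAlg (ε : Sgn) {p : ℕ} (hp1 : 1 ≤ p) (hp : p ≤ N) (s : ℕ) :
    (fun w : Word n N => PowerSeries.coeff s (eigProd ε p w)) ∈ eigAlg n N := by
  rcases Nat.eq_zero_or_pos s with rfl | hs
  · have : (fun w : Word n N => PowerSeries.coeff 0 (eigProd ε p w)) = 1 :=
      funext fun w => (PowerSeries.coeff_zero_eq_constantCoeff_apply _).trans
        (constantCoeff_eigProd ε p w)
    rw [this]
    exact one_mem _
  · exact ⟨_, Algebra.subset_adjoin (Or.inr ⟨ε, p, hp, s, hp1, hs, rfl⟩), hasEig_Aser ε p hp1 hp s⟩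

/-- Newton's identity is solved for its highest power sum, which occurs there with the constant term
of the eigenvalue series, that is 1. -/
theorem powEig_mem_eigAlg (ε : Sgn) {p : ℕ} (hp : p ≤ N) (s : ℕ) :
    (powEig ε p (s + 1) : Word n N → P n) ∈ eigAlg n N := by
  rcases Nat.eq_zero_or_pos p with rfl | hp1
  · have : (powEig ε 0 (s + 1) : Word n N → P n) = 0 := by
      funext w; simp [powEig]
    rw [this]
    exact zero_mem _
  induction s using Nat.strong_induction_on with
  | _ s ih =>
    have h0 : ((0, s) : ℕ × ℕ) ∈ Finset.HasAntidiagonal.antidiagonal s := by simp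
    have key : (powEig ε p (s + 1) : Word n N → P n) =
        (fun w => PowerSeries.coeff (s + 1) (eigProd ε p w)) * ((s : Word n N → P n) + 1) -
        ∑ q ∈ (Finset.HasAntidiagonal.antidiagonal s).erase (0, s),
          (fun w => PowerSeries.coeff q.1 (eigProd ε p w)) * powEig ε p (q.2 + 1) := by
      funext w
      have h := coeff_succ_eigProd ε p w s
      rw [← Finset.add_sum_erase _ _ h0] at h
      simp only [PowerSeries.coeff_zero_eq_constantCoeff_apply, constantCoeff_eigProd,
        one_mul] at h
      simp only [Pi.sub_apply, Pi.mul_apply, Finset.sum_apply, Pi.add_apply, Pi.one_apply,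
        Pi.natCast_apply]
      rw [h]
      ring
    rw [key]
    refine sub_mem (mul_mem (coeff_eigProd_mem_eigAlg ε hp1 hp _)
      (add_mem (natCast_mem _ s) (one_mem _))) (sum_mem fun q hq => mul_mem
        (coeff_eigProd_mem_eigAlg ε hp1 hp _) (ih q.2 ?_))
    have h1 := Finset.mem_erase.1 hq
    have h2 := Finset.HasAntidiagonal.mem_antidiagonal.1 h1.2
    have h3 : q.1 ≠ 0 := fun h => h1.1 (Prod.ext h (by omega))
    omega

/-- The power sums of the variables in a block. -/
def blockSum (k : Fin N) (m : ℤ) (w : Word n N) : P n :=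
  ∑ a, if w a = k then AddMonoidAlgebra.single (Finsupp.single a m) 1 else 0

theorem signedVar_pow (ε : Sgn) (a : Fin n) (s : ℕ) :
    signedVar ε a ^ s = AddMonoidAlgebra.single (Finsupp.single a (-ε.toInt * s)) 1 := by
  cases ε
  · show ziP a ^ s = _
    rw [ziP, AddMonoidAlgebra.single_pow, one_pow, Finsupp.smul_single]
    simp [Sgn.toInt]
  · show zP a ^ s = _
    rw [zP, AddMonoidAlgebra.single_pow, one_pow, Finsupp.smul_single]
    simp [Sgn.toInt]

/-- The power sums for `p = k + 1` and `p = k` differ by the block `k`, and the factor `1 - h^{±s}`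
is invertible in `ℂ(h)`. The sign `+` yields negative exponents and the sign `-` positive ones. -/
theorem blockSum_mem_eigAlg (k : Fin N) {m : ℤ} (hm : m ≠ 0) :
    (blockSum k m : Word n N → P n) ∈ eigAlg n N := by
  obtain ⟨ε, s, rfl⟩ : ∃ (ε : Sgn) (s : ℕ), m = -ε.toInt * ((s + 1 : ℕ) : ℤ) := by
    rcases lt_or_gt_of_ne hm with h | h
    · refine ⟨.plus, (-m).toNat - 1, ?_⟩
      show m = -1 * _
      omega
    · refine ⟨.minus, m.toNat - 1, ?_⟩
      show m = - -1 * _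
      omega
  have hne : (1 : Ch) - signedH ε ^ (s + 1) ≠ 0 :=
    sub_ne_zero.2 (signedH_pow_ne_one ε (Nat.succ_ne_zero s)).symm
  have : (blockSum k (-ε.toInt * ((s + 1 : ℕ) : ℤ)) : Word n N → P n) =
      (1 - signedH ε ^ (s + 1))⁻¹ •
        (powEig ε (k.val + 1) (s + 1) - powEig ε k.val (s + 1) : Word n N → P n) := by
    funext w
    rw [Pi.smul_apply, Pi.sub_apply, powEig, powEig, ← Finset.sum_sub_distrib, Finset.smul_sum,
      blockSum]
    refine Finset.sum_congr rfl fun a _ => ?_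
    rw [← signedVar_pow, ← Algebra.smul_def]
    rcases lt_trichotomy (w a) k with h | h | h
    · have h1 : (w a).val < k.val := h
      rw [if_neg h.ne, if_pos (by omega), if_pos h1, sub_self, smul_zero]
    · rw [if_pos h, if_pos (by rw [h]; omega), if_neg (by rw [h]; omega), sub_zero,
        inv_smul_smul₀ hne]
    · have h1 : k.val < (w a).val := h
      rw [if_neg h.ne', if_neg (by omega), if_neg (by omega), sub_zero, smul_zero]
  rw [this]
  exact Subalgebra.smul_mem _ (sub_mem (powEig_mem_eigAlg ε k.2 s)
    (powEig_mem_eigAlg ε k.2.le s)) _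

theorem hh_pow_injective : Function.Injective fun k : ℕ => hh ^ k := by
  have key : ∀ a b : ℕ, a ≤ b → hh ^ a = hh ^ b → a = b := by
    intro a b hab h
    obtain ⟨c, rfl⟩ := Nat.exists_eq_add_of_le hab
    by_contra hne
    refine hh_pow_ne_one (k := c) (by omega) ?_
    rw [pow_add] at h
    exact mul_left_cancel₀ (pow_ne_zero a hh_ne_zero) (by rw [← h, mul_one])
  intro a b h
  rcases le_total a b with hab | hab
  · exact key a b hab h
  · exact (key b a hab h.symm).symm

/-- `L̃_{k,k,+0}` counts the letters up to `k` in the exponent of `h`; multiplying by the inverse of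
its predecessor isolates the letters equal to `k`. -/
theorem hh_pow_wt_mem_eigAlg (k : Fin N) :
    (fun w : Word n N => algebraMap Ch (P n) (hh ^ (wt w).1 k)) ∈ eigAlg n N := by
  have hval : ∀ w : Word n N, algebraMap Ch (P n) (hh ^ (wt w).1 k) =
      ∏ a, if w a = k then algebraMap Ch (P n) hh else 1 := by
    intro w
    rw [← Finset.prod_filter, Finset.prod_const, ← map_pow]; rfl
  simp only [hval]
  have hL : ∀ j : Fin N, (fun w : Word n N =>
      ∏ a, if w a ≤ j then algebraMap Ch (P n) hh else 1) ∈ eigAlg n N := fun j =>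
    ⟨_, Algebra.subset_adjoin (Or.inl ⟨j, Or.inl rfl⟩), hasEig_L j⟩
  have hL' : ∀ j : Fin N, (fun w : Word n N =>
      ∏ a, if w a ≤ j then algebraMap Ch (P n) hh⁻¹ else 1) ∈ eigAlg n N := fun j =>
    ⟨_, Algebra.subset_adjoin (Or.inl ⟨j, Or.inr rfl⟩), hasEig_Linv j⟩
  by_cases hk : k.val = 0
  · convert hL k using 4 with w
    refine ⟨fun h => h.le, fun h => Fin.ext ?_⟩
    have : (w _).val ≤ k.val := h
    omega
  · convert mul_mem (hL k) (hL' ⟨k.val - 1, by omega⟩) using 1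
    funext w
    rw [Pi.mul_apply, ← Finset.prod_mul_distrib]
    refine Finset.prod_congr rfl fun a _ => ?_
    have hk' : w a ≤ ⟨k.val - 1, by omega⟩ ↔ (w a).val ≤ k.val - 1 := Iff.rfl
    rw [if_congr hk' rfl rfl]
    rcases lt_trichotomy (w a) k with h | h | h
    · have h1 : (w a).val < k.val := h
      rw [if_neg h.ne, if_pos h.le, if_pos (show (w a).val ≤ k.val - 1 by omega), ← map_mul,
        mul_inv_cancel₀ hh_ne_zero, map_one]
    · rw [if_pos h, if_pos h.le, if_neg (show ¬ (w a).val ≤ k.val - 1 by rw [h]; omega), mul_one]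
    · have h1 : k.val < (w a).val := h
      rw [if_neg h.ne', if_neg h.not_ge, if_neg (show ¬ (w a).val ≤ k.val - 1 by omega), mul_one]

/-- Lagrange interpolation: for each other weight some `λ_k` differs, the corresponding powers of
`h` differ too, and one factor vanishing at that weight is available. -/
theorem indicator_mem_eigAlg (l : Comp n N) :
    (fun w : Word n N => if wt w = l then (1 : P n) else 0) ∈ eigAlg n N := by
  have h1 : ∀ l' : Comp n N, ∃ f ∈ eigAlg n N, (∀ w, wt w = l → f w = 1) ∧
      (l' ≠ l → ∀ w, wt w = l' → f w = 0) := by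
    intro l'
    by_cases hl : l' = l
    · exact ⟨1, one_mem _, fun _ _ => rfl, fun h => absurd hl h⟩
    obtain ⟨k, hk⟩ : ∃ k, l'.1 k ≠ l.1 k := by
      by_contra! hc
      exact hl (Subtype.ext (funext hc))
    have hne : hh ^ l.1 k - hh ^ l'.1 k ≠ 0 :=
      sub_ne_zero.2 fun h => hk (hh_pow_injective h).symm
    refine ⟨(hh ^ l.1 k - hh ^ l'.1 k)⁻¹ • ((fun w : Word n N =>
      algebraMap Ch (P n) (hh ^ (wt w).1 k)) - algebraMap Ch (Word n N → P n) (hh ^ l'.1 k)),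
      Subalgebra.smul_mem _ (sub_mem (hh_pow_wt_mem_eigAlg k) (Subalgebra.algebraMap_mem _ _)) _,
      ?_, ?_⟩
    · rintro w rfl
      rw [Pi.smul_apply, Pi.sub_apply, Pi.algebraMap_apply, ← map_sub, Algebra.smul_def, ← map_mul,
        inv_mul_cancel₀ hne, map_one]
    · rintro - w rfl
      rw [Pi.smul_apply, Pi.sub_apply, Pi.algebraMap_apply, sub_self, smul_zero]
  choose f hf hf1 hf0 using h1
  have : (fun w : Word n N => if wt w = l then (1 : P n) else 0) = ∏ u : Word n N, f (wt u) := by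
    funext w
    rw [Finset.prod_apply]
    split_ifs with h
    · exact (Finset.prod_eq_one fun u _ => hf1 _ w h).symm
    · exact (Finset.prod_eq_zero (f := fun u => f (wt u) w) (Finset.mem_univ w)
        (hf0 (wt w) h w rfl)).symm
  rw [this]
  exact prod_mem fun u _ => hf _

/-- The group `S_λ`. -/
def stab (l : Comp n N) : Finset (Equiv.Perm (Fin n)) :=
  Finset.univ.filter fun σ => imin l ∘ σ = imin l

theorem mem_stab {l : Comp n N} {σ : Equiv.Perm (Fin n)} :
    σ ∈ stab l ↔ imin l ∘ σ = imin l := by simp [stab]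

theorem mul_mem_stab {l : Comp n N} {σ τ : Equiv.Perm (Fin n)} (hσ : σ ∈ stab l)
    (hτ : τ ∈ stab l) : σ * τ ∈ stab l := by
  rw [mem_stab] at hσ hτ ⊢
  show (imin l ∘ σ) ∘ τ = _
  rw [hσ, hτ]

theorem inv_mem_stab {l : Comp n N} {σ : Equiv.Perm (Fin n)} (hσ : σ ∈ stab l) :
    σ⁻¹ ∈ stab l := by
  rw [mem_stab] at hσ ⊢
  conv_lhs => rw [← hσ]
  funext a
  exact congr_arg (imin l) (σ.apply_symm_apply a)

/-- The sum over the group `S_λ` of the transforms of a Laurent polynomial. -/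
def symSum (l : Comp n N) (f : P n) : P n := ∑ σ ∈ stab l, permP σ f

theorem symSum_permP (l : Comp n N) (f : P n) {τ : Equiv.Perm (Fin n)}
    (hτ : imin l ∘ τ = imin l) : symSum l (permP τ f) = symSum l f := by
  rw [← mem_stab] at hτ
  exact Finset.sum_bij (fun σ _ => σ * τ) (fun σ hσ => mul_mem_stab hσ hτ)
    (fun a _ b _ h => mul_right_cancel h)
    (fun σ hσ => ⟨σ * τ⁻¹, mul_mem_stab hσ (inv_mem_stab hτ), inv_mul_cancel_right _ _⟩)
    fun σ _ => (permP_mul σ τ f).symm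

theorem symSum_of_mem {l : Comp n N} {f : P n} (hf : f ∈ symL l) :
    symSum l f = ((stab l).card : Ch) • f := by
  rw [symSum, Finset.sum_congr rfl fun σ hσ => hf σ (mem_stab.1 hσ), Finset.sum_const,
    Nat.cast_smul_eq_nsmul]

theorem symSum_mul_of_mem {l : Comp n N} {f g : P n} (hg : g ∈ symL l) :
    symSum l (f * g) = symSum l f * g := by
  rw [symSum, symSum, Finset.sum_mul]
  refine Finset.sum_congr rfl fun σ hσ => ?_
  rw [map_mul, hg σ (mem_stab.1 hσ)]

theorem symSum_add (l : Comp n N) (f g : P n) : symSum l (f + g) = symSum l f + symSum l g := by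
  simp only [symSum, map_add, Finset.sum_add_distrib]

theorem symSum_sum {ι : Type*} (l : Comp n N) (s : Finset ι) (f : ι → P n) :
    symSum l (∑ i ∈ s, f i) = ∑ i ∈ s, symSum l (f i) := by
  simp only [symSum, map_sum]
  exact Finset.sum_comm

theorem symSum_smul (l : Comp n N) (c : Ch) (f : P n) : symSum l (c • f) = c • symSum l f := by
  simp only [symSum, map_smul, Finset.smul_sum]

theorem symSum_mem (l : Comp n N) (f : P n) : symSum l f ∈ symL l := by
  intro τ hτ
  rw [← mem_stab] at hτ
  rw [symSum, map_sum]
  exact Finset.sum_bij (fun σ _ => τ * σ) (fun σ hσ => mul_mem_stab hτ hσ)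
    (fun a _ b _ h => mul_left_cancel h)
    (fun σ hσ => ⟨τ⁻¹ * σ, mul_mem_stab (inv_mem_stab hτ) hσ, mul_inv_cancel_left _ _⟩)
    fun σ _ => (permP_mul τ σ f).symm

theorem card_stab_ne_zero (l : Comp n N) : ((stab l).card : Ch) ≠ 0 := by
  rw [Nat.cast_ne_zero, ← Nat.pos_iff_ne_zero, Finset.card_pos]
  exact ⟨1, mem_stab.2 rfl⟩

/-- The values at `I^min` of the eigenvalue families of the Gelfand–Zetlin algebra. -/
def eigAlgAt (l : Comp n N) : Subalgebra Ch (P n) :=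
  (eigAlg n N).map (Pi.evalAlgHom Ch (fun _ : Word n N => P n) (imin l))

theorem eigAlg_le_symFam : eigAlg n N ≤ symFam n N := fun _ ⟨_, _, h⟩ => h.mem_symFam

/-- Power sums generate the invariants, by induction on the number of variables in the monomial.
Remove the variable `i` with its exponent `e`, symmetrize the rest, and multiply by the power sum of
degree `e` in the block of `i`. The terms where `e` falls on a variable already present involve
fewer variables. All others equal the wanted sum, and their number is invertible in characteristic
zero. -/
theorem symSum_single_mem (l : Comp n N) (m : Fin n →₀ ℤ) :
    symSum l (AddMonoidAlgebra.single m 1) ∈ eigAlgAt l := by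
  induction h : m.support.card using Nat.strong_induction_on generalizing m with
  | _ c ih =>
    by_cases hm : m = 0
    · subst hm
      have h1 : (AddMonoidAlgebra.single 0 1 : P n) = 1 := rfl
      rw [h1, symSum_of_mem (one_mem _)]
      exact Subalgebra.smul_mem _ (one_mem _) _
    obtain ⟨i, hi⟩ := Finsupp.support_nonempty_iff.2 hm
    obtain ⟨e, he⟩ : ∃ e, m i = e := ⟨_, rfl⟩
    have hmi : e ≠ 0 := he ▸ Finsupp.mem_support_iff.1 hi
    set m' := m.erase i with hm'
    have hdec : m' + Finsupp.single i e = m := he ▸ Finsupp.erase_add_single i m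
    have hs' : m'.support = m.support.erase i := Finsupp.support_erase
    have hcard : m'.support.card + 1 = c := by
      rw [hs', Finset.card_erase_add_one hi, h]
    have hbmem : blockSum (imin l i) e (imin l) ∈ eigAlgAt l :=
      ⟨_, blockSum_mem_eigAlg _ hmi, rfl⟩
    have hbsym : blockSum (imin l i) e (imin l) ∈ symL l :=
      symFam_imin_mem (eigAlg_le_symFam (blockSum_mem_eigAlg (imin l i) hmi)) l
    have key : symSum l (AddMonoidAlgebra.single m' 1) * blockSum (imin l i) e (imin l) =
        ∑ b with imin l b = imin l i,
          symSum l (AddMonoidAlgebra.single (m' + Finsupp.single b e) 1) := by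
      rw [← symSum_mul_of_mem hbsym, blockSum, ← Finset.sum_filter, Finset.mul_sum, symSum_sum]
      refine Finset.sum_congr rfl fun b _ => ?_
      rw [AddMonoidAlgebra.single_mul_single, mul_one]
    rw [← Finset.sum_filter_add_sum_filter_not _ fun b => b ∉ m'.support] at key
    have hlow : ∑ b ∈ (Finset.univ.filter fun b => imin l b = imin l i) with ¬ b ∉ m'.support,
        symSum l (AddMonoidAlgebra.single (m' + Finsupp.single b e) 1) ∈ eigAlgAt l := by
      refine sum_mem fun b hb => ih _ ?_ _ rfl
      have hb' : b ∈ m'.support := not_not.1 (Finset.mem_filter.1 hb).2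
      have hsub : (m' + Finsupp.single b e).support ⊆ m'.support := by
        refine Finsupp.support_add.trans (Finset.union_subset subset_rfl ?_)
        exact Finsupp.support_single_subset.trans (Finset.singleton_subset_iff.2 hb')
      have := Finset.card_le_card hsub
      omega
    have hhigh : ∑ b ∈ (Finset.univ.filter fun b => imin l b = imin l i) with b ∉ m'.support,
        symSum l (AddMonoidAlgebra.single (m' + Finsupp.single b e) 1) =
        (((Finset.univ.filter fun b => imin l b = imin l i).filter
          fun b => b ∉ m'.support).card : Ch) • symSum l (AddMonoidAlgebra.single m 1) := by
      rw [Nat.cast_smul_eq_nsmul, ← Finset.sum_const]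
      refine Finset.sum_congr rfl fun b hb => ?_
      obtain ⟨hb1, hb2⟩ := Finset.mem_filter.1 hb
      have hb3 : imin l b = imin l i := (Finset.mem_filter.1 hb1).2
      -- The transposition of `i` and `b` lies in `S_λ` and turns the original monomial into the one
      -- with exponent `e` at `b`.
      have hτ : imin l ∘ ⇑(Equiv.swap i b) = imin l := by
        funext a
        rw [Function.comp_apply]
        by_cases h1 : a = i
        · rw [h1, Equiv.swap_apply_left, hb3]
        · by_cases h2 : a = b
          · rw [h2, Equiv.swap_apply_right, hb3]
          · rw [Equiv.swap_apply_of_ne_of_ne h1 h2]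
      rw [← symSum_permP l (AddMonoidAlgebra.single m 1) hτ, permP_single]
      congr 2
      have h0i : m' i = 0 := by rw [hm']; exact Finsupp.erase_same
      have h0b : m' b = 0 := Finsupp.notMem_support_iff.1 hb2
      ext a
      rw [Finsupp.equivMapDomain_apply, ← hdec, Finsupp.add_apply, Finsupp.add_apply,
        Equiv.symm_swap]
      by_cases h1 : a = i
      · rw [h1, Equiv.swap_apply_left, h0i, h0b]
        by_cases h4 : i = b
        · rw [h4]
        · rw [Finsupp.single_eq_of_ne h4, Finsupp.single_eq_of_ne (Ne.symm h4)]
      · by_cases h2 : a = b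
        · rw [h2, Equiv.swap_apply_right, h0i, h0b, Finsupp.single_eq_same, Finsupp.single_eq_same]
        · rw [Equiv.swap_apply_of_ne_of_ne h1 h2, Finsupp.single_eq_of_ne h1,
            Finsupp.single_eq_of_ne h2]
    rw [hhigh] at key
    have hc0 : (((Finset.univ.filter fun b => imin l b = imin l i).filter
          fun b => b ∉ m'.support).card : Ch) ≠ 0 := by
      rw [Nat.cast_ne_zero, ← Nat.pos_iff_ne_zero, Finset.card_pos]
      refine ⟨i, ?_⟩
      rw [hs']
      simp
    have hmem := sub_mem (mul_mem (ih _ (by omega) m' rfl) hbmem) hlow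
    rw [key, add_sub_cancel_right] at hmem
    have := Subalgebra.smul_mem _ hmem (((Finset.univ.filter fun b =>
      imin l b = imin l i).filter fun b => b ∉ m'.support).card : Ch)⁻¹
    rwa [inv_smul_smul₀ hc0] at this

theorem symL_le_eigAlgAt (l : Comp n N) : symL l ≤ eigAlgAt l := by
  have h1 : ∀ g : P n, symSum l g ∈ eigAlgAt l := by
    intro g
    induction g using AddMonoidAlgebra.induction_linear with
    | zero => simp [symSum, zero_mem]
    | add f g hf hg => rw [symSum_add]; exact add_mem hf hg
    | single m c =>
      rw [show (AddMonoidAlgebra.single m c : P n) = c • AddMonoidAlgebra.single m 1 by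
        rw [AddMonoidAlgebra.smul_single, smul_eq_mul, mul_one], symSum_smul]
      exact Subalgebra.smul_mem _ (symSum_single_mem l m) c
  intro g hg
  have := Subalgebra.smul_mem _ (h1 g) ((stab l).card : Ch)⁻¹
  rwa [symSum_of_mem hg, inv_smul_smul₀ (card_stab_ne_zero l)] at this

/-- For each weight the prescribed value at `I^min` is attained separately; the indicators of the
weights glue these solutions. -/
theorem exists_mem_GZ {e : Word n N → P n} (he : e ∈ symFam n N) :
    ∃ X ∈ GZ N, HasEig X e := by
  have h1 : ∀ l : Comp n N, ∃ f ∈ eigAlg n N, f (imin l) = e (imin l) := fun l =>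
    symL_le_eigAlgAt l (symFam_imin_mem he l)
  choose f hf hfe using h1
  have h2 : e = ∑ l ∈ Finset.univ.image (wt : Word n N → Comp n N),
      (fun w : Word n N => if wt w = l then (1 : P n) else 0) * f l := by
    funext w
    rw [Finset.sum_apply, Finset.sum_eq_single (wt w)]
    · rw [Pi.mul_apply, if_pos rfl, one_mul]
      exact symFam_ext he (eigAlg_le_symFam (hf _)) (hfe _).symm rfl
    · intro l _ hl
      rw [Pi.mul_apply, if_neg hl.symm, zero_mul]
    · intro h
      exact absurd (Finset.mem_image_of_mem _ (Finset.mem_univ w)) h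
  show e ∈ eigAlg n N
  rw [h2]
  exact sum_mem fun l _ => mul_mem (indicator_mem_eigAlg l) (hf l)

end Families
-- Coordinates of invariant vectors, starting from `I^max`.
section Descent

variable {n N : ℕ}

theorem antitone_imax (l : Comp n N) : Antitone (imax l) := fun _ _ h =>
  monotone_imin l (Fin.rev_le_rev.2 h)

theorem imax_comp_rev (l : Comp n N) : imax l ∘ Fin.revPerm = imin l := by
  funext a
  simp [imax]

theorem imin_comp_rev (l : Comp n N) : imin l ∘ Fin.revPerm = imax l := rfl

theorem wt_imax (l : Comp n N) : wt (imax l) = l := by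
  rw [← imin_comp_rev, wt_comp, wt_imin]

theorem eq_imax_of_antitone {w : Word n N} (h : Antitone w) : w = imax (wt w) := by
  have h1 : Monotone (w ∘ Fin.revPerm) := fun a b hab => h (Fin.rev_le_rev.2 hab)
  have h2 := eq_of_monotone h1 (monotone_imin (wt w)) (by rw [wt_comp, wt_imin])
  funext a
  have := congr_fun h2 (Fin.rev a)
  simpa [imax] using this

/-- The number of pairs of positions in increasing order. -/
def coinv (w : Word n N) : ℕ := (invSet (OrderDual.toDual ∘ w)).card

theorem coinv_comp_s_of_gt {w : Word n N} {i : Adj n} (h : w i.next < w i.1) :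
    coinv (w ∘ i.s) = coinv w + 1 :=
  card_invSet_comp_s (OrderDual.toDual ∘ w) i (OrderDual.toDual_lt_toDual.2 h)

theorem coinv_comp_s_of_lt {w : Word n N} {i : Adj n} (h : w i.1 < w i.next) :
    coinv w = coinv (w ∘ i.s) + 1 := by
  have := coinv_comp_s_of_gt (w := w ∘ i.s) (i := i) (by
    rw [Function.comp_apply, Function.comp_apply, i.s_left, i.s_right]; exact h)
  rwa [i.comp_s_s] at this

theorem coinv_imax (l : Comp n N) : coinv (imax l) = 0 := by
  rw [coinv, Finset.card_eq_zero]
  exact Finset.filter_eq_empty_iff.2 fun p _ hp =>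
    (antitone_imax l hp.1.le).not_gt (OrderDual.toDual_lt_toDual.1 hp.2)

theorem exists_adj_of_not_antitone {w : Word n N} (h : ¬ Antitone w) :
    ∃ i : Adj n, w i.1 < w i.next := by
  obtain ⟨i, hi⟩ := exists_adj_of_not_monotone (w := OrderDual.toDual ∘ w)
    fun hm => h fun a b hab => OrderDual.toDual_le_toDual.1 (hm hab)
  exact ⟨i, OrderDual.toDual_lt_toDual.1 hi⟩

/-- Every word is obtained from the weakly decreasing one by descending transpositions. -/
theorem word_induction_desc {p : Word n N → Prop} (h0 : ∀ l, p (imax l))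
    (hs : ∀ (i : Adj n) (w : Word n N), w i.next < w i.1 → p w → p (w ∘ i.s)) (w : Word n N) :
    p w := by
  by_cases hm : Antitone w
  · rw [eq_imax_of_antitone hm]
    exact h0 _
  · obtain ⟨i, hi⟩ := exists_adj_of_not_antitone hm
    have hlt : (w ∘ i.s) i.next < (w ∘ i.s) i.1 := by
      rw [Function.comp_apply, Function.comp_apply, i.s_left, i.s_right]; exact hi
    have hcard' : coinv (w ∘ i.s) < coinv w := by
      rw [coinv_comp_s_of_lt hi]; exact Nat.lt_succ_self _
    have := hs i (w ∘ i.s) hlt (word_induction_desc h0 hs (w ∘ i.s))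
    rwa [i.comp_s_s] at this
termination_by coinv w
decreasing_by exact hcard'

theorem below_imax (w : Word n N) : Below w (imax (wt w)) := by
  refine word_induction_desc (p := fun w => Below w (imax (wt w))) (fun l => ?_)
    (fun i u hu h => ?_) w
  · rw [wt_imax]; exact Below.refl _
  · rw [wt_comp]
    have h1 : (u ∘ i.s) i.1 < (u ∘ i.s) i.next := by
      rw [Function.comp_apply, Function.comp_apply, i.s_left, i.s_right]; exact hu
    have h2 := Below.comp_s_or i h1 (Or.inl (Below.refl _))
    rw [i.comp_s_s] at h2
    exact h2.trans h

/-- The word of `I^max` is the top of the Bruhat order, so among the `ξ_I` only `ξ_{I^max}` has a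
nonzero coordinate there. -/
theorem xi_apply_imax {l : Comp n N} {w : Word n N} (hw : wt w = l) (hne : w ≠ imax l) :
    xi w (imax l) = 0 := by
  by_contra h
  subst hw
  exact hne ((below_imax w).antisymm ((isXiVec_xi w).supp _ h))

theorem exists_wordAct (w : Word n N) :
    ∃ js : List (Adj n), wordAct js (imax (wt w)) = w ∧ js.length = coinv w := by
  refine word_induction_desc (p := fun w => ∃ js : List (Adj n),
    wordAct js (imax (wt w)) = w ∧ js.length = coinv w) (fun l => ?_) (fun i u hu h => ?_) w
  · exact ⟨[], by rw [wt_imax]; rfl, (coinv_imax l).symm⟩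
  · obtain ⟨js, h1, h2⟩ := h
    refine ⟨i :: js, ?_, ?_⟩
    · rw [wt_comp]
      show (wordAct js (imax (wt u))) ∘ i.s = _
      rw [h1]
    · rw [List.length_cons, h2, coinv_comp_s_of_gt hu]

theorem coinv_comp_s_le (w : Word n N) (i : Adj n) : coinv (w ∘ i.s) ≤ coinv w + 1 := by
  rcases lt_trichotomy (w i.1) (w i.next) with h | h | h
  · have := coinv_comp_s_of_lt h; omega
  · rw [i.comp_s_of_eq h]; omega
  · rw [coinv_comp_s_of_gt h]

theorem coinv_wordAct_le (js : List (Adj n)) (l : Comp n N) :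
    coinv (wordAct js (imax l)) ≤ js.length := by
  induction js with
  | nil => exact (coinv_imax l).le
  | cons i js ih =>
    refine (coinv_comp_s_le _ i).trans ?_
    rw [List.length_cons]
    exact Nat.add_le_add_right ih 1

/-- The length condition forces each letter of `js` to create exactly one new ascending pair, so
every step is of the kind covered by `hv`. Since the left side does not involve `js` beyond its
endpoint, independence of the reduced presentation comes for free. -/
theorem hatAct_eq {l : Comp n N} {v : V n N}
    (hv : ∀ (i : Adj n) (w : Word n N), w i.next < w i.1 → v (w ∘ i.s) = sHat i (v w)) :
    ∀ js : List (Adj n), js.length ≤ coinv (wordAct js (imax l)) →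
      v (wordAct js (imax l)) = hatAct js (v (imax l)) := by
  intro js
  induction js with
  | nil => intro _; rfl
  | cons i js ih =>
    intro h
    have h' : js.length + 1 ≤ coinv (wordAct js (imax l) ∘ i.s) := h
    have h1 := coinv_wordAct_le js l
    have h2 : wordAct js (imax l) i.next < wordAct js (imax l) i.1 := by
      rcases lt_trichotomy (wordAct js (imax l) i.1) (wordAct js (imax l) i.next) with h3 | h3 | h3
      · have := coinv_comp_s_of_lt h3; omega
      · rw [i.comp_s_of_eq h3] at h'; omega
      · exact h3
    rw [coinv_comp_s_of_gt h2] at h'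
    show v (wordAct js (imax l) ∘ i.s) = sHat i (hatAct js (v (imax l)))
    rw [hv i _ h2, ih (by omega)]

theorem IsReducedFor.eval {w : Word n N} {js : List (Adj n)} (h : IsReducedFor js w) {v : V n N}
    (hv : ∀ (i : Adj n) (w : Word n N), w i.next < w i.1 → v (w ∘ i.s) = sHat i (v w)) :
    v w = hatAct js (v (imax (wt w))) := by
  obtain ⟨js', h1, h2⟩ := exists_wordAct w
  have h3 := h.2 js' h1
  have := hatAct_eq (l := wt w) hv js (by rw [h.1]; omega)
  rwa [h.1] at this

/-- At a descending word the invariance equation involves only the coordinates `w` and `w ∘ i.s`.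
Solving it for the latter produces `ŝ_i`. -/
theorem sHat_of_invariant {v : V n N} {i : Adj n} (hv : sTilde i v = v) {w : Word n N}
    (hw : w i.next < w i.1) : v (w ∘ i.s) = sHat i (v w) := by
  have h := congr_fun hv w
  rw [sTilde_apply_gt i v hw] at h
  have h1 := congr_arg (permK i.s) h
  simp only [map_mul, map_add, map_sub, map_inv₀, permK_s_s, permK_z, permK_hK, i.s_left,
      i.s_right, map_one] at h1
  have h2 : (z i.1 : K n) - hK n * z i.next ≠ 0 := z_sub_hz_ne_zero i.ne
  have h3 : (z i.1 : K n) - z i.next ≠ 0 := z_sub_z_ne_zero i.ne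
  rw [inv_mul_eq_iff_eq_mul₀ h2] at h1
  have h4 := z_ne_zero i.1
  have h5 : 1 - z i.next / z i.1 = ((z i.1 : K n) - z i.next) / z i.1 := by
    rw [sub_div, div_self h4]
  have h6 : 1 - hK n * (z i.next / z i.1) = ((z i.1 : K n) - hK n * z i.next) / z i.1 := by
    rw [sub_div, div_self h4, mul_div_assoc]
  rw [sHat, h5, h6]
  field_simp
  linear_combination h1

end Descent

/-! ### Invariant vectors in the basis `ξ_I`. -/

section Invariants

variable {n N : ℕ}

theorem permK_Rf (i : Adj n) (w : Word n N) : permK i.s (Rf w) = Rf (w ∘ i.s) := by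
  unfold Rf
  rw [map_prod, ← Equiv.prod_comp i.s]
  refine Finset.prod_congr rfl fun a _ => ?_
  rw [map_prod, ← Equiv.prod_comp i.s]
  refine Finset.prod_congr rfl fun b _ => ?_
  rw [apply_ite (permK i.s), map_sub, map_div₀, map_one, permK_z, permK_z, i.s_s, i.s_s]
  rfl

theorem one_sub_div_ne_zero {a b : Fin n} (h : a ≠ b) : (1 : K n) - z b / z a ≠ 0 := by
  rw [← div_self (z_ne_zero a), ← sub_div]
  exact div_ne_zero (z_sub_z_ne_zero h) (z_ne_zero a)

theorem one_sub_h_div_ne_zero {a b : Fin n} (h : a ≠ b) : (1 : K n) - hK n * (z b / z a) ≠ 0 := by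
  rw [← div_self (z_ne_zero a), ← mul_div_assoc, ← sub_div]
  exact div_ne_zero (z_sub_hz_ne_zero h) (z_ne_zero a)

theorem Rf_ne_zero (w : Word n N) : Rf w ≠ 0 := by
  refine Finset.prod_ne_zero_iff.2 fun a _ => Finset.prod_ne_zero_iff.2 fun b _ => ?_
  split_ifs with h
  · exact one_sub_div_ne_zero fun hab => by rw [hab] at h; exact lt_irrefl _ h
  · exact one_ne_zero

theorem Qf_ne_zero (w : Word n N) : Qf w ≠ 0 := by
  refine Finset.prod_ne_zero_iff.2 fun a _ => Finset.prod_ne_zero_iff.2 fun b _ => ?_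
  split_ifs with h
  · exact one_sub_h_div_ne_zero fun hab => by rw [hab] at h; exact lt_irrefl _ h
  · exact one_ne_zero

theorem prod_lt_imax (l : Comp n N) (f : Fin n → Fin n → K n) :
    ∏ a, ∏ b, (if imax l a < imax l b then f a b else 1) = ∏ p ∈ invSet (imax l), f p.2 p.1 := by
  rw [invSet, Finset.prod_filter, Fintype.prod_prod_type, Finset.prod_comm]
  refine Finset.prod_congr rfl fun a _ => Finset.prod_congr rfl fun b _ => if_congr ?_ rfl rfl
  exact ⟨fun h => ⟨not_le.1 fun hba => (antitone_imax l hba).not_gt h, h⟩, fun h => h.2⟩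

/-- In `I^max` every pair of positions with different letters is an inversion, so the diagonal
coefficient contains all factors of `R` and `Q`. This is where the two denominators in the formulas
for `θ_λ` meet. -/
theorem leadCoeff_imax (l : Comp n N) : leadCoeff (imax l) = Rf (imax l) / Qf (imax l) := by
  rw [Rf, Qf, prod_lt_imax, prod_lt_imax l fun a b => 1 - hK n * (z b / z a),
    ← Finset.prod_div_distrib]
  refine Finset.prod_congr rfl fun p _ => ?_
  have h := z_ne_zero p.2
  rw [← div_self h, ← mul_div_assoc, ← sub_div, ← sub_div, div_div_div_cancel_right₀ h]

/-- The vector `∑_I (e_I / R(z_I)) ξ_I`. -/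
def vecOf (e : Word n N → P n) : V n N := ∑ w, (algebraMap (P n) (K n) (e w) / Rf w) • xi w

theorem vecOf_add (e e' : Word n N → P n) : vecOf (e + e') = vecOf e + vecOf e' := by
  simp only [vecOf, Pi.add_apply, map_add, add_div, add_smul, Finset.sum_add_distrib]

theorem vecOf_smul (c : P n) (e : Word n N → P n) : vecOf (c • e) = c • vecOf e := by
  simp only [vecOf, Finset.smul_sum, Pi.smul_apply, smul_eq_mul, map_mul, mul_div_assoc, mul_smul,
    algebraMap_smul]

/-- `e ↦ ∑_I (e_I / R(z_I)) ξ_I` as a linear map. -/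
def vecHom (n N : ℕ) : (Word n N → P n) →ₗ[P n] V n N where
  toFun := vecOf
  map_add' := vecOf_add
  map_smul' := vecOf_smul

theorem vecOf_injective : Function.Injective (vecOf : (Word n N → P n) → V n N) := by
  refine (injective_iff_map_eq_zero (vecHom n N)).2 fun e he => ?_
  have := Fintype.linearIndependent_iff.1 linearIndependent_xi _ he
  funext w
  have h1 := (div_eq_zero_iff.1 (this w)).resolve_right (Rf_ne_zero w)
  exact (map_eq_zero_iff _ (IsFractionRing.injective (P n) (K n))).1 h1

theorem sum_comp_s (i : Adj n) (f : Word n N → V n N) : ∑ w, f (w ∘ i.s) = ∑ w, f w :=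
  Fintype.sum_bijective (fun w : Word n N => w ∘ i.s)
    (Function.Involutive.bijective fun w => i.comp_s_s w) _ _ fun _ => rfl

theorem sTilde_vecOf {e : Word n N → P n} (he : e ∈ symFam n N) (i : Adj n) :
    sTilde i (vecOf e) = vecOf e := by
  rw [vecOf, sTilde_sum, ← sum_comp_s i]
  refine Finset.sum_congr rfl fun w _ => ?_
  rw [sTilde_smul, ← xi_comp_s, i.comp_s_s, map_div₀, permK_algebraMap, he, permK_Rf, i.comp_s_s]

theorem repr_comp_s {v : V n N} {i : Adj n} (hv : sTilde i v = v) (w : Word n N) :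
    (xiBasis n N).repr v (w ∘ i.s) = permK i.s ((xiBasis n N).repr v w) := by
  have h1 : v = ∑ w, permK i.s ((xiBasis n N).repr v (w ∘ i.s)) • xi w := by
    conv_lhs => rw [← hv, ← sum_repr_xi v]
    rw [sTilde_sum, ← sum_comp_s i]
    refine Finset.sum_congr rfl fun w _ => ?_
    rw [sTilde_smul, ← xi_comp_s, i.comp_s_s]
  have h2 := congr_arg (fun x => (xiBasis n N).repr x (w ∘ i.s)) h1
  simp only [← xiBasis_apply] at h2
  rw [(xiBasis n N).repr_sum_self, i.comp_s_s] at h2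
  exact h2

/-- The `s̃_i` permute the basis and act on scalars by permuting variables, so the coefficients of
an invariant vector are equivariant. -/
theorem repr_comp_perm {v : V n N} (hv : ∀ i : Adj n, sTilde i v = v)
    (σ : Equiv.Perm (Fin n)) (w : Word n N) :
    permK σ ((xiBasis n N).repr v (w ∘ σ)) = (xiBasis n N).repr v w := by
  refine perm_induction (p := fun σ => ∀ w, permK σ ((xiBasis n N).repr v (w ∘ σ)) =
    (xiBasis n N).repr v w) (fun w => permK_one _) (fun i τ h w => ?_) σ w
  have h2 := h (w ∘ i.s)
  rw [permK_mul]
  have h3 : w ∘ ⇑(i.s * τ) = (w ∘ i.s) ∘ τ := rfl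
  rw [h3, h2, ← repr_comp_s (hv i), i.comp_s_s]

end Invariants
-- Laurent polynomials among the rational functions, and the denominator `D`.
section Regular

variable {n : ℕ}

theorem single_mem_of_var_mem {S : Subalgebra Ch (P n)} (hz : ∀ i, zP i ∈ S) (hzi : ∀ i, ziP i ∈ S)
    (m : Fin n →₀ ℤ) : (AddMonoidAlgebra.single m 1 : P n) ∈ S := by
  induction m using Finsupp.induction_linear with
  | zero => exact one_mem S
  | add f g hf hg =>
    rw [show (AddMonoidAlgebra.single (f + g) 1 : P n) =
      AddMonoidAlgebra.single f 1 * AddMonoidAlgebra.single g 1 by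
        rw [AddMonoidAlgebra.single_mul_single, mul_one]]
    exact mul_mem hf hg
  | single a m =>
    rcases le_total 0 m with h | h
    · obtain ⟨k, rfl⟩ := Int.eq_ofNat_of_zero_le h
      have : (AddMonoidAlgebra.single (Finsupp.single a (k : ℤ)) 1 : P n) = zP a ^ k := by
        have := signedVar_pow .minus a k
        simpa [Sgn.toInt, signedVar] using this.symm
      rw [this]
      exact pow_mem (hz a) k
    · obtain ⟨k, hk⟩ := Int.eq_ofNat_of_zero_le (neg_nonneg.2 h)
      obtain rfl : m = -(k : ℤ) := by omega
      have : (AddMonoidAlgebra.single (Finsupp.single a (-(k : ℤ))) 1 : P n) = ziP a ^ k := by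
        have := signedVar_pow .plus a k
        simpa [Sgn.toInt, signedVar] using this.symm
      rw [this]
      exact pow_mem (hzi a) k

theorem single_eq_smul (m : Fin n →₀ ℤ) (c : Ch) :
    (AddMonoidAlgebra.single m c : P n) = c • AddMonoidAlgebra.single m 1 := by
  rw [AddMonoidAlgebra.smul_single, smul_eq_mul, mul_one]

theorem eq_top_of_var_mem {S : Subalgebra Ch (P n)} (hz : ∀ i, zP i ∈ S) (hzi : ∀ i, ziP i ∈ S) :
    S = ⊤ := by
  refine eq_top_iff.2 fun f _ => ?_
  induction f using AddMonoidAlgebra.induction_linear with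
  | zero => exact zero_mem S
  | add f g hf hg => exact add_mem (hf trivial) (hg trivial)
  | single m c =>
    rw [single_eq_smul]
    exact Subalgebra.smul_mem _ (single_mem_of_var_mem hz hzi m) c

/-- The Laurent polynomials `f` for which `s_i(f) - f` is divisible by `z_i - z_{i+1}`. -/
def divDiffAlg (i : Adj n) : Subalgebra Ch (P n) where
  carrier := {f | zP i.1 - zP i.next ∣ permP i.s f - f}
  mul_mem' {f g} hf hg := by
    have this : permP i.s (f * g) - f * g =
        (permP i.s f - f) * permP i.s g + f * (permP i.s g - g) := by
      rw [map_mul]; ring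
    change (zP i.1 - zP i.next : P n) ∣ _
    rw [this]
    exact dvd_add (Dvd.dvd.mul_right hf _) (Dvd.dvd.mul_left hg _)
  add_mem' {f g} hf hg := by
    have : permP i.s (f + g) - (f + g) = (permP i.s f - f) + (permP i.s g - g) := by
      rw [map_add]; ring
    change (zP i.1 - zP i.next : P n) ∣ _
    rw [this]
    exact dvd_add hf hg
  algebraMap_mem' c := by
    change (zP i.1 - zP i.next : P n) ∣ _
    rw [AlgEquiv.commutes, sub_self]
    exact dvd_zero _

theorem sub_dvd_permP_sub (i : Adj n) (f : P n) : zP i.1 - zP i.next ∣ permP i.s f - f := by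
  have hz : ∀ a, zP a ∈ divDiffAlg i := by
    intro a
    change (zP i.1 - zP i.next : P n) ∣ _
    rw [permP_zP]
    by_cases h1 : a = i.1
    · rw [h1, i.s_left]; exact ⟨-1, by ring⟩
    · by_cases h2 : a = i.next
      · rw [h2, i.s_right]
      · rw [i.s_of_ne h1 h2, sub_self]; exact dvd_zero _
  have hzi : ∀ a, ziP a ∈ divDiffAlg i := by
    intro a
    have h : permP i.s (ziP a) - ziP a =
        -(permP i.s (zP a) - zP a) * (ziP (i.s a) * ziP a) := by
      rw [permP_ziP, permP_zP]
      linear_combination ziP a * zP_mul_ziP (i.s a) - ziP (i.s a) * zP_mul_ziP a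
    change (zP i.1 - zP i.next : P n) ∣ _
    rw [h]
    exact Dvd.dvd.mul_right (Dvd.dvd.neg_right (hz a)) _
  have := eq_top_of_var_mem hz hzi
  exact (this ▸ Algebra.mem_top : f ∈ divDiffAlg i)

/-- The Laurent polynomials among the rational functions. -/
def regK (n : ℕ) : Subring (K n) := (algebraMap (P n) (K n)).range

theorem algebraMap_mem_regK (f : P n) : algebraMap (P n) (K n) f ∈ regK n := ⟨f, rfl⟩

theorem z_mem_regK (a : Fin n) : z a ∈ regK n := ⟨zP a, rfl⟩

theorem algebraMap_ziP (a : Fin n) : algebraMap (P n) (K n) (ziP a) = (z a)⁻¹ := by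
  rw [← algebraMap_zP]
  refine eq_inv_of_mul_eq_one_left ?_
  rw [← map_mul, mul_comm, zP_mul_ziP, map_one]

theorem z_inv_mem_regK (a : Fin n) : (z a)⁻¹ ∈ regK n := ⟨ziP a, algebraMap_ziP a⟩

theorem hK_mem_regK : hK n ∈ regK n := ⟨hP n, algebraMap_hP⟩

theorem algebraMap_Ch_mem_regK (c : Ch) : algebraMap Ch (K n) c ∈ regK n :=
  ⟨algebraMap Ch (P n) c, (IsScalarTower.algebraMap_apply Ch (P n) (K n) c).symm⟩

theorem one_sub_h_div_mem_regK (a b : Fin n) : 1 - hK n * (z b / z a) ∈ regK n := by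
  rw [div_eq_mul_inv]
  exact sub_mem (one_mem _) (mul_mem hK_mem_regK (mul_mem (z_mem_regK b) (z_inv_mem_regK a)))

theorem intLaurent_le_regK {x : K n} (hx : x ∈ intLaurent n) : x ∈ regK n := by
  refine Algebra.adjoin_induction (p := fun x _ => x ∈ regK n) ?_ ?_ (fun _ _ _ _ => add_mem)
    (fun _ _ _ _ => mul_mem) hx
  · rintro _ (⟨i, rfl | rfl⟩ | rfl | rfl)
    · exact z_mem_regK i
    · exact z_inv_mem_regK i
    · exact hK_mem_regK
    · rw [hK, ← map_inv₀]; exact algebraMap_Ch_mem_regK _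
  · intro c
    rw [IsScalarTower.algebraMap_apply ℂ Ch (K n)]
    exact algebraMap_Ch_mem_regK _

theorem z_mem_intLaurent (a : Fin n) : z a ∈ intLaurent n :=
  Algebra.subset_adjoin (Or.inl ⟨a, Or.inl rfl⟩)

theorem z_inv_mem_intLaurent (a : Fin n) : (z a)⁻¹ ∈ intLaurent n :=
  Algebra.subset_adjoin (Or.inl ⟨a, Or.inr rfl⟩)

theorem polynomial_mem_intLaurent (q : Polynomial ℂ) :
    algebraMap Ch (K n) (algebraMap (Polynomial ℂ) Ch q) ∈ intLaurent n := by
  have hh_mem : algebraMap Ch (K n) hh ∈ intLaurent n :=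
    Algebra.subset_adjoin (Or.inr (Or.inl rfl))
  induction q using Polynomial.induction_on' with
  | add p q hp hq => rw [map_add, map_add]; exact add_mem hp hq
  | monomial k c =>
    rw [← Polynomial.C_mul_X_pow_eq_monomial, map_mul, map_pow, RatFunc.algebraMap_X,
      RatFunc.algebraMap_C, map_mul, map_pow]
    refine mul_mem ?_ (pow_mem hh_mem k)
    have : algebraMap Ch (K n) (RatFunc.C c) = algebraMap ℂ (K n) c :=
      (IsScalarTower.algebraMap_apply ℂ Ch (K n) c).symm
    rw [this]
    exact Subalgebra.algebraMap_mem _ c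

/-- The Laurent polynomials that become integral after multiplication by a polynomial in `h`. -/
def clearable (n : ℕ) : Subalgebra Ch (P n) where
  carrier := {f | ∃ q : Polynomial ℂ, q ≠ 0 ∧
    algebraMap Ch (K n) (algebraMap (Polynomial ℂ) Ch q) * algebraMap (P n) (K n) f ∈ intLaurent n}
  mul_mem' := by
    rintro f g ⟨p, hp, hf⟩ ⟨q, hq, hg⟩
    refine ⟨p * q, mul_ne_zero hp hq, ?_⟩
    rw [map_mul, map_mul, map_mul, mul_mul_mul_comm]
    exact mul_mem hf hg
  add_mem' := by
    rintro f g ⟨p, hp, hf⟩ ⟨q, hq, hg⟩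
    refine ⟨p * q, mul_ne_zero hp hq, ?_⟩
    have h1 := add_mem (mul_mem (polynomial_mem_intLaurent q) hf)
      (mul_mem (polynomial_mem_intLaurent p) hg)
    rw [map_mul, map_mul, map_add]
    convert h1 using 1
    ring
  algebraMap_mem' c := by
    refine ⟨c.denom, c.denom_ne_zero, ?_⟩
    rw [← IsScalarTower.algebraMap_apply Ch (P n) (K n), ← map_mul]
    have h : algebraMap (Polynomial ℂ) Ch c.denom * c = algebraMap (Polynomial ℂ) Ch c.num := by
      conv_lhs => rw [← RatFunc.num_div_denom c]
      rw [RatFunc.num_div_denom c]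
      have hd : algebraMap (Polynomial ℂ) Ch c.denom ≠ 0 :=
        RatFunc.algebraMap_ne_zero c.denom_ne_zero
      rw [mul_comm, ← eq_div_iff hd, RatFunc.num_div_denom]
    rw [h]
    exact polynomial_mem_intLaurent _

theorem clearable_eq_top : clearable n = ⊤ := by
  refine eq_top_of_var_mem (fun i => ?_) fun i => ?_
  · refine ⟨1, one_ne_zero, ?_⟩
    rw [map_one, map_one, one_mul]
    exact z_mem_intLaurent i
  · refine ⟨1, one_ne_zero, ?_⟩
    rw [map_one, map_one, one_mul, algebraMap_ziP]
    exact z_inv_mem_intLaurent i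

/-- Finitely many elements have a common denominator in `h`; this bridges integral functions and
their `ℂ(h)`-span. -/
theorem exists_clear {ι : Type*} (s : Finset ι) (x : ι → K n) (hx : ∀ j ∈ s, x j ∈ regK n) :
    ∃ c : Ch, c ≠ 0 ∧ algebraMap Ch (K n) c ∈ intLaurent n ∧
      ∀ j ∈ s, algebraMap Ch (K n) c * x j ∈ intLaurent n := by
  classical
  induction s using Finset.induction_on with
  | empty => exact ⟨1, one_ne_zero, by rw [map_one]; exact one_mem _, by simp⟩
  | insert a s _ ih =>
    obtain ⟨c, hc, hc1, hc2⟩ := ih fun j hj => hx j (Finset.mem_insert_of_mem hj)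
    obtain ⟨f, hf⟩ := hx a (Finset.mem_insert_self a s)
    obtain ⟨q, hq, hqf⟩ : f ∈ clearable n := clearable_eq_top ▸ Algebra.mem_top
    refine ⟨c * algebraMap (Polynomial ℂ) Ch q, mul_ne_zero hc (RatFunc.algebraMap_ne_zero hq),
      ?_, fun j hj => ?_⟩
    · rw [map_mul]; exact mul_mem hc1 (polynomial_mem_intLaurent q)
    · rw [map_mul]
      rcases Finset.mem_insert.1 hj with rfl | hj
      · rw [mul_assoc, ← hf]; exact mul_mem hc1 hqf
      · rw [mul_right_comm]; exact mul_mem (hc2 j hj) (polynomial_mem_intLaurent q)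

/-- The pairs of positions in increasing order. -/
def ltPairs (n : ℕ) : Finset (Fin n × Fin n) := Finset.univ.filter fun p => p.1 < p.2

theorem Den_eq : Den n = ∏ p ∈ ltPairs n, (1 - hK n * (z p.1 / z p.2)) := by
  rw [Den, ltPairs, Finset.prod_filter, Fintype.prod_prod_type, Finset.prod_comm]

theorem permK_Den (i : Adj n) :
    permK i.s (Den n) * (1 - hK n * (z i.1 / z i.next)) =
      Den n * (1 - hK n * (z i.next / z i.1)) := by
  have hmem : (i.1, i.next) ∈ ltPairs n := Finset.mem_filter.2 ⟨Finset.mem_univ _, i.lt⟩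
  set E := ∏ p ∈ (ltPairs n).erase (i.1, i.next), (1 - hK n * (z p.1 / z p.2)) with hE
  have h1 : Den n = (1 - hK n * (z i.1 / z i.next)) * E := by
    rw [Den_eq, ← Finset.mul_prod_erase _ _ hmem]
  have hmaps : ∀ p ∈ (ltPairs n).erase (i.1, i.next), i.pairMap p ∈
      (ltPairs n).erase (i.1, i.next) := by
    intro p hp
    obtain ⟨hp1, hp2⟩ := Finset.mem_erase.1 hp
    have hp3 := (Finset.mem_filter.1 hp2).2
    refine Finset.mem_erase.2 ⟨fun h => ?_, Finset.mem_filter.2 ⟨Finset.mem_univ _,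
      i.s_lt_s (fun h => hp1 (Prod.ext h.1 h.2)) hp3⟩⟩
    obtain ⟨h2, h3⟩ := Prod.mk.inj h
    have h4 : p.1 = i.next := by rw [← i.s_s p.1, h2, i.s_left]
    have h5 : p.2 = i.1 := by rw [← i.s_s p.2, h3, i.s_right]
    rw [h4, h5] at hp3
    exact lt_asymm hp3 i.lt
  have h2 : permK i.s E = E := by
    rw [hE, map_prod]
    refine Finset.prod_bij (fun p _ => i.pairMap p) hmaps
      (fun p _ q _ hpq => i.pairMap.injective hpq)
      (fun p hp => ⟨i.pairMap p, hmaps p hp, Prod.ext (i.s_s _) (i.s_s _)⟩) fun p _ => ?_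
    simp only [map_div₀, map_sub, map_mul, permK_hK, permK_z, map_one]
    rfl
  rw [h1, map_mul, h2]
  simp only [map_div₀, map_sub, map_mul, permK_hK, permK_z, map_one, i.s_left, i.s_right]
  ring

/-- Put `f = D x`. Since `s_i` changes only one factor of `D`, the product `D ŝ_i x` equals
`z_i/(z_i - z_{i+1})` times `(1 - h z_i/z_{i+1}) s_i(f) + (h - 1) f`. The bracket vanishes at `z_i =
z_{i+1}`, because `s_i(f) - f` and `h - h z_i/z_{i+1}` do, so the pole cancels. -/
theorem Den_mul_sHat_mem (i : Adj n) {x : K n} (hx : Den n * x ∈ regK n) :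
    Den n * sHat i x ∈ regK n := by
  obtain ⟨f, hf⟩ := hx
  obtain ⟨q, hq⟩ := sub_dvd_permP_sub i f
  have hq' := congr_arg (algebraMap (P n) (K n)) hq
  rw [map_sub, map_mul, map_sub, ← permK_algebraMap, algebraMap_zP, algebraMap_zP, hf,
    map_mul] at hq'
  have h0 := permK_Den i
  have h1 : (z i.1 : K n) - z i.next ≠ 0 := z_sub_z_ne_zero i.ne
  have h2 := z_ne_zero i.1
  have h3 := z_ne_zero i.next
  have key : Den n * sHat i x = z i.1 * ((1 - hK n * (z i.1 / z i.next)) *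
      algebraMap (P n) (K n) q - hK n * (z i.next)⁻¹ * (Den n * x)) := by
    have h5 : 1 - z i.next / z i.1 = ((z i.1 : K n) - z i.next) / z i.1 := by
      rw [sub_div, div_self h2]
    have h6 : (1 - hK n * (z i.next / z i.1)) * Den n * permK i.s x =
        (1 - hK n * (z i.1 / z i.next)) * (Den n * x + ((z i.1 - z i.next) *
          algebraMap (P n) (K n) q)) := by
      linear_combination (-permK i.s x) * h0 + (1 - hK n * (z i.1 / z i.next)) * hq'
    have h7 : Den n * sHat i x = z i.1 * (z i.1 - z i.next)⁻¹ *
        ((1 - hK n * (z i.next / z i.1)) * Den n * permK i.s x + (hK n - 1) * (Den n * x)) := by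
      rw [sHat, h5, div_div_eq_mul_div, div_div_eq_mul_div]
      ring
    rw [h7, h6]
    field_simp
    ring
  rw [key]
  exact mul_mem (z_mem_regK _) (sub_mem (mul_mem (one_sub_h_div_mem_regK _ _)
    (algebraMap_mem_regK q)) (mul_mem (mul_mem hK_mem_regK (z_inv_mem_regK _)) ⟨f, hf⟩))

end Regular
-- Invariant vectors with denominator `D` and equivariant families.
section Integrality

variable {n N : ℕ}

/-- The pairs of positions in increasing order within the blocks of a word. -/
def blockPairs (u : Word n N) : Finset (Fin n × Fin n) :=
  (ltPairs n).filter fun p => u p.1 = u p.2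

theorem mem_blockPairs {u : Word n N} {p : Fin n × Fin n} :
    p ∈ blockPairs u ↔ p.1 < p.2 ∧ u p.1 = u p.2 := by simp [blockPairs, ltPairs]

/-- The product of the factors `1 - h z_b / z_a` over pairs within the blocks, after a
permutation of the variables. -/
def blockDen (u : Word n N) (σ : Equiv.Perm (Fin n)) : P n :=
  ∏ p ∈ blockPairs u, (1 - hP n * (zP (σ p.1) * ziP (σ p.2)))

theorem permP_blockDen (u : Word n N) (σ : Equiv.Perm (Fin n)) :
    permP σ (blockDen u 1) = blockDen u σ := by
  rw [blockDen, blockDen, map_prod]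
  refine Finset.prod_congr rfl fun p _ => ?_
  rw [map_sub, map_one, map_mul, map_mul, permP_hP, permP_zP, permP_ziP]; rfl

theorem algebraMap_blockDen (u : Word n N) : algebraMap (P n) (K n) (blockDen u 1) =
    ∏ p ∈ blockPairs u, (1 - hK n * (z p.1 / z p.2)) := by
  rw [blockDen, map_prod]
  refine Finset.prod_congr rfl fun p _ => ?_
  rw [map_sub, map_one, map_mul, map_mul, algebraMap_hP, algebraMap_zP, algebraMap_ziP,
    div_eq_mul_inv]; rfl

theorem Den_eq_Qf_mul (l : Comp n N) :
    Den n = Qf (imax l) * algebraMap (P n) (K n) (blockDen (imax l) 1) := by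
  rw [algebraMap_blockDen, Qf, prod_lt_imax l fun a b => 1 - hK n * (z b / z a), Den_eq,
    ← Finset.prod_filter_not_mul_prod_filter (ltPairs n) fun p => imax l p.1 = imax l p.2]
  congr 1
  refine Finset.prod_congr (Finset.ext fun p => ?_) fun p _ => rfl
  simp only [ltPairs, invSet, Finset.mem_filter, Finset.mem_univ, true_and]
  constructor
  · rintro ⟨h1, h2⟩
    exact ⟨h1, lt_of_le_of_ne (antitone_imax l h1.le) (Ne.symm h2)⟩
  · rintro ⟨h1, h2⟩
    exact ⟨h1, h2.ne'⟩

/-- In a field, the letters of each block can be ordered so that no variable is `h` times an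
earlier one. -/
theorem exists_perm_ne {k : Type*} [Field k] {h : k} (hpow : ∀ j : ℕ, j ≠ 0 → h ^ j ≠ 1)
    {y : Fin n → k} (hy : ∀ a, y a ≠ 0) {u : Word n N} (hu : Antitone u) :
    ∃ σ : Equiv.Perm (Fin n), u ∘ σ = u ∧
      ∀ p ∈ blockPairs u, y (σ p.2) ≠ h * y (σ p.1) := by
  classical
  -- `r a` is the number of variables that are positive powers of `h` times `y a`. It drops strictly
  -- on passing from `y b` to `h y b`, because `h` is not a root of unity. Sorting each block by `r`
  -- therefore places `h y b` before `y b`.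
  set r : Fin n → ℕ := fun a =>
    (Finset.univ.filter fun b => ∃ j : ℕ, j ≠ 0 ∧ y b = h ^ j * y a).card with hr
  have hrlt : ∀ a b, y a = h * y b → r a < r b := by
    intro a b hab
    refine Finset.card_lt_card (Finset.ssubset_iff_of_subset ?_ |>.2 ⟨a, ?_, ?_⟩)
    · intro c hc
      obtain ⟨j, -, hj⟩ := (Finset.mem_filter.1 hc).2
      refine Finset.mem_filter.2 ⟨Finset.mem_univ _, j + 1, Nat.succ_ne_zero j, ?_⟩
      rw [hj, hab, pow_succ, mul_assoc]
    · exact Finset.mem_filter.2 ⟨Finset.mem_univ _, 1, one_ne_zero, by rw [pow_one, hab]⟩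
    · intro ha
      obtain ⟨j, hj0, hj⟩ := (Finset.mem_filter.1 ha).2
      exact hpow j hj0 (mul_right_cancel₀ (hy a) (by rw [← hj, one_mul]))
  -- The letter comes first in the lexicographic order and is reversed, so the sorted word is again
  -- weakly decreasing and hence equal to `u`.
  set f : Fin n → (Fin N)ᵒᵈ ×ₗ ℕ := fun a => toLex (OrderDual.toDual (u a), r a) with hf
  have hmono := Tuple.monotone_sort f
  set σ := Tuple.sort f with hσ
  have hanti : Antitone (u ∘ σ) := by
    intro a b hab
    have := (Prod.Lex.le_iff).1 (hmono hab)
    rcases this with h1 | h1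
    · exact (OrderDual.toDual_lt_toDual.1 h1).le
    · exact (OrderDual.toDual_inj.1 h1.1).ge
  have hσu : u ∘ σ = u := Tuple.unique_antitone (f := u) (τ := 1) hanti hu
  refine ⟨σ, hσu, fun p hp heq => ?_⟩
  obtain ⟨hp1, hp2⟩ := mem_blockPairs.1 hp
  have h1 : u (σ p.1) = u (σ p.2) := by
    rw [show u (σ p.1) = u p.1 from congr_fun hσu _, show u (σ p.2) = u p.2 from congr_fun hσu _,
      hp2]
  rcases (Prod.Lex.le_iff).1 (hmono hp1.le) with h2 | h2
  · exact (OrderDual.toDual_lt_toDual.1 h2).ne' h1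
  · exact (hrlt _ _ heq).not_ge h2.2

/-- The Laurent polynomials `p` with `p F` regular form an ideal, which by invariance of `F`
contains all transforms of the block denominator. If it were proper, all of them would vanish in the
residue field of some maximal ideal. There the variables and `h` remain nonzero and `h` is still not
a root of unity, so `exists_perm_ne` provides a transform that does not vanish. -/
theorem mem_regK_of_blockDen {u : Word n N} (hu : Antitone u) {F : K n}
    (hF : ∀ σ : Equiv.Perm (Fin n), u ∘ σ = u → permK σ F = F)
    (h : algebraMap (P n) (K n) (blockDen u 1) * F ∈ regK n) : F ∈ regK n := by
  let I : Ideal (P n) :=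
    { carrier := {p | algebraMap (P n) (K n) p * F ∈ regK n}
      zero_mem' := by
        show _ ∈ regK n
        rw [map_zero, zero_mul]; exact zero_mem _
      add_mem' := fun {a b} ha hb => by
        show _ ∈ regK n
        rw [map_add, add_mul]; exact add_mem ha hb
      smul_mem' := fun c a ha => by
        show _ ∈ regK n
        rw [smul_eq_mul, map_mul, mul_assoc]
        exact mul_mem (algebraMap_mem_regK c) ha }
  have hIσ : ∀ σ : Equiv.Perm (Fin n), u ∘ σ = u → blockDen u σ ∈ I := by
    intro σ hσ
    obtain ⟨g, hg⟩ := h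
    show _ ∈ regK n
    rw [← permP_blockDen, ← permK_algebraMap]
    nth_rewrite 1 [← hF σ hσ]
    rw [← map_mul, ← hg, permK_algebraMap]
    exact algebraMap_mem_regK _
  by_cases hI : I = ⊤
  · have h1 : (1 : P n) ∈ I := hI ▸ Submodule.mem_top
    have h2 : algebraMap (P n) (K n) 1 * F ∈ regK n := h1
    rwa [map_one, one_mul] at h2
  exfalso
  obtain ⟨m, hm, hIm⟩ := Ideal.exists_le_maximal I hI
  let _ := Ideal.Quotient.field m
  let q : P n →+* P n ⧸ m := Ideal.Quotient.mk m
  have hy : ∀ a, q (zP a) ≠ 0 := by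
    intro a h0
    have := congr_arg q (zP_mul_ziP a)
    rw [map_mul, h0, zero_mul, map_one] at this
    exact zero_ne_one this
  have hpow : ∀ j : ℕ, j ≠ 0 → q (hP n) ^ j ≠ 1 := by
    intro j hj h1
    refine hh_pow_ne_one hj ((q.comp (algebraMap Ch (P n))).injective ?_)
    rw [map_pow, map_one]
    exact h1
  obtain ⟨σ, hσ, hne⟩ := exists_perm_ne hpow hy hu
  have h0 : q (blockDen u σ) = 0 := Ideal.Quotient.eq_zero_iff_mem.2 (hIm (hIσ σ hσ))
  rw [blockDen, map_prod, Finset.prod_eq_zero_iff] at h0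
  obtain ⟨p, hp, h1⟩ := h0
  refine hne p hp ?_
  rw [map_sub, map_one, map_mul, map_mul, sub_eq_zero] at h1
  have h2 : q (zP (σ p.2)) * q (ziP (σ p.2)) = 1 := by rw [← map_mul, zP_mul_ziP, map_one]
  linear_combination (q (zP (σ p.2))) * h1 + q (hP n) * q (zP (σ p.1)) * h2

theorem permK_Rf_perm (σ : Equiv.Perm (Fin n)) (w : Word n N) :
    permK σ (Rf (w ∘ σ)) = Rf w := by
  unfold Rf
  rw [map_prod]
  refine Fintype.prod_equiv σ _ _ fun a => ?_
  rw [map_prod]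
  refine Fintype.prod_equiv σ _ _ fun b => ?_
  rw [apply_ite (permK σ), map_sub, map_div₀, map_one, permK_z, permK_z]
  rfl

theorem vecOf_imax (e : Word n N → P n) (l : Comp n N) :
    vecOf e (imax l) = algebraMap (P n) (K n) (e (imax l)) / Qf (imax l) := by
  rw [vecOf, Finset.sum_apply, Finset.sum_eq_single (imax l)]
  · rw [Pi.smul_apply, (isXiVec_xi _).lead, leadCoeff_imax, smul_eq_mul,
      div_mul_div_cancel₀ (Rf_ne_zero _)]
  · intro w _ hw
    have : xi w (imax l) = 0 := by
      by_contra h0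
      have h1 := mem_Vwt.1 (xi_mem w) _ h0
      rw [wt_imax] at h1
      exact h0 (xi_apply_imax h1.symm hw)
    rw [Pi.smul_apply, this, smul_zero]
  · intro h; exact absurd (Finset.mem_univ _) h

/-- At `I^max` the denominator is `Q`, which divides `D`; the operators `ŝ_i` then reach all other
coordinates. -/
theorem Den_mul_vecOf_mem {e : Word n N → P n} (he : e ∈ symFam n N) (w : Word n N) :
    Den n * vecOf e w ∈ regK n := by
  refine word_induction_desc (p := fun w => Den n * vecOf e w ∈ regK n) (fun l => ?_)
    (fun i u hu h => ?_) w
  · rw [vecOf_imax, Den_eq_Qf_mul l, mul_right_comm, mul_div_cancel₀ _ (Qf_ne_zero _)]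
    exact mul_mem (algebraMap_mem_regK _) (algebraMap_mem_regK _)
  · rw [sHat_of_invariant (sTilde_vecOf he i) hu]
    exact Den_mul_sHat_mem i h

theorem exists_isDV_smul {e : Word n N → P n} (he : e ∈ symFam n N) :
    ∃ c : Ch, c ≠ 0 ∧ IsDV (c • vecOf e) := by
  obtain ⟨c, hc, -, h⟩ := exists_clear Finset.univ (fun w => Den n * vecOf e w)
    fun w _ => Den_mul_vecOf_mem he w
  refine ⟨c, hc, fun w => ?_, fun i => ?_⟩
  · have := h w (Finset.mem_univ w)
    rw [Pi.smul_apply, Algebra.smul_def, mul_left_comm]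
    exact this
  · have h1 : c • vecOf e = algebraMap Ch (K n) c • vecOf e := (algebraMap_smul _ _ _).symm
    rw [h1, sTilde_smul, permK_algebraMap_Ch, sTilde_vecOf he]

theorem xiBasis_repr_imax (v : V n N) (l : Comp n N) :
    v (imax l) = (xiBasis n N).repr v (imax l) * leadCoeff (imax l) := by
  conv_lhs => rw [← sum_repr_xi v]
  rw [Finset.sum_apply, Finset.sum_eq_single (imax l)]
  · rw [Pi.smul_apply, (isXiVec_xi _).lead, smul_eq_mul]
  · intro w _ hw
    have : xi w (imax l) = 0 := by
      by_contra h0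
      have h1 := mem_Vwt.1 (xi_mem w) _ h0
      rw [wt_imax] at h1
      exact h0 (xi_apply_imax h1.symm hw)
    rw [Pi.smul_apply, this, smul_zero]
  · intro h; exact absurd (Finset.mem_univ _) h

/-- If `c_I` are the coefficients of `v`, the coordinate at `I^max` is `c R/Q`. Multiplied by `D` it
becomes `c R` times the block denominator, and `c R` is `S_λ`-symmetric up to relabelling. So `c R`
is a Laurent polynomial at `I^max`, and by equivariance everywhere. -/
theorem IsDV.exists_vecOf {v : V n N} (hv : IsDV v) : ∃ e ∈ symFam n N, v = vecOf e := by
  set c := fun w => (xiBasis n N).repr v w with hc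
  have hperm : ∀ (σ : Equiv.Perm (Fin n)) w, permK σ (c (w ∘ σ) * Rf (w ∘ σ)) = c w * Rf w := by
    intro σ w
    rw [map_mul, permK_Rf_perm, repr_comp_perm hv.2]
  have h1 : ∀ l : Comp n N, c (imax l) * Rf (imax l) ∈ regK n := by
    intro l
    refine mem_regK_of_blockDen (antitone_imax l) (fun σ hσ => ?_) ?_
    · conv_lhs => rw [← hσ]
      exact hperm σ _
    · have h2 := intLaurent_le_regK (hv.1 (imax l))
      rw [xiBasis_repr_imax v l, leadCoeff_imax, Den_eq_Qf_mul l] at h2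
      convert h2 using 1
      have := Qf_ne_zero (imax l)
      field_simp
      simp only [hc]
      ring
  have h2 : ∀ w, c w * Rf w ∈ regK n := by
    intro w
    obtain ⟨τ, hτ⟩ := wt_eq_iff.1 ((wt_imax (wt w)).symm ▸ rfl : wt (imax (wt w)) = wt w)
    rw [← hperm τ w, ← hτ]
    obtain ⟨g, hg⟩ := h1 (wt w)
    rw [← hg, permK_algebraMap]
    exact algebraMap_mem_regK _
  choose e he using h2
  refine ⟨e, mem_symFam_of_perm fun σ w => IsFractionRing.injective (P n) (K n) ?_, ?_⟩
  · rw [← permK_algebraMap]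
    exact (congr_arg _ (he _)).trans ((hperm σ w).trans (he w).symm)
  · rw [vecOf]
    conv_lhs => rw [← sum_repr_xi v]
    refine Finset.sum_congr rfl fun w _ => ?_
    rw [show algebraMap (P n) (K n) (e w) = c w * Rf w from he w,
      mul_div_cancel_right₀ _ (Rf_ne_zero w)]

end Integrality
-- Artin's staircase monomials.
section Monomials

open Polynomial

variable {n : ℕ} {R Q : Type*} [CommRing R] [CommRing Q] [Algebra R Q] (γ : Fin n → Q)

/-- The span of the monomials in the first `k` variables with exponents `a_j < n - j`. -/
def stairSpan (R : Type*) [CommRing R] [Algebra R Q] (k : ℕ) : Submodule R Q :=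
  Submodule.span R {x | ∃ a : Fin n → ℕ, (∀ j : Fin n, a j < n - j.val) ∧
    (∀ j : Fin n, k ≤ j.val → a j = 0) ∧ x = ∏ j, γ j ^ a j}

variable {γ}

theorem mul_pow_mem_stairSpan {k : Fin n} {j : ℕ} (hj : j < n - k.val) {x : Q}
    (hx : x ∈ stairSpan γ R k.val) : x * γ k ^ j ∈ stairSpan γ R (k.val + 1) := by
  refine Submodule.span_induction (p := fun x _ => x * γ k ^ j ∈ stairSpan γ R (k.val + 1))
    ?_ ?_ ?_ ?_ hx
  · rintro _ ⟨a, ha1, ha2, rfl⟩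
    refine Submodule.subset_span ⟨fun i => a i + if i = k then j else 0, fun i => ?_,
      fun i hi => ?_, ?_⟩
    · dsimp only
      split_ifs with h
      · rw [h, ha2 k le_rfl, zero_add]; exact hj
      · exact ha1 i
    · have h : i ≠ k := fun h => by rw [h] at hi; omega
      show a i + (if i = k then j else 0) = 0
      rw [if_neg h, ha2 i (by omega)]
    · simp only [pow_add, Finset.prod_mul_distrib]
      congr 1
      rw [Finset.prod_eq_single k]
      · rw [if_pos rfl]
      · intro b _ hb; rw [if_neg hb, pow_zero]
      · intro h; exact absurd (Finset.mem_univ k) h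
  · rw [zero_mul]; exact zero_mem _
  · intro x y _ _ hx hy
    rw [add_mul]; exact add_mem hx hy
  · intro c x _ hx
    rw [smul_mul_assoc]; exact Submodule.smul_mem _ c hx

variable {y : Fin n → R}

/-- By hypothesis `∏ (X - γ_i)` has coefficients in `R`. Dividing by `∏_{j<k} (X - γ_j)` over the
algebra generated by the first `k` elements gives a monic polynomial of degree `n - k` with root
`γ_k`. Hence powers of `γ_k` below `n - k` suffice. -/
theorem adjoin_le_stairSpan [Nontrivial Q]
    (h : ∏ i, (X - C (γ i)) = ∏ i, (X - C (algebraMap R Q (y i)))) (k : ℕ) (hk : k ≤ n) :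
    Subalgebra.toSubmodule (Algebra.adjoin R (γ '' {j | j.val < k})) ≤ stairSpan γ R k := by
  classical
  induction k with
  | zero =>
    have : γ '' {j : Fin n | j.val < 0} = ∅ := by simp
    rw [this, Algebra.adjoin_empty, Algebra.toSubmodule_bot]
    refine Submodule.one_le.2 (Submodule.subset_span ⟨fun _ => 0,
      fun j => Nat.sub_pos_of_lt j.2, fun _ _ => rfl, by simp⟩)
  | succ k ih =>
    specialize ih (by omega)
    set B := Algebra.adjoin R (γ '' {j | j.val < k}) with hB
    have hγ : ∀ j : Fin n, j.val < k → γ j ∈ B := fun j hj =>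
      Algebra.subset_adjoin ⟨j, hj, rfl⟩
    let kk : Fin n := ⟨k, hk⟩
    let F : B[X] := ∏ i, (X - C (algebraMap R B (y i)))
    let G : B[X] := ∏ j : {j : Fin n // j.val < k}, (X - C (⟨γ j.1, hγ j.1 j.2⟩ : B))
    let g : B[X] := F /ₘ G
    have hG : G.Monic := monic_prod_of_monic _ _ fun j _ => monic_X_sub_C _
    have hinj : Function.Injective (algebraMap B Q) := Subtype.val_injective
    have hFm : F.map (algebraMap B Q) = ∏ i, (X - C (γ i)) := by
      rw [h, Polynomial.map_prod]
      refine Finset.prod_congr rfl fun i _ => ?_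
      rw [Polynomial.map_sub, map_X, map_C, ← IsScalarTower.algebraMap_apply]
    have hGm : G.map (algebraMap B Q) = ∏ j ∈ Finset.univ.filter fun j : Fin n => j.val < k,
        (X - C (γ j)) := by
      rw [Polynomial.map_prod, ← Finset.prod_subtype_eq_prod_filter]
      rw [Finset.subtype_univ]
      refine Finset.prod_congr rfl fun i _ => ?_
      rw [Polynomial.map_sub, map_X, map_C]; rfl
    have hgm : g.map (algebraMap B Q) = ∏ j ∈ Finset.univ.filter fun j : Fin n => ¬ j.val < k,
        (X - C (γ j)) := by
      rw [Polynomial.map_divByMonic _ hG, hFm,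
        ← Finset.prod_filter_mul_prod_filter_not Finset.univ (fun j : Fin n => j.val < k), hGm]
      exact mul_divByMonic_cancel_left _ (monic_prod_of_monic _ _ fun j _ => monic_X_sub_C _)
    have hgmon : g.Monic := by
      refine Polynomial.monic_of_injective hinj ?_
      rw [hgm]
      exact monic_prod_of_monic _ _ fun j _ => monic_X_sub_C _
    have hgdeg : g.natDegree = n - k := by
      rw [← natDegree_map_eq_of_injective hinj, hgm, natDegree_finsetProd_X_sub_C_eq_card]
      have h1 := Finset.card_filter_add_card_filter_not (s := (Finset.univ : Finset (Fin n)))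
        fun j : Fin n => j.val < k
      have h2 : (Finset.univ.filter fun j : Fin n => j.val < k).card = k := by
        have : (Finset.univ.filter fun j : Fin n => j.val < k) = Finset.Iio kk := by
          ext j
          rw [Finset.mem_filter, Finset.mem_Iio]
          exact ⟨fun h => h.2, fun h => ⟨Finset.mem_univ _, h⟩⟩
        rw [this, Fin.card_Iio]
      rw [h2, Finset.card_univ, Fintype.card_fin] at h1
      omega
    have hroot : aeval (γ kk) g = 0 := by
      rw [aeval_def, eval₂_eq_eval_map, hgm, eval_prod]
      refine Finset.prod_eq_zero (i := kk) (Finset.mem_filter.2 ⟨Finset.mem_univ _, ?_⟩) ?_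
      · show ¬ k < k
        exact lt_irrefl k
      · rw [eval_sub, eval_X, eval_C, sub_self]
    have hle : Algebra.adjoin R (γ '' {j | j.val < k + 1}) ≤
        ((aeval (R := B) (γ kk)).range).restrictScalars R := by
      refine Algebra.adjoin_le ?_
      rintro _ ⟨j, hj, rfl⟩
      rcases Nat.lt_succ_iff_lt_or_eq.1 hj with h1 | h1
      · exact ⟨C (⟨γ j, hγ j h1⟩ : B), aeval_C _ _⟩
      · exact ⟨X, (aeval_X _).trans (by rw [show kk = j from Fin.ext h1.symm])⟩
    intro x hx
    obtain ⟨p, hp⟩ := hle hx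
    have hp' : aeval (γ kk) p = x := hp
    have hx2 : x = aeval (γ kk) (p %ₘ g) := by
      rw [← hp']
      conv_lhs => rw [← modByMonic_add_div p g]
      rw [map_add, map_mul, hroot, zero_mul, add_zero]
    have hdeg : (p %ₘ g).natDegree < n - k := by
      rw [← hgdeg]
      refine natDegree_modByMonic_lt p hgmon fun h1 => ?_
      rw [h1, natDegree_one] at hgdeg
      omega
    rw [hx2, as_sum_range' _ _ hdeg, map_sum]
    refine sum_mem fun j hj => ?_
    rw [aeval_monomial]
    exact mul_pow_mem_stairSpan (k := kk) (Finset.mem_range.1 hj) (ih (SetLike.coe_mem _))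

end Monomials

/-! ### Fixed point localization for full flags. -/

section Localization

variable {n : ℕ}

/-- The relations of the equivariant K-theory of the variety of full flags. -/
def fullRel (n : ℕ) : Ideal (P n ⊗[Ch] P n) :=
  Ideal.span {x | ∃ f : P n, IsSymm f ∧ x = 1 ⊗ₜ[Ch] f - f ⊗ₜ[Ch] 1}

/-- The equivariant K-theory of the variety of full flags. -/
def FullK (n : ℕ) : Type := P n ⊗[Ch] P n ⧸ fullRel n

instance (n : ℕ) : CommRing (FullK n) := inferInstanceAs (CommRing (P n ⊗[Ch] P n ⧸ fullRel n))

instance (n : ℕ) : Algebra (P n) (FullK n) :=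
  inferInstanceAs (Algebra (P n) (P n ⊗[Ch] P n ⧸ fullRel n))

instance (n : ℕ) : Algebra Ch (FullK n) :=
  inferInstanceAs (Algebra Ch (P n ⊗[Ch] P n ⧸ fullRel n))

instance (n : ℕ) : IsScalarTower Ch (P n) (FullK n) :=
  inferInstanceAs (IsScalarTower Ch (P n) (P n ⊗[Ch] P n ⧸ fullRel n))

/-- The projection onto the quotient. -/
def fullMk (n : ℕ) : P n ⊗[Ch] P n →ₐ[P n] FullK n := Ideal.Quotient.mkₐ (P n) (fullRel n)

theorem fullMk_surjective : Function.Surjective (fullMk n) := Ideal.Quotient.mk_surjective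

/-- The localization at a fixed point of the variety of full flags. -/
def evFull (σ : Equiv.Perm (Fin n)) : P n ⊗[Ch] P n →ₐ[P n] P n :=
  Algebra.TensorProduct.lift (AlgHom.id (P n) (P n)) (permP σ).toAlgHom
    (fun _ _ => Commute.all _ _)

theorem evFull_tmul (σ : Equiv.Perm (Fin n)) (p f : P n) :
    evFull σ (p ⊗ₜ f) = p * permP σ f := by
  rw [evFull, Algebra.TensorProduct.lift_tmul]; rfl

theorem evFull_of_mem (σ : Equiv.Perm (Fin n)) (x : P n ⊗[Ch] P n) (hx : x ∈ fullRel n) :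
    evFull σ x = 0 := by
  have : fullRel n ≤ RingHom.ker (evFull σ) := by
    refine Ideal.span_le.2 ?_
    rintro _ ⟨f, hf, rfl⟩
    show evFull σ _ = 0
    rw [map_sub, evFull_tmul, evFull_tmul, hf σ, map_one, one_mul, mul_one, sub_self]
  exact this hx

/-- The localization maps on the quotient. -/
def evQ (σ : Equiv.Perm (Fin n)) : FullK n →ₐ[P n] P n :=
  Ideal.Quotient.liftₐ (fullRel n) (evFull σ) (evFull_of_mem σ)

instance : Nontrivial (FullK n) := (evQ (1 : Equiv.Perm (Fin n))).toRingHom.domain_nontrivial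

/-- The map `f ↦ [f(Γ)]`. -/
def incR (n : ℕ) : P n →ₐ[Ch] FullK n :=
  ((fullMk n).restrictScalars Ch).comp Algebra.TensorProduct.includeRight

theorem evQ_incR (σ : Equiv.Perm (Fin n)) (f : P n) : evQ σ (incR n f) = permP σ f := by
  show evFull σ (1 ⊗ₜ f) = _
  rw [evFull_tmul, one_mul]

theorem incR_symm {f : P n} (hf : IsSymm f) : incR n f = algebraMap (P n) (FullK n) f := by
  refine Ideal.Quotient.eq.2 (Ideal.subset_span ⟨f, hf, rfl⟩)

open Polynomial in
theorem prod_incR : ∏ i : Fin n, (X - C (incR n (zP i))) =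
    ∏ i, (X - C (algebraMap (P n) (FullK n) (zP i))) := by
  set F : (P n)[X] := ∏ i, (X - C (zP i)) with hF
  have h1 : F.map (incR n : P n →+* FullK n) = ∏ i : Fin n, (X - C (incR n (zP i))) := by
    rw [hF, Polynomial.map_prod]
    simp
  have h2 : F.map (algebraMap (P n) (FullK n)) =
      ∏ i, (X - C (algebraMap (P n) (FullK n) (zP i))) := by
    rw [hF, Polynomial.map_prod]
    simp
  rw [← h1, ← h2]
  refine Polynomial.ext fun j => ?_
  rw [coeff_map, coeff_map]
  refine incR_symm fun σ => ?_
  have h3 : F.map (permP σ : P n →+* P n) = F := by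
    rw [hF, Polynomial.map_prod]
    refine Fintype.prod_equiv σ _ _ fun i => ?_
    rw [Polynomial.map_sub, map_X, map_C, RingHom.coe_coe, permP_zP]
  have h4 := congr_arg (fun p => p.coeff j) h3
  rw [coeff_map] at h4
  exact h4

/-- The product of all variables is symmetric, hence an invertible scalar in the quotient. So the
inverse of one variable is a scalar times the product of the others, and only nonnegative powers are
needed. -/
theorem adjoin_incR_eq_top :
    Algebra.adjoin (P n) ((fun i => incR n (zP i)) '' {j : Fin n | j.val < n}) = ⊤ := by
  set B := Algebra.adjoin (P n) ((fun i => incR n (zP i)) '' {j : Fin n | j.val < n}) with hB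
  have hz : ∀ i, incR n (zP i) ∈ B := fun i => Algebra.subset_adjoin ⟨i, i.2, rfl⟩
  have hzi : ∀ i, incR n (ziP i) ∈ B := by
    intro i
    have h1 : IsSymm (∏ j : Fin n, zP j) := by
      intro σ
      rw [map_prod]
      exact Fintype.prod_equiv σ _ _ fun j => permP_zP σ j
    have h2 : incR n (ziP i) = (∏ j ∈ Finset.univ.erase i, incR n (zP j)) *
        algebraMap (P n) (FullK n) (∏ j : Fin n, ziP j) := by
      have h3 := incR_symm h1
      rw [map_prod, ← Finset.mul_prod_erase _ _ (Finset.mem_univ i)] at h3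
      have h4 : incR n (zP i) * incR n (ziP i) = 1 := by rw [← map_mul, zP_mul_ziP, map_one]
      have h5 : algebraMap (P n) (FullK n) (∏ j : Fin n, zP j) *
          algebraMap (P n) (FullK n) (∏ j : Fin n, ziP j) = 1 := by
        rw [← map_mul, ← Finset.prod_mul_distrib, Finset.prod_congr rfl fun j _ => zP_mul_ziP j,
          Finset.prod_const_one, map_one]
      rw [← h3] at h5
      linear_combination (-incR n (ziP i)) * h5 + ((∏ j ∈ Finset.univ.erase i, incR n (zP j)) *
        algebraMap (P n) (FullK n) (∏ j : Fin n, ziP j)) * h4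
    rw [h2]
    exact mul_mem (prod_mem fun j _ => hz j) (Subalgebra.algebraMap_mem _ _)
  have h1 : (B.restrictScalars Ch).comap (incR n) = ⊤ := eq_top_of_var_mem hz hzi
  refine eq_top_iff.2 fun x _ => ?_
  obtain ⟨x, rfl⟩ := fullMk_surjective x
  induction x using TensorProduct.induction_on with
  | zero => rw [map_zero]; exact zero_mem _
  | add x y hx hy => rw [map_add]; exact add_mem (hx trivial) (hy trivial)
  | tmul p f =>
    have h2 : incR n f ∈ B := (h1 ▸ Algebra.mem_top : f ∈ (B.restrictScalars Ch).comap (incR n))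
    have h3 : fullMk n (p ⊗ₜ f) = p • incR n f := by
      have : (p ⊗ₜ[Ch] f : P n ⊗[Ch] P n) = p • (1 ⊗ₜ f) := by
        rw [TensorProduct.smul_tmul', smul_eq_mul, mul_one]
      rw [this, map_smul]; rfl
    rw [h3]
    exact Subalgebra.smul_mem _ h2 p

/-- The exponents of the monomials that span the K-theory of the variety of full flags. -/
abbrev Stair (n : ℕ) : Type := (j : Fin n) → Fin (n - j.val)

/-- The monomials that span the K-theory of the variety of full flags. -/
def stairMon (a : Stair n) : FullK n := ∏ j, incR n (zP j) ^ (a j).val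

theorem exists_eq_sum_stairMon (x : FullK n) : ∃ c : Stair n → P n, ∑ a, c a • stairMon a = x := by
  have h1 : x ∈ stairSpan (fun i => incR n (zP i)) (P n) n := by
    refine adjoin_le_stairSpan prod_incR n le_rfl ?_
    rw [adjoin_incR_eq_top]
    exact Submodule.mem_top
  have h2 : stairSpan (fun i => incR n (zP i)) (P n) n ≤
      Submodule.span (P n) (Set.range (stairMon (n := n))) := by
    refine Submodule.span_le.2 ?_
    rintro _ ⟨a, ha, -, rfl⟩
    exact Submodule.subset_span ⟨fun j => ⟨a j, ha j⟩, rfl⟩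
  exact (Submodule.mem_span_range_iff_exists_fun _).1 (h2 h1)

theorem card_Stair : Fintype.card (Equiv.Perm (Fin n)) = Fintype.card (Stair n) := by
  rw [Fintype.card_perm, Fintype.card_fin, Fintype.card_pi]
  simp only [Fintype.card_fin]
  rw [Fin.prod_univ_eq_prod_range (fun j => n - j) n, ← Finset.prod_range_add_one_eq_factorial,
    ← Finset.prod_range_reflect]
  refine Finset.prod_congr rfl fun j hj => ?_
  have := Finset.mem_range.1 hj
  omega

/-- Dedekind's theorem: distinct permutations of the variables are distinct characters of the
multiplicative monoid. -/
theorem linearIndependent_perm {d : Equiv.Perm (Fin n) → K n}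
    (h : ∀ f : P n, ∑ σ, d σ * algebraMap (P n) (K n) (permP σ f) = 0) : d = 0 := by
  let ρ : Equiv.Perm (Fin n) → (P n →* K n) := fun σ =>
    (algebraMap (P n) (K n) : P n →* K n).comp (permP σ : P n →* P n)
  have hρ : Function.Injective ρ := by
    intro σ τ hst
    refine Equiv.ext fun i => ?_
    have h1 := DFunLike.congr_fun hst (zP i)
    have h2 : algebraMap (P n) (K n) (permP σ (zP i)) = algebraMap (P n) (K n) (permP τ (zP i)) :=
      h1
    have h3 := IsFractionRing.injective (P n) (K n) h2
    rw [permP_zP, permP_zP] at h3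
    by_contra hne
    have := zP_sub_smul_ne_zero hne 1
    rw [map_one, one_mul] at this
    exact this (sub_eq_zero.2 h3)
  have h1 := (linearIndependent_monoidHom (P n) (K n)).comp ρ hρ
  funext σ
  refine Fintype.linearIndependent_iff.1 h1 d (funext fun f => ?_) σ
  rw [Finset.sum_apply]
  exact h f

/-- The matrix of values of the spanning monomials at the fixed points is square of size `n!`. A
linear relation between its rows would hold on all classes, contradicting the independence of
characters. So the matrix is invertible, and a combination of the monomials vanishing at all fixed
points has zero coefficients. -/
theorem evQ_injective {x : FullK n} (hx : ∀ σ, evQ σ x = 0) : x = 0 := by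
  obtain ⟨e⟩ := Fintype.card_eq.1 (card_Stair (n := n))
  let M : Matrix (Equiv.Perm (Fin n)) (Equiv.Perm (Fin n)) (K n) :=
    Matrix.of fun σ τ => algebraMap (P n) (K n) (evQ σ (stairMon (e τ)))
  have hM : IsUnit M := by
    rw [← Matrix.vecMul_injective_iff_isUnit]
    refine (injective_iff_map_eq_zero (Matrix.vecMulLinear M)).2 fun d hd => ?_
    refine linearIndependent_perm fun f => ?_
    obtain ⟨c, hc⟩ := exists_eq_sum_stairMon (incR n f)
    have h1 : ∀ σ, algebraMap (P n) (K n) (permP σ f) =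
        ∑ a, algebraMap (P n) (K n) (c a) * algebraMap (P n) (K n) (evQ σ (stairMon a)) := by
      intro σ
      rw [← evQ_incR, ← hc, map_sum, map_sum]
      refine Finset.sum_congr rfl fun a _ => ?_
      rw [map_smul, smul_eq_mul, map_mul]
    simp only [h1, Finset.mul_sum]
    rw [Finset.sum_comm]
    refine Finset.sum_eq_zero fun a _ => ?_
    have h2 := congr_fun hd (e.symm a)
    have h3 : ∑ σ, d σ * algebraMap (P n) (K n) (evQ σ (stairMon a)) = 0 := by
      have h4 : ∑ σ, d σ * algebraMap (P n) (K n) (evQ σ (stairMon (e (e.symm a)))) = 0 := h2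
      rwa [e.apply_symm_apply] at h4
    have h5 := congr_arg (algebraMap (P n) (K n) (c a) * ·) h3
    simp only [mul_zero, Finset.mul_sum] at h5
    rw [← h5]
    exact Finset.sum_congr rfl fun σ _ => by ring
  obtain ⟨c, hc⟩ := exists_eq_sum_stairMon x
  have h1 : M.mulVec (fun τ => algebraMap (P n) (K n) (c (e τ))) = 0 := by
    funext σ
    have h2 := congr_arg (algebraMap (P n) (K n)) (hx σ)
    rw [← hc, map_sum, map_sum, map_zero, ← Equiv.sum_comp e] at h2
    rw [Pi.zero_apply, ← h2]
    refine Finset.sum_congr rfl fun τ _ => ?_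
    rw [map_smul, smul_eq_mul, map_mul, mul_comm]; rfl
  have h2 : (fun τ => algebraMap (P n) (K n) (c (e τ))) = 0 :=
    Matrix.mulVec_injective_iff_isUnit.2 hM (by rw [h1, Matrix.mulVec_zero])
  rw [← hc]
  refine Finset.sum_eq_zero fun a _ => ?_
  have h3 := congr_fun h2 (e.symm a)
  simp only [Pi.zero_apply, e.apply_symm_apply] at h3
  rw [(map_eq_zero_iff _ (IsFractionRing.injective (P n) (K n))).1 h3, zero_smul]

theorem mem_fullRel {x : P n ⊗[Ch] P n} (hx : ∀ σ, evFull σ x = 0) : x ∈ fullRel n :=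
  Ideal.Quotient.eq_zero_iff_mem.1 (evQ_injective hx)

end Localization

/-! ### Partial flags by averaging over `S_λ`. -/

section PartialFlags

variable {n N : ℕ}

/-- The inclusion of the presentation for partial flags into that for full flags. -/
def incL (l : Comp n N) : preK l →ₐ[P n] P n ⊗[Ch] P n :=
  Algebra.TensorProduct.map (AlgHom.id (P n) (P n)) (symL l).val

/-- The averaging operator over `S_λ`. -/
def avg (l : Comp n N) : P n →ₗ[Ch] symL l where
  toFun f := ⟨((stab l).card : Ch)⁻¹ • symSum l f, Subalgebra.smul_mem _ (symSum_mem l f) _⟩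
  map_add' f g := Subtype.ext (by
    show _ • symSum l (f + g) = _ • symSum l f + _ • symSum l g
    rw [symSum_add, smul_add])
  map_smul' c f := Subtype.ext (by
    show _ • symSum l (c • f) = c • _ • symSum l f
    rw [symSum_smul, smul_comm])

theorem avg_mul (l : Comp n N) (f : P n) (g : symL l) : avg l (f * g) = avg l f * g :=
  Subtype.ext (by
    show _ • symSum l (f * g) = (_ • symSum l f) * (g : P n)
    rw [symSum_mul_of_mem g.2, smul_mul_assoc])

theorem avg_of_mem (l : Comp n N) (g : symL l) : avg l g = g :=
  Subtype.ext (by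
    show _ • symSum l g = (g : P n)
    rw [symSum_of_mem g.2, inv_smul_smul₀ (card_stab_ne_zero l)])

/-- The averaging operator on the presentations. -/
def avgK (l : Comp n N) : P n ⊗[Ch] P n →ₗ[Ch] preK l := TensorProduct.map LinearMap.id (avg l)

theorem avgK_incL (l : Comp n N) (x : preK l) : avgK l (incL l x) = x := by
  induction x using TensorProduct.induction_on with
  | zero => rw [map_zero, map_zero]
  | add x y hx hy => rw [map_add, map_add, hx, hy]
  | tmul p g =>
    show avgK l (p ⊗ₜ (g : P n)) = _
    rw [avgK, TensorProduct.map_tmul, avg_of_mem]; rfl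

theorem avgK_mul (l : Comp n N) (x : P n ⊗[Ch] P n) (g : preK l) :
    avgK l (x * incL l g) = avgK l x * g := by
  induction g using TensorProduct.induction_on with
  | zero => simp
  | add g g' hg hg' => rw [map_add, mul_add, map_add, hg, hg', mul_add]
  | tmul q g =>
    induction x using TensorProduct.induction_on with
    | zero => simp
    | add x y hx hy => rw [add_mul, map_add, hx, hy, map_add, add_mul]
    | tmul p f =>
      show avgK l (p ⊗ₜ f * q ⊗ₜ (g : P n)) = _
      rw [Algebra.TensorProduct.tmul_mul_tmul, avgK, TensorProduct.map_tmul, avg_mul,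
        TensorProduct.map_tmul, Algebra.TensorProduct.tmul_mul_tmul]; rfl

theorem isSymm_mem_symL {f : P n} (hf : IsSymm f) (l : Comp n N) : f ∈ symL l := fun σ _ => hf σ

/-- The generators of both ideals come from the same symmetric polynomials, which belong to
`ℂ[z^{±1}]^{S_λ} ⊗ ℂ(h)`. Averaging is linear over the smaller presentation, so multiples of such
generators stay in the smaller ideal. -/
theorem avgK_mem_relK (l : Comp n N) {x : P n ⊗[Ch] P n} (hx : x ∈ fullRel n) :
    avgK l x ∈ relK l := by
  have h : ∀ a, avgK l (a * x) ∈ relK l := by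
    refine Submodule.span_induction (p := fun x _ => ∀ a, avgK l (a * x) ∈ relK l)
      ?_ ?_ ?_ ?_ hx
    · rintro _ ⟨f, hf, rfl⟩ a
      have h1 : (1 ⊗ₜ[Ch] f - f ⊗ₜ[Ch] 1 : P n ⊗[Ch] P n) =
          incL l (1 ⊗ₜ[Ch] ⟨f, isSymm_mem_symL hf l⟩ - f ⊗ₜ[Ch] 1) := by
        rw [map_sub]; rfl
      rw [h1, avgK_mul]
      exact Ideal.mul_mem_left _ _ (Ideal.subset_span ⟨⟨f, isSymm_mem_symL hf l⟩, hf, rfl⟩)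
    · intro a
      rw [mul_zero, map_zero]; exact zero_mem _
    · intro x y _ _ hx hy a
      rw [mul_add, map_add]; exact add_mem (hx a) (hy a)
    · intro c x _ hx a
      rw [smul_eq_mul, ← mul_assoc]; exact hx _
  have := h 1
  rwa [one_mul] at this

theorem locI_tmul (l : Comp n N) (w : Word n N) (p : P n) (g : symL l) :
    locI l w (p ⊗ₜ g) = p * atI w (g : P n) := by
  rw [locI, Algebra.TensorProduct.lift_tmul]; rfl

theorem evFull_incL (l : Comp n N) (σ : Equiv.Perm (Fin n)) (x : preK l) :
    evFull σ (incL l x) = locI l (imin l ∘ σ.symm) x := by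
  induction x using TensorProduct.induction_on with
  | zero => rw [map_zero, map_zero, map_zero]
  | add x y hx hy => rw [map_add, map_add, map_add, hx, hy]
  | tmul p g =>
    show evFull σ (p ⊗ₜ (g : P n)) = _
    rw [evFull_tmul, locI_tmul, atI_eq (τ := σ) g.2]
    funext a
    simp

/-- The fixed points of full flags lie over those of partial flags, so such an `x` becomes a
relation for full flags; averaging brings this relation back and fixes `x`. -/
theorem mem_relK {l : Comp n N} {x : preK l} (hx : ∀ w, wt w = l → locI l w x = 0) :
    x ∈ relK l := by
  rw [← avgK_incL l x]
  refine avgK_mem_relK l (mem_fullRel fun σ => ?_)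
  rw [evFull_incL]
  exact hx _ (by rw [wt_comp, wt_imin])

theorem locI_of_mem_relK {l : Comp n N} (w : Word n N) (x : preK l)
    (hx : x ∈ relK l) : locI l w x = 0 := by
  have : relK l ≤ RingHom.ker (locI l w) := by
    refine Ideal.span_le.2 ?_
    rintro _ ⟨f, hf, rfl⟩
    show locI l w _ = 0
    have h1 : atI w (f : P n) = f := hf _
    rw [map_sub, locI_tmul, locI_tmul, h1, one_mul, OneMemClass.coe_one, map_one, mul_one,
      sub_self]
  exact this hx

/-- The localization at a fixed point, on the K-theory algebra. -/
def locKT (l : Comp n N) (w : Word n N) : KT l →ₐ[P n] P n :=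
  Ideal.Quotient.liftₐ (relK l) (locI l w) (locI_of_mem_relK w)

theorem locKT_cls {l : Comp n N} (w : Word n N) (x : preK l) : locKT l w (cls x) = locI l w x := rfl

theorem cls_surjective (l : Comp n N) : Function.Surjective (cls : preK l → KT l) :=
  Ideal.Quotient.mk_surjective

theorem locKT_injective {l : Comp n N} {x : KT l} (hx : ∀ w, wt w = l → locKT l w x = 0) :
    x = 0 := by
  obtain ⟨x, rfl⟩ := cls_surjective l x
  exact Ideal.Quotient.eq_zero_iff_mem.2 (mem_relK hx)

/-- The localization map on the K-theory of the disjoint union of the partial flag varieties. -/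
def locX (n N : ℕ) : KX n N →ₐ[P n] (Word n N → P n) :=
  AlgHom.pi fun w => (locKT (wt w) w).comp (Pi.evalAlgHom (P n) _ (wt w))

theorem locX_apply (f : KX n N) (w : Word n N) : locX n N f w = locKT (wt w) w (f (wt w)) := rfl

theorem locX_injective : Function.Injective (locX n N) := by
  refine (injective_iff_map_eq_zero (locX n N)).2 fun f hf => funext fun l => ?_
  refine locKT_injective fun w hw => ?_
  subst hw
  exact congr_fun hf w

end PartialFlags
-- Diagonal operators in the basis `ξ_I`.
section Diagonal

variable {n N : ℕ}

/-- The operator `ξ_I ↦ e_I ξ_I`. -/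
def diagEnd (e : Word n N → P n) : Module.End (K n) (V n N) :=
  (xiBasis n N).constr (K n) fun w => algebraMap (P n) (K n) (e w) • xi w

theorem diagEnd_xi (e : Word n N → P n) (w : Word n N) :
    diagEnd e (xi w) = algebraMap (P n) (K n) (e w) • xi w := by
  conv_lhs => rw [← xiBasis_apply w]
  exact (xiBasis n N).constr_basis (K n) _ w

theorem end_ext_xi {S T : Module.End (K n) (V n N)} (h : ∀ w, S (xi w) = T (xi w)) : S = T :=
  (xiBasis n N).ext fun w => by rw [xiBasis_apply]; exact h w

/-- The operators `ξ_I ↦ e_I ξ_I`, as an algebra homomorphism. -/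
def diagHom (n N : ℕ) : (Word n N → P n) →ₐ[P n] Module.End (K n) (V n N) :=
  AlgHom.ofLinearMap
    { toFun := diagEnd
      map_add' := fun e f => end_ext_xi fun w => by
        rw [LinearMap.add_apply, diagEnd_xi, diagEnd_xi, diagEnd_xi, Pi.add_apply, map_add,
          add_smul]
      map_smul' := fun c e => end_ext_xi fun w => by
        rw [RingHom.id_apply, LinearMap.smul_apply, diagEnd_xi, diagEnd_xi, Pi.smul_apply,
          smul_eq_mul, map_mul, mul_smul, algebraMap_smul] }
    (end_ext_xi fun w => by
      show diagEnd 1 (xi w) = xi w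
      rw [diagEnd_xi, Pi.one_apply, map_one, one_smul])
    fun e f => end_ext_xi fun w => by
      show diagEnd (e * f) (xi w) = diagEnd e (diagEnd f (xi w))
      rw [diagEnd_xi, diagEnd_xi, map_smul, diagEnd_xi, smul_smul, Pi.mul_apply, map_mul, mul_comm]

theorem diagHom_apply (e : Word n N → P n) : diagHom n N e = diagEnd e := rfl

theorem HasEig.pho_eq {X : U N} {e : Word n N → P n} (h : HasEig X e) :
    pho n N X = diagEnd e := end_ext_xi fun w => by rw [h w, diagEnd_xi]

theorem diagEnd_injective : Function.Injective (diagEnd : (Word n N → P n) → _) := by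
  intro e f h
  funext w
  have := congr_arg (fun T => T (xi w)) h
  simp only [diagEnd_xi] at this
  exact xi_smul_cancel this

theorem diagEnd_vecOf (e f : Word n N → P n) : diagEnd e (vecOf f) = vecOf (e * f) := by
  rw [vecOf, vecOf, map_sum]
  refine Finset.sum_congr rfl fun w _ => ?_
  rw [map_smul, diagEnd_xi, smul_smul, Pi.mul_apply, map_mul, mul_comm, mul_div_assoc]

theorem diagEnd_congr {e f : Word n N → P n} {l : Comp n N} (h : ∀ w, wt w = l → e w = f w)
    {v : V n N} (hv : v ∈ Vwt l) : diagEnd e v = diagEnd f v := by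
  rw [← sum_repr_xi v, map_sum, map_sum]
  refine Finset.sum_congr rfl fun w _ => ?_
  by_cases hw : wt w = l
  · rw [map_smul, map_smul, diagEnd_xi, diagEnd_xi, h w hw]
  · rw [repr_xi_of_mem hv hw, zero_smul, map_zero, map_zero]

theorem diagEnd_mem (e : Word n N → P n) {l : Comp n N} {v : V n N} (hv : v ∈ Vwt l) :
    diagEnd e v ∈ Vwt l := by
  rw [← sum_repr_xi v, map_sum]
  refine sum_mem fun w _ => ?_
  by_cases hw : wt w = l
  · rw [map_smul, diagEnd_xi]
    exact Submodule.smul_mem _ _ (Submodule.smul_mem _ _ (hw ▸ xi_mem w))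
  · rw [repr_xi_of_mem hv hw, zero_smul, map_zero]; exact zero_mem _

theorem pho_mem_Vwt {X : U N} (hX : X ∈ GZ N) {l : Comp n N} {v : V n N} (hv : v ∈ Vwt l) :
    pho n N X v ∈ Vwt l := by
  obtain ⟨e, he⟩ := exists_hasEig (n := n) hX
  rw [he.pho_eq]
  exact diagEnd_mem e hv

/-- The family `f(z_I)`, `I ∈ 𝓘_λ`, extended by zero to the other weights. -/
def famOf (l : Comp n N) (g : P n) : Word n N → P n := fun w => if wt w = l then atI w g else 0

theorem famOf_mem {l : Comp n N} {g : P n} (hg : g ∈ symL l) : famOf l g ∈ symFam n N := by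
  have h := atI_mem_symFam (n := n) (N := N) (Pi.single l ⟨g, hg⟩)
  convert h using 1
  funext w
  unfold famOf
  split_ifs with hw
  · subst hw
    rw [Pi.single_eq_same]
  · rw [Pi.single_eq_of_ne hw, ZeroMemClass.coe_zero, map_zero]

theorem famOf_add (l : Comp n N) (f g : P n) : famOf l (f + g) = famOf l f + famOf l g := by
  funext w
  simp only [famOf, Pi.add_apply]
  split_ifs
  · rw [map_add]
  · rw [add_zero]

theorem famOf_mul (l : Comp n N) (f g : P n) : famOf l (f * g) = famOf l f * famOf l g := by
  funext w
  simp only [famOf, Pi.mul_apply]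
  split_ifs
  · rw [map_mul]
  · rw [mul_zero]

theorem famOf_smul (l : Comp n N) (c : Ch) (f : P n) : famOf l (c • f) = c • famOf l f := by
  funext w
  simp only [famOf, Pi.smul_apply]
  split_ifs
  · rw [map_smul]
  · rw [smul_zero]

theorem famOf_eq {l : Comp n N} {e : Word n N → P n} (he : e ∈ symFam n N) {w : Word n N}
    (hw : wt w = l) : e w = famOf l (e (imin l)) w := by
  rw [famOf, if_pos hw, symFam_eq_atI he, hw]

theorem locX_single (l : Comp n N) (p : P n) (g : symL l) :
    locX n N (Pi.single l (cls (p ⊗ₜ g))) = p • famOf l (g : P n) := by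
  funext w
  rw [locX_apply, Pi.smul_apply, famOf]
  split_ifs with hw
  · subst hw
    rw [Pi.single_eq_same, locKT_cls, locI_tmul, smul_eq_mul]
  · rw [Pi.single_eq_of_ne hw, map_zero, smul_zero]

theorem KX_induction {p : KX n N → Prop} (hadd : ∀ x y, p x → p y → p (x + y)) (h0 : p 0)
    (hs : ∀ (l : Comp n N) (q : P n) (g : symL l), p (Pi.single l (cls (q ⊗ₜ g)))) (x : KX n N) :
    p x := by
  have h1 : ∀ (l : Comp n N) (y : preK l), p (Pi.single l (cls y)) := by
    intro l y
    induction y using TensorProduct.induction_on with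
    | zero =>
      rw [show cls (0 : preK l) = 0 from map_zero (Ideal.Quotient.mk (relK l)), Pi.single_zero]
      exact h0
    | add y y' hy hy' =>
      rw [show cls (y + y') = cls y + cls y' from map_add (Ideal.Quotient.mk (relK l)) y y',
        Pi.single_add]
      exact hadd _ _ hy hy'
    | tmul q g => exact hs l q g
  have h2 : ∀ s : Finset (Comp n N), p (∑ l ∈ s, Pi.single l (x l)) := by
    intro s
    induction s using Finset.induction_on with
    | empty => rw [Finset.sum_empty]; exact h0
    | insert l s hl ih =>
      rw [Finset.sum_insert hl]
      obtain ⟨y, hy⟩ := cls_surjective l (x l)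
      rw [← hy]
      exact hadd _ _ (h1 l y) ih
  have : Finite (Comp n N) := Finite.of_surjective wt fun l => ⟨imin l, wt_imin l⟩
  have := Fintype.ofFinite (Comp n N)
  rw [← Finset.univ_sum_single x]
  exact h2 Finset.univ

end Diagonal
-- The isomorphisms `θ_λ` and `ψ_λ`.
section RegularRepresentation

variable {n N : ℕ}

theorem eq_zero_of_vecOf_mem {e : Word n N → P n} {l : Comp n N} (h : vecOf e ∈ Vwt l)
    {w : Word n N} (hw : wt w ≠ l) : e w = 0 := by
  have h1 := repr_xi_of_mem h hw
  rw [vecOf] at h1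
  simp only [← xiBasis_apply] at h1
  rw [(xiBasis n N).repr_sum_self] at h1
  exact (map_eq_zero_iff _ (IsFractionRing.injective (P n) (K n))).1
    ((div_eq_zero_iff.1 h1).resolve_right (Rf_ne_zero w))

theorem vecOf_famOf (l : Comp n N) (g : P n) : vecOf (famOf l g) =
    ∑ w with wt w = l, (algebraMap (P n) (K n) (atI w g) / Rf w) • xi w := by
  rw [vecOf, Finset.sum_filter]
  refine Finset.sum_congr rfl fun w _ => ?_
  rw [famOf]
  split_ifs
  · rfl
  · rw [map_zero, zero_div, zero_smul]

theorem vecOf_famOf_mem_Vwt (l : Comp n N) (g : P n) : vecOf (famOf l g) ∈ Vwt l := by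
  rw [vecOf_famOf]
  refine sum_mem fun w hw => Submodule.smul_mem _ _ ?_
  obtain rfl := (Finset.mem_filter.1 hw).2
  exact xi_mem w

theorem vecOf_mem_DVz {e : Word n N → P n} (he : e ∈ symFam n N) : vecOf e ∈ DVz n N := by
  obtain ⟨c, hc, h⟩ := exists_isDV_smul he
  have h1 : vecOf e = algebraMap Ch (P n) c⁻¹ • c • vecOf e := by
    rw [algebraMap_smul, inv_smul_smul₀ hc]
  rw [h1]
  exact Submodule.smul_mem _ _ (Submodule.subset_span h)

theorem vecOf_famOf_mem_DVh {l : Comp n N} {g : P n} (hg : g ∈ symL l) :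
    vecOf (famOf l g) ∈ DVh l := by
  obtain ⟨c, hc, h⟩ := exists_isDV_smul (famOf_mem hg)
  rw [← inv_smul_smul₀ hc (vecOf (famOf l g))]
  refine Submodule.smul_mem _ _ (Submodule.subset_span ⟨?_, h⟩)
  rw [← algebraMap_smul (K n)]
  exact Submodule.smul_mem _ _ (vecOf_famOf_mem_Vwt l g)

theorem eq_famOf {e : Word n N → P n} (he : e ∈ symFam n N) {l : Comp n N}
    (h : ∀ w, wt w ≠ l → e w = 0) : e = famOf l (e (imin l)) := by
  funext w
  by_cases hw : wt w = l
  · exact famOf_eq he hw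
  · rw [h w hw, famOf, if_neg hw]

/-- The map `f ↦ ∑_{I ∈ 𝓘_λ} (f(z_I) / R(z_I)) ξ_I`. -/
def thetaHom (l : Comp n N) : symL l →ₗ[Ch] DVh l where
  toFun g := ⟨vecOf (famOf l g), vecOf_famOf_mem_DVh g.2⟩
  map_add' f g := Subtype.ext (by
    change vecOf (famOf l ((f : P n) + g)) = vecOf (famOf l f) + vecOf (famOf l g)
    rw [famOf_add, vecOf_add])
  map_smul' c g := Subtype.ext (by
    change vecOf (famOf l (c • (g : P n))) = c • vecOf (famOf l g)
    rw [famOf_smul, ← algebraMap_smul (P n) c, vecOf_smul, algebraMap_smul])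

/-- Surjectivity need only be checked on the spanning integral invariant vectors. Each comes from an
equivariant family, which vanishes off weight `λ` and is thus given by its value at `I^min`. -/
theorem thetaHom_bijective (l : Comp n N) : Function.Bijective (thetaHom l) := by
  refine ⟨fun f g h => Subtype.ext ?_, fun ⟨v, hv⟩ => ?_⟩
  · have h1 := congr_fun (vecOf_injective (congr_arg Subtype.val h)) (imin l)
    simp only [famOf, if_pos (wt_imin l), atI_imin f.2, atI_imin g.2] at h1
    exact h1
  · suffices h : DVh l ≤ (LinearMap.range (thetaHom l)).map (DVh l).subtype by
      obtain ⟨x, ⟨g, rfl⟩, hg⟩ := h hv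
      exact ⟨g, Subtype.ext hg⟩
    refine Submodule.span_le.2 ?_
    rintro u ⟨hu, hu'⟩
    obtain ⟨e, he, rfl⟩ := hu'.exists_vecOf
    refine ⟨_, ⟨⟨e (imin l), symFam_imin_mem he l⟩, rfl⟩, ?_⟩
    exact congr_arg vecOf (eq_famOf he fun w hw => eq_zero_of_vecOf_mem hu hw).symm

/-- The isomorphism `θ_λ`. -/
def theta (l : Comp n N) : symL l ≃ₗ[Ch] DVh l :=
  LinearEquiv.ofBijective (thetaHom l) (thetaHom_bijective l)

theorem theta_apply (l : Comp n N) (f : symL l) : (theta l f : V n N) = vecOf (famOf l f) := rfl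

/-- The reversal `z_n, …, z_1` appears because it carries `I^min` to `I^max`, where the descent
starts. -/
theorem theta_hatAct {l : Comp n N} (f : symL l) {w : Word n N} {js : List (Adj n)}
    (hw : wt w = l) (h : IsReducedFor js w) : (theta l f : V n N) w =
      hatAct js (algebraMap (P n) (K n) (permP Fin.revPerm f) / Qf (imax l)) := by
  rw [theta_apply, h.eval fun i u hu => sHat_of_invariant (sTilde_vecOf (famOf_mem f.2) i) hu, hw,
    vecOf_imax, famOf, if_pos (wt_imax l), atI_eq f.2 (imax_comp_rev l)]

theorem atI_of_isSymm {s : P n} (hs : IsSymm s) (w : Word n N) : atI w s = s := hs _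

theorem famOf_isSymm_mul {l : Comp n N} {s : P n} (hs : IsSymm s) (f : P n) :
    famOf l (s * f) = s • famOf l f := by
  funext w
  rw [Pi.smul_apply, famOf, famOf, map_mul, atI_of_isSymm hs]
  split_ifs
  · rfl
  · rw [smul_zero]

/-- The restriction of the operator `ξ_I ↦ g(z_I) ξ_I` to a weight subspace. -/
def psiEnd (l : Comp n N) (g : P n) : Module.End (K n) (Vwt (n := n) l) :=
  (diagEnd fun w => atI w g).restrict fun _ hv => diagEnd_mem _ hv

theorem coe_psiEnd (l : Comp n N) (g : P n) (v : Vwt (n := n) l) :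
    (psiEnd l g v : V n N) = diagEnd (fun w => atI w g) v := rfl

theorem coe_psiEnd_eq (l : Comp n N) (g : P n) (v : Vwt (n := n) l) :
    (psiEnd l g v : V n N) = diagEnd (famOf l g) v :=
  diagEnd_congr (fun w hw => by rw [famOf, if_pos hw]) v.2

theorem psiEnd_mem {l : Comp n N} {g : P n} (hg : g ∈ symL l) :
    psiEnd l g ∈ GZimage (pho n N) l := by
  obtain ⟨X, hX, he⟩ := exists_mem_GZ (famOf_mem hg)
  exact ⟨X, hX, fun v => by rw [coe_psiEnd_eq, he.pho_eq]⟩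

theorem psiEnd_ext {l : Comp n N} {S T : Module.End (K n) (Vwt (n := n) l)}
    (h : ∀ v, (S v : V n N) = T v) : S = T := LinearMap.ext fun v => Subtype.ext (h v)

/-- The homomorphism `g ↦ (ξ_I ↦ g(z_I) ξ_I)`. -/
def psiHom (l : Comp n N) : symL l →ₐ[Ch] GZimage (pho n N) l :=
  AlgHom.ofLinearMap
    { toFun := fun g => ⟨psiEnd l g, psiEnd_mem g.2⟩
      map_add' := fun f g => Subtype.ext (psiEnd_ext fun v => by
        change (psiEnd l ((f : P n) + g) v : V n N) = psiEnd l f v + psiEnd l g v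
        rw [coe_psiEnd_eq, coe_psiEnd_eq, coe_psiEnd_eq, famOf_add, ← diagHom_apply, map_add]; rfl)
      map_smul' := fun c g => Subtype.ext (psiEnd_ext fun v => by
        change (psiEnd l (c • (g : P n)) v : V n N) = c • (psiEnd l g v : V n N)
        rw [coe_psiEnd_eq, coe_psiEnd_eq, famOf_smul, ← algebraMap_smul (P n) c, ← diagHom_apply,
          map_smul, ← algebraMap_smul (P n) c]; rfl) }
    (Subtype.ext (psiEnd_ext fun v => by
      change (psiEnd l (1 : P n) v : V n N) = v
      have h1 : (fun w : Word n N => atI w (1 : P n)) = 1 := funext fun w => map_one _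
      rw [coe_psiEnd, h1, ← diagHom_apply, map_one]; rfl))
    fun f g => Subtype.ext (psiEnd_ext fun v => by
      change (psiEnd l ((f : P n) * g) v : V n N) = psiEnd l f (psiEnd l g v)
      rw [coe_psiEnd_eq, coe_psiEnd_eq, coe_psiEnd_eq, famOf_mul, ← diagHom_apply, map_mul]; rfl)

/-- The value on `ξ_{I^min}` recovers `g`. Conversely the eigenvalues of an element of `𝓑^∞` on a
weight space are determined by the one at `I^min`. -/
theorem psiHom_bijective (l : Comp n N) : Function.Bijective (psiHom (n := n) l) := by
  refine ⟨fun f g h => Subtype.ext ?_, fun ⟨T, X, hX, hT⟩ => ?_⟩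
  · have hm : xi (imin l) ∈ Vwt (n := n) l := by
      have := xi_mem (imin (n := n) l)
      rwa [wt_imin] at this
    have h1 : (psiEnd l f ⟨xi (imin l), hm⟩ : V n N) = psiEnd l g ⟨xi (imin l), hm⟩ :=
      congr_arg (fun T : GZimage (pho n N) l => (T.1 ⟨xi (imin l), hm⟩ : V n N)) h
    rw [coe_psiEnd, coe_psiEnd, diagEnd_xi, diagEnd_xi, atI_imin f.2, atI_imin g.2] at h1
    exact xi_smul_cancel h1
  · obtain ⟨e, he⟩ := exists_hasEig (n := n) hX
    refine ⟨⟨e (imin l), symFam_imin_mem he.mem_symFam l⟩, Subtype.ext (psiEnd_ext fun v => ?_)⟩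
    change (psiEnd l (e (imin l)) v : V n N) = T v
    rw [← hT, coe_psiEnd_eq, he.pho_eq]
    exact (diagEnd_congr (fun w hw => famOf_eq he.mem_symFam hw) v.2).symm

/-- The isomorphism `ψ_λ`. -/
def psi (l : Comp n N) : symL l ≃ₐ[Ch] GZimage (pho n N) l :=
  AlgEquiv.ofBijective (psiHom l) (psiHom_bijective l)

theorem coe_psi (l : Comp n N) (g : symL l) :
    (psi l g : Module.End (K n) (Vwt l)) = psiEnd l g := rfl

theorem psiEnd_isSymm {l : Comp n N} {s : P n} (hs : IsSymm s) (v : Vwt (n := n) l) :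
    (psiEnd l s v : V n N) = s • (v : V n N) := by
  have h1 : (fun w : Word n N => atI w s) = s • 1 := funext fun w => by
    rw [atI_of_isSymm hs, Pi.smul_apply, Pi.one_apply, smul_eq_mul, mul_one]
  rw [coe_psiEnd, h1, ← diagHom_apply, map_smul, map_one]; rfl

end RegularRepresentation

/-! ### The isomorphisms `ν` and `μ`. -/

section KTheory

variable {n N : ℕ}

theorem vecOf_locX_mem (x : KX n N) : vecOf (locX n N x) ∈ DVz n N := by
  refine KX_induction (p := fun x => vecOf (locX n N x) ∈ DVz n N) (fun x y hx hy => ?_) ?_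
    (fun l q g => ?_) x
  · rw [map_add, vecOf_add]
    exact add_mem hx hy
  · have h0 : vecOf (0 : Word n N → P n) = 0 := map_zero (vecHom n N)
    rw [map_zero, h0]
    exact zero_mem _
  · rw [locX_single, vecOf_smul]
    exact Submodule.smul_mem _ _ (vecOf_mem_DVz (famOf_mem g.2))

/-- The class with the localizations `e_I`. -/
def liftFam {e : Word n N → P n} (he : e ∈ symFam n N) : KX n N :=
  fun l => cls (1 ⊗ₜ ⟨e (imin l), symFam_imin_mem he l⟩)

theorem locX_liftFam {e : Word n N → P n} (he : e ∈ symFam n N) : locX n N (liftFam he) = e := by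
  funext w
  rw [locX_apply, liftFam, locKT_cls, locI_tmul, one_mul]
  exact (symFam_eq_atI he w).symm

/-- The map `[f] ↦ ∑_I (f(z_I, z) / R(z_I)) ξ_I`. -/
def nuHom (n N : ℕ) : KX n N →ₗ[P n] DVz n N :=
  ((vecHom n N).comp (locX n N).toLinearMap).codRestrict (DVz n N) vecOf_locX_mem

theorem nuHom_bijective : Function.Bijective (nuHom n N) := by
  refine ⟨fun x y h => ?_, fun ⟨v, hv⟩ => ?_⟩
  · exact locX_injective (vecOf_injective (congr_arg Subtype.val h))
  · suffices h : DVz n N ≤ (LinearMap.range (nuHom n N)).map (DVz n N).subtype by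
      obtain ⟨x, ⟨g, rfl⟩, hg⟩ := h hv
      exact ⟨g, Subtype.ext hg⟩
    refine Submodule.span_le.2 fun u hu => ?_
    obtain ⟨e, he, rfl⟩ := IsDV.exists_vecOf hu
    exact ⟨_, ⟨liftFam he, rfl⟩, congr_arg vecOf (locX_liftFam he)⟩

/-- The isomorphism `ν`. -/
def nu (n N : ℕ) : KX n N ≃ₗ[P n] DVz n N := LinearEquiv.ofBijective (nuHom n N) nuHom_bijective

theorem coe_nu (x : KX n N) : (nu n N x : V n N) = vecOf (locX n N x) := rfl

theorem diagEnd_locX_mem (x : KX n N) : diagEnd (locX n N x) ∈ GZz (pho n N) := by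
  refine KX_induction (p := fun x => diagEnd (locX n N x) ∈ GZz (pho n N)) (fun x y hx hy => ?_) ?_
    (fun l q g => ?_) x
  · rw [map_add, ← diagHom_apply, map_add]
    exact add_mem hx hy
  · rw [map_zero, ← diagHom_apply, map_zero]
    exact zero_mem _
  · rw [locX_single, ← diagHom_apply, map_smul]
    obtain ⟨X, hX, he⟩ := exists_mem_GZ (famOf_mem g.2)
    refine Subalgebra.smul_mem _ (Algebra.subset_adjoin ?_) q
    exact ⟨X, hX, he.pho_eq.symm⟩

/-- The map `[f] ↦ (ξ_I ↦ f(z_I, z) ξ_I)`. -/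
def muHom (n N : ℕ) : KX n N →ₐ[P n] GZz (pho n N) :=
  ((diagHom n N).comp (locX n N)).codRestrict (GZz (pho n N)) diagEnd_locX_mem

theorem muHom_bijective : Function.Bijective (muHom n N) := by
  refine ⟨fun x y h => ?_, fun ⟨T, hT⟩ => ?_⟩
  · exact locX_injective (diagEnd_injective (congr_arg Subtype.val h))
  · suffices h : GZz (pho n N) ≤ ((diagHom n N).comp (locX n N)).range by
      obtain ⟨x, hx⟩ := h hT
      exact ⟨x, Subtype.ext hx⟩
    refine Algebra.adjoin_le ?_
    rintro _ ⟨X, hX, rfl⟩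
    obtain ⟨e, he⟩ := exists_hasEig (n := n) hX
    refine ⟨liftFam he.mem_symFam, ?_⟩
    change diagEnd (locX n N _) = _
    rw [locX_liftFam, he.pho_eq]

/-- The isomorphism `μ`. -/
def mu (n N : ℕ) : KX n N ≃ₐ[P n] GZz (pho n N) := AlgEquiv.ofBijective (muHom n N) muHom_bijective

theorem coe_mu (x : KX n N) : (mu n N x : Module.End (K n) (V n N)) = diagEnd (locX n N x) := rfl

theorem nu_mul (b f : KX n N) :
    (nu n N (b * f) : V n N) = (mu n N b : Module.End (K n) (V n N)) (nu n N f) := by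
  rw [coe_nu, coe_nu, coe_mu, diagEnd_vecOf, map_mul]

/-- The elements of the Gelfand–Zetlin algebra act on the K-theory algebras by multiplication
operators. -/
theorem nu_single_mul {X : U N} {e : Word n N → P n} (he : HasEig X e) (l : Comp n N) (f : KT l) :
    (nu n N (Pi.single l (liftFam he.mem_symFam l * f)) : V n N) =
      pho n N X (nu n N (Pi.single l f)) := by
  have h1 : Pi.single l (liftFam he.mem_symFam l * f) =
      liftFam he.mem_symFam * (Pi.single l f : KX n N) := by
    funext k
    rw [Pi.mul_apply]
    by_cases hk : k = l
    · subst hk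
      rw [Pi.single_eq_same, Pi.single_eq_same]
    · rw [Pi.single_eq_of_ne hk, Pi.single_eq_of_ne hk, mul_zero]
  rw [h1, nu_mul, coe_mu, locX_liftFam, he.pho_eq]

/-- An operator coming from `𝓑^∞` is multiplication by the class whose localizations are the
eigenvalues, by injectivity of `ν`. Conversely every class `[g(Γ)]` is obtained in this way from
some `X`, and such classes span over the Laurent polynomials in `z`. -/
theorem adjoin_GZonKT (l : Comp n N) :
    Algebra.adjoin (P n) (GZonKT (pho n N) (fun f => (nu n N f : V n N)) l) =
      (Algebra.lmul (P n) (KT l)).range := by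
  refine le_antisymm (Algebra.adjoin_le ?_) ?_
  · rintro T ⟨X, hX, hT⟩
    obtain ⟨e, he⟩ := exists_hasEig (n := n) hX
    refine ⟨liftFam he.mem_symFam l, LinearMap.ext fun f => ?_⟩
    refine Pi.single_injective (M := fun l : Comp n N => KT l) l
      ((nu n N).injective (Subtype.ext ?_))
    exact (nu_single_mul he l f).trans (hT f).symm
  · rintro _ ⟨x, rfl⟩
    obtain ⟨y, rfl⟩ := cls_surjective l x
    change Algebra.lmul (P n) (KT l) (cls y) ∈ _
    induction y using TensorProduct.induction_on with
    | zero =>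
      rw [show cls (0 : preK l) = 0 from map_zero (Ideal.Quotient.mk (relK l)), map_zero]
      exact zero_mem _
    | add y y' hy hy' =>
      rw [show cls (y + y') = cls y + cls y' from map_add (Ideal.Quotient.mk (relK l)) y y',
        map_add]
      exact add_mem hy hy'
    | tmul q g =>
      have h1 : cls (q ⊗ₜ[Ch] g : preK l) = q • cls (1 ⊗ₜ[Ch] g : preK l) := by
        have : (q ⊗ₜ[Ch] g : preK l) = q • (1 ⊗ₜ g) := by
          rw [TensorProduct.smul_tmul', smul_eq_mul, mul_one]
        rw [this]; rfl
      rw [h1, map_smul]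
      obtain ⟨X, hX, he⟩ := exists_mem_GZ (famOf_mem g.2)
      have h2 : liftFam he.mem_symFam l = cls (1 ⊗ₜ g) := by
        refine congr_arg (fun g => cls (1 ⊗ₜ g)) (Subtype.ext ?_)
        change famOf l (g : P n) (imin l) = g
        rw [famOf, if_pos (wt_imin l), atI_imin g.2]
      refine Subalgebra.smul_mem _ (Algebra.subset_adjoin ?_) q
      exact ⟨X, hX, fun f => h2 ▸ nu_single_mul he l f⟩

end KTheory

end KStab
end

theorem theorem11p9 (n N : ℕ) :
    -- the `R`-matrix representation `φ` of the quantum loop algebra, and the vectors `ξ_I`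
    ∃ (φ : U N →ₐ[Ch] Module.End (K n) (V n N)) (ξ : Word n N → V n N),
      IsPho φ ∧ (∀ φ', IsPho φ' → φ' = φ) ∧
      (∀ (X : U N) (w w' : Word n N),
        ∃ p : P n, φ X (Pi.single w' 1) w = algebraMap (P n) (K n) p) ∧
      IsXi ξ ∧ (∀ ξ', IsXi ξ' → ξ' = ξ) ∧
      LinearIndependent (K n) ξ ∧
      (∀ l : Comp n N, Submodule.span (K n) (ξ '' {w | wt w = l}) = Vwt l) ∧
      -- the Gelfand–Zetlin algebra preserves the weight subspaces
      (∀ (l : Comp n N), ∀ X ∈ GZ N, ∀ v ∈ Vwt l, φ X v ∈ Vwt l) ∧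
      -- the identification with the regular representation of `ℂ[z^{±1}]^{S_λ} ⊗ ℂ(h)`
      (∀ l : Comp n N,
        ∃ (θ : symL l ≃ₗ[Ch] DVh l) (ψ : symL l ≃ₐ[Ch] GZimage φ l),
          (∀ (f : symL l) (w : Word n N) (js : List (Adj n)), wt w = l → IsReducedFor js w →
            (θ f : V n N) w =
              hatAct js (algebraMap (P n) (K n) (permP Fin.revPerm f) / Qf (imax l))) ∧
          (∀ f : symL l, (θ f : V n N) =
            ∑ w with wt w = l, (algebraMap (P n) (K n) (atI w f) / Rf w) • ξ w) ∧
          (∀ (s f : symL l), IsSymm (s : P n) →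
            (θ (s * f) : V n N) = (s : P n) • (θ f : V n N)) ∧
          (∀ (g : symL l) (w : Word n N), wt w = l → ∀ v : Vwt l, (v : V n N) = ξ w →
            ((ψ g : Module.End (K n) (Vwt l)) v : V n N) =
              algebraMap (P n) (K n) (atI w g) • ξ w) ∧
          (∀ s : symL l, IsSymm (s : P n) → ∀ v : Vwt l,
            ((ψ s : Module.End (K n) (Vwt l)) v : V n N) = (s : P n) • (v : V n N)) ∧
          (∀ g f : symL l,
            ((ψ g : Module.End (K n) (Vwt l)) ⟨θ f, DVh_le (θ f).2⟩ : V n N) = θ (g * f))) ∧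
      -- the K-theoretic form
      ∃ (ν : KX n N ≃ₗ[P n] DVz n N) (μ : KX n N ≃ₐ[P n] GZz φ),
        (∀ f : (l : Comp n N) → preK l,
          (ν (fun l => cls (f l)) : V n N) =
            ∑ w, (algebraMap (P n) (K n) (locI (wt w) w (f (wt w))) / Rf w) • ξ w) ∧
        (∀ (f : (l : Comp n N) → preK l) (w : Word n N),
          (μ (fun l => cls (f l)) : Module.End (K n) (V n N)) (ξ w) =
            algebraMap (P n) (K n) (locI (wt w) w (f (wt w))) • ξ w) ∧
        (∀ b f : KX n N,
          (ν (b * f) : V n N) = (μ b : Module.End (K n) (V n N)) (ν f : V n N)) ∧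
        -- on each `K_T(T^*𝓕_λ) ⊗ ℂ(h)` the Gelfand–Zetlin algebra is the algebra of
        -- multiplication operators
        (∀ l : Comp n N,
          (∀ X ∈ GZ N, ∃ T : Module.End (P n) (KT l),
            ∀ f : KT l, (ν (Pi.single l (T f)) : V n N) = φ X (ν (Pi.single l f))) ∧
          Algebra.adjoin (P n) (GZonKT φ (fun f => (ν f : V n N)) l) =
            (Algebra.lmul (P n) (KT l)).range) := by
  refine ⟨pho n N, xi, isPho_pho, fun φ' h => h.eq isPho_pho, fun X w w' => ⟨_, pho_single X w w'⟩,
    isXi_xi, fun ξ' h => h.eq_xi, linearIndependent_xi, span_xi, fun l X hX v hv =>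
    pho_mem_Vwt hX hv, fun l => ⟨theta l, psi l, fun f w js hw h => theta_hatAct f hw h,
      fun f => vecOf_famOf l f, fun s f hs => ?_, fun g w hw v hv => ?_,
      fun s hs v => psiEnd_isSymm hs v, fun g f => ?_⟩,
    nu n N, mu n N, fun f => rfl, fun f w => diagEnd_xi _ w, nu_mul,
    fun l => ⟨fun X hX => ?_, adjoin_GZonKT l⟩⟩
  · change vecOf (famOf l ((s : P n) * f)) = (s : P n) • vecOf (famOf l f)
    rw [famOf_isSymm_mul hs, vecOf_smul]
  · rw [coe_psi, coe_psiEnd, hv, diagEnd_xi]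
  · rw [coe_psi, coe_psiEnd_eq, theta_apply, theta_apply, diagEnd_vecOf, ← famOf_mul]; rfl
  · obtain ⟨e, he⟩ := exists_hasEig (n := n) hX
    exact ⟨LinearMap.mulLeft (P n) (liftFam he.mem_symFam l), nu_single_mul he l⟩
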